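/- **Setting.** Let $\Omega\subset\mathbb R^2$ be a bounded open set with $C^\infty$ boundary $\Gamma$, i.e. $\Gamma=\partial\Omega$ is a finite disjoint union of smooth simple closed curves, $\Omega$ lying locally on one side of $\Gamma$; fix smooth regular periodic parametrizations of these curves that leave $\Omega$ on the left, and let $\mathbf n$ be the outward unit normal. Let $\mathcal L$ be one of * $-\Delta u$ (Laplace, $\sigma=1$) or $-\Delta u-(\omega/c)^2u$ (Helmholtz, $\sigma=1$, $\omega,c>0$), with $\gamma_0u=u|_\Gamma$ and $\gamma_1 u=\nabla u\cdot\mathbf n$ on $\Gamma$; * $-\mu\Delta u-(\mu+\lambda)\nabla(\nabla\cdot u)$ (elastostatics, $\sigma=2$) or $-\mu\Delta u-(\mu+\lambda)\nabla(\nabla\cdot u)-\omega^2\rho u$ (elastodynamics, $\sigma=2$, $\rho,\omega>0$), where $\mu>0$, $\lambda+2\mu>0$, with $\gamma_0u=u|_\Gamma$ and $\gamma_1u=\lambda(\nabla\cdot u)\mathbf n+\mu(\nabla u+\nabla u^{\top})\mathbf n$ on $\Gamma$. Let $G(\boldsymbol x,\boldsymbol y)=\mathcal G(\boldsymbol x-\boldsymbol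 y)$ be the free-space Green's function: with $R=|\boldsymbol R|$ and $\hat{\boldsymbol R}=\boldsymbol R/R$, $\mathcal G(\boldsymbol R)$ is respectively $-\frac1{2\pi}\log R$, $\;\frac{\mathrm i}4H^{(1)}_0(\omega R/c)$, $$\frac{\lambda+3\mu}{4\pi\mu(\lambda+2\mu)}\Big\{-\log R\,\mathbf I+\frac{\lambda+\mu}{\lambda+3\mu}\hat{\boldsymbol R}\hat{\boldsymbol R}^{\top}\Big\},\qquad \frac{\mathrm i}{4\mu}\Big\{H^{(1)}_0(k_TR)\,\mathbf I+k_T^{-2}\nabla\nabla^{\top}\big[H_0^{(1)}(k_TR)-H_0^{(1)}(k_LR)\big]\Big\},$$ where $k_L^2=\rho\omega^2/(\lambda+2\mu)$, $k_T^2=\rho\omega^2/\mu$, $k_L,k_T>0$. For a smooth density $\varphi:\Gamma\to\mathbb C^\sigma$, $\alpha,\beta\in\mathbb C$ and $\boldsymbol x\in\Gamma$ put $V_{\alpha,\beta}=\alpha K-\beta S$ and $W_{\alpha,\beta}=\alpha T-\beta K'$, where $S,K,K',T$ are the integral operators over $\Gamma$ (with respect to arc length) with kernels $G(\boldsymbol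 x,\boldsymbol y)$, $(\gamma_{1,\boldsymbol y}G(\boldsymbol x,\boldsymbol y))^{\top}$, $\gamma_{1,\boldsymbol x}G(\boldsymbol x,\boldsymbol y)$, $\gamma_{1,\boldsymbol x}(\gamma_{1,\boldsymbol y}G(\boldsymbol x,\boldsymbol y))^{\top}$, with $\gamma_1$ acting on each column of a matrix. The integrals $K,K'$ are Cauchy principal values, $\lim_{\varepsilon\to0^+}\int_{\Gamma\setminus\overline{B_\varepsilon(\boldsymbol x)}}$, and $T$ is a Hadamard finite part: the $v$ such that $\int_{\Gamma\setminus \overline{B_\varepsilon(\boldsymbol x)}}=m/\varepsilon+v+o(1)$ as $\varepsilon\to0^+$ for some $m$. A *patch of size $h$ at $\boldsymbol x\in\Gamma$* is an arc $\Gamma_h(\boldsymbol x)=\chi([a,b])\ni\boldsymbol x$ of diameter less than $h$, where $\chi$ is one of the fixed parametrizations and $b-a$ is less than its period. A *collocation density interpolant* of $\varphi$ on the patch, for distinct points $\boldsymbol y_1,\dots,\boldsymbol y_P\in\Gamma_h(\boldsymbol x)$, is a function $\Phi(\boldsymbol r)=\sum_{\ell=1}^LG(\boldsymbol r,\boldsymbol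 z_\ell)c_\ell$ with $\boldsymbol z_\ell\in\mathbb R^2\setminus\overline\Omega$, $c_\ell\in\mathbb C^\sigma$, such that $\gamma_0\Phi(\boldsymbol y_j)=\alpha\varphi(\boldsymbol y_j)$ and $\gamma_1\Phi(\boldsymbol y_j)=\beta\varphi(\boldsymbol y_j)$ for $j=1,\dots,P$. Dropping the self-patch contribution gives $$\widetilde V_{\alpha,\beta}[\varphi](\boldsymbol x)=\int_{\Gamma\setminus\Gamma_h(\boldsymbol x)}(\gamma_{1,\boldsymbol y}G)^{\top}\{\alpha\varphi-\gamma_0\Phi\}\,ds-\int_{\Gamma\setminus\Gamma_h(\boldsymbol x)}G\{\beta\varphi-\gamma_1\Phi\}\,ds-\tfrac12\gamma_0\Phi(\boldsymbol x),$$ $$\widetilde W_{\alpha,\beta}[\varphi](\boldsymbol x)=\int_{\Gamma\setminus\Gamma_h(\boldsymbol x)}\gamma_{1,\boldsymbol x}(\gamma_{1,\boldsymbol y}G)^{\top}\{\alpha\varphi-\gamma_0\Phi\}\,ds-\int_{\Gamma\setminus\Gamma_h(\boldsymbol x)}(\gamma_{1,\boldsymbol x}G)\{\beta\varphi-\gamma_1\Phi\}\,ds-\tfrac12\gamma_1\Phi(\boldsymbol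 x).$$ **Theorem.** Let $P\ge1$, $0<\kappa<1$, $\alpha,\beta\in\mathbb C$, $c_0,c_1\in\mathbb R$, and let $\varphi$ be a smooth density. There are $C$ and $h_0>0$, depending only on $\Gamma$ with its parametrizations, $\mathcal L$, $\varphi,\alpha,\beta,P,\kappa,c_0,c_1$, such that the following holds for all $0<h<h_0$, all $\boldsymbol x\in\Gamma$, all patches $\Gamma_h(\boldsymbol x)=\chi([a,b])$ of size $h$ for which both end points have distance greater than $\kappa h$ from $\boldsymbol x$, and all collocation density interpolants $\Phi$ of $\varphi$ at $P$ distinct points of the patch (any number and position of sources) whose traces $F_\ell(s)=(\gamma_\ell\Phi)(\chi(s))$ satisfy $|F_\ell^{(k)}(s)|\le c_\ell$ for $s\in[a,b]$, $\ell=0,1$, $0\le k\le P$. The values $V_{\alpha,\beta}[\varphi](\boldsymbol x)$ and $W_{\alpha,\beta}[\varphi](\boldsymbol x)$ exist, and * for Laplace and Helmholtz: $\;|V_{\alpha,\beta}[\varphi](\boldsymbol x)-\widetilde V_{\alpha,\beta}[\varphi](\boldsymbol x)|\le C\,h^{P+1}|\log h|\;$ and $\;|W_{\alpha,\beta}[\varphi](\boldsymbol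 x)-\widetilde W_{\alpha,\beta}[\varphi](\boldsymbol x)|\le C\,h^{P-1}$; * for elastostatics and elastodynamics: $\;|V_{\alpha,\beta}[\varphi](\boldsymbol x)-\widetilde V_{\alpha,\beta}[\varphi](\boldsymbol x)|\le C\,h^{P}\;$ and $\;|W_{\alpha,\beta}[\varphi](\boldsymbol x)-\widetilde W_{\alpha,\beta}[\varphi](\boldsymbol x)|\le C\,h^{P-1}$; where, when $P=1$, the bounds for $W$ are asserted under the additional condition $|F_0''(s)|\le c_0$ for $s\in[a,b]$. -/

import Mathlib

open Set Filter Topology MeasureTheory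
open scoped ContDiff Matrix

noncomputable section

/-! ### The domain and its boundary curve -/

/-- The Euclidean plane. -/
abbrev Plane : Type := EuclideanSpace ℝ (Fin 2)

/-- Rotation of a plane vector by a right angle, clockwise. -/
def rotCW (v : Plane) : Plane := !₂[v 1, -v 0]

/-- A bounded open set `Ω` of the plane with `C^∞` boundary `Γ`.  The boundary is the disjoint union
of finitely many smooth regular simple closed curves, given with smooth periodic parametrizations
that leave `Ω` on their left, and `Ω` lies locally on one side of `Γ`. -/
structure SmoothDomain where
  Ω : Set Plane
  isOpen_Ω : IsOpen Ω
  isBounded_Ω : Bornology.IsBounded Ω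
  /-- number of components of `Γ` -/
  numCurves : ℕ
  period : Fin numCurves → ℝ
  period_pos : ∀ i, 0 < period i
  curve : Fin numCurves → ℝ → Plane
  curve_smooth : ∀ i, ContDiff ℝ ∞ (curve i)
  curve_periodic : ∀ i, Function.Periodic (curve i) (period i)
  curve_regular : ∀ i s, deriv (curve i) s ≠ 0
  curve_injOn : ∀ i, InjOn (curve i) (Ico 0 (period i))
  curve_disjoint : ∀ i j, i ≠ j → Disjoint (range (curve i)) (range (curve j))
  frontier_eq : frontier Ω = ⋃ i, range (curve i)
  /-- the outward unit normal (only its values on `Γ` matter) -/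
  normal : Plane → Plane
  normal_curve : ∀ i s,
    normal (curve i s) = ‖deriv (curve i) s‖⁻¹ • rotCW (deriv (curve i) s)
  one_sided : ∀ x ∈ frontier Ω, ∀ᶠ ε in 𝓝[>] (0 : ℝ),
    x - ε • normal x ∈ Ω ∧ x + ε • normal x ∉ closure Ω

namespace SmoothDomain

/-- The arc-length integral `∫_{Γ ∩ A} f ds`. -/
def lineIntegral (D : SmoothDomain) {E : Type*} [NormedAddCommGroup E] [NormedSpace ℝ E]
    (A : Set Plane) (f : Plane → E) : E :=
  ∑ i, ∫ s in Ico 0 (D.period i) ∩ D.curve i ⁻¹' A, ‖deriv (D.curve i) s‖ • f (D.curve i s)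

/-- `φ` is a smooth density on `Γ`. -/
def SmoothDensity (D : SmoothDomain) {σ : ℕ} (φ : Plane → Fin σ → ℂ) : Prop :=
  ∀ i, ContDiff ℝ ∞ (fun s => φ (D.curve i s))

/-- `v` is the Cauchy principal value `p.v. ∫_Γ f ds`, for `f` singular at `x`. -/
def HasPrincipalValue (D : SmoothDomain) {σ : ℕ} (x : Plane) (f : Plane → Fin σ → ℂ)
    (v : Fin σ → ℂ) : Prop :=
  Tendsto (fun ε : ℝ => D.lineIntegral {y | ε < dist y x} f) (𝓝[>] 0) (𝓝 v)

/-- `v` is the Hadamard finite part `f.p. ∫_Γ f ds`, for `f` with a singularity of the type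
`|x - y|⁻²` at `x`: the integral over `{y ∈ Γ | |y - x| > ε}` equals `ε⁻¹ m + v + o(1)` as `ε → 0⁺`.
Such a `v` is unique. -/
def HasFinitePart (D : SmoothDomain) {σ : ℕ} (x : Plane) (f : Plane → Fin σ → ℂ)
    (v : Fin σ → ℂ) : Prop :=
  ∃ m : Fin σ → ℂ,
    Tendsto (fun ε : ℝ => D.lineIntegral {y | ε < dist y x} f - ε⁻¹ • m) (𝓝[>] 0) (𝓝 v)

end SmoothDomain

/-! ### Bessel and Hankel functions of a positive argument -/

/-- Bessel function of the first kind `J_n(x)`. -/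
def besselJ (n : ℕ) (x : ℝ) : ℝ :=
  ∑' m : ℕ, (-1) ^ m / ((m.factorial : ℝ) * ((m + n).factorial : ℝ)) * (x / 2) ^ (2 * m + n)

/-- The digamma function at a positive integer, `ψ(m + 1) = -γ + ∑_{j=1}^m 1/j`. -/
def psiSucc (m : ℕ) : ℝ := -Real.eulerMascheroniConstant + (harmonic m : ℝ)

/-- Bessel function of the second kind `Y_n(x)`, for `x > 0`. -/
def besselY (n : ℕ) (x : ℝ) : ℝ :=
  2 / Real.pi * Real.log (x / 2) * besselJ n x
    - 1 / Real.pi * ∑ m ∈ Finset.range n,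
        ((n - 1 - m).factorial : ℝ) / (m.factorial : ℝ) * (x / 2) ^ (2 * (m : ℤ) - (n : ℤ))
    - 1 / Real.pi * ∑' m : ℕ, (-1) ^ m * (psiSucc m + psiSucc (m + n)) /
        ((m.factorial : ℝ) * ((m + n).factorial : ℝ)) * (x / 2) ^ (2 * m + n)

/-- Hankel function of the first kind `H_n^{(1)}(x) = J_n(x) + i Y_n(x)`, for `x > 0`. -/
def hankel1 (n : ℕ) (x : ℝ) : ℂ := (besselJ n x : ℂ) + Complex.I * (besselY n x : ℂ)

/-! ### Green's functions and conormal derivatives -/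

/-- The data of a layer operator for fields with values in `ℂ^σ`: a Green's function `G(r, r')`, and
the Neumann boundary operator `conormal u n x` at a point `x` and for a unit normal `n`.  For fields
that are smooth near `x`, as are all those it is applied to below, this is the value of the trace
`γ₁ u (x)`.  Only the four instances below are used. -/
structure LayerModel (σ : ℕ) where
  G : Plane → Plane → Matrix (Fin σ) (Fin σ) ℂ
  conormal : (Plane → Fin σ → ℂ) → Plane → Plane → Fin σ → ℂ

/-- The partial derivative `∂_j u_k (x)`. -/
def partialD {σ : ℕ} (u : Plane → Fin σ → ℂ) (j : Fin 2) (k : Fin σ) (x : Plane) : ℂ :=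
  fderiv ℝ (fun r => u r k) x (EuclideanSpace.single j 1)

/-- `∇u(x) · n`. -/
def normalDeriv (u : Plane → Fin 1 → ℂ) (n x : Plane) : Fin 1 → ℂ :=
  fun k => ∑ j, partialD u j k x * (n j : ℂ)

/-- The elastic traction `λ (∇ · u) n + 2 μ ∇u · n + μ n × (∇ × u)`, that is
`λ (∇ · u) n + μ (∇u + ∇uᵀ) n`. -/
def traction (lam mu : ℝ) (u : Plane → Fin 2 → ℂ) (n x : Plane) : Fin 2 → ℂ :=
  fun k => (lam : ℂ) * (∑ j, partialD u j j x) * (n k : ℂ)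
    + (mu : ℂ) * ∑ j, (partialD u j k x + partialD u k j x) * (n j : ℂ)

/-- `-Δ u`: `G = -(2π)⁻¹ log R`. -/
def laplaceModel : LayerModel 1 where
  G x y := fun _ _ => ((-(1 / (2 * Real.pi)) * Real.log ‖x - y‖ : ℝ) : ℂ)
  conormal := normalDeriv

/-- `-Δ u - (ω/c)² u`: `G = (i/4) H₀⁽¹⁾(ω R / c)`. -/
def helmholtzModel (omega c : ℝ) : LayerModel 1 where
  G x y := fun _ _ => Complex.I / 4 * hankel1 0 (omega / c * ‖x - y‖)
  conormal := normalDeriv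

/-- The matrix `R Rᵀ / |R|²`. -/
def unitDyad (R : Plane) : Matrix (Fin 2) (Fin 2) ℂ :=
  fun i j => ((R i * R j / ‖R‖ ^ 2 : ℝ) : ℂ)

/-- `-μ Δ u - (μ + λ) ∇(∇ · u)`, with Kelvin's tensor for the plane. -/
def elastostaticModel (lam mu : ℝ) : LayerModel 2 where
  G x y := (((lam + 3 * mu) / (4 * Real.pi * mu * (lam + 2 * mu)) : ℝ) : ℂ) •
    (((-Real.log ‖x - y‖ : ℝ) : ℂ) • (1 : Matrix (Fin 2) (Fin 2) ℂ)
      + (((lam + mu) / (lam + 3 * mu) : ℝ) : ℂ) • unitDyad (x - y))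
  conormal := traction lam mu

/-- The wavenumber of longitudinal waves. -/
def waveNumberL (lam mu rho omega : ℝ) : ℝ := omega * Real.sqrt (rho / (lam + 2 * mu))

/-- The wavenumber of transversal waves. -/
def waveNumberT (mu rho omega : ℝ) : ℝ := omega * Real.sqrt (rho / mu)

/-- The coefficient `A(R) = H₀(k_T R) - (k_T R)⁻¹ (H₁(k_T R) - (k_L/k_T) H₁(k_L R))`. -/
def elastodynamicA (kL kT R : ℝ) : ℂ :=
  hankel1 0 (kT * R) - (1 / (kT * R) : ℝ) *
    (hankel1 1 (kT * R) - (kL / kT : ℝ) * hankel1 1 (kL * R))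

/-- The coefficient
`B(R) = 2 (k_T R)⁻¹ (H₁(k_T R) - (k_L/k_T) H₁(k_L R)) - (H₀(k_T R) - (k_L/k_T)² H₀(k_L R))`. -/
def elastodynamicB (kL kT R : ℝ) : ℂ :=
  (2 / (kT * R) : ℝ) * (hankel1 1 (kT * R) - (kL / kT : ℝ) * hankel1 1 (kL * R))
    - (hankel1 0 (kT * R) - ((kL / kT) ^ 2 : ℝ) * hankel1 0 (kL * R))

/-- `-μ Δ u - (μ + λ) ∇(∇ · u) - ω² ρ u`, with
`G = (i/(4μ)) (A I + B R Rᵀ/|R|²) = (i/(4μ)) (H₀(k_T R) I + k_T⁻² ∇∇ᵀ (H₀(k_T R) - H₀(k_L R)))`. -/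
def elastodynamicModel (lam mu rho omega : ℝ) : LayerModel 2 where
  G x y := (Complex.I / (4 * (mu : ℂ))) •
    (elastodynamicA (waveNumberL lam mu rho omega) (waveNumberT mu rho omega) ‖x - y‖ •
        (1 : Matrix (Fin 2) (Fin 2) ℂ)
      + elastodynamicB (waveNumberL lam mu rho omega) (waveNumberT mu rho omega) ‖x - y‖ •
        unitDyad (x - y))
  conormal := traction lam mu

/-! ### Layer operators on `Γ` -/

namespace LayerModel

variable {σ : ℕ} (M : LayerModel σ) (D : SmoothDomain)

/-- The Neumann trace `γ₁ u (x)` at `x ∈ Γ`. -/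
def trace1 (u : Plane → Fin σ → ℂ) (x : Plane) : Fin σ → ℂ :=
  M.conormal u (D.normal x) x

/-- The Neumann trace at `x ∈ Γ` of each column of a matrix field. -/
def matTrace1 (U : Plane → Matrix (Fin σ) (Fin σ) ℂ) (x : Plane) : Matrix (Fin σ) (Fin σ) ℂ :=
  fun i j => M.trace1 D (fun r k => U r k j) x i

/-- The kernel `(γ_{1,y} G(x,y))ᵀ` of the double-layer operator. -/
def kerK (x y : Plane) : Matrix (Fin σ) (Fin σ) ℂ := (M.matTrace1 D (fun r => M.G x r) y)ᵀ

/-- The kernel `γ_{1,x} G(x,y)` of the adjoint double-layer operator. -/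
def kerK' (x y : Plane) : Matrix (Fin σ) (Fin σ) ℂ := M.matTrace1 D (fun r => M.G r y) x

/-- The kernel `γ_{1,x} (γ_{1,y} G(x,y))ᵀ` of the hypersingular operator. -/
def kerT (x y : Plane) : Matrix (Fin σ) (Fin σ) ℂ := M.matTrace1 D (fun r => M.kerK D r y) x

/-- The single-layer operator `S[φ](x)`. -/
def opS (φ : Plane → Fin σ → ℂ) (x : Plane) : Fin σ → ℂ :=
  D.lineIntegral univ (fun y => M.G x y *ᵥ φ y)

/-- `v = V_{α,β}[φ](x) = α K[φ](x) - β S[φ](x)`, where `K` is a principal value. -/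
def IsV (α β : ℂ) (φ : Plane → Fin σ → ℂ) (x : Plane) (v : Fin σ → ℂ) : Prop :=
  ∃ k, D.HasPrincipalValue x (fun y => M.kerK D x y *ᵥ φ y) k ∧
    v = α • k - β • M.opS D φ x

/-- `w = W_{α,β}[φ](x) = α T[φ](x) - β K'[φ](x)`, where `T` is a finite part and `K'` a principal
value. -/
def IsW (α β : ℂ) (φ : Plane → Fin σ → ℂ) (x : Plane) (w : Fin σ → ℂ) : Prop :=
  ∃ τ k', D.HasFinitePart x (fun y => M.kerT D x y *ᵥ φ y) τ ∧
    D.HasPrincipalValue x (fun y => M.kerK' D x y *ᵥ φ y) k' ∧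
    w = α • τ - β • k'

/-- The approximation `Ṽ_{α,β}[φ](x)`, with interpolant `Φ` and the patch `A` dropped. -/
def Vtilde (α β : ℂ) (φ Φ : Plane → Fin σ → ℂ) (A : Set Plane) (x : Plane) : Fin σ → ℂ :=
  D.lineIntegral Aᶜ (fun y => M.kerK D x y *ᵥ (α • φ y - Φ y))
    - D.lineIntegral Aᶜ (fun y => M.G x y *ᵥ (β • φ y - M.trace1 D Φ y))
    - (1 / 2 : ℂ) • Φ x

/-- The approximation `W̃_{α,β}[φ](x)`, with interpolant `Φ` and the patch `A` dropped. -/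
def Wtilde (α β : ℂ) (φ Φ : Plane → Fin σ → ℂ) (A : Set Plane) (x : Plane) : Fin σ → ℂ :=
  D.lineIntegral Aᶜ (fun y => M.kerT D x y *ᵥ (α • φ y - Φ y))
    - D.lineIntegral Aᶜ (fun y => M.kerK' D x y *ᵥ (β • φ y - M.trace1 D Φ y))
    - (1 / 2 : ℂ) • M.trace1 D Φ x

/-! ### The collocation density interpolant -/

/-- The combination `Φ(r) = ∑_ℓ G(r, z_ℓ) c_ℓ` of point sources. -/
def sourceField {L : ℕ} (z : Fin L → Plane) (c : Fin L → Fin σ → ℂ) (r : Plane) : Fin σ → ℂ :=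
  ∑ l, M.G r (z l) *ᵥ c l

/-- `Φ = ∑_ℓ G(·, z_ℓ) c_ℓ` is a collocation density interpolant of `φ` at the points `y_j`: the
sources lie outside `Ω ∪ Γ`, and `γ₀ Φ = α φ`, `γ₁ Φ = β φ` at every `y_j`. -/
structure IsCollocationInterpolant (α β : ℂ) (φ : Plane → Fin σ → ℂ) {P L : ℕ}
    (y : Fin P → Plane) (z : Fin L → Plane) (c : Fin L → Fin σ → ℂ) : Prop where
  source_exterior : ∀ l, z l ∉ closure D.Ω
  dirichlet : ∀ j, M.sourceField z c (y j) = α • φ (y j)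
  neumann : ∀ j, M.trace1 D (M.sourceField z c) (y j) = β • φ (y j)

end LayerModel

/-! ### Patches -/

/-- A patch `Γ_h(x)`: a closed proper sub-arc, parametrized by `[a, b]`, of one of the boundary curves,
with diameter less than `h`, that contains the point `x` (of parameter `t`), such that the distance
from `x` to both end points is greater than `κ h`. -/
structure Patch (D : SmoothDomain) (κ h : ℝ) where
  i : Fin D.numCurves
  a : ℝ
  b : ℝ
  t : ℝ
  t_mem : t ∈ Icc a b
  length_lt : b - a < D.period i
  diam_lt : Metric.diam (D.curve i '' Icc a b) < h
  dist_left : κ * h < dist (D.curve i t) (D.curve i a)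
  dist_right : κ * h < dist (D.curve i t) (D.curve i b)

namespace Patch

variable {D : SmoothDomain} {κ h : ℝ}

/-- The local parametrization `χ` of the patch. -/
def χ (p : Patch D κ h) : ℝ → Plane := D.curve p.i

/-- The patch as a subset of `Γ`. -/
def arc (p : Patch D κ h) : Set Plane := p.χ '' Icc p.a p.b

/-- The point `x` at which the operators are evaluated. -/
def x (p : Patch D κ h) : Plane := p.χ p.t

end Patch

end

/-!
The interpolant `Φ` is a combination of point sources outside `closure Ω`, hence a smooth solution
`v` of the homogeneous system in a neighbourhood of `closure Ω`. Green's representation of such a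
field at a boundary point reads `K[γ₀ v] - S[γ₁ v] = -½ γ₀ v` and `T[γ₀ v] - K'[γ₁ v] = -½ γ₁ v`.
Subtracting it from `V` and `W` turns them into layer operators with the densities
`ψ₀ = α φ - γ₀ Φ` and `ψ₁ = β φ - γ₁ Φ`, minus half a trace of `Φ`, so the error of the method is
exactly the contribution of the patch to these operators. On the patch `ψ₀` and `ψ₁` vanish at `P`
points and have bounded derivatives of order `P`, so by Rolle's theorem they are `O(h^P)`, with
derivatives `O(h^(P-1))` and, if `P ≥ 2`, second derivatives `O(h^(P-2))`; the additional condition on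
`F₀''` for `P = 1` says that the second derivative of `ψ₀` is bounded. It remains to bound, for each of
the kernels, the finite part over a patch by the size of the density and of its Taylor coefficients.

*Finite parts.* All four operators are read as finite parts of the same kind: the kernel is
multiplied by a smooth or sharp cutoff `W(|x - y| / ε)`, and the integral has an expansion
`m / ε + v + o(1)` whose constant term does not depend on the cutoff (`HasCutoffFinitePart`). With the
sharp cutoff this is the principal value and the Hadamard finite part of the statement; with a smooth
one the divergence theorem in `Ω` applies. On a curve the singular functions `1 / s²` and `1 / s` are
replaced by derivatives of functions of the signed chord, whose cutoff integrals are explicit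
(`IsChordArc.tendsto_finitePart`), and the difference is integrable.

*Kernels on a patch.* An `IsFundamentalModel` has a Green's function with a principal part whose
gradient is homogeneous of degree `-1` and a remainder with logarithmically bounded derivatives.
Hence along a curve every kernel has an expansion `a(t) / (s - t)² + b(t) / (s - t)` up to a
logarithm (`HasSingularExpansion`). For `G` both coefficients vanish; `K` and `K'` have `a = 0`, and
for the scalar equations `K` also has `b = 0`, since the gradient of `log` at a tangent vector is
orthogonal to the normal; `T` has both. The resulting estimates are collected in `HasPatchBound`. They give
`h^(P+1) |log h|` for the scalar `V`, `h^P` for the elastic one and `h^(P-1)` for `W`; the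
distance `κ h` between `x` and the ends of the patch keeps the boundary terms of the finite parts
under control.

*Green's representation.* The reciprocity flux of two solutions is divergence free. Cutting it off at
distance `ε` from the boundary point `x` and letting `ε → 0` leaves an integral over the half plane
`{r | r · n(x) < 0}` of a homogeneous flux against the gradient of the cutoff. By parity this is half
of the flux over the whole plane, which is the normalization of the fundamental solution
(`bumpFlux`). For `T` and `K'` the same is done with the derivatives of the Green's function
(`IsDipoleField`). There the linear Taylor term of the solution takes the part of the constant one,
and the flux of the principal part against constants has a vanishing finite part, because it is the
derivative along the boundary of a function (`exists_hasCutoffFinitePart_homogeneous_two`).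

*The four models.* The Hankel function is given by its power series, from which Bessel's equation and
the logarithmic asymptotics at the origin follow. The elastic Green's functions combine a transversal
and a longitudinal wave (`hessField`) with Kelvin's tensor as principal part. The principal part of a
dynamic model is itself, up to a constant, the Green's function of the static one
(`IsFundamentalModel.of_principal`), so the static models need no separate verification.
-/

open Finset (sum_congr sum_comm sum_mul mul_sum sum_sub_distrib sum_neg_distrib sum_add_distrib sum_nonneg smul_sum)
open Complex (norm_real real_smul ofReal_ne_zero ofRealCLM ofReal_mul continuous_ofReal)
open Real (log norm_eq_abs log_div log_mul)
open Metric (ball closedBall)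
open EuclideanSpace (single proj)
open intervalIntegral (integral_of_le)
open scoped Real

noncomputable section

/-! ### The boundary curves near one of their points -/

lemma Plane.inner_eq (v w : Plane) : inner ℝ v w = v 0 * w 0 + v 1 * w 1 := by
  simp [PiLp.inner_apply, Fin.sum_univ_two, mul_comm]

lemma Plane.norm_sq_eq (v : Plane) : ‖v‖ ^ 2 = v 0 ^ 2 + v 1 ^ 2 := by
  rw [← real_inner_self_eq_norm_sq, Plane.inner_eq]; ring

@[simp] theorem rotCW_zero_apply (v : Plane) : rotCW v 0 = v 1 := by simp [rotCW]

@[simp] theorem rotCW_one_apply (v : Plane) : rotCW v 1 = -v 0 := by simp [rotCW]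

lemma norm_rotCW (v : Plane) : ‖rotCW v‖ = ‖v‖ := by
  have h : ‖rotCW v‖ ^ 2 = ‖v‖ ^ 2 := by
    rw [Plane.norm_sq_eq, Plane.norm_sq_eq]; simp; ring
  exact (sq_eq_sq₀ (norm_nonneg _) (norm_nonneg _)).1 h

/-- A plane vector is determined by its components along a nonzero vector and its rotation. -/
lemma Plane.eq_zero_of_inner_eq_zero {v τ : Plane} (hτ : τ ≠ 0) (h₁ : inner ℝ v τ = 0)
    (h₂ : inner ℝ v (rotCW τ) = 0) : v = 0 := by
  rw [Plane.inner_eq] at h₁ h₂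
  simp only [rotCW_zero_apply, rotCW_one_apply] at h₂
  have hτ2 : 0 < τ 0 ^ 2 + τ 1 ^ 2 := by
    rw [← Plane.norm_sq_eq]; positivity
  have h0 : v 0 * (τ 0 ^ 2 + τ 1 ^ 2) = 0 := by linear_combination τ 0 * h₁ + τ 1 * h₂
  have h1 : v 1 * (τ 0 ^ 2 + τ 1 ^ 2) = 0 := by linear_combination τ 1 * h₁ - τ 0 * h₂
  ext k
  fin_cases k
  · simpa using (mul_eq_zero.1 h0).resolve_right hτ2.ne'
  · simpa using (mul_eq_zero.1 h1).resolve_right hτ2.ne'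

lemma Function.Periodic.apply_toIcoMod {E : Type*} {f : ℝ → E} {T : ℝ}
    (hf : Function.Periodic f T) (hT : 0 < T) (c s : ℝ) : f (toIcoMod hT c s) = f s := by
  rw [toIcoMod]; exact hf.sub_zsmul_eq _

/-- A property that holds near `t` holds on all small intervals about `t`. -/
lemma eventually_forall_Icc {t : ℝ} {p : ℝ → Prop} (h : ∀ᶠ s in 𝓝 t, p s) :
    ∀ᶠ δ in 𝓝[>] (0 : ℝ), ∀ s ∈ Icc (t - δ) (t + δ), p s := by
  obtain ⟨ε, hε, h⟩ := Metric.eventually_nhds_iff_ball.1 h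
  filter_upwards [Ioo_mem_nhdsGT hε] with δ hδ s hs
  refine h s ?_
  rw [Real.ball_eq_Ioo]
  exact ⟨by linarith [hs.1, hδ.2], by linarith [hs.2, hδ.2]⟩

lemma int_eq_zero_of_abs_mul_lt {k : ℤ} {T : ℝ} (h₁ : -T < k * T) (h₂ : k * T < T) : k = 0 := by
  have hT : 0 ≤ T := by linarith
  have h3 := lt_of_mul_lt_mul_right (by linarith : (-1 : ℝ) * T < k * T) hT
  have h4 := lt_of_mul_lt_mul_right (by linarith : k * T < (1 : ℝ) * T) hT
  norm_cast at h3 h4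
  omega

namespace SmoothDomain

variable (D : SmoothDomain)

lemma curve_continuous (i : Fin D.numCurves) : Continuous (D.curve i) :=
  (D.curve_smooth i).continuous

lemma curve_differentiable (i : Fin D.numCurves) : Differentiable ℝ (D.curve i) :=
  (D.curve_smooth i).differentiable (by simp)

lemma curve_hasDerivAt (i : Fin D.numCurves) (s : ℝ) :
    HasDerivAt (D.curve i) (deriv (D.curve i) s) s :=
  (D.curve_differentiable i s).hasDerivAt

lemma deriv_curve_smooth (i : Fin D.numCurves) : ContDiff ℝ ∞ (deriv (D.curve i)) :=
  (contDiff_infty_iff_deriv.1 (D.curve_smooth i)).2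

lemma deriv_curve_continuous (i : Fin D.numCurves) : Continuous (deriv (D.curve i)) :=
  (D.deriv_curve_smooth i).continuous

lemma curve_eq_iff (i : Fin D.numCurves) {s s' : ℝ} :
    D.curve i s = D.curve i s' ↔ ∃ k : ℤ, s' = s + k * D.period i := by
  constructor
  · intro h
    have hT := D.period_pos i
    have e : ∀ u, D.curve i u = D.curve i (toIcoMod hT 0 u) := fun u =>
      ((D.curve_periodic i).apply_toIcoMod hT 0 u).symm
    have m : ∀ u, toIcoMod hT 0 u ∈ Ico 0 (D.period i) := fun u => by
      simpa using toIcoMod_mem_Ico hT 0 u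
    rw [e s, e s'] at h
    have h2 := D.curve_injOn i (m s) (m s') h
    refine ⟨toIcoDiv hT 0 s' - toIcoDiv hT 0 s, ?_⟩
    have a := toIcoMod_add_toIcoDiv_zsmul hT 0 s
    have b := toIcoMod_add_toIcoDiv_zsmul hT 0 s'
    simp only [zsmul_eq_mul] at a b
    push_cast
    rw [sub_mul]
    linarith
  · rintro ⟨k, rfl⟩
    have := (D.curve_periodic i).int_mul k s
    exact this.symm

lemma curve_mem_frontier (i : Fin D.numCurves) (s : ℝ) : D.curve i s ∈ frontier D.Ω := by
  rw [D.frontier_eq]; exact mem_iUnion.2 ⟨i, s, rfl⟩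

lemma curve_notMem (i : Fin D.numCurves) (s : ℝ) : D.curve i s ∉ D.Ω :=
  (D.isOpen_Ω.frontier_eq ▸ D.curve_mem_frontier i s).2

lemma norm_normal (i : Fin D.numCurves) (s : ℝ) : ‖D.normal (D.curve i s)‖ = 1 := by
  rw [D.normal_curve, norm_smul, norm_inv, norm_norm, norm_rotCW]
  exact inv_mul_cancel₀ (norm_ne_zero_iff.2 (D.curve_regular i s))

lemma speed_smul_normal (i : Fin D.numCurves) (s : ℝ) :
    ‖deriv (D.curve i) s‖ • D.normal (D.curve i s) = rotCW (deriv (D.curve i) s) := by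
  rw [D.normal_curve, smul_smul, mul_inv_cancel₀ (norm_ne_zero_iff.2 (D.curve_regular i s)),
    one_smul]

lemma inner_normal_deriv (i : Fin D.numCurves) (s : ℝ) :
    inner ℝ (D.normal (D.curve i s)) (deriv (D.curve i) s) = 0 := by
  rw [D.normal_curve, inner_smul_left, Plane.inner_eq]
  simp; right; ring

lemma range_curve_isCompact (j : Fin D.numCurves) : IsCompact (range (D.curve j)) := by
  have : range (D.curve j) = D.curve j '' Icc 0 (0 + D.period j) :=
    ((D.curve_periodic j).image_Icc (D.period_pos j) 0).symm
  rw [this]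
  exact isCompact_Icc.image (D.curve_continuous j)

section Arc

variable {D} {i : Fin D.numCurves} {a t b : ℝ}

lemma curve_mem_arc_iff (hab : b - a < D.period i) {s : ℝ} (hs : s ∈ Ico a (a + D.period i)) :
    D.curve i s ∈ D.curve i '' Icc a b ↔ s ∈ Icc a b := by
  refine ⟨?_, fun h => mem_image_of_mem _ h⟩
  rintro ⟨u, hu, hus⟩
  obtain ⟨k, hk⟩ := (D.curve_eq_iff i).1 hus
  have := int_eq_zero_of_abs_mul_lt (k := k) (T := D.period i) (by linarith [hu.2, hs.1])
    (by linarith [hu.1, hs.2])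
  rw [hk, this]
  simpa using hu

lemma arc_isCompact : IsCompact (D.curve i '' Icc a b) :=
  isCompact_Icc.image (D.curve_continuous i)

lemma curve_notMem_arc {j : Fin D.numCurves} (hj : j ≠ i) (s : ℝ) :
    D.curve j s ∉ D.curve i '' Icc a b := by
  rintro ⟨u, -, hu⟩
  exact disjoint_left.1 (D.curve_disjoint j i hj) (mem_range_self s) ⟨u, hu⟩

/-- The rest of the boundary keeps a positive distance from an interior point of an arc. -/
lemma exists_dist_ge_of_notMem_arc (hab : b - a < D.period i) (ht : t ∈ Ioo a b) :
    ∃ d > 0, ∀ y ∈ frontier D.Ω, y ∉ D.curve i '' Icc a b → d ≤ dist y (D.curve i t) := by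
  set K : Set Plane := (⋃ j ∈ ({j | j ≠ i} : Set (Fin D.numCurves)), range (D.curve j)) ∪
    D.curve i '' Icc b (a + D.period i)
  have hKc : IsCompact K :=
    ((toFinite _).isCompact_biUnion fun j _ => D.range_curve_isCompact j).union
      (isCompact_Icc.image (D.curve_continuous i))
  have hsub : ∀ y ∈ frontier D.Ω, y ∉ D.curve i '' Icc a b → y ∈ K := by
    intro y hy hya
    rw [D.frontier_eq] at hy
    obtain ⟨j, s, rfl⟩ := mem_iUnion.1 hy
    by_cases hj : j = i
    · subst hj
      right
      rw [← (D.curve_periodic j).apply_toIcoMod (D.period_pos j) a s] at hya ⊢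
      have hm := toIcoMod_mem_Ico (D.period_pos j) a s
      rw [curve_mem_arc_iff hab hm] at hya
      exact mem_image_of_mem _ ⟨not_lt.1 fun hc => hya ⟨hm.1, hc.le⟩, hm.2.le⟩
    · left
      exact mem_biUnion (show j ∈ {j | j ≠ i} from hj) (mem_range_self s)
  have hx : D.curve i t ∉ K := by
    rintro (h | ⟨u, hu, hut⟩)
    · obtain ⟨j, hj, hjm⟩ := mem_iUnion₂.1 h
      exact disjoint_left.1 (D.curve_disjoint j i hj) hjm (mem_range_self t)
    · obtain ⟨k, hk⟩ := (D.curve_eq_iff i).1 hut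
      have := int_eq_zero_of_abs_mul_lt (k := k) (T := D.period i) (by linarith [hu.2, ht.1])
        (by linarith [hu.1, ht.2, D.period_pos i])
      simp [this] at hk
      linarith [hu.1, ht.2]
  obtain ⟨d, hd, hdb⟩ := Metric.isOpen_iff.1 hKc.isClosed.isOpen_compl _ hx
  exact ⟨d, hd, fun y hy hya => not_lt.1 fun hc => hdb (Metric.mem_ball.2 hc) (hsub y hy hya)⟩

end Arc

/-- Near a boundary point `x = γ(t)` the coordinates `(s, ν) ↦ γ(s) + ν n(x)` flatten the boundary:
in a small box the boundary is `ν = 0`, the domain is `ν < 0`, and the box covers a disc about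
`x`. -/
lemma exists_localBox (i : Fin D.numCurves) (t : ℝ) :
    ∃ δ > 0, ∃ η > 0, δ < D.period i / 2 ∧
      (∀ s ∈ Icc (t - δ) (t + δ), 0 < inner ℝ (deriv (D.curve i) s) (deriv (D.curve i) t)) ∧
      (∀ s ∈ Icc (t - δ) (t + δ), ∀ ν : ℝ, |ν| ≤ η →
        (ν < 0 → D.curve i s + ν • D.normal (D.curve i t) ∈ D.Ω) ∧
        (0 < ν → D.curve i s + ν • D.normal (D.curve i t) ∉ closure D.Ω) ∧
        ∀ j s', D.curve j s' = D.curve i s + ν • D.normal (D.curve i t) →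
          j = i ∧ ν = 0 ∧ ∃ k : ℤ, s' = s + k * D.period i) ∧
      (∀ s ∈ Icc (t - δ) (t + δ), ∀ s' ∈ Icc (t - δ) (t + δ), ∀ ν ν' : ℝ,
        D.curve i s + ν • D.normal (D.curve i t) = D.curve i s' + ν' • D.normal (D.curve i t) →
          s = s' ∧ ν = ν') ∧
      ∃ r > 0, ∀ y ∈ ball (D.curve i t) r, ∃ s ∈ Ioo (t - δ) (t + δ), ∃ ν : ℝ, |ν| < η ∧
        y = D.curve i s + ν • D.normal (D.curve i t) := by
  set γ := D.curve i with hγ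
  set τ := deriv γ t with hτ
  set n := D.normal (γ t)
  set T := D.period i
  have hTpos : 0 < T := D.period_pos i
  have hτ0 : τ ≠ 0 := D.curve_regular i t
  have hn1 : ‖n‖ = 1 := D.norm_normal i t
  have hnτ : inner ℝ n τ = 0 := D.inner_normal_deriv i t
  have hcont : Continuous γ := D.curve_continuous i
  -- the tangential coordinate is increasing for parameters near `t`
  obtain ⟨δ₁, hpos, hδ₁, hδ₁T⟩ := ((eventually_forall_Icc
    (((D.deriv_curve_continuous i).inner continuous_const).tendsto t |>.eventually
      (lt_mem_nhds (real_inner_self_pos.2 hτ0)))).and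
    (Ioo_mem_nhdsGT (show 0 < T / 2 by positivity))).exists
  have hmono : StrictMonoOn (fun s => inner ℝ (γ s) τ) (Icc (t - δ₁) (t + δ₁)) := by
    apply strictMonoOn_of_deriv_pos (convex_Icc _ _) (hcont.inner continuous_const).continuousOn
    intro s hs
    have : HasDerivAt (fun s => inner ℝ (γ s) τ) (inner ℝ (deriv γ s) τ) s := by
      simpa using (D.curve_hasDerivAt i s).inner ℝ (hasDerivAt_const s τ)
    rw [this.deriv]
    exact hpos s (interior_subset hs)
  have hinj : ∀ s ∈ Icc (t - δ₁) (t + δ₁), ∀ s' ∈ Icc (t - δ₁) (t + δ₁), ∀ ν ν' : ℝ,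
      γ s + ν • n = γ s' + ν' • n → s = s' ∧ ν = ν' := by
    intro s hs s' hs' ν ν' h
    obtain rfl : s = s' := hmono.injOn hs hs' <| by
      simpa [inner_add_left, inner_smul_left, hnτ] using congrArg (fun v => inner ℝ v τ) h
    exact ⟨rfl, smul_left_injective ℝ (norm_ne_zero_iff.1 (by simp [hn1])) (add_left_cancel h)⟩
  -- the rest of the boundary has positive distance from `x`
  obtain ⟨d, hd, hfar⟩ := exists_dist_ge_of_notMem_arc (i := i) (t := t) (a := t - δ₁) (b := t + δ₁)
    (by change _ < T; linarith) ⟨by linarith, by linarith⟩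
  set η := d / 4 with hη
  have hη0 : 0 < η := by positivity
  obtain ⟨δ, hclose, hδ, hδδ₁⟩ := ((eventually_forall_Icc (Metric.continuousAt_iff'.1
    hcont.continuousAt (η / 2) (by positivity))).and (Ioc_mem_nhdsGT hδ₁)).exists
  simp only [dist_eq_norm] at hclose
  have hsub : Icc (t - δ) (t + δ) ⊆ Icc (t - δ₁) (t + δ₁) :=
    Icc_subset_Icc (by linarith) (by linarith)
  have hgam : ∀ s ∈ Icc (t - δ) (t + δ), ∀ ν : ℝ, |ν| ≤ η → ∀ j s',
        D.curve j s' = γ s + ν • n → j = i ∧ ν = 0 ∧ ∃ k : ℤ, s' = s + k * T := by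
    intro s hs ν hν j s' h
    have hd : dist (γ s + ν • n) (γ t) < d := by
      rw [dist_eq_norm, add_sub_right_comm]
      refine (norm_add_le _ _).trans_lt ?_
      rw [norm_smul, hn1, mul_one, norm_eq_abs]
      linarith [hclose s hs]
    obtain ⟨u, hu, e⟩ : D.curve j s' ∈ γ '' Icc (t - δ₁) (t + δ₁) := by
      by_contra hc
      exact (hfar _ (D.curve_mem_frontier j s') hc).not_gt (h ▸ hd)
    obtain rfl : j = i := by
      by_contra hj
      exact curve_notMem_arc hj s' ⟨u, hu, e⟩
    obtain ⟨rfl, h2⟩ := hinj u hu s (hsub hs) 0 ν (by rw [zero_smul, add_zero, e, h])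
    exact ⟨rfl, h2.symm, (D.curve_eq_iff j).1 e⟩
  -- the two halves of the box are connected and do not meet the boundary
  have hpre : ∀ I : Set ℝ, Convex ℝ I →
      IsPreconnected ((fun p : ℝ × ℝ => γ p.1 + p.2 • n) '' (Icc (t - δ) (t + δ) ×ˢ I)) :=
    fun I hI => ((convex_Icc _ _).prod hI).isPreconnected.image _ (by fun_prop)
  have hhalf : ∀ I : Set ℝ, (∀ ν ∈ I, |ν| ≤ η ∧ ν ≠ 0) →
      (fun p : ℝ × ℝ => γ p.1 + p.2 • n) '' (Icc (t - δ) (t + δ) ×ˢ I) ⊆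
        D.Ω ∪ (closure D.Ω)ᶜ := by
    rintro I hI _ ⟨⟨s, ν⟩, ⟨hs, hν⟩, rfl⟩
    by_contra hc
    have : γ s + ν • n ∈ frontier D.Ω := by
      rw [D.isOpen_Ω.frontier_eq]
      simpa [and_comm, not_or] using hc
    rw [D.frontier_eq, mem_iUnion] at this
    obtain ⟨j, s', h⟩ := this
    exact (hI ν hν).2 (hgam s hs ν (hI ν hν).1 j s' h).2.1
  have hdisj : Disjoint D.Ω (closure D.Ω)ᶜ := disjoint_compl_right.mono_left subset_closure
  have htm : t ∈ Icc (t - δ) (t + δ) := ⟨by linarith, by linarith⟩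
  obtain ⟨ε, ⟨hε1, hε2⟩, hε3⟩ := ((D.one_sided (γ t) (D.curve_mem_frontier i t)).and
    (Ioo_mem_nhdsGT hη0)).exists
  have hin := image_subset_iff.1 <| (hpre _ (convex_Ico (-η) 0)).subset_left_of_subset_union
    D.isOpen_Ω isClosed_closure.isOpen_compl hdisj
    (hhalf _ fun ν h => ⟨abs_le.2 ⟨h.1, by linarith [h.2]⟩, h.2.ne⟩)
    ⟨_, ⟨(t, -ε), ⟨htm, by constructor <;> simp [hε3.1, hε3.2.le]⟩, rfl⟩, by
      simpa [sub_eq_add_neg] using hε1⟩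
  have hout := image_subset_iff.1 <| (hpre _ (convex_Ioc 0 η)).subset_right_of_subset_union
    D.isOpen_Ω isClosed_closure.isOpen_compl hdisj
    (hhalf _ fun ν h => ⟨abs_le.2 ⟨by linarith [h.1], h.2⟩, h.1.ne'⟩)
    ⟨_, ⟨(t, ε), ⟨htm, by simpa using ⟨hε3.1, hε3.2.le⟩⟩, rfl⟩, hε2⟩
  refine ⟨δ, hδ, η, hη0, hδδ₁.trans_lt hδ₁T, fun s hs => hpos s (hsub hs), fun s hs ν hν =>
    ⟨fun h => @hin (s, ν) ⟨hs, (abs_le.1 hν).1, h⟩,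
      fun h => @hout (s, ν) ⟨hs, h, (abs_le.1 hν).2⟩, hgam s hs ν hν⟩,
    fun s hs s' hs' => hinj s (hsub hs) s' (hsub hs'), ?_⟩
  -- the box covers a disc: solve for the tangential coordinate with the intermediate value theorem
  have hc : Continuous (fun y : Plane => inner ℝ y τ) := by fun_prop
  have hev : ∀ᶠ y in 𝓝 (γ t), inner ℝ y τ ∈ Ioo (inner ℝ (γ (t - δ)) τ) (inner ℝ (γ (t + δ)) τ) :=
    hc.tendsto _ |>.eventually <| Ioo_mem_nhds
      (hmono (hsub ⟨le_rfl, by linarith⟩) (hsub htm) (by linarith))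
      (hmono (hsub htm) (hsub ⟨by linarith, le_rfl⟩) (by linarith))
  obtain ⟨r, hr0, hrb⟩ := Metric.eventually_nhds_iff_ball.1
    (hev.and (Metric.ball_mem_nhds _ (half_pos hη0)))
  refine ⟨r, hr0, fun y hy => ?_⟩
  obtain ⟨h1, h3⟩ := hrb y hy
  obtain ⟨s, hs, hsy⟩ := intermediate_value_Ioo (by linarith : t - δ ≤ t + δ)
    (hc.comp hcont).continuousOn h1
  refine ⟨s, hs, inner ℝ (y - γ s) n, ?_, ?_⟩
  · have h4 := hclose s (Ioo_subset_Icc_self hs)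
    have h5 := (abs_real_inner_le_norm (y - γ s) n).trans_eq
      (by rw [hn1, mul_one, ← sub_sub_sub_cancel_right y (γ s) (γ t)])
    rw [dist_eq_norm] at h3
    linarith [norm_sub_le (y - γ t) (γ s - γ t)]
  · refine (sub_eq_iff_eq_add'.1 (sub_eq_zero.1 (Plane.eq_zero_of_inner_eq_zero hτ0 ?_ ?_)))
    · simp only [inner_sub_left, inner_smul_left, hnτ]
      simpa [sub_eq_zero] using hsy.symm
    · rw [← D.speed_smul_normal i t, inner_smul_right, inner_sub_left, inner_smul_left,
        real_inner_self_eq_norm_sq, hn1]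
      simp [n, hγ]

end SmoothDomain

/-! ### The divergence theorem on a smooth plane domain -/

/-- The partial derivative `∂_j f` of a function on the plane. -/
def pd (j : Fin 2) (f : Plane → ℂ) (x : Plane) : ℂ := fderiv ℝ f x (single j 1)

lemma Plane.eq_sum_single (v : Plane) :
    v = v 0 • single 0 (1 : ℝ) + v 1 • single 1 (1 : ℝ) := by
  ext k; fin_cases k <;> simp

lemma fderiv_eq_pd (f : Plane → ℂ) (x v : Plane) :
    fderiv ℝ f x v = v 0 * pd 0 f x + v 1 * pd 1 f x := by
  conv_lhs => rw [Plane.eq_sum_single v]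
  rw [map_add, map_smul, map_smul]
  simp [pd]

lemma continuous_pd {f : Plane → ℂ} (hf : ContDiff ℝ 1 f) (j : Fin 2) : Continuous (pd j f) :=
  (hf.continuous_fderiv (by simp)).clm_apply continuous_const

lemma pd_eq_zero_of_notMem_tsupport {f : Plane → ℂ} {x : Plane} (hx : x ∉ tsupport f)
    (j : Fin 2) : pd j f x = 0 := by
  have : fderiv ℝ f x = 0 := by
    by_contra h
    exact hx (support_fderiv_subset ℝ h)
  simp [pd, this]

lemma integrable_pd {f : Plane → ℂ} (hf : ContDiff ℝ 1 f) (hc : HasCompactSupport f)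
    (j : Fin 2) : Integrable (pd j f) :=
  (continuous_pd hf j).integrable_of_hasCompactSupport <| hc.mono' fun _ hx =>
    not_not.1 fun h => hx (pd_eq_zero_of_notMem_tsupport h j)

lemma integral_pd_eq_zero {f : Plane → ℂ} (hf : ContDiff ℝ 1 f) (hc : HasCompactSupport f)
    (j : Fin 2) : ∫ x, pd j f x = 0 := by
  simpa [pd] using integral_mul_fderiv_eq_neg_fderiv_mul_of_integrable
    (μ := (volume : Measure Plane)) (f := fun _ => (1 : ℂ)) (g := f) (v := single j 1) (by simp)
    (by simp only [one_mul]; exact integrable_pd hf hc j)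
    (by simpa using hf.continuous.integrable_of_hasCompactSupport hc)
    (fun x _ => by fun_prop) (fun x _ => hf.differentiable (by simp) x)

/-- Coordinates on the plane as a measurable equivalence with `ℝ × ℝ`. -/
def planeEquiv : Plane ≃ᵐ ℝ × ℝ :=
  (MeasurableEquiv.toLp 2 (Fin 2 → ℝ)).symm.trans MeasurableEquiv.finTwoArrow

lemma planeEquiv_measurePreserving : MeasurePreserving planeEquiv volume volume :=
  (volume_preserving_finTwoArrow ℝ).comp
    (EuclideanSpace.volume_preserving_symm_measurableEquiv_toLp (Fin 2))

/-- Change of variables for a map from `ℝ × ℝ` to the plane, with partial derivatives `a`, `b`. -/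
lemma setIntegral_image_plane {B : Set (ℝ × ℝ)} (hB : MeasurableSet B) {Ψ : ℝ × ℝ → Plane}
    {a b : ℝ × ℝ → Plane} (hinj : InjOn Ψ B)
    (hΨ : ∀ p ∈ B, HasFDerivAt Ψ ((ContinuousLinearMap.fst ℝ ℝ ℝ).smulRight (a p) +
      (ContinuousLinearMap.snd ℝ ℝ ℝ).smulRight (b p)) p) (G : Plane → ℂ) :
    ∫ y in Ψ '' B, G y = ∫ p in B, |a p 0 * b p 1 - a p 1 * b p 0| • G (Ψ p) := by
  set M : ℝ × ℝ → ℝ × ℝ →L[ℝ] ℝ × ℝ := fun p =>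
    (Matrix.toLin (Module.Basis.finTwoProd ℝ) (Module.Basis.finTwoProd ℝ)
      !![a p 0, b p 0; a p 1, b p 1]).toContinuousLinearMap with hM
  have hdet : ∀ p, (M p).det = a p 0 * b p 1 - a p 1 * b p 0 := by
    intro p
    rw [hM]
    simp only [LinearMap.det_toContinuousLinearMap, LinearMap.det_toLin, Matrix.det_fin_two_of]
    ring
  have hd : ∀ p ∈ B, HasFDerivWithinAt (fun p => planeEquiv (Ψ p)) (M p) B p := by
    intro p hp
    apply HasFDerivAt.hasFDerivWithinAt
    rw [hM]
    simp only [Matrix.toLin_finTwoProd_toContinuousLinearMap]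
    have h0 : HasFDerivAt (fun p => Ψ p 0) _ p :=
      (proj (𝕜 := ℝ) (0 : Fin 2)).hasFDerivAt.comp p (hΨ p hp)
    have h1 : HasFDerivAt (fun p => Ψ p 1) _ p :=
      (proj (𝕜 := ℝ) (1 : Fin 2)).hasFDerivAt.comp p (hΨ p hp)
    refine (h0.prodMk h1).congr_fderiv ?_
    ext <;> simp
  have h := integral_image_eq_integral_abs_det_fderiv_smul volume hB hd
    (planeEquiv.injective.comp_injOn hinj) (fun q => G (planeEquiv.symm q))
  simp only [hdet, MeasurableEquiv.symm_apply_apply] at h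
  rw [← h, ← planeEquiv_measurePreserving.setIntegral_preimage_emb
    planeEquiv.measurableEmbedding]
  have : planeEquiv ⁻¹' ((fun p => planeEquiv (Ψ p)) '' B) = Ψ '' B := by
    ext y
    constructor
    · rintro ⟨p, hp, h⟩; exact ⟨p, hp, planeEquiv.injective h⟩
    · rintro ⟨p, hp, rfl⟩; exact ⟨p, hp, rfl⟩
  rw [this]
  simp

namespace SmoothDomain

variable (D : SmoothDomain)

/-- The flux of a field through the boundary, in the parametrizations. -/
lemma lineIntegral_univ_normal (F : Fin 2 → Plane → ℂ) :
    D.lineIntegral univ (fun y => ∑ j, F j y * (D.normal y j : ℂ)) =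
      ∑ i, ∫ s in (0 : ℝ)..D.period i,
        (F 0 (D.curve i s) * deriv (D.curve i) s 1 - F 1 (D.curve i s) * deriv (D.curve i) s 0) := by
  unfold lineIntegral
  refine sum_congr rfl fun i _ => ?_
  rw [preimage_univ, inter_univ, integral_of_le (D.period_pos i).le,
    setIntegral_congr_set (Ico_ae_eq_Ioc (μ := volume))]
  congr 1
  ext s
  have h := D.speed_smul_normal i s
  have h0 := congrArg (fun v : Plane => ((v 0 : ℝ) : ℂ)) h
  have h1 := congrArg (fun v : Plane => ((v 1 : ℝ) : ℂ)) h
  simp only [PiLp.smul_apply, smul_eq_mul, rotCW_zero_apply, rotCW_one_apply, ofReal_mul,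
    Complex.ofReal_neg] at h0 h1
  simp only [Fin.sum_univ_two, real_smul]
  linear_combination F 0 (D.curve i s) * h0 + F 1 (D.curve i s) * h1

lemma deriv_curve_periodic (i : Fin D.numCurves) :
    Function.Periodic (deriv (D.curve i)) (D.period i) := by
  intro s
  have : (fun u => D.curve i (u + D.period i)) = D.curve i := funext (D.curve_periodic i)
  conv_rhs => rw [← this]
  rw [deriv_comp_add_const]

/-- The divergence theorem for a field supported near a boundary point. -/
lemma exists_divergence_ball (i : Fin D.numCurves) (t : ℝ) :
    ∃ r > 0, ∀ F : Fin 2 → Plane → ℂ, (∀ j, ContDiff ℝ 1 (F j)) →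
      (∀ j, tsupport (F j) ⊆ ball (D.curve i t) r) →
      D.lineIntegral univ (fun y => ∑ j, F j y * (D.normal y j : ℂ)) =
        ∫ y in D.Ω, ∑ j, pd j (F j) y := by
  obtain ⟨δ, hδ, η, hη, hδT, hpos, hbox, hinj, r, hr, hcov⟩ := D.exists_localBox i t
  refine ⟨r, hr, fun F hF hsupp => ?_⟩
  set γ := D.curve i with hγ
  set n := D.normal (γ t)
  set J := Icc (t - δ) (t + δ)
  have hz : ∀ j y, y ∉ ball (γ t) r → F j y = 0 := fun j y hy =>
    image_eq_zero_of_notMem_tsupport fun h => hy (hsupp j h)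
  set Ψ : ℝ × ℝ → Plane := fun p => γ p.1 + p.2 • n with hΨ
  have hΨd : ∀ p : ℝ × ℝ, HasFDerivAt Ψ ((ContinuousLinearMap.fst ℝ ℝ ℝ).smulRight (deriv γ p.1) +
      (ContinuousLinearMap.snd ℝ ℝ ℝ).smulRight n) p := by
    intro p
    have h1 : HasFDerivAt (fun p : ℝ × ℝ => γ p.1) _ p :=
      (D.curve_hasDerivAt i p.1).hasFDerivAt.comp p hasFDerivAt_fst
    refine (h1.add ((hasFDerivAt_snd (𝕜 := ℝ) (E := ℝ) (F := ℝ) (p := p)).smul_const n)).congr_fderiv ?_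
    ext <;> simp [hγ]
  have hΨs : ContDiff ℝ ∞ Ψ :=
    ((D.curve_smooth i).comp contDiff_fst).add (contDiff_snd.smul contDiff_const)
  -- the fields that appear in the coordinates
  set f : ℝ × ℝ → ℂ := fun p => n 0 * F 1 (Ψ p) - n 1 * F 0 (Ψ p) with hf
  set g : ℝ × ℝ → ℂ := fun p => F 0 (Ψ p) * deriv γ p.1 1 - F 1 (Ψ p) * deriv γ p.1 0 with hg
  have hFΨ : ∀ j, ContDiff ℝ 1 (fun p => F j (Ψ p)) := fun j => (hF j).comp (hΨs.of_le (by simp))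
  have hFd : ∀ j p, HasFDerivAt (fun p => F j (Ψ p)) ((fderiv ℝ (F j) (Ψ p)).comp
      ((ContinuousLinearMap.fst ℝ ℝ ℝ).smulRight (deriv γ p.1) +
      (ContinuousLinearMap.snd ℝ ℝ ℝ).smulRight n)) p := fun j p =>
    ((hF j).differentiable (by simp) _).hasFDerivAt.comp p (hΨd p)
  have hc : ∀ k : Fin 2, ContDiff ℝ 1 (fun s => ((deriv γ s k : ℝ) : ℂ)) := fun k =>
    ofRealCLM.contDiff.comp ((proj (𝕜 := ℝ) k).contDiff.comp
      ((D.deriv_curve_smooth i).of_le (by simp)))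
  have hcd : ∀ k (p : ℝ × ℝ), HasFDerivAt (fun p : ℝ × ℝ => ((deriv γ p.1 k : ℝ) : ℂ)) _ p :=
    fun k p => ((hc k).differentiable (by simp) p.1).hasFDerivAt.comp p hasFDerivAt_fst
  have hf1 : ContDiff ℝ 1 f := (contDiff_const.mul (hFΨ 1)).sub (contDiff_const.mul (hFΨ 0))
  have hg1 : ContDiff ℝ 1 g := ((hFΨ 0).mul ((hc 1).comp contDiff_fst)).sub
    ((hFΨ 1).mul ((hc 0).comp contDiff_fst))
  have hfd : ∀ p, fderiv ℝ f p (1, 0) =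
      n 0 * fderiv ℝ (F 1) (Ψ p) (deriv γ p.1) - n 1 * fderiv ℝ (F 0) (Ψ p) (deriv γ p.1) := by
    intro p
    rw [(show HasFDerivAt f _ p from
      ((hFd 1 p).const_mul (n 0 : ℂ)).sub ((hFd 0 p).const_mul (n 1 : ℂ))).fderiv]
    simp
  have hgd : ∀ p, fderiv ℝ g p (0, 1) =
      fderiv ℝ (F 0) (Ψ p) n * deriv γ p.1 1 - fderiv ℝ (F 1) (Ψ p) n * deriv γ p.1 0 := by
    intro p
    rw [(show HasFDerivAt g _ p from
      ((hFd 0 p).mul (hcd 1 p)).sub ((hFd 1 p).mul (hcd 0 p))).fderiv]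
    simp [mul_comm]
  -- the line integral is an integral over the axis of the box
  have hL : D.lineIntegral univ (fun y => ∑ j, F j y * (D.normal y j : ℂ)) =
      ∫ s in (t - δ)..(t + δ), g (s, 0) := by
    have hnot : ∀ j s, D.curve j s ∈ ball (γ t) r →
        ∃ s' ∈ Ioo (t - δ) (t + δ), j = i ∧ ∃ k : ℤ, s = s' + k * D.period i := by
      intro j s hs
      obtain ⟨s', hs', ν, hν, h⟩ := hcov _ hs
      obtain ⟨h1, -, h2⟩ := (hbox s' (Ioo_subset_Icc_self hs') ν hν.le).2.2 j s h
      exact ⟨s', hs', h1, h2⟩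
    have hg0 : ∀ s, g (s, 0) = F 0 (γ s) * deriv γ s 1 - F 1 (γ s) * deriv γ s 0 := by
      simp [hg, hΨ]
    rw [lineIntegral_univ_normal, Finset.sum_eq_single i]
    · simp only [← hγ, ← hg0]
      have hper : Function.Periodic (fun s => g (s, 0)) (D.period i) := by
        intro s
        simp only [hg0, hγ, D.curve_periodic i s, D.deriv_curve_periodic i s]
      have hci : Continuous (fun s => g (s, 0)) := hg1.continuous.comp (by fun_prop)
      rw [← zero_add (D.period i), hper.intervalIntegral_add_eq 0 (t - δ),
        ← intervalIntegral.integral_add_adjacent_intervals (b := t + δ)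
        (hci.intervalIntegrable _ _) (hci.intervalIntegrable _ _), add_eq_left]
      refine intervalIntegral.integral_zero_ae (Eventually.of_forall fun s hs => ?_)
      rw [uIoc_of_le (by linarith)] at hs
      have : γ s ∉ ball (γ t) r := fun hb => by
        obtain ⟨s', hs', -, k, hk⟩ := hnot i s hb
        have := int_eq_zero_of_abs_mul_lt (k := k) (T := D.period i)
          (by linarith [D.period_pos i, hs.1, hs'.2]) (by linarith [hs.2, hs'.1])
        simp [this] at hk
        linarith [hs.1, hs'.2]
      simp [hg0, hz _ _ this]
    · intro j _ hj
      refine intervalIntegral.integral_zero_ae (Eventually.of_forall fun s _ => ?_)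
      have : D.curve j s ∉ ball (γ t) r := fun hb => by
        obtain ⟨-, -, h, -⟩ := hnot j s hb
        exact hj h
      simp [hz _ _ this]
    · simp
  set B : Set (ℝ × ℝ) := J ×ˢ Ico (-η) 0 with hB
  have hBm : MeasurableSet B := measurableSet_Icc.prod measurableSet_Ico
  have hinjB : InjOn Ψ B := by
    rintro ⟨s, ν⟩ hp ⟨s', ν'⟩ hp' h
    exact Prod.ext_iff.2 (hinj s hp.1 s' hp'.1 ν ν' h)
  have hin : Ψ '' B ⊆ D.Ω := by
    rintro _ ⟨p, hp, rfl⟩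
    exact (hbox p.1 hp.1 p.2 (abs_le.2 ⟨hp.2.1, by linarith [hp.2.2]⟩)).1 hp.2.2
  have hzero : ∀ y ∈ D.Ω \ Ψ '' B, ∑ j, pd j (F j) y = 0 := by
    rintro y ⟨hy, hyB⟩
    have hnot : y ∉ ball (γ t) r := fun hc => by
      obtain ⟨s, hs, ν, hν, rfl⟩ := hcov y hc
      have hs' := Ioo_subset_Icc_self hs
      rcases lt_trichotomy ν 0 with h0 | rfl | h0
      · exact hyB ⟨(s, ν), ⟨hs', (abs_lt.1 hν).1.le, h0⟩, rfl⟩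
      · rw [zero_smul, add_zero] at hy
        exact D.curve_notMem i s hy
      · exact (hbox s hs' ν hν.le).2.1 h0 (subset_closure hy)
    exact Finset.sum_eq_zero fun j _ => pd_eq_zero_of_notMem_tsupport (fun h => hnot (hsupp j h)) j
  -- the Jacobian times the divergence is a divergence in the new coordinates
  have hkey : ∀ p ∈ B, |deriv γ p.1 0 * n 1 - deriv γ p.1 1 * n 0| • ∑ j, pd j (F j) (Ψ p) =
      fderiv ℝ f p (1, 0) + fderiv ℝ g p (0, 1) := by
    intro p hp
    have hp1 := hpos p.1 hp.1
    have hτn := D.speed_smul_normal i t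
    have h0 := congrArg (fun v : Plane => v 0) hτn
    have h1 := congrArg (fun v : Plane => v 1) hτn
    simp only [PiLp.smul_apply, smul_eq_mul, rotCW_zero_apply, rotCW_one_apply] at h0 h1
    rw [Plane.inner_eq] at hp1
    have hJ : deriv γ p.1 0 * n 1 - deriv γ p.1 1 * n 0 < 0 := by
      refine neg_of_mul_neg_right (a := ‖deriv γ t‖) ?_ (norm_nonneg _)
      linear_combination hp1 + deriv γ p.1 0 * h1 - deriv γ p.1 1 * h0
    rw [abs_of_neg hJ, hfd, hgd, Fin.sum_univ_two, fderiv_eq_pd (F 0), fderiv_eq_pd (F 1),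
      fderiv_eq_pd (F 0) _ n, fderiv_eq_pd (F 1) _ n, real_smul]
    push_cast
    ring
  have hvan : ∀ s ∈ J, ∀ ν, s ∉ Ioo (t - δ) (t + δ) ∨ η ≤ |ν| → f (s, ν) = 0 ∧ g (s, ν) = 0 := by
    intro s hs ν h
    have hnot : Ψ (s, ν) ∉ ball (γ t) r := fun hc => by
      obtain ⟨s', hs', ν', hν', e⟩ := hcov _ hc
      obtain ⟨rfl, rfl⟩ := hinj s hs s' (Ioo_subset_Icc_self hs') ν ν' e
      exact h.elim (fun h => h hs') fun h => h.not_gt hν'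
    simp [hf, hg, hz _ _ hnot]
  have hle : t - δ ≤ t + δ := by linarith
  have hcont : Continuous (fun p : ℝ × ℝ => fderiv ℝ f p (1, 0) + fderiv ℝ g p (0, 1)) :=
    ((hf1.continuous_fderiv (by simp)).clm_apply continuous_const).add
      ((hg1.continuous_fderiv (by simp)).clm_apply continuous_const)
  have hBae : (B : Set (ℝ × ℝ)) =ᵐ[volume] (J ×ˢ Icc (-η) 0 : Set (ℝ × ℝ)) := by
    rw [Measure.volume_eq_prod]
    exact Measure.set_prod_ae_eq (ae_eq_refl _) Ico_ae_eq_Icc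
  rw [hL, setIntegral_eq_of_subset_of_forall_sdiff_eq_zero D.isOpen_Ω.measurableSet hin hzero,
    setIntegral_image_plane hBm hinjB (a := fun p => deriv γ p.1) (b := fun _ => n)
      (fun p _ => hΨd p), setIntegral_congr_fun hBm hkey, setIntegral_congr_set hBae,
    Measure.volume_eq_prod, setIntegral_prod _ (by
      rw [← Measure.volume_eq_prod]
      exact hcont.continuousOn.integrableOn_compact (isCompact_Icc.prod isCompact_Icc))]
  simp only [J, integral_Icc_eq_integral_Ioc, ← integral_of_le hle,
    ← integral_of_le (neg_nonpos.2 hη.le)]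
  rw [integral2_divergence_prod_of_hasFDerivAt f g (fderiv ℝ f) (fderiv ℝ g)
    (t - δ) (-η) (t + δ) 0 hf1.continuous.continuousOn hg1.continuous.continuousOn
    (fun p _ => (hf1.differentiable (by simp) p).hasFDerivAt)
    (fun p _ => (hg1.differentiable (by simp) p).hasFDerivAt)
    (hcont.continuousOn.integrableOn_compact (isCompact_uIcc.prod isCompact_uIcc)),
    intervalIntegral.integral_congr (g := fun _ => 0) fun s hs =>
      (hvan s (by rwa [uIcc_of_le hle] at hs) (-η) (Or.inr (by simp [abs_of_pos hη]))).2]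
  simp [hvan (t + δ) (right_mem_Icc.2 hle) _ (Or.inl (by simp)),
    hvan (t - δ) (left_mem_Icc.2 hle) _ (Or.inl (by simp))]

end SmoothDomain

namespace SmoothDomain

variable (D : SmoothDomain)

lemma closure_isCompact : IsCompact (closure D.Ω) :=
  Metric.isCompact_of_isClosed_isBounded isClosed_closure D.isBounded_Ω.closure

lemma divergence_of_tsupport_subset {F : Fin 2 → Plane → ℂ} (hF : ∀ j, ContDiff ℝ 1 (F j))
    (hsupp : ∀ j, tsupport (F j) ⊆ D.Ω) :
    D.lineIntegral univ (fun y => ∑ j, F j y * (D.normal y j : ℂ)) =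
      ∫ y in D.Ω, ∑ j, pd j (F j) y := by
  have hc := fun j =>
    Metric.isCompact_of_isClosed_isBounded (isClosed_tsupport _) (D.isBounded_Ω.subset (hsupp j))
  have hz := fun j i s =>
    image_eq_zero_of_notMem_tsupport fun h => D.curve_notMem i s (hsupp j h)
  rw [lineIntegral_univ_normal]
  simp only [hz, zero_mul, sub_zero]
  rw [setIntegral_eq_integral_of_forall_compl_eq_zero fun y hy => Finset.sum_eq_zero fun j _ =>
    pd_eq_zero_of_notMem_tsupport (fun h => hy (hsupp j h)) j,
    integral_finsetSum _ fun j _ => integrable_pd (hF j) (hc j) j]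
  simp [integral_pd_eq_zero (hF _) (hc _)]

/-- **Divergence theorem** on a smooth plane domain, for a field that is continuously
differentiable near the closure. -/
lemma divergence_theorem {O : Set Plane} (hO : IsOpen O) (hΩO : closure D.Ω ⊆ O)
    {F : Fin 2 → Plane → ℂ} (hF : ∀ j, ContDiffOn ℝ 1 (F j) O) :
    D.lineIntegral univ (fun y => ∑ j, F j y * (D.normal y j : ℂ)) =
      ∫ y in D.Ω, ∑ j, pd j (F j) y := by
  -- every point of the closure has a neighbourhood on which supported fields satisfy the theorem
  have hloc : ∀ p ∈ closure D.Ω, ∃ U : Set Plane, IsOpen U ∧ p ∈ U ∧ Bornology.IsBounded U ∧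
      ∀ F : Fin 2 → Plane → ℂ, (∀ j, ContDiff ℝ 1 (F j)) → (∀ j, tsupport (F j) ⊆ U) →
      D.lineIntegral univ (fun y => ∑ j, F j y * (D.normal y j : ℂ)) =
        ∫ y in D.Ω, ∑ j, pd j (F j) y := by
    intro p hp; rw [closure_eq_self_union_frontier] at hp
    rcases hp with hp | hp
    · exact ⟨D.Ω, D.isOpen_Ω, hp, D.isBounded_Ω, fun F hF hs =>
        D.divergence_of_tsupport_subset hF hs⟩
    · rw [D.frontier_eq, mem_iUnion] at hp
      obtain ⟨i, t, rfl⟩ := hp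
      obtain ⟨r, hr, h⟩ := D.exists_divergence_ball i t
      exact ⟨_, Metric.isOpen_ball, Metric.mem_ball_self hr, Metric.isBounded_ball, h⟩
  choose! U hUo hpU hUb hU using hloc
  obtain ⟨T, hTΩ, hTcov⟩ := D.closure_isCompact.elim_nhds_subcover (fun p => U p ∩ O)
    (fun p hp => ((hUo p hp).inter hO).mem_nhds ⟨hpU p hp, hΩO hp⟩)
  obtain ⟨ρ, hρ⟩ := SmoothPartitionOfUnity.exists_isSubordinate (modelWithCornersSelf ℝ Plane)
    (isClosed_closure (s := D.Ω)) (fun p : T => U p ∩ O) (fun p => (hUo p (hTΩ p p.2)).inter hO) (by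
      intro y hy
      obtain ⟨p, hp, h⟩ := mem_iUnion₂.1 (hTcov hy)
      exact mem_iUnion.2 ⟨⟨p, hp⟩, h⟩)
  set E : T → Fin 2 → Plane → ℂ := fun p j y => (ρ p y : ℂ) * F j y with hE
  have hρs : ∀ p, ContDiff ℝ 1 (fun y => (ρ p y : ℂ)) := fun p =>
    ofRealCLM.contDiff.comp ((ρ p).contMDiff.contDiff.of_le (by simp))
  have hEU := fun p j => by
    have : tsupport (E p j) ⊆ tsupport (ρ p) := closure_mono fun y hy hc => hy (by simp [hE, hc])
    exact (this.trans (hρ p)).trans inter_subset_left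
  have hEs : ∀ p j, ContDiff ℝ 1 (E p j) := by
    intro p j; rw [contDiff_iff_contDiffAt]; intro y
    by_cases hy : y ∈ tsupport (ρ p)
    · have hyO := (hρ p hy).2
      exact (hρs p).contDiffAt.mul ((hF j).contDiffAt (hO.mem_nhds hyO))
    · have : E p j =ᶠ[𝓝 y] fun _ => 0 := by
        filter_upwards [(isClosed_tsupport (ρ p)).isOpen_compl.mem_nhds hy] with z hz
        simp [hE, image_eq_zero_of_notMem_tsupport hz]
      exact contDiffAt_const.congr_of_eventuallyEq this
  have hEc : ∀ p j, HasCompactSupport (E p j) := fun p j =>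
    Metric.isCompact_of_isClosed_isBounded (isClosed_tsupport _)
      ((hUb p (hTΩ p p.2)).subset (hEU p j))
  have hsumE : ∀ j, ∀ y ∈ closure D.Ω, ∑ p, E p j y = F j y := by
    intro j y hy
    have := ρ.sum_eq_one hy
    rw [finsum_eq_sum_of_fintype] at this
    rw [← sum_mul, ← Complex.ofReal_sum, this, Complex.ofReal_one, one_mul]
  have hL : D.lineIntegral univ (fun y => ∑ j, F j y * (D.normal y j : ℂ)) =
      ∑ p, D.lineIntegral univ (fun y => ∑ j, E p j y * (D.normal y j : ℂ)) := by
    simp only [lineIntegral_univ_normal]; rw [sum_comm]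
    refine sum_congr rfl fun i _ => ?_
    rw [← intervalIntegral.integral_finsetSum]
    · congr 1
      ext s
      have hy := frontier_subset_closure (D.curve_mem_frontier i s)
      rw [← hsumE 0 _ hy, ← hsumE 1 _ hy, sum_mul, sum_mul, sum_sub_distrib]
    · intro p _
      apply Continuous.intervalIntegrable
      have hc := D.deriv_curve_continuous i
      have h0 := (hEs p 0).continuous.comp (D.curve_continuous i)
      have h1 := (hEs p 1).continuous.comp (D.curve_continuous i)
      exact (h0.mul (by fun_prop)).sub (h1.mul (by fun_prop))
  have hR : ∫ y in D.Ω, ∑ j, pd j (F j) y = ∑ p, ∫ y in D.Ω, ∑ j, pd j (E p j) y := by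
    rw [← integral_finsetSum]
    · refine setIntegral_congr_fun D.isOpen_Ω.measurableSet fun y hy => ?_
      rw [sum_comm]
      refine sum_congr rfl fun j _ => ?_
      have hev : F j =ᶠ[𝓝 y] fun z => ∑ p, E p j z := by
        filter_upwards [D.isOpen_Ω.mem_nhds hy] with z hz
        exact (hsumE j z (subset_closure hz)).symm
      rw [pd, hev.fderiv_eq, fderiv_fun_sum fun p _ => (hEs p j).differentiable (by simp) y]
      simp [pd]
    · exact fun p _ => (integrable_finsetSum _ fun j _ =>
        integrable_pd (hEs p j) (hEc p j) j).integrableOn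
  rw [hL, hR]
  exact sum_congr rfl fun p _ => hU p (hTΩ p p.2) (E p) (hEs p) (hEU p)

/-- Seen from a boundary point, the domain looks like the half plane `⟨ζ, n⟩ < 0`. -/
lemma eventually_mem_iff_inner_neg (i : Fin D.numCurves) (t : ℝ) {ζ : Plane}
    (hζ : inner ℝ ζ (D.normal (D.curve i t)) ≠ 0) :
    ∀ᶠ ε in 𝓝[>] (0 : ℝ), D.curve i t + ε • ζ ∈ D.Ω ↔ inner ℝ ζ (D.normal (D.curve i t)) < 0 := by
  obtain ⟨δ, hδ, η, hη, -, hpos, hbox, -, r, hr, hcov⟩ := D.exists_localBox i t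
  set γ := D.curve i with hγ
  set τ := deriv γ t with hτ
  set n := D.normal (γ t)
  set c : ℝ := inner ℝ ζ n
  have hnn : inner ℝ n n = (1 : ℝ) := by rw [real_inner_self_eq_norm_sq, D.norm_normal]; norm_num
  have hnτ : inner ℝ n τ = 0 := D.inner_normal_deriv i t
  have hdX := fun s => by simpa using (D.curve_hasDerivAt i s).inner ℝ (hasDerivAt_const s τ)
  have htm : t ∈ Icc (t - δ) (t + δ) := ⟨by linarith, by linarith⟩
  obtain ⟨m, hm, hmle⟩ : ∃ m > 0, ∀ s ∈ Icc (t - δ) (t + δ), m ≤ inner ℝ (deriv γ s) τ := by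
    obtain ⟨s₀, hs₀, h⟩ := isCompact_Icc.exists_isMinOn ⟨t, htm⟩
      ((D.deriv_curve_continuous i).inner (𝕜 := ℝ) (continuous_const (y := τ))).continuousOn
    exact ⟨_, hpos s₀ hs₀, fun s hs => h hs⟩
  have key := Convex.mul_sub_le_image_sub_of_le_deriv (convex_Icc (t - δ) (t + δ))
      (fun s _ => (hdX s).continuousAt.continuousWithinAt)
      (fun s _ => (hdX s).differentiableAt.differentiableWithinAt)
      fun s hs => (hdX s).deriv ▸ hmle s (interior_subset hs)
  have hXlow : ∀ s ∈ Icc (t - δ) (t + δ), m * |s - t| ≤ |inner ℝ (γ s) τ - inner ℝ (γ t) τ| := by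
    intro s hs
    rcases le_total s t with h | h
    · rw [abs_sub_comm, abs_of_nonneg (sub_nonneg.2 h), abs_sub_comm (inner ℝ (γ s) τ)]
      exact (key s hs t htm h).trans (le_abs_self _)
    · rw [abs_of_nonneg (sub_nonneg.2 h)]
      exact (key t htm s hs h).trans (le_abs_self _)
  set A : ℝ := |inner ℝ ζ τ|
  have hA : 0 ≤ A := abs_nonneg _
  -- the boundary is tangent to the line orthogonal to `n`
  have hlit : ∀ᶠ s in 𝓝 t, |inner ℝ (γ s - γ t) n| ≤ |c| * m / (2 * (A + 1)) * |s - t| := by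
    have hd : HasDerivAt (fun s => inner ℝ (γ s - γ t) n) 0 t := by
      have := ((D.curve_hasDerivAt i t).sub_const (γ t)).inner ℝ (hasDerivAt_const t n)
      simp [inner_zero_right, zero_add] at this
      rwa [← hγ, ← hτ, real_inner_comm, hnτ] at this
    simpa using (hasDerivAt_iff_isLittleO.1 hd).bound (show 0 < |c| * m / (2 * (A + 1)) by positivity)
  obtain ⟨d, hd, hlit⟩ := Metric.eventually_nhds_iff.1 hlit
  have hsm : ∀ᶠ ε in 𝓝 (0 : ℝ), γ t + ε • ζ ∈ ball (γ t) r ∧ ε * A < m * d :=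
    ((Continuous.tendsto' (by fun_prop) _ _ (by simp)).eventually (Metric.ball_mem_nhds _ hr)).and
      ((Continuous.tendsto' (by fun_prop) _ 0 (by simp)).eventually (gt_mem_nhds (by positivity)))
  filter_upwards [hsm.filter_mono nhdsWithin_le_nhds, self_mem_nhdsWithin] with ε ⟨h1, h2⟩ hε
  have hε : 0 < ε := hε
  obtain ⟨s, hs, ν, hν, h⟩ := hcov _ h1
  have hs' := Ioo_subset_Icc_self hs
  have hτeq := congrArg (fun v => inner ℝ v τ) h
  have hneq := congrArg (fun v => inner ℝ v n) h
  simp only [inner_add_left, inner_smul_left, hnτ, hnn, RCLike.conj_to_real] at hτeq hneq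
  have hst := hXlow s hs'
  rw [show inner ℝ (γ s) τ - inner ℝ (γ t) τ = ε * inner ℝ ζ τ by linarith, abs_mul,
    abs_of_pos hε] at hst
  have h3 :=
    calc _ ≤ |c| * m / (2 * (A + 1)) * |s - t| :=
          hlit (lt_of_mul_lt_mul_left (hst.trans_lt h2) hm.le)
      _ = |c| / (2 * (A + 1)) * (m * |s - t|) := by ring
      _ ≤ |c| / (2 * (A + 1)) * (ε * A) := by gcongr
      _ = ε * |c| * (A / (2 * (A + 1))) := by ring
      _ < ε * |c| * 1 := by
        gcongr
        rw [div_lt_one (by positivity)]; linarith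
      _ = _ := mul_one _
  rw [inner_sub_left, abs_lt] at h3
  rw [h]
  rcases lt_or_gt_of_ne hζ with h0 | h0
  · rw [abs_of_neg h0] at h3
    exact iff_of_true ((hbox s hs' ν hν.le).1 (by linarith)) h0
  · rw [abs_of_pos h0] at h3
    exact iff_of_false (fun hmem => (hbox s hs' ν hν.le).2.1 (by linarith)
      (subset_closure hmem)) h0.not_gt

end SmoothDomain

/-! ### Cutoffs and the flux of a singular field -/

/-- A cutoff of the distance from the singular point: `0` near the origin and `1` beyond `1`. -/
structure IsCutoff (W : ℝ → ℝ) : Prop where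
  measurable : Measurable W
  abs_le_one : ∀ u, |W u| ≤ 1
  eq_zero : ∀ u, 0 ≤ u → u ≤ 1 / 2 → W u = 0
  eq_one : ∀ u, 1 < u → W u = 1

/-- The cutoff that defines principal values and finite parts. -/
def sharpCutoff : ℝ → ℝ := (Ioi 1).indicator fun _ => 1

lemma sharpCutoff_isCutoff : IsCutoff sharpCutoff where
  measurable := measurable_const.indicator measurableSet_Ioi
  abs_le_one u := by
    unfold sharpCutoff indicator
    split_ifs <;> simp
  eq_zero u _ h := indicator_of_notMem (by simp; linarith) _
  eq_one u h := indicator_of_mem (by exact h) _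

/-- A smooth radial bump on the plane: `1` for `‖ζ‖ ≤ 1/2` and `0` for `‖ζ‖ ≥ 1`. -/
def radialBump (ζ : Plane) : ℝ := Real.smoothTransition ((1 - ‖ζ‖ ^ 2) * (4 / 3))

/-- The profile of `1 - radialBump`. -/
def smoothCutoff (u : ℝ) : ℝ := 1 - Real.smoothTransition ((1 - u ^ 2) * (4 / 3))

lemma radialBump_contDiff {n : ℕ∞} : ContDiff ℝ n radialBump :=
  Real.smoothTransition.contDiff.comp ((contDiff_const.sub (contDiff_norm_sq ℝ)).mul contDiff_const)

lemma radialBump_eq_one {ζ : Plane} (h : ‖ζ‖ ≤ 1 / 2) : radialBump ζ = 1 :=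
  Real.smoothTransition.one_of_one_le (by nlinarith [norm_nonneg ζ])

lemma radialBump_eq_zero {ζ : Plane} (h : 1 ≤ ‖ζ‖) : radialBump ζ = 0 :=
  Real.smoothTransition.zero_of_nonpos (by nlinarith [norm_nonneg ζ])

lemma smoothCutoff_isCutoff : IsCutoff smoothCutoff where
  measurable := by
    have : Continuous smoothCutoff := by
      exact continuous_const.sub (Real.smoothTransition.continuous.comp (by fun_prop))
    exact this.measurable
  abs_le_one u := by
    unfold smoothCutoff
    have h1 := Real.smoothTransition.nonneg ((1 - u ^ 2) * (4 / 3))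
    have h2 := Real.smoothTransition.le_one ((1 - u ^ 2) * (4 / 3))
    rw [abs_le]; constructor <;> linarith
  eq_zero u h0 h := by
    unfold smoothCutoff; rw [Real.smoothTransition.one_of_one_le (by nlinarith), sub_self]
  eq_one u h := by
    unfold smoothCutoff; rw [Real.smoothTransition.zero_of_nonpos (by nlinarith), sub_zero]

/-- The bump as a complex-valued function. -/
def bumpC (ζ : Plane) : ℂ := (radialBump ζ : ℂ)

lemma bumpC_contDiff {n : ℕ∞} : ContDiff ℝ n bumpC := ofRealCLM.contDiff.comp radialBump_contDiff

lemma bumpC_neg (ζ : Plane) : bumpC (-ζ) = bumpC ζ := by simp [bumpC, radialBump]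

lemma pd_neg_of_even {f : Plane → ℂ} (hf : ∀ ζ, f (-ζ) = f ζ) (j : Fin 2) (ζ : Plane) :
    pd j f (-ζ) = -pd j f ζ := by
  have h := fderiv_comp_smul (𝕜 := ℝ) (f := f) (c := (-1 : ℝ)) (x := ζ)
  have e : (fun x => f ((-1 : ℝ) • x)) = f := funext fun x => by rw [neg_one_smul, hf]
  rw [e] at h
  unfold pd
  rw [h]; simp

lemma pd_bumpC_eq_zero {ζ : Plane} (h : ‖ζ‖ < 1 / 2 ∨ 1 < ‖ζ‖) (j : Fin 2) : pd j bumpC ζ = 0 := by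
  have : bumpC =ᶠ[𝓝 ζ] fun _ => bumpC ζ := by
    rcases h with h | h
    · filter_upwards [(isOpen_lt continuous_norm continuous_const).mem_nhds h] with z hz
      simp [bumpC, radialBump_eq_one hz.le, radialBump_eq_one h.le]
    · filter_upwards [(isOpen_lt continuous_const continuous_norm).mem_nhds h] with z hz
      simp [bumpC, radialBump_eq_zero (le_of_lt hz), radialBump_eq_zero h.le]
  unfold pd
  rw [this.fderiv_eq]; simp

lemma exists_norm_pd_bumpC_le : ∃ B, ∀ j ζ, ‖pd j bumpC ζ‖ ≤ B := by
  have : ∀ j, ∃ B, ∀ ζ, ‖pd j bumpC ζ‖ ≤ B := by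
    intro j
    have hc : HasCompactSupport (pd j bumpC) := by
      refine HasCompactSupport.intro (isCompact_closedBall (0 : Plane) 1) fun ζ hζ => ?_
      apply pd_bumpC_eq_zero
      right; simpa using hζ
    obtain ⟨B, hB⟩ := (continuous_pd (bumpC_contDiff (n := 1)) j).bounded_above_of_compact_support hc
    exact ⟨B, hB⟩
  choose B hB using this
  refine ⟨max (B 0) (B 1), fun j ζ => ?_⟩
  fin_cases j
  · exact (hB 0 ζ).trans (le_max_left _ _)
  · exact (hB 1 ζ).trans (le_max_right _ _)

/-- The pairing of a field with the gradient of the bump. For a divergence-free field that is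
homogeneous of degree `-1` it is minus the flux through a circle about the origin. -/
def bumpFlux (F : Fin 2 → Plane → ℂ) : ℂ := ∫ ζ, ∑ j, pd j bumpC ζ * F j ζ

lemma bumpFlux_integrable {F : Fin 2 → Plane → ℂ} (hF : ∀ j, ContinuousOn (F j) {0}ᶜ) :
    Integrable (fun ζ => ∑ j, pd j bumpC ζ * F j ζ) := by
  set A : Set Plane := closedBall 0 1 \ ball 0 (1 / 2)
  have hAc : IsCompact A := (isCompact_closedBall _ _).diff Metric.isOpen_ball
  have hAs : A ⊆ {0}ᶜ := by rintro y ⟨-, hy⟩ rfl; exact hy (Metric.mem_ball_self (by norm_num))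
  have hc : ContinuousOn (fun ζ => ∑ j, pd j bumpC ζ * F j ζ) A :=
    continuousOn_finsetSum _ fun j _ =>
      (continuous_pd (bumpC_contDiff (n := 1)) j).continuousOn.mul ((hF j).mono hAs)
  refine (integrableOn_iff_integrable_of_support_subset ?_).1 (hc.integrableOn_compact hAc)
  intro y hy
  by_contra h
  apply hy
  have : ‖y‖ < 1 / 2 ∨ 1 < ‖y‖ := by
    by_contra hc
    push Not at hc; exact h ⟨by simpa using hc.2, by simpa using hc.1⟩
  simp [pd_bumpC_eq_zero this]

lemma volume_inner_eq_zero {n : Plane} (hn : n ≠ 0) :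
    (volume : Measure Plane) {ζ | inner ℝ ζ n = 0} = 0 := by
  convert Measure.addHaar_submodule volume (LinearMap.ker (innerSL ℝ n).toLinearMap) fun h => hn ?_
    using 2
  · ext ζ
    simp [real_inner_comm]
  · have : n ∈ LinearMap.ker (innerSL ℝ n).toLinearMap := h ▸ trivial
    simpa using this

lemma setIntegral_halfPlane_of_even {H : Plane → ℂ} (hH : Integrable H) (he : ∀ ζ, H (-ζ) = H ζ)
    {n : Plane} (hn : n ≠ 0) : ∫ ζ in {ζ | inner ℝ ζ n < 0}, H ζ = (1 / 2) * ∫ ζ, H ζ := by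
  have hc : Continuous fun ζ : Plane => inner ℝ ζ n := by fun_prop
  have m1 : MeasurableSet {ζ : Plane | inner ℝ ζ n < 0} :=
    (isOpen_lt hc continuous_const).measurableSet
  have m2 : MeasurableSet {ζ : Plane | 0 < inner ℝ ζ n} :=
    (isOpen_lt continuous_const hc).measurableSet
  have h1 : ∫ ζ in {ζ | 0 < inner ℝ ζ n}, H ζ = ∫ ζ in {ζ | inner ℝ ζ n < 0}, H ζ := by
    rw [← integral_indicator m2, ← integral_indicator m1, ← integral_neg_eq_self]; congr 1
    ext ζ; simp [indicator, he]
  have h2 : ∫ ζ, H ζ = (∫ ζ in {ζ | inner ℝ ζ n < 0}, H ζ) + ∫ ζ in {ζ | 0 < inner ℝ ζ n}, H ζ := by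
    rw [← setIntegral_union (Set.disjoint_left.2 fun ζ h h' => lt_asymm h.out h'.out) m2
      hH.integrableOn hH.integrableOn, ← setIntegral_univ]
    refine setIntegral_congr_set (ae_eq_univ.2 ?_).symm
    convert volume_inner_eq_zero hn using 2
    ext ζ; simp [le_antisymm_iff, and_comm]
  rw [h2, h1]; ring

namespace SmoothDomain

variable (D : SmoothDomain)

/-- The flux through `Γ` of a divergence-free field with a singularity of order `-1` at a boundary
point, in the principal value sense: half of the flux of the blow-up `F₀` through the whole circle,
since the blow-up of the domain is a half plane and `F₀` is odd. -/
lemma tendsto_smooth_flux (i : Fin D.numCurves) (t : ℝ) {O : Set Plane} (hO : IsOpen O)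
    (hΩO : closure D.Ω ⊆ O) {F F₀ : Fin 2 → Plane → ℂ}
    (hF : ∀ j, ContDiffOn ℝ 1 (F j) (O \ {D.curve i t}))
    (hdiv : ∀ y ∈ D.Ω, ∑ j, pd j (F j) y = 0) {C : ℝ}
    (hbd : ∀ᶠ y in 𝓝[≠] (D.curve i t), ∀ j, ‖F j y‖ ≤ C / ‖y - D.curve i t‖)
    (hF₀ : ∀ j, ContinuousOn (F₀ j) {0}ᶜ) (hodd : ∀ j ζ, F₀ j (-ζ) = -F₀ j ζ)
    (hlim : ∀ j ζ, ζ ≠ 0 → Tendsto (fun ε : ℝ => (ε : ℂ) * F j (D.curve i t + ε • ζ)) (𝓝[>] 0)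
      (𝓝 (F₀ j ζ))) :
    Tendsto (fun ε : ℝ => D.lineIntegral univ (fun y =>
      (smoothCutoff (dist y (D.curve i t) / ε) : ℂ) * ∑ j, F j y * (D.normal y j : ℂ)))
      (𝓝[>] 0) (𝓝 (-(1 / 2) * bumpFlux F₀)) := by
  set x := D.curve i t with hx
  have hxΩ : x ∉ D.Ω := D.curve_notMem i t
  -- the divergence theorem for the field cut off near `x`
  have hstokes : ∀ ε > 0, D.lineIntegral univ (fun y =>
      (smoothCutoff (dist y x / ε) : ℂ) * ∑ j, F j y * (D.normal y j : ℂ)) =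
      -∫ ζ, {ζ | x + ε • ζ ∈ D.Ω}.indicator
        (fun ζ => ∑ j, pd j bumpC ζ * ((ε : ℂ) * F j (x + ε • ζ))) ζ := by
    intro ε hε
    set Fε : Fin 2 → Plane → ℂ := fun j y => (1 - bumpC (ε⁻¹ • (y - x))) * F j y with hFε
    have hcut : ∀ y, (smoothCutoff (dist y x / ε) : ℂ) = 1 - bumpC (ε⁻¹ • (y - x)) := by
      intro y
      simp [smoothCutoff, bumpC, radialBump, norm_smul, norm_inv, norm_eq_abs,
        abs_of_pos hε, dist_eq_norm]
      rw [div_eq_inv_mul]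
    have hbs : ContDiff ℝ 1 fun y : Plane => 1 - bumpC (ε⁻¹ • (y - x)) :=
      contDiff_const.sub ((bumpC_contDiff (n := 1)).comp
        ((contDiff_id.sub contDiff_const).const_smul ε⁻¹))
    have hFεs : ∀ j, ContDiffOn ℝ 1 (Fε j) O := by
      intro j y hy
      apply ContDiffAt.contDiffWithinAt
      by_cases hyx : y = x
      · have : Fε j =ᶠ[𝓝 y] fun _ => 0 := by
          rw [hyx]
          filter_upwards [Metric.ball_mem_nhds x (show 0 < ε / 2 by positivity)] with z hz
          have hz' : ‖ε⁻¹ • (z - x)‖ ≤ 1 / 2 := by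
            rw [norm_smul, norm_inv, norm_eq_abs, abs_of_pos hε, inv_mul_le_iff₀ hε]
            rw [mem_ball_iff_norm] at hz
            linarith
          simp [hFε, bumpC, radialBump_eq_one hz']
        exact contDiffAt_const.congr_of_eventuallyEq this
      · exact hbs.contDiffAt.mul ((hF j).contDiffAt
          ((hO.sdiff isClosed_singleton).mem_nhds ⟨hy, hyx⟩))
    have h1 : (fun y => (smoothCutoff (dist y x / ε) : ℂ) * ∑ j, F j y * (D.normal y j : ℂ)) =
        fun y => ∑ j, Fε j y * (D.normal y j : ℂ) := by
      ext y
      rw [hcut, mul_sum]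
      exact sum_congr rfl fun j _ => by ring
    rw [h1, D.divergence_theorem hO hΩO hFεs]
    have h2 : ∀ y ∈ D.Ω, ∑ j, pd j (Fε j) y =
        -∑ j, (ε : ℂ)⁻¹ * pd j bumpC (ε⁻¹ • (y - x)) * F j y := by
      intro y hy
      have hyx : y ≠ x := fun h => hxΩ (h ▸ hy)
      have hpd : ∀ j, pd j (Fε j) y = -((ε : ℂ)⁻¹ * pd j bumpC (ε⁻¹ • (y - x)) * F j y) +
          (1 - bumpC (ε⁻¹ • (y - x))) * pd j (F j) y := by
        intro j
        have d1 : HasFDerivAt (fun y : Plane => bumpC (ε⁻¹ • (y - x)))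
            ((fderiv ℝ bumpC (ε⁻¹ • (y - x))).comp (ε⁻¹ • ContinuousLinearMap.id ℝ Plane)) y := by
          apply HasFDerivAt.comp y
            ((bumpC_contDiff (n := 1)).differentiable (by simp) _).hasFDerivAt
          exact ((hasFDerivAt_id y).sub_const x).const_smul ε⁻¹
        have d2 :=
          ((hF j).contDiffAt ((hO.sdiff isClosed_singleton).mem_nhds
            ⟨hΩO (subset_closure hy), hyx⟩)).differentiableAt (by simp)
        have d3 := (d1.const_sub 1).mul d2.hasFDerivAt
        have d4 : HasFDerivAt (Fε j) _ y := d3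
        unfold pd
        rw [d4.fderiv]
        simp
        ring
      have e := hdiv y hy
      rw [Fin.sum_univ_two] at e
      rw [Fin.sum_univ_two, Fin.sum_univ_two, hpd, hpd]
      linear_combination (1 - bumpC (ε⁻¹ • (y - x))) * e
    rw [setIntegral_congr_fun D.isOpen_Ω.measurableSet h2, integral_neg, neg_inj,
      ← integral_indicator D.isOpen_Ω.measurableSet,
      ← integral_add_left_eq_self (μ := (volume : Measure Plane)) _ x]
    set G : Plane → ℂ := fun z =>
      D.Ω.indicator (fun y => ∑ j, (ε : ℂ)⁻¹ * pd j bumpC (ε⁻¹ • (y - x)) * F j y) (x + z) with hG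
    have h4 : ∫ z, G z = ε ^ 2 • ∫ z, G (ε • z) := by
      rw [Measure.integral_comp_smul volume G ε, finrank_euclideanSpace_fin, abs_inv,
        abs_of_pos (by positivity : 0 < ε ^ 2), smul_smul, mul_inv_cancel₀ (by positivity),
        one_smul]
    rw [h4, ← integral_smul]
    congr 1
    ext ζ
    simp only [hG, indicator, mem_ofPred_eq]
    split_ifs
    · rw [add_sub_cancel_left, smul_smul, inv_mul_cancel₀ hε.ne', one_smul, smul_sum]
      refine sum_congr rfl fun j _ => ?_
      rw [real_smul]
      push_cast
      field_simp
    · simp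
  set n := D.normal x with hn
  have hn0 : n ≠ 0 := norm_ne_zero_iff.1 (by rw [hn, D.norm_normal]; exact one_ne_zero)
  have hhalf : -(1 / 2) * bumpFlux F₀ =
      -∫ ζ, {ζ | inner ℝ ζ n < 0}.indicator (fun ζ => ∑ j, pd j bumpC ζ * F₀ j ζ) ζ := by
    rw [integral_indicator (isOpen_lt (by fun_prop) continuous_const).measurableSet,
      setIntegral_halfPlane_of_even (bumpFlux_integrable hF₀)
        (fun ζ => by simp [pd_neg_of_even bumpC_neg, hodd]) hn0, bumpFlux]
    ring
  rw [hhalf]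
  refine (Tendsto.neg ?_).congr' (eventually_nhdsWithin_of_forall fun ε hε => (hstokes ε hε).symm)
  obtain ⟨B, hB⟩ := exists_norm_pd_bumpC_le
  rw [eventually_nhdsWithin_iff, Metric.eventually_nhds_iff_ball] at hbd
  obtain ⟨r, hr, hbd⟩ := hbd
  apply tendsto_integral_filter_of_dominated_convergence
    ((closedBall (0 : Plane) 1).indicator fun _ => 2 * (B * (2 * |C|)))
  · filter_upwards [self_mem_nhdsWithin] with ε hε
    have hcm : Continuous fun ζ : Plane => x + ε • ζ := by fun_prop
    have hopen : IsOpen {ζ : Plane | x + ε • ζ ∈ D.Ω} := D.isOpen_Ω.preimage hcm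
    rw [aestronglyMeasurable_indicator_iff hopen.measurableSet]
    refine ContinuousOn.aestronglyMeasurable ?_ hopen.measurableSet
    refine continuousOn_finsetSum _ fun j _ => ?_
    refine (continuous_pd (bumpC_contDiff (n := 1)) j).continuousOn.mul
      (continuousOn_const.mul ?_)
    exact (hF j).continuousOn.comp hcm.continuousOn fun ζ (hζ : x + ε • ζ ∈ D.Ω) =>
      ⟨hΩO (subset_closure hζ), fun h => hxΩ (h ▸ hζ)⟩
  · filter_upwards [Ioo_mem_nhdsGT hr] with ε hε
    refine Eventually.of_forall fun ζ => ?_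
    have hB0 : 0 ≤ B := (norm_nonneg _).trans (hB 0 0)
    have h0 : 0 ≤ (closedBall (0 : Plane) 1).indicator (fun _ => 2 * (B * (2 * |C|))) ζ :=
      indicator_nonneg (fun _ _ => by positivity) ζ
    by_cases h2 : ‖ζ‖ < 1 / 2 ∨ 1 < ‖ζ‖
    · simpa [indicator, pd_bumpC_eq_zero h2] using h0
    push Not at h2
    by_cases h1 : x + ε • ζ ∈ D.Ω
    swap
    · simpa [indicator, h1] using h0
    rw [indicator_of_mem (show ζ ∈ {ζ | x + ε • ζ ∈ D.Ω} from h1),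
      indicator_of_mem (by simpa using h2.2)]
    have hε0 := hε.1
    have hζ0 : 0 < ‖ζ‖ := by linarith [h2.1]
    have key : ∀ j, ‖pd j bumpC ζ * ((ε : ℂ) * F j (x + ε • ζ))‖ ≤ B * (2 * |C|) := by
      intro j
      have hb := hbd (x + ε • ζ) (by
        rw [mem_ball_iff_norm, add_sub_cancel_left, norm_smul, norm_eq_abs, abs_of_pos hε0]
        nlinarith [hε.2]) (fun h => hxΩ (h ▸ h1)) j
      rw [add_sub_cancel_left, norm_smul, norm_eq_abs, abs_of_pos hε0, le_div_iff₀ (by positivity)] at hb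
      rw [norm_mul, norm_mul, norm_real, norm_eq_abs, abs_of_pos hε0]
      refine mul_le_mul (hB j ζ) ?_ (by positivity) hB0
      have := mul_le_mul_of_nonneg_left h2.1 (mul_nonneg (norm_nonneg (F j (x + ε • ζ))) hε0.le)
      linarith [le_abs_self C]
    exact (norm_sum_le_of_le _ fun j _ => key j).trans_eq (by simp)
  · exact (integrable_indicator_iff measurableSet_closedBall).2
      (integrableOn_const (isCompact_closedBall _ _).measure_lt_top.ne)
  · have hae : ∀ᵐ ζ : Plane, inner ℝ ζ n ≠ 0 := by
      rw [ae_iff]; simpa using volume_inner_eq_zero hn0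
    filter_upwards [hae] with ζ hζ
    have hζ0 : ζ ≠ 0 := by rintro rfl; simp at hζ
    have hev := D.eventually_mem_iff_inner_neg i t hζ
    by_cases hneg : inner ℝ ζ n < 0
    · rw [indicator_of_mem (show ζ ∈ {ζ | inner ℝ ζ n < 0} from hneg)]
      refine (tendsto_finsetSum _ fun j _ => (hlim j ζ hζ0).const_mul _).congr' ?_
      filter_upwards [hev] with ε hε
      rw [indicator_of_mem]; exact hε.2 hneg
    · rw [indicator_of_notMem (show ζ ∉ {ζ | inner ℝ ζ n < 0} from hneg)]
      refine tendsto_const_nhds.congr' ?_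
      filter_upwards [hev] with ε hε
      rw [indicator_of_notMem]; exact fun h => hneg (hε.1 h)

end SmoothDomain

/-! ### Finite parts along an arc, in terms of the signed chord length -/

/-- The coefficient of the divergent term in the finite part of `u⁻²` with cutoff `W`. -/
def cutoffMoment (W : ℝ → ℝ) : ℝ := 2 * ((∫ u in (0 : ℝ)..1, W u / u ^ 2) + 1)

namespace IsCutoff

variable {W : ℝ → ℝ} (hW : IsCutoff W)
include hW

lemma abs_div_pow_le (k : ℕ) (u : ℝ) (hu : 0 ≤ u) : |W u / u ^ k| ≤ 2 ^ k := by
  rcases le_or_gt u (1 / 2) with h | h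
  · rw [hW.eq_zero u hu h]; simp
  · rw [abs_div, abs_of_nonneg (pow_nonneg hu k), div_le_iff₀ (by positivity)]
    calc |W u| ≤ 1 := hW.abs_le_one u
      _ = 2 ^ k * (1 / 2) ^ k := by rw [← mul_pow]; norm_num
      _ ≤ 2 ^ k * u ^ k := by gcongr

lemma intervalIntegrable_abs_div_pow (k : ℕ) {ε : ℝ} (hε : 0 < ε) (a b : ℝ) :
    IntervalIntegrable (fun u => W (|u| / ε) / u ^ k) volume a b := by
  rw [intervalIntegrable_iff]
  refine Measure.integrableOn_of_bounded (M := (2 / ε) ^ k) (by simp [uIoc]) ?_ ?_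
  · exact ((hW.measurable.comp (measurable_id.norm.div_const ε)).div
      (measurable_id.pow_const k)).aestronglyMeasurable
  · refine Eventually.of_forall fun u => ?_
    have e : |W (|u| / ε) / u ^ k| = |W (|u| / ε) / (|u| / ε) ^ k| * (1 / ε) ^ k := by
      rw [abs_div, abs_div, abs_pow, abs_pow, abs_div, abs_abs, abs_of_pos hε, div_pow, one_div_pow]
      field_simp
    rw [norm_eq_abs, e, show (2 / ε) ^ k = 2 ^ k * (1 / ε) ^ k by rw [← mul_pow]; congr 1; ring]
    exact mul_le_mul_of_nonneg_right (hW.abs_div_pow_le k _ (by positivity)) (by positivity)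

lemma intervalIntegrable_div_pow (k : ℕ) {ε r : ℝ} (hε : 0 < ε) (hr : 0 ≤ r) :
    IntervalIntegrable (fun u => W (u / ε) / u ^ k) volume 0 r :=
  (hW.intervalIntegrable_abs_div_pow k hε 0 r).congr fun u hu => by
    rw [uIoc_of_le hr] at hu; simp [abs_of_pos hu.1]

lemma integral_div_pow_split (k : ℕ) {ε r : ℝ} (hε : 0 < ε) (hr : ε < r) :
    ∫ u in (0 : ℝ)..r, W (u / ε) / u ^ (k + 1) =
      (ε ^ k)⁻¹ * (∫ u in (0 : ℝ)..1, W u / u ^ (k + 1)) + ∫ u in ε..r, (u ^ (k + 1))⁻¹ := by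
  rw [← intervalIntegral.integral_add_adjacent_intervals (b := ε)
    (hW.intervalIntegrable_div_pow _ hε hε.le)
    ((hW.intervalIntegrable_div_pow (k + 1) hε (hε.trans hr).le).mono_set (by
      rw [uIcc_of_le hr.le, uIcc_of_le (hε.trans hr).le]; exact Icc_subset_Icc_left hε.le))]
  congr 1
  · have h := intervalIntegral.integral_comp_div (a := 0) (b := ε) (c := ε)
      (fun v => (ε ^ (k + 1))⁻¹ * (W v / v ^ (k + 1))) hε.ne'
    rw [zero_div, div_self hε.ne', intervalIntegral.integral_const_mul, intervalIntegral.integral_const_mul,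
      smul_eq_mul] at h
    rw [show (ε ^ k)⁻¹ * ∫ u in (0 : ℝ)..1, W u / u ^ (k + 1) =
      ε * ((ε ^ (k + 1))⁻¹ * ∫ u in (0 : ℝ)..1, W u / u ^ (k + 1)) by
        rw [pow_succ]; field_simp, ← h, ← intervalIntegral.integral_const_mul]
    congr 1; ext u; rw [div_pow]
    field_simp
  · apply intervalIntegral.integral_congr_ae
    refine Eventually.of_forall fun u hu => ?_
    rw [uIoc_of_le hr.le] at hu; rw [hW.eq_one _ ((one_lt_div hε).2 hu.1), one_div]

lemma integral_inv {ε r : ℝ} (hε : 0 < ε) (hr : ε < r) :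
    ∫ u in (0 : ℝ)..r, W (u / ε) / u = (∫ u in (0 : ℝ)..1, W u / u) + log (r / ε) := by
  have h := hW.integral_div_pow_split 0 hε hr
  simp [zero_add, pow_one, pow_zero, inv_one, one_mul] at h
  rw [h, integral_inv_of_pos hε (hε.trans hr)]

lemma integral_inv_sq {ε r : ℝ} (hε : 0 < ε) (hr : ε < r) : ∫ u in (0 : ℝ)..r, W (u / ε) / u ^ 2 =
      ε⁻¹ * ((∫ u in (0 : ℝ)..1, W u / u ^ 2) + 1) - r⁻¹ := by
  have h := hW.integral_div_pow_split 1 hε hr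
  have h2 : ∫ u in ε..r, (u ^ 2)⁻¹ = ε⁻¹ - r⁻¹ := by
    have h0 : (0 : ℝ) ∉ uIcc ε r := by
      rw [uIcc_of_le hr.le]; exact fun h => absurd h.1 (not_le.2 hε)
    rw [intervalIntegral.integral_eq_sub_of_hasDerivAt (f := fun u => -u⁻¹)]
    · ring
    · intro u hu
      have hu0 : u ≠ 0 := fun h => h0 (h ▸ hu)
      exact (hasDerivAt_inv hu0).neg.congr_deriv (by simp)
    · apply ContinuousOn.intervalIntegrable
      exact (continuousOn_id.pow 2).inv₀ fun u hu => pow_ne_zero 2 fun h => h0 (h ▸ hu)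
  rw [h, h2]; ring

lemma integral_abs_div_pow (k : ℕ) {ε r₁ r₂ : ℝ} (hε : 0 < ε) (h₁ : 0 ≤ r₁) (h₂ : 0 ≤ r₂) :
    ∫ u in Icc (-r₁) r₂, W (|u| / ε) / u ^ k =
      (-1) ^ k * (∫ u in (0 : ℝ)..r₁, W (u / ε) / u ^ k) + ∫ u in (0 : ℝ)..r₂, W (u / ε) / u ^ k := by
  have hi := hW.intervalIntegrable_abs_div_pow k hε
  rw [integral_Icc_eq_integral_Ioc, ← integral_of_le (by linarith),
    ← intervalIntegral.integral_add_adjacent_intervals (hi _ 0) (hi 0 _),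
    ← intervalIntegral.integral_const_mul]
  congr 1
  · have := intervalIntegral.integral_comp_neg (a := 0) (b := r₁) fun u => W (|u| / ε) / u ^ k
    rw [neg_zero] at this; rw [← this]
    refine intervalIntegral.integral_congr_ae (Eventually.of_forall fun u hu => ?_)
    rw [uIoc_of_le h₁] at hu
    rcases neg_one_pow_eq_or ℝ k with h | h <;> simp [neg_pow u, h, div_neg, abs_of_pos hu.1]
  · refine intervalIntegral.integral_congr_ae (Eventually.of_forall fun u hu => ?_)
    rw [uIoc_of_le h₂] at hu; rw [abs_of_pos hu.1]

lemma integral_symm_odd {ε r₁ r₂ : ℝ} (hε : 0 < ε) (h₁ : ε < r₁) (h₂ : ε < r₂) :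
    ∫ u in Icc (-r₁) r₂, W (|u| / ε) / u = log (r₂ / r₁) := by
  have hr₁ := hε.trans h₁
  have hr₂ := hε.trans h₂
  have := hW.integral_abs_div_pow 1 hε hr₁.le hr₂.le
  simp only [pow_one] at this
  rw [this, hW.integral_inv hε h₁, hW.integral_inv hε h₂, log_div hr₂.ne' hε.ne',
    log_div hr₁.ne' hε.ne', log_div hr₂.ne' hr₁.ne']
  ring

lemma integral_symm_even {ε r₁ r₂ : ℝ} (hε : 0 < ε) (h₁ : ε < r₁) (h₂ : ε < r₂) :
    ∫ u in Icc (-r₁) r₂, W (|u| / ε) / u ^ 2 = ε⁻¹ * cutoffMoment W - r₁⁻¹ - r₂⁻¹ := by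
  rw [hW.integral_abs_div_pow 2 hε (hε.trans h₁).le (hε.trans h₂).le, hW.integral_inv_sq hε h₁,
    hW.integral_inv_sq hε h₂, cutoffMoment]
  ring

end IsCutoff

/-- The distance from `γ t` to `γ s`, with the sign of `s - t`. -/
def signedChord (γ : ℝ → Plane) (t s : ℝ) : ℝ := if s < t then -‖γ s - γ t‖ else ‖γ s - γ t‖

/-- The logarithmic derivative of the chord length, `∼ 1 / (s - t)`. -/
def chordLog (γ : ℝ → Plane) (t s : ℝ) : ℝ := inner ℝ (γ s - γ t) (deriv γ s) / ‖γ s - γ t‖ ^ 2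

/-- An arc about the parameter `t` on which the chord length from `γ t` increases in both
directions. -/
structure IsChordArc (γ : ℝ → Plane) (a t b : ℝ) : Prop where
  diff : Differentiable ℝ γ
  left : a < t
  right : t < b
  pos : ∀ s ∈ Icc a b, s ≠ t → 0 < (s - t) * inner ℝ (γ s - γ t) (deriv γ s)

namespace IsChordArc

variable {γ : ℝ → Plane} {a t b : ℝ} (h : IsChordArc γ a t b)
include h

lemma ne {s : ℝ} (hs : s ∈ Icc a b) (hst : s ≠ t) : γ s - γ t ≠ 0 := by
  intro h0
  have := h.pos s hs hst
  rw [h0] at this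
  simp at this

lemma signedChord_left {s : ℝ} (hst : s ≤ t) : signedChord γ t s = -‖γ s - γ t‖ := by
  rcases hst.lt_or_eq with h | rfl
  · rw [signedChord, if_pos h]
  · simp [signedChord]

omit h in
lemma signedChord_right {s : ℝ} (hst : t ≤ s) : signedChord γ t s = ‖γ s - γ t‖ := by
  rw [signedChord, if_neg (not_lt.2 hst)]

omit h in
lemma abs_signedChord (s : ℝ) : |signedChord γ t s| = ‖γ s - γ t‖ := by
  unfold signedChord; split_ifs <;> simp

lemma hasDerivAt_chord {s : ℝ} (hs : s ∈ Icc a b) (hst : s ≠ t) :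
    HasDerivAt (signedChord γ t) (chordLog γ t s * signedChord γ t s) s := by
  have h0 := h.ne hs hst
  have hn : HasDerivAt (fun s => ‖γ s - γ t‖) (inner ℝ (γ s - γ t) (deriv γ s) / ‖γ s - γ t‖) s := by
    have h1 := ((h.diff s).hasDerivAt.sub_const (γ t)).norm_sq
    have h2 := h1.sqrt (by simpa using h0)
    simp [Real.sqrt_sq (norm_nonneg _)] at h2
    convert h2 using 1
    field_simp
  rcases lt_or_gt_of_ne hst with hlt | hgt
  · have hev : signedChord γ t =ᶠ[𝓝 s] fun s => -‖γ s - γ t‖ := by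
      filter_upwards [gt_mem_nhds hlt] with u hu
      exact h.signedChord_left hu.le
    have h3 := hn.neg.congr_of_eventuallyEq hev
    refine h3.congr_deriv ?_
    rw [h.signedChord_left hlt.le, chordLog]; field_simp
  · have hev : signedChord γ t =ᶠ[𝓝 s] fun s => ‖γ s - γ t‖ := by
      filter_upwards [lt_mem_nhds hgt] with u hu
      exact signedChord_right hu.le
    have h3 := hn.congr_of_eventuallyEq hev
    refine h3.congr_deriv ?_
    rw [signedChord_right hgt.le, chordLog]; field_simp

lemma deriv_chord_pos {s : ℝ} (hs : s ∈ Icc a b) (hst : s ≠ t) :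
    0 < chordLog γ t s * signedChord γ t s := by
  have h0 := norm_pos_iff.2 (h.ne hs hst)
  have hp := h.pos s hs hst
  rcases lt_or_gt_of_ne hst with hlt | hgt
  · rw [h.signedChord_left hlt.le]
    have : inner ℝ (γ s - γ t) (deriv γ s) < 0 := by
      by_contra hc
      nlinarith
    exact mul_pos_of_neg_of_neg (div_neg_of_neg_of_pos this (by positivity)) (by linarith)
  · rw [signedChord_right hgt.le, chordLog]
    have := pos_of_mul_pos_right hp (by linarith)
    positivity

lemma continuous_chord : Continuous (signedChord γ t) := by
  have e : signedChord γ t = fun s => if s ≤ t then -‖γ s - γ t‖ else ‖γ s - γ t‖ := by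
    ext s
    split_ifs with hs
    · exact h.signedChord_left hs
    · exact signedChord_right (not_le.1 hs).le
  rw [e]
  have hc := h.diff.continuous
  exact Continuous.if_le (by fun_prop) (by fun_prop) continuous_id continuous_const
    (fun s hs => by simp [show s = t from hs])

lemma strictMonoOn_chord : StrictMonoOn (signedChord γ t) (Icc a b) := by
  have key : ∀ c d, a ≤ c → d ≤ b → t ∉ Ioo c d → StrictMonoOn (signedChord γ t) (Icc c d) := by
    intro c d hc hd ht
    apply strictMonoOn_of_deriv_pos (convex_Icc _ _) h.continuous_chord.continuousOn
    intro s hs; rw [interior_Icc] at hs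
    have hs' : s ∈ Icc a b := ⟨hc.trans hs.1.le, hs.2.le.trans hd⟩
    have hst : s ≠ t := fun e => ht (e ▸ hs)
    rw [(h.hasDerivAt_chord hs' hst).deriv]; exact h.deriv_chord_pos hs' hst
  have hl := key a t le_rfl h.right.le (by simp)
  have hr := key t b h.left.le le_rfl (by simp)
  have := hl.union hr (isGreatest_Icc h.left.le) (isLeast_Icc h.right.le)
  rwa [Icc_union_Icc_eq_Icc h.left.le h.right.le] at this

omit h in
lemma chord_self : signedChord γ t t = 0 := by simp [signedChord]

lemma chord_ne_zero {s : ℝ} (hs : s ∈ Icc a b) (hst : s ≠ t) : signedChord γ t s ≠ 0 := by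
  rw [← abs_pos, abs_signedChord, norm_pos_iff]
  exact h.ne hs hst

lemma image_chord : signedChord γ t '' (Icc a b \ {t}) = Icc (-‖γ a - γ t‖) ‖γ b - γ t‖ \ {0} := by
  have hab := h.left.le.trans h.right.le
  have himg : signedChord γ t '' Icc a b = Icc (-‖γ a - γ t‖) ‖γ b - γ t‖ := by
    rw [← h.signedChord_left h.left.le, ← signedChord_right h.right.le]
    apply Subset.antisymm
    · rintro _ ⟨s, hs, rfl⟩
      exact ⟨h.strictMonoOn_chord.monotoneOn (left_mem_Icc.2 hab) hs hs.1,
        h.strictMonoOn_chord.monotoneOn hs (right_mem_Icc.2 hab) hs.2⟩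
    · exact intermediate_value_Icc hab h.continuous_chord.continuousOn
  rw [h.strictMonoOn_chord.injOn.image_sdiff_subset (by
    rintro _ rfl; exact ⟨h.left.le, h.right.le⟩), himg, image_singleton, chord_self]

lemma setIntegral_comp_chord (F : ℝ → ℝ) :
    ∫ s in Icc a b, chordLog γ t s * signedChord γ t s * F (signedChord γ t s) =
      ∫ u in Icc (-‖γ a - γ t‖) ‖γ b - γ t‖, F u := by
  have hm : MeasurableSet (Icc a b \ {t}) := measurableSet_Icc.diff (measurableSet_singleton t)
  have e := integral_image_eq_integral_abs_deriv_smul hm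
    (fun s hs => (h.hasDerivAt_chord hs.1 hs.2).hasDerivWithinAt)
    (h.strictMonoOn_chord.injOn.mono sdiff_subset) F
  rw [h.image_chord] at e
  have n1 : (Icc (-‖γ a - γ t‖) ‖γ b - γ t‖ \ {0} : Set ℝ) =ᵐ[volume]
      Icc (-‖γ a - γ t‖) ‖γ b - γ t‖ := sdiff_null_ae_eq_self (by simp)
  have n2 : (Icc a b \ {t} : Set ℝ) =ᵐ[volume] Icc a b := sdiff_null_ae_eq_self (by simp)
  rw [setIntegral_congr_set n1] at e
  rw [e, ← setIntegral_congr_set n2]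
  refine setIntegral_congr_fun hm fun s hs => ?_
  simp only [smul_eq_mul]
  rw [abs_of_pos (h.deriv_chord_pos hs.1 hs.2)]

lemma integrableOn_comp_chord {F : ℝ → ℝ} (hF : IntegrableOn F (Icc (-‖γ a - γ t‖) ‖γ b - γ t‖)) :
    IntegrableOn (fun s => chordLog γ t s * signedChord γ t s * F (signedChord γ t s))
      (Icc a b) := by
  have hm : MeasurableSet (Icc a b \ {t}) := measurableSet_Icc.diff (measurableSet_singleton t)
  have e := integrableOn_image_iff_integrableOn_abs_deriv_smul hm
    (fun s hs => (h.hasDerivAt_chord hs.1 hs.2).hasDerivWithinAt)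
    (h.strictMonoOn_chord.injOn.mono sdiff_subset) F
  rw [h.image_chord] at e
  have n2 : (Icc a b \ {t} : Set ℝ) =ᵐ[volume] Icc a b := sdiff_null_ae_eq_self (by simp)
  have := e.1 (hF.mono_set sdiff_subset)
  rw [← integrableOn_congr_set_ae n2]
  refine this.congr_fun (fun s hs => ?_) hm
  simp only [smul_eq_mul]
  rw [abs_of_pos (h.deriv_chord_pos hs.1 hs.2)]

/-- Finite part of `A ρ'/ρ² + B ρ'/ρ + integrable`, where `ρ` is the signed chord length. -/
lemma tendsto_finitePart {W : ℝ → ℝ} (hW : IsCutoff W) {f : ℝ → ℂ} (A B : ℂ)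
    (hf : IntegrableOn (fun s => f s - A * (chordLog γ t s / signedChord γ t s : ℝ) -
      B * (chordLog γ t s : ℝ)) (Icc a b)) :
    Tendsto (fun ε : ℝ => (∫ s in Icc a b, (W (‖γ s - γ t‖ / ε) : ℂ) * f s) -
        (ε : ℂ)⁻¹ * (cutoffMoment W * A)) (𝓝[>] 0)
      (𝓝 (A * ((-‖γ a - γ t‖⁻¹ - ‖γ b - γ t‖⁻¹ : ℝ) : ℂ) +
        B * (log (‖γ b - γ t‖ / ‖γ a - γ t‖) : ℝ) +
        ∫ s in Icc a b, (f s - A * (chordLog γ t s / signedChord γ t s : ℝ) -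
          B * (chordLog γ t s : ℝ)))) := by
  have hab := h.left.le.trans h.right.le
  set rem : ℝ → ℂ := fun s => f s - A * (chordLog γ t s / signedChord γ t s : ℝ) -
      B * (chordLog γ t s : ℝ) with hrem
  have hr₁ := norm_pos_iff.2 (h.ne (left_mem_Icc.2 hab) h.left.ne)
  have hr₂ := norm_pos_iff.2 (h.ne (right_mem_Icc.2 hab) h.right.ne')
  have hWm : ∀ ε, AEStronglyMeasurable (fun s => (W (‖γ s - γ t‖ / ε) : ℂ))
      (volume.restrict (Icc a b)) := fun ε =>
    (Complex.measurable_ofReal.comp (hW.measurable.comp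
      (((h.diff.continuous.sub continuous_const).norm.measurable).div_const ε))).aestronglyMeasurable
  have hremlim : Tendsto (fun ε : ℝ => ∫ s in Icc a b, (W (‖γ s - γ t‖ / ε) : ℂ) * rem s) (𝓝[>] 0)
      (𝓝 (∫ s in Icc a b, rem s)) := by
    apply tendsto_integral_filter_of_dominated_convergence (fun s => ‖rem s‖)
    · exact Eventually.of_forall fun ε => (hWm ε).mul hf.aestronglyMeasurable
    · refine Eventually.of_forall fun ε => Eventually.of_forall fun s => ?_
      rw [norm_mul, norm_real]; exact mul_le_of_le_one_left (norm_nonneg _) (hW.abs_le_one _)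
    · exact hf.norm
    · rw [ae_restrict_iff' measurableSet_Icc]
      have : ∀ᵐ s : ℝ, s ≠ t := by simp [ae_iff]
      filter_upwards [this] with s hst hs
      have h0 := norm_pos_iff.2 (h.ne hs hst)
      refine Tendsto.congr' (f₁ := fun _ => rem s) ?_ tendsto_const_nhds
      filter_upwards [Ioo_mem_nhdsGT h0] with ε hε
      rw [hW.eq_one _ ((one_lt_div hε.1).2 hε.2)]; simp
  refine Tendsto.congr' (f₁ := fun ε : ℝ => A * ((-‖γ a - γ t‖⁻¹ - ‖γ b - γ t‖⁻¹ : ℝ) : ℂ) +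
        B * (log (‖γ b - γ t‖ / ‖γ a - γ t‖) : ℝ) +
        ∫ s in Icc a b, (W (‖γ s - γ t‖ / ε) : ℂ) * rem s) ?_ (tendsto_const_nhds.add hremlim)
  filter_upwards [Ioo_mem_nhdsGT (lt_min hr₁ hr₂)] with ε hε
  have hε0 := hε.1
  have h₁ := hε.2.trans_le (min_le_left _ _)
  have h₂ := hε.2.trans_le (min_le_right _ _)
  -- the two singular terms, by substitution of the chord length
  have hi := fun k : ℕ => (intervalIntegrable_iff_integrableOn_Icc_of_le (by linarith)).1
    (hW.intervalIntegrable_abs_div_pow (k + 1) hε0 (-‖γ a - γ t‖) ‖γ b - γ t‖)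
  have hpt : ∀ k : ℕ, ∀ s ∈ Icc a b \ {t}, chordLog γ t s * signedChord γ t s *
      (W (|signedChord γ t s| / ε) / signedChord γ t s ^ (k + 1)) =
      W (‖γ s - γ t‖ / ε) * (chordLog γ t s / signedChord γ t s ^ k) := by
    intro k s hs
    have := h.chord_ne_zero hs.1 hs.2
    rw [abs_signedChord, pow_succ]; field_simp
  have hm : MeasurableSet (Icc a b \ {t}) := measurableSet_Icc.diff (measurableSet_singleton t)
  have n2 : (Icc a b \ {t} : Set ℝ) =ᵐ[volume] Icc a b := sdiff_null_ae_eq_self (by simp)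
  have hI : ∀ k : ℕ, IntegrableOn (fun s => W (‖γ s - γ t‖ / ε) *
      (chordLog γ t s / signedChord γ t s ^ k)) (Icc a b) := by
    intro k
    have := h.integrableOn_comp_chord (hi k)
    rw [← integrableOn_congr_set_ae n2] at this ⊢; exact this.congr_fun (hpt k) hm
  have hV : ∀ k : ℕ, ∫ s in Icc a b, W (‖γ s - γ t‖ / ε) * (chordLog γ t s / signedChord γ t s ^ k) =
      ∫ u in Icc (-‖γ a - γ t‖) ‖γ b - γ t‖, W (|u| / ε) / u ^ (k + 1) := by
    intro k
    rw [← h.setIntegral_comp_chord (fun u => W (|u| / ε) / u ^ (k + 1)),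
      ← setIntegral_congr_set n2, ← setIntegral_congr_set n2 (f := fun s => chordLog γ t s * signedChord γ t s *
      (W (|signedChord γ t s| / ε) / signedChord γ t s ^ (k + 1)))]
    exact (setIntegral_congr_fun hm (hpt k)).symm
  have v0 := hV 0
  have v1 := hV 1
  have i0 := hI 0
  have i1 := hI 1
  simp only [pow_zero, div_one, zero_add, pow_one] at v0 v1 i0 i1
  replace i0 : Integrable (fun s => ((W (‖γ s - γ t‖ / ε) * chordLog γ t s : ℝ) : ℂ))
    (volume.restrict (Icc a b)) := i0.ofReal
  replace i1 : Integrable (fun s => ((W (‖γ s - γ t‖ / ε) *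
    (chordLog γ t s / signedChord γ t s) : ℝ) : ℂ)) (volume.restrict (Icc a b)) := i1.ofReal
  rw [hW.integral_symm_odd hε0 h₁ h₂] at v0
  rw [hW.integral_symm_even hε0 h₁ h₂] at v1
  have iw : IntegrableOn (fun s => (W (‖γ s - γ t‖ / ε) : ℂ) * rem s) (Icc a b) := by
    refine Integrable.bdd_mul (c := 1) hf (hWm ε) (Eventually.of_forall fun s => ?_)
    rw [norm_real]; exact hW.abs_le_one _
  have hsplit : ∫ s in Icc a b, (W (‖γ s - γ t‖ / ε) : ℂ) * f s =
      (∫ s in Icc a b, A * ((W (‖γ s - γ t‖ / ε) * (chordLog γ t s / signedChord γ t s) : ℝ) : ℂ)) +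
      (∫ s in Icc a b, B * ((W (‖γ s - γ t‖ / ε) * chordLog γ t s : ℝ) : ℂ)) +
      ∫ s in Icc a b, (W (‖γ s - γ t‖ / ε) : ℂ) * rem s := by
    have j := integral_add ((i1.const_mul A).add (i0.const_mul B)) iw
    simp only [Pi.add_apply] at j; rw [← integral_add (i1.const_mul A) (i0.const_mul B), ← j]
    congr 1; ext s; simp [hrem]
    ring
  rw [hsplit, integral_const_mul, integral_const_mul, integral_complex_ofReal, integral_complex_ofReal, v0, v1]
  push_cast
  ring

end IsChordArc

lemma isOpen_punctured : IsOpen ({0}ᶜ : Set Plane) := isOpen_compl_singleton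

/-! ### Expansions along a curve at a small parameter distance -/

/-- A smooth plane curve whose derivatives are bounded and whose speed is bounded below. -/
structure IsRegularCurve (γ : ℝ → Plane) : Prop where
  smooth : ContDiff ℝ ∞ γ
  exists_speed_ge : ∃ m > 0, ∀ t, m ≤ ‖deriv γ t‖
  exists_bound : ∃ M, ∀ t, ‖deriv γ t‖ ≤ M ∧ ‖deriv (deriv γ) t‖ ≤ M ∧
    ‖deriv (deriv (deriv γ)) t‖ ≤ M

lemma Function.Periodic.exists_norm_le {E : Type*} [NormedAddCommGroup E] {f : ℝ → E} {T : ℝ}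
    (hf : Function.Periodic f T) (hT : 0 < T) (hc : Continuous f) : ∃ M, ∀ t, ‖f t‖ ≤ M := by
  obtain ⟨M, hM⟩ := isCompact_Icc.exists_bound_of_continuousOn (s := Icc 0 T) hc.continuousOn
  refine ⟨M, fun t => ?_⟩
  rw [← hf.apply_toIcoMod hT 0 t]
  have := toIcoMod_mem_Ico hT 0 t
  rw [zero_add] at this
  exact hM _ ⟨this.1, this.2.le⟩

lemma Function.Periodic.deriv_periodic {E : Type*} [NormedAddCommGroup E] [NormedSpace ℝ E]
    {f : ℝ → E} {T : ℝ} (hf : Function.Periodic f T) : Function.Periodic (deriv f) T := by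
  intro s
  have := funext hf
  conv_rhs => rw [← this]
  rw [deriv_comp_add_const]

lemma SmoothDomain.curve_isRegularCurve (D : SmoothDomain) (i : Fin D.numCurves) :
    IsRegularCurve (D.curve i) where
  smooth := D.curve_smooth i
  exists_speed_ge := by
    have hc := (D.deriv_curve_continuous i).norm
    obtain ⟨s, -, hs⟩ := isCompact_Icc.exists_isMinOn
      (⟨0, le_rfl, (D.period_pos i).le⟩ : (Icc 0 (D.period i)).Nonempty) hc.continuousOn
    refine ⟨_, norm_pos_iff.2 (D.curve_regular i s), fun t => ?_⟩
    rw [← (D.curve_periodic i).deriv_periodic.apply_toIcoMod (D.period_pos i) 0 t]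
    have := toIcoMod_mem_Ico (D.period_pos i) 0 t
    rw [zero_add] at this; exact hs ⟨this.1, this.2.le⟩
  exists_bound := by
    have p1 := (D.curve_periodic i).deriv_periodic
    have s1 := D.deriv_curve_smooth i
    have s2 := (contDiff_infty_iff_deriv.1 s1).2
    have s3 := (contDiff_infty_iff_deriv.1 s2).2
    obtain ⟨M1, h1⟩ := p1.exists_norm_le (D.period_pos i) s1.continuous
    obtain ⟨M2, h2⟩ := p1.deriv_periodic.exists_norm_le (D.period_pos i) s2.continuous
    obtain ⟨M3, h3⟩ := p1.deriv_periodic.deriv_periodic.exists_norm_le (D.period_pos i) s3.continuous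
    exact ⟨max M1 (max M2 M3), fun t => ⟨(h1 t).trans (le_max_left _ _),
      (h2 t).trans ((le_max_left _ _).trans (le_max_right _ _)),
      (h3 t).trans ((le_max_right _ _).trans (le_max_right _ _))⟩⟩

/-- Integration of a power bound on the derivative. -/
lemma norm_sub_le_of_norm_deriv_le_pow {E : Type*} [NormedAddCommGroup E] [NormedSpace ℝ E]
    {G g : ℝ → E} {t σ C : ℝ} {n : ℕ} (hG : ∀ s, HasDerivAt G (g s) s)
    (hg : ∀ u, |u| ≤ |σ| → ‖g (t + u)‖ ≤ C * |σ| ^ n) : ‖G (t + σ) - G t‖ ≤ C * |σ| ^ (n + 1) := by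
  have h := Convex.norm_image_sub_le_of_norm_hasDerivWithin_le (s := uIcc t (t + σ))
    (f := G) (f' := g) (C := C * |σ| ^ n) (fun s _ => (hG s).hasDerivWithinAt) ?_
    (convex_uIcc _ _) left_mem_uIcc right_mem_uIcc
  · rwa [add_sub_cancel_left, norm_eq_abs, mul_assoc, ← pow_succ] at h
  · intro s hs
    have := hg (s - t) (by
      have := abs_sub_left_of_mem_uIcc hs
      rwa [add_sub_cancel_left] at this)
    rwa [add_sub_cancel] at this

/-- Taylor's estimate of order two. -/
lemma norm_sub_sub_smul_le {E : Type*} [NormedAddCommGroup E] [NormedSpace ℝ E] {f f' f'' : ℝ → E}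
    {M : ℝ} (hf : ∀ s, HasDerivAt f (f' s) s) (hf' : ∀ s, HasDerivAt f' (f'' s) s)
    (hM : ∀ s, ‖f'' s‖ ≤ M) (t σ : ℝ) : ‖f (t + σ) - f t - σ • f' t‖ ≤ M * |σ| ^ 2 := by
  have := norm_sub_le_of_norm_deriv_le_pow (G := fun s => f s - (s - t) • f' t)
    (g := fun s => f' s - (1 : ℝ) • f' t) (t := t) (σ := σ) (n := 1) (C := M)
    (fun s => (hf s).sub (((hasDerivAt_id s).sub_const t).smul_const _)) fun u hu => by
      have := norm_sub_le_of_norm_deriv_le_pow (t := t) (σ := u) (n := 0) hf'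
        fun v _ => by simpa using hM (t + v)
      rw [one_smul]
      have := (norm_nonneg _).trans (hM t)
      exact ‹‖f' (t + u) - f' t‖ ≤ _›.trans (by gcongr)
  simp only [add_sub_cancel_left, sub_self, zero_smul, sub_zero] at this
  rwa [sub_right_comm] at this

namespace IsRegularCurve

variable {γ : ℝ → Plane} (h : IsRegularCurve γ)
include h

lemma hasDerivAt (s : ℝ) : HasDerivAt γ (deriv γ s) s :=
  (h.smooth.differentiable (by simp) s).hasDerivAt

lemma hasDerivAt₂ (s : ℝ) : HasDerivAt (deriv γ) (deriv (deriv γ) s) s :=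
  ((contDiff_infty_iff_deriv.1 h.smooth).2.differentiable (by simp) s).hasDerivAt

lemma hasDerivAt₃ (s : ℝ) : HasDerivAt (deriv (deriv γ)) (deriv (deriv (deriv γ)) s) s :=
  ((contDiff_infty_iff_deriv.1 (contDiff_infty_iff_deriv.1 h.smooth).2).2.differentiable
    (by simp) s).hasDerivAt

lemma exists_taylor : ∃ C > 0, (∀ t, ‖deriv γ t‖ ≤ C ∧ ‖deriv (deriv γ) t‖ ≤ C) ∧
    (∀ t σ, ‖γ (t + σ) - γ t‖ ≤ C * |σ|) ∧ (∀ t σ, ‖deriv γ (t + σ) - deriv γ t‖ ≤ C * |σ|) ∧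
    (∀ t σ, ‖γ (t + σ) - γ t - σ • deriv γ t‖ ≤ C * |σ| ^ 2) ∧
    (∀ t σ, ‖deriv γ (t + σ) - deriv γ t - σ • deriv (deriv γ) t‖ ≤ C * |σ| ^ 2) ∧
    (∀ t σ, ‖γ (t + σ) - γ t - σ • deriv γ t - (σ ^ 2 / 2) • deriv (deriv γ) t‖ ≤ C * |σ| ^ 3) := by
  obtain ⟨M, hM⟩ := h.exists_bound
  have hM0 := (norm_nonneg _).trans (hM 0).1
  have t1 := fun t σ => by
    simpa using norm_sub_le_of_norm_deriv_le_pow (t := t) (σ := σ) (n := 0) h.hasDerivAt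
      (fun u _ => by simpa using (hM (t + u)).1)
  have t1' := fun t σ => by
    simpa using norm_sub_le_of_norm_deriv_le_pow (t := t) (σ := σ) (n := 0) h.hasDerivAt₂
      (fun u _ => by simpa using (hM (t + u)).2.1)
  have t2 := norm_sub_sub_smul_le h.hasDerivAt h.hasDerivAt₂ fun s => (hM s).2.1
  have t2' := norm_sub_sub_smul_le h.hasDerivAt₂ h.hasDerivAt₃ fun s => (hM s).2.2
  have t3 : ∀ t σ, ‖γ (t + σ) - γ t - σ • deriv γ t - (σ ^ 2 / 2) • deriv (deriv γ) t‖ ≤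
      M * |σ| ^ 3 := fun t σ => by
    have := norm_sub_le_of_norm_deriv_le_pow
      (G := fun s => γ s - (s - t) • deriv γ t - ((s - t) ^ 2 / 2) • deriv (deriv γ) t)
      (g := fun s => deriv γ s - (1 : ℝ) • deriv γ t - (s - t) • deriv (deriv γ) t)
      (t := t) (σ := σ) (n := 2) (C := M)
      (fun s => ((h.hasDerivAt s).sub (((hasDerivAt_id s).sub_const t).smul_const _)).sub
        (HasDerivAt.smul_const (by
          have := (((hasDerivAt_id s).sub_const t).pow 2).div_const 2
          exact this.congr_deriv (by simp)) _)) (fun u hu => by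
        rw [one_smul, add_sub_cancel_left]; exact (t2' t u).trans (by gcongr))
    simp only [add_sub_cancel_left, sub_self, zero_smul, sub_zero, ne_eq, OfNat.ofNat_ne_zero,
      not_false_eq_true, zero_pow, zero_div] at this
    refine le_trans (le_of_eq ?_) this
    congr 1
    abel
  have hle : M ≤ M + 1 := by linarith
  refine ⟨M + 1, by positivity, fun t => ⟨(hM t).1.trans hle, (hM t).2.1.trans hle⟩,
    fun t σ => (t1 t σ).trans (by gcongr), fun t σ => (t1' t σ).trans (by gcongr),
    fun t σ => (t2 t σ).trans (by gcongr), fun t σ => (t2' t σ).trans (by gcongr),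
    fun t σ => (t3 t σ).trans (by gcongr)⟩

end IsRegularCurve

/-- `f(t, σ) = a(t) + O(1) σ + O(σ²)` as `σ → 0`, with a bounded coefficient of `σ` and uniformly
in `t`. -/
def HasExpansion (f : ℝ → ℝ → ℂ) (a : ℝ → ℂ) : Prop :=
  ∃ (b : ℝ → ℂ) (C δ : ℝ), 0 < δ ∧ (∀ t, ‖a t‖ ≤ C ∧ ‖b t‖ ≤ C) ∧
    ∀ t σ, σ ≠ 0 → |σ| ≤ δ → ‖f t σ - a t - σ * b t‖ ≤ C * σ ^ 2

namespace HasExpansion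

variable {f g : ℝ → ℝ → ℂ} {a a' : ℝ → ℂ}

lemma of_bounded {c : ℝ → ℂ} (hc : ∃ C, ∀ t, ‖c t‖ ≤ C) : HasExpansion (fun t _ => c t) c := by
  obtain ⟨C, hC⟩ := hc
  have hC0 := (norm_nonneg _).trans (hC 0)
  refine ⟨fun _ => 0, C, 1, one_pos, fun t => ⟨hC t, by simpa using hC0⟩, fun t σ _ _ => ?_⟩
  simp; positivity

lemma congr_of_ne (hf : HasExpansion f a) (e : ∀ t σ, σ ≠ 0 → g t σ = f t σ)
    (ea : ∀ t, a' t = a t) : HasExpansion g a' := by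
  obtain ⟨b, C, δ, hδ, h1, h2⟩ := hf
  refine ⟨b, C, δ, hδ, fun t => by rw [ea]; exact h1 t, fun t σ h0 h => ?_⟩
  rw [e t σ h0, ea]; exact h2 t σ h0 h

lemma add (hf : HasExpansion f a) (hg : HasExpansion g a') :
    HasExpansion (fun t σ => f t σ + g t σ) (fun t => a t + a' t) := by
  obtain ⟨b, C, δ, hδ, h1, h2⟩ := hf
  obtain ⟨b', C', δ', hδ', h1', h2'⟩ := hg
  refine ⟨fun t => b t + b' t, C + C', min δ δ', lt_min hδ hδ', fun t =>
    ⟨(norm_add_le _ _).trans (add_le_add (h1 t).1 (h1' t).1),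
      (norm_add_le _ _).trans (add_le_add (h1 t).2 (h1' t).2)⟩, fun t σ h0 h => ?_⟩
  have e1 := h2 t σ h0 (h.trans (min_le_left _ _))
  have e2 := h2' t σ h0 (h.trans (min_le_right _ _))
  calc _ = ‖(f t σ - a t - σ * b t) + (g t σ - a' t - σ * b' t)‖ := by congr 1; ring
    _ ≤ _ := (norm_add_le _ _).trans (by linarith)

lemma mul (hf : HasExpansion f a) (hg : HasExpansion g a') :
    HasExpansion (fun t σ => f t σ * g t σ) (fun t => a t * a' t) := by
  obtain ⟨b, C, δ, hδ, h1, h2⟩ := hf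
  obtain ⟨b', C', δ', hδ', h1', h2'⟩ := hg
  have hC := (norm_nonneg _).trans (h1 0).1
  have hC' := (norm_nonneg _).trans (h1' 0).1
  refine ⟨fun t => a t * b' t + b t * a' t, 7 * (C * C'), min 1 (min δ δ'), by positivity, fun t => ⟨?_, ?_⟩,
    fun t σ h0 h => ?_⟩
  · rw [norm_mul]
    calc _ ≤ C * C' := mul_le_mul (h1 t).1 (h1' t).1 (norm_nonneg _) hC
      _ ≤ _ := by nlinarith
  · calc _ ≤ ‖a t‖ * ‖b' t‖ + ‖b t‖ * ‖a' t‖ := by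
          rw [← norm_mul, ← norm_mul]; exact norm_add_le _ _
      _ ≤ C * C' + C * C' := add_le_add (mul_le_mul (h1 t).1 (h1' t).2 (norm_nonneg _) hC)
          (mul_le_mul (h1 t).2 (h1' t).1 (norm_nonneg _) hC)
      _ ≤ _ := by nlinarith
  · have hσ1 := h.trans (min_le_left _ _)
    have e1 := h2 t σ h0 (h.trans ((min_le_right _ _).trans (min_le_left _ _)))
    have e2 := h2' t σ h0 (h.trans ((min_le_right _ _).trans (min_le_right _ _)))
    have hσ2 : σ ^ 2 ≤ 1 := by rw [← sq_abs]; exact pow_le_one₀ (abs_nonneg _) hσ1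
    set r := f t σ - a t - σ * b t with hr
    set r' := g t σ - a' t - σ * b' t with hr'
    have n1 : ‖(σ : ℂ)‖ = |σ| := by simp
    have key : f t σ * g t σ - a t * a' t - σ * (a t * b' t + b t * a' t) =
        r * r' + r * (a' t + σ * b' t) + (a t + σ * b t) * r' + (σ : ℂ) ^ 2 * (b t * b' t) := by
      ring
    have m1 : ‖a t + σ * b t‖ ≤ 2 * C := by
      calc _ ≤ ‖a t‖ + |σ| * ‖b t‖ := by rw [← n1, ← norm_mul]; exact norm_add_le _ _
        _ ≤ C + 1 * C := add_le_add (h1 t).1 (mul_le_mul hσ1 (h1 t).2 (norm_nonneg _) one_pos.le)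
        _ = _ := by ring
    have m2 : ‖a' t + σ * b' t‖ ≤ 2 * C' := by
      calc _ ≤ ‖a' t‖ + |σ| * ‖b' t‖ := by rw [← n1, ← norm_mul]; exact norm_add_le _ _
        _ ≤ C' + 1 * C' := add_le_add (h1' t).1 (mul_le_mul hσ1 (h1' t).2 (norm_nonneg _) one_pos.le)
        _ = _ := by ring
    have e2' : ‖r'‖ ≤ C' := e2.trans (mul_le_of_le_one_right hC' hσ2)
    rw [key]
    calc _ ≤ ‖r * r'‖ + ‖r * (a' t + σ * b' t)‖ + ‖(a t + σ * b t) * r'‖ +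
          ‖(σ : ℂ) ^ 2 * (b t * b' t)‖ := norm_add₄_le
      _ = ‖r‖ * ‖r'‖ + ‖r‖ * ‖a' t + σ * b' t‖ + ‖a t + σ * b t‖ * ‖r'‖ +
          σ ^ 2 * (‖b t‖ * ‖b' t‖) := by simp only [norm_mul, norm_pow, n1, sq_abs]
      _ ≤ (C * σ ^ 2) * C' + (C * σ ^ 2) * (2 * C') + (2 * C) * (C' * σ ^ 2) + σ ^ 2 * (C * C') := by
          have := (h1 t).2
          have := (h1' t).2
          gcongr
      _ ≤ _ := by nlinarith [mul_nonneg (mul_nonneg hC hC') (sq_nonneg σ)]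

lemma const_mul (c : ℂ) (hf : HasExpansion f a) :
    HasExpansion (fun t σ => c * f t σ) (fun t => c * a t) :=
  (of_bounded ⟨‖c‖, fun _ => le_rfl⟩).mul hf

lemma sum {ι : Type*} (s : Finset ι) {f : ι → ℝ → ℝ → ℂ} {a : ι → ℝ → ℂ}
    (hf : ∀ i, HasExpansion (f i) (a i)) :
    HasExpansion (fun t σ => ∑ i ∈ s, f i t σ) (fun t => ∑ i ∈ s, a i t) := by
  classical
  induction s using Finset.induction_on with
  | empty => simpa using of_bounded (c := fun _ => 0) ⟨0, by simp⟩
  | insert i s hi ih =>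
    simp [Finset.sum_insert hi]; exact (hf i).add ih

end HasExpansion

/-- Second-order Taylor estimate for a function that is smooth off the origin, uniformly on an
annulus. -/
lemma exists_quadratic_remainder {e : Plane → ℂ} (he : ContDiffOn ℝ 2 e {0}ᶜ) {m : ℝ} (hm : 0 < m)
    (M : ℝ) : ∃ C, ∀ p v : Plane, m ≤ ‖p‖ → ‖p‖ ≤ M → ‖v‖ ≤ m / 2 →
      ‖fderiv ℝ e p‖ ≤ C ∧ ‖e (p + v) - e p - fderiv ℝ e p v‖ ≤ C * ‖v‖ ^ 2 := by
  set K : Set Plane := closedBall 0 (M + m / 2) \ ball 0 (m / 2)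
  have hKc : IsCompact K := (isCompact_closedBall _ _).diff Metric.isOpen_ball
  have hopen := isOpen_punctured
  have hK0 : K ⊆ {0}ᶜ := by rintro y ⟨-, hy⟩ rfl; exact hy (Metric.mem_ball_self (by positivity))
  have h1 : ContDiffOn ℝ 1 (fderiv ℝ e) {0}ᶜ := he.fderiv_of_isOpen hopen (by norm_num)
  have h2 := h1.continuousOn_fderiv_of_isOpen hopen (by norm_num)
  obtain ⟨C1, hC1⟩ := hKc.exists_bound_of_continuousOn (h1.continuousOn.mono hK0)
  obtain ⟨C2, hC2⟩ : ∃ C2, ∀ y ∈ K, ‖fderiv ℝ (fderiv ℝ e) y‖ ≤ C2 := by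
    obtain ⟨B, hB⟩ := hKc.bddAbove_image
      (ContinuousOn.norm (E := Plane →L[ℝ] Plane →L[ℝ] ℂ) (h2.mono hK0))
    exact ⟨B, fun y hy => hB (mem_image_of_mem _ hy)⟩
  refine ⟨max C1 C2, fun p v hp1 hp2 hv => ⟨?_, ?_⟩⟩
  · refine (hC1 p ⟨?_, ?_⟩).trans (le_max_left _ _)
    · rw [mem_closedBall_zero_iff]; linarith
    · rw [mem_ball_zero_iff]; linarith
  have hsub : closedBall p ‖v‖ ⊆ K := by
    intro y hy; rw [mem_closedBall_iff_norm] at hy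
    have e1 : ‖y‖ ≤ ‖p‖ + ‖v‖ := by
      calc ‖y‖ = ‖p + (y - p)‖ := by congr 1; abel
        _ ≤ ‖p‖ + ‖y - p‖ := norm_add_le _ _
        _ ≤ _ := by linarith
    have e2 : ‖p‖ - ‖v‖ ≤ ‖y‖ := by
      have : ‖p‖ ≤ ‖y‖ + ‖y - p‖ := by
        calc ‖p‖ = ‖y - (y - p)‖ := by congr 1; abel
          _ ≤ _ := norm_sub_le _ _
      linarith
    refine ⟨?_, ?_⟩
    · rw [mem_closedBall_zero_iff]; linarith
    · rw [mem_ball_zero_iff]; linarith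
  have hd : ∀ y ∈ closedBall p ‖v‖, DifferentiableAt ℝ e y := fun y hy =>
    (he.contDiffAt (hopen.mem_nhds (hK0 (hsub hy)))).differentiableAt (by norm_num)
  have hd2 : ∀ y ∈ closedBall p ‖v‖, DifferentiableAt ℝ (fderiv ℝ e) y := fun y hy =>
    (h1.contDiffAt (hopen.mem_nhds (hK0 (hsub hy)))).differentiableAt (by norm_num)
  have hpm : p ∈ closedBall p ‖v‖ := Metric.mem_closedBall_self (norm_nonneg _)
  have hC2' : 0 ≤ max C1 C2 := (norm_nonneg _).trans ((hC1 p (hsub hpm)).trans (le_max_left C1 C2))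
  have hstep : ∀ y ∈ closedBall p ‖v‖, ‖fderiv ℝ e y - fderiv ℝ e p‖ ≤ max C1 C2 * ‖v‖ := by
    intro y hy
    have := (convex_closedBall p ‖v‖).norm_image_sub_le_of_norm_fderiv_le (f := fderiv ℝ e)
      (C := max C1 C2) (𝕜 := ℝ) hd2 (fun z hz => (hC2 z (hsub hz)).trans (le_max_right _ _)) hpm hy
    rw [mem_closedBall_iff_norm] at hy; exact this.trans (by gcongr)
  have hpv : p + v ∈ closedBall p ‖v‖ := by simp
  have := (convex_closedBall p ‖v‖).norm_image_sub_le_of_norm_fderiv_le' (f := e) (𝕜 := ℝ)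
    (φ := fderiv ℝ e p) hd hstep hpm hpv
  rw [add_sub_cancel_left] at this
  rwa [pow_two, ← mul_assoc]

namespace IsRegularCurve

variable {γ : ℝ → Plane} (h : IsRegularCurve γ)
include h

/-- A function of the difference quotient of the curve. -/
lemma hasExpansion_comp {e : Plane → ℂ} (he : ContDiffOn ℝ 2 e {0}ᶜ) :
    HasExpansion (fun t σ => e (σ⁻¹ • (γ (t + σ) - γ t))) (fun t => e (deriv γ t)) := by
  obtain ⟨C, hC, hb, -, -, -, -, h3⟩ := h.exists_taylor
  obtain ⟨m, hm, hml⟩ := h.exists_speed_ge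
  obtain ⟨C', hC'⟩ := exists_quadratic_remainder he hm C
  have hcont : ContinuousOn e (closedBall 0 C \ ball 0 m) := by
    refine he.continuousOn.mono ?_
    rintro y ⟨-, hy⟩ rfl; exact hy (Metric.mem_ball_self hm)
  obtain ⟨C₀, hC₀⟩ := ((isCompact_closedBall _ _).diff Metric.isOpen_ball).exists_bound_of_continuousOn
    hcont
  have hC'0 := (norm_nonneg _).trans
    (hC' (deriv γ 0) 0 (hml 0) (hb 0).1 (by rw [norm_zero]; positivity)).1
  have hde := fun t =>
    (hC' (deriv γ t) 0 (hml t) (hb t).1 (by rw [norm_zero]; positivity)).1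
  refine ⟨fun t => fderiv ℝ e (deriv γ t) ((1 / 2 : ℝ) • deriv (deriv γ) t),
    max C₀ (C' * C + C' * (2 * C) ^ 2), min 1 (m / (4 * C)), by positivity, fun t => ⟨?_, ?_⟩,
    fun t σ h0 hσ => ?_⟩
  · refine (hC₀ _ ⟨?_, ?_⟩).trans (le_max_left _ _)
    · rw [mem_closedBall_zero_iff]; exact (hb t).1
    · rw [mem_ball_zero_iff, not_lt]; exact hml t
  · refine le_trans ?_ (le_max_right _ _)
    calc _ ≤ ‖fderiv ℝ e (deriv γ t)‖ * ‖(1 / 2 : ℝ) • deriv (deriv γ) t‖ :=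
          ContinuousLinearMap.le_opNorm _ _
      _ ≤ C' * C := by
          have e1 : ‖(1 / 2 : ℝ) • deriv (deriv γ) t‖ ≤ C := by
            rw [norm_smul]
            have := (hb t).2
            norm_num; linarith
          exact mul_le_mul (hde t) e1 (norm_nonneg _) hC'0
      _ ≤ _ := le_add_of_nonneg_right (by positivity)
  · have hσ1 := hσ.trans (min_le_left _ _)
    have hσm : |σ| ≤ m / (4 * C) := hσ.trans (min_le_right _ _)
    have hσpos := abs_pos.2 h0
    set v := σ⁻¹ • (γ (t + σ) - γ t) - deriv γ t with hv
    set w := v - σ • ((1 / 2 : ℝ) • deriv (deriv γ) t) with hw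
    have hweq : w = σ⁻¹ • (γ (t + σ) - γ t - σ • deriv γ t - (σ ^ 2 / 2) • deriv (deriv γ) t) := by
      have e3 : σ⁻¹ * (σ ^ 2 / 2) = σ * (1 / 2) := by field_simp
      rw [hw, hv]; simp only [smul_sub, smul_smul]; rw [inv_mul_cancel₀ h0, one_smul, e3]
    have hwn : ‖w‖ ≤ C * σ ^ 2 := by
      rw [hweq, norm_smul, norm_inv, norm_eq_abs, inv_mul_le_iff₀ hσpos]
      calc _ ≤ C * |σ| ^ 3 := h3 t σ
        _ = |σ| * (C * σ ^ 2) := by rw [← sq_abs σ]; ring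
    have hvn : ‖v‖ ≤ 2 * C * |σ| := by
      calc ‖v‖ = ‖w + σ • ((1 / 2 : ℝ) • deriv (deriv γ) t)‖ := by rw [hw]; congr 1; abel
        _ ≤ ‖w‖ + |σ| * (1 / 2 * ‖deriv (deriv γ) t‖) := by
            refine (norm_add_le _ _).trans (le_of_eq ?_)
            rw [norm_smul, norm_smul]; norm_num
        _ ≤ C * (|σ| * 1) + |σ| * (1 / 2 * C) := by
            have h5 : σ ^ 2 ≤ |σ| * 1 := by rw [← sq_abs, pow_two]; gcongr
            have h6 := (hb t).2
            have : C * σ ^ 2 ≤ C * (|σ| * 1) := by gcongr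
            gcongr
            exact hwn.trans this
        _ ≤ _ := by nlinarith
    have hvm : ‖v‖ ≤ m / 2 := by
      refine hvn.trans ?_
      calc 2 * C * |σ| ≤ 2 * C * (m / (4 * C)) := by gcongr
        _ = m / 2 := by field_simp; norm_num
    have key := (hC' (deriv γ t) v (hml t) (hb t).1 hvm).2
    have e1 : deriv γ t + v = σ⁻¹ • (γ (t + σ) - γ t) := by rw [hv]; abel
    rw [e1] at key
    have e2 : fderiv ℝ e (deriv γ t) v = fderiv ℝ e (deriv γ t) w +
        (σ : ℂ) * fderiv ℝ e (deriv γ t) ((1 / 2 : ℝ) • deriv (deriv γ) t) := by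
      have : v = w + σ • ((1 / 2 : ℝ) • deriv (deriv γ) t) := by rw [hw]; abel
      rw [← real_smul, ← map_smul, ← map_add, ← this]
    calc _ = ‖(e (σ⁻¹ • (γ (t + σ) - γ t)) - e (deriv γ t) - fderiv ℝ e (deriv γ t) v) +
          fderiv ℝ e (deriv γ t) w‖ := by rw [e2]; congr 1; ring
      _ ≤ C' * ‖v‖ ^ 2 + C' * ‖w‖ := (norm_add_le _ _).trans (add_le_add key
          ((ContinuousLinearMap.le_opNorm _ _).trans (by gcongr; exact hde t)))
      _ ≤ C' * (2 * C * |σ|) ^ 2 + C' * (C * σ ^ 2) := by gcongr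
      _ = (C' * C + C' * (2 * C) ^ 2) * σ ^ 2 := by rw [mul_pow, sq_abs]; ring
      _ ≤ _ := by gcongr; exact le_max_right _ _

lemma hasExpansion_deriv (j : Fin 2) :
    HasExpansion (fun t σ => (deriv γ (t + σ) j : ℂ)) (fun t => (deriv γ t j : ℂ)) := by
  obtain ⟨C, hC, hb, -, -, -, h3, -⟩ := h.exists_taylor
  have hle : ∀ v : Plane, ‖((v j : ℝ) : ℂ)‖ ≤ ‖v‖ := fun v => by
    rw [norm_real]; exact PiLp.norm_apply_le v j
  refine ⟨fun t => (deriv (deriv γ) t j : ℂ), C, 1, one_pos, fun t =>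
    ⟨(hle _).trans (hb t).1, (hle _).trans (hb t).2⟩, fun t σ _ _ => ?_⟩
  have := (hle _).trans (h3 t σ)
  simpa using this

end IsRegularCurve

/-! ### Kernels with a singular expansion along a curve -/

/-- `k(t, t + σ) = a(t) σ⁻² + b(t) σ⁻¹ + O(1 + |log σ|)` as `σ → 0`, uniformly in `t` and with
bounded coefficients. -/
def HasSingularExpansion (k : ℝ → ℝ → ℂ) (a b : ℝ → ℂ) : Prop :=
  ∃ C δ : ℝ, 0 < δ ∧ (∀ t, ‖a t‖ ≤ C ∧ ‖b t‖ ≤ C) ∧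
    ∀ t σ, σ ≠ 0 → |σ| ≤ δ → ‖k t (t + σ) - a t / σ ^ 2 - b t / σ‖ ≤ C * (1 + |log σ|)

namespace HasSingularExpansion

variable {k k' : ℝ → ℝ → ℂ} {a b a' b' : ℝ → ℂ}

lemma add (hk : HasSingularExpansion k a b) (hk' : HasSingularExpansion k' a' b') :
    HasSingularExpansion (fun t s => k t s + k' t s) (fun t => a t + a' t)
      (fun t => b t + b' t) := by
  obtain ⟨C, δ, hδ, h1, h2⟩ := hk
  obtain ⟨C', δ', hδ', h1', h2'⟩ := hk'
  refine ⟨C + C', min δ δ', lt_min hδ hδ', fun t =>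
    ⟨(norm_add_le _ _).trans (add_le_add (h1 t).1 (h1' t).1),
      (norm_add_le _ _).trans (add_le_add (h1 t).2 (h1' t).2)⟩, fun t σ h0 h => ?_⟩
  have e1 := h2 t σ h0 (h.trans (min_le_left _ _))
  have e2 := h2' t σ h0 (h.trans (min_le_right _ _))
  calc _ = ‖(k t (t + σ) - a t / σ ^ 2 - b t / σ) + (k' t (t + σ) - a' t / σ ^ 2 - b' t / σ)‖ := by
        ring_nf
    _ ≤ _ := (norm_add_le _ _).trans (by linarith)

lemma of_bound {C δ : ℝ} (hδ : 0 < δ)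
    (hk : ∀ t σ, σ ≠ 0 → |σ| ≤ δ → ‖k t (t + σ)‖ ≤ C * (1 + |log σ|)) :
    HasSingularExpansion k (fun _ => 0) (fun _ => 0) :=
  ⟨max C 0, δ, hδ, fun t => by simp, fun t σ h0 h => by
    rw [zero_div, zero_div, sub_zero, sub_zero]
    exact (hk t σ h0 h).trans (mul_le_mul_of_nonneg_right (le_max_left _ _) (by positivity))⟩

lemma of_expansion_sq {f : ℝ → ℝ → ℂ} (hf : HasExpansion f a)
    (hk : ∀ t σ, σ ≠ 0 → k t (t + σ) = ((σ : ℂ) ^ 2)⁻¹ * f t σ) :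
    ∃ b, HasSingularExpansion k a b := by
  obtain ⟨b, C, δ, hδ, h1, h2⟩ := hf
  refine ⟨b, C, δ, hδ, h1, fun t σ h0 h => ?_⟩
  have hC := (norm_nonneg _).trans (h1 0).1
  have e : k t (t + σ) - a t / σ ^ 2 - b t / σ = ((σ : ℂ) ^ 2)⁻¹ * (f t σ - a t - σ * b t) := by
    rw [hk t σ h0]; field_simp
  have hn : ‖((σ : ℂ) ^ 2)⁻¹‖ = (σ ^ 2)⁻¹ := by simp
  rw [e, norm_mul, hn, inv_mul_le_iff₀ (by positivity)]
  refine (h2 t σ h0 h).trans ?_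
  rw [mul_comm C]
  gcongr
  exact le_mul_of_one_le_right hC (le_add_of_nonneg_right (abs_nonneg _))

lemma of_expansion_inv {f : ℝ → ℝ → ℂ} (hf : HasExpansion f b)
    (hk : ∀ t σ, σ ≠ 0 → k t (t + σ) = (σ : ℂ)⁻¹ * f t σ) :
    HasSingularExpansion k (fun _ => 0) b := by
  obtain ⟨d, C, δ, hδ, h1, h2⟩ := hf
  have hC := (norm_nonneg _).trans (h1 0).1
  refine ⟨2 * C, min δ 1, by positivity, fun t => ⟨by simpa using hC, by linarith [(h1 t).1]⟩,
    fun t σ h0 h => ?_⟩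
  have h0' := ofReal_ne_zero.2 h0
  have hσ1 := h.trans (min_le_right _ _)
  have e : k t (t + σ) - 0 / σ ^ 2 - b t / σ = (σ : ℂ)⁻¹ * (f t σ - b t - σ * d t) + d t := by
    rw [hk t σ h0]; field_simp; ring
  have hn : ‖(σ : ℂ)⁻¹‖ = |σ|⁻¹ := by simp
  rw [e]
  calc _ ≤ |σ|⁻¹ * (C * σ ^ 2) + C := by
        refine (norm_add_le _ _).trans (add_le_add ?_ (h1 t).2)
        rw [norm_mul, hn]
        gcongr
        exact h2 t σ h0 (h.trans (min_le_left _ _))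
    _ = C * |σ| + C := by rw [← sq_abs]; field_simp
    _ ≤ C * 1 + C := by gcongr
    _ = 2 * C * 1 := by ring
    _ ≤ _ := by gcongr; exact le_add_of_nonneg_right (abs_nonneg _)

end HasSingularExpansion

/-! ### Chord length along a regular curve -/

lemma contDiffOn_coord_div_norm_pow (j : Fin 2) (k : ℕ) {n : WithTop ℕ∞} :
    ContDiffOn ℝ n (fun v : Plane => ((v j / ‖v‖ ^ k : ℝ) : ℂ)) {0}ᶜ := by
  intro v hv
  apply ContDiffAt.contDiffWithinAt
  apply ofRealCLM.contDiff.contDiffAt.comp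
  have hn : ContDiffAt ℝ n (fun v : Plane => ‖v‖) v := contDiffAt_norm ℝ hv
  refine ContDiffAt.div ?_ (hn.pow k) (pow_ne_zero _ (norm_ne_zero_iff.2 hv))
  exact (proj (𝕜 := ℝ) j).contDiff.contDiffAt

lemma signedChord_add (γ : ℝ → Plane) (t σ : ℝ) (h0 : σ ≠ 0) :
    signedChord γ t (t + σ) = σ * ‖σ⁻¹ • (γ (t + σ) - γ t)‖ := by
  rw [norm_smul, norm_inv, norm_eq_abs, signedChord]
  split_ifs with h
  · rw [abs_of_neg (by linarith)]; field_simp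
  · rw [abs_of_nonneg (by linarith)]; field_simp

lemma chordLog_add (γ : ℝ → Plane) (t σ : ℝ) (h0 : σ ≠ 0) :
    chordLog γ t (t + σ) = σ⁻¹ * ∑ j, ((σ⁻¹ • (γ (t + σ) - γ t)) j /
      ‖σ⁻¹ • (γ (t + σ) - γ t)‖ ^ 2) * deriv γ (t + σ) j := by
  rw [chordLog, norm_smul, norm_inv, norm_eq_abs, Plane.inner_eq, Fin.sum_univ_two, mul_pow,
    inv_pow, sq_abs]
  simp [PiLp.smul_apply, smul_eq_mul]
  rcases eq_or_ne (γ (t + σ) - γ t) 0 with h | h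
  · simp [h]
  · field_simp

namespace IsRegularCurve

variable {γ : ℝ → Plane} (h : IsRegularCurve γ)
include h

lemma deriv_ne_zero (t : ℝ) : deriv γ t ≠ 0 := by
  obtain ⟨m, hm, hml⟩ := h.exists_speed_ge
  exact norm_pos_iff.1 (hm.trans_le (hml t))

/-- The chord is comparable to the parameter distance, and its length increases away from the base
point; both hold uniformly along the curve. -/
lemma exists_chord_bounds : ∃ δ c : ℝ, 0 < δ ∧ δ ≤ 1 ∧ 0 < c ∧ ∀ t σ, σ ≠ 0 → |σ| ≤ δ →
    c * |σ| ≤ ‖γ (t + σ) - γ t‖ ∧ 0 < σ * inner ℝ (γ (t + σ) - γ t) (deriv γ (t + σ)) := by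
  obtain ⟨C, hC, hb, -, -, h2, -, -⟩ := h.exists_taylor
  obtain ⟨m, hm, hml⟩ := h.exists_speed_ge
  refine ⟨min 1 (min (m / (2 * C)) (m ^ 2 / (2 * C ^ 2))), m / 2, by positivity, min_le_left _ _,
    by positivity, fun t σ h0 hσ => ?_⟩
  have s1 := hσ.trans ((min_le_right _ _).trans (min_le_left _ _))
  have s2 := hσ.trans ((min_le_right _ _).trans (min_le_right _ _))
  have hσ0 := abs_pos.2 h0
  have t1 := h2 (t + σ) (-σ)
  rw [abs_neg, neg_smul, sub_neg_eq_add] at t1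
  set v := deriv γ (t + σ)
  set d := γ (t + σ) - γ t with hd
  have t1 : ‖σ • v - d‖ ≤ C * |σ| ^ 2 := by rw [hd]; convert t1 using 2; abel_nf
  have e1 : C * |σ| ^ 2 ≤ m / 2 * |σ| := by rw [le_div_iff₀ (by positivity)] at s1; nlinarith
  constructor
  · have : ‖σ • v‖ ≤ ‖σ • v - d‖ + ‖d‖ := by
      calc _ = ‖(σ • v - d) + d‖ := by congr 1; abel
        _ ≤ _ := norm_add_le _ _
    rw [norm_smul, norm_eq_abs] at this
    have := mul_le_mul_of_nonneg_left (hml (t + σ)) hσ0.le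
    nlinarith
  · have i1 : σ * inner ℝ d v = σ ^ 2 * ‖v‖ ^ 2 - σ * inner ℝ (σ • v - d) v := by
      rw [inner_sub_left (σ • v), real_inner_smul_left, real_inner_self_eq_norm_sq]; ring
    have i2 : |σ * inner ℝ (σ • v - d) v| ≤ |σ| * (C * |σ| ^ 2 * C) := by
      rw [abs_mul]
      gcongr
      refine (abs_real_inner_le_norm _ _).trans ?_
      exact mul_le_mul t1 (hb _).1 (norm_nonneg _) (by positivity)
    have i3 : |σ| * (C * |σ| ^ 2 * C) ≤ |σ| ^ 2 * (m ^ 2 / 2) := by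
      rw [le_div_iff₀ (by positivity)] at s2
      nlinarith [sq_nonneg |σ|]
    have i4 : |σ| ^ 2 * m ^ 2 ≤ σ ^ 2 * ‖v‖ ^ 2 := by rw [sq_abs]; gcongr; exact hml _
    rw [i1]
    have := (abs_le.1 i2).2
    have : 0 < |σ| ^ 2 * (m ^ 2 / 2) := by positivity
    nlinarith

lemma hasSingularExpansion_chordLog :
    HasSingularExpansion (fun t s => (chordLog γ t s : ℝ)) (fun _ => 0) (fun _ => 1) := by
  have hf := HasExpansion.sum Finset.univ (fun j : Fin 2 =>
    (h.hasExpansion_comp (contDiffOn_coord_div_norm_pow j 2)).mul (h.hasExpansion_deriv j))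
  refine HasSingularExpansion.of_expansion_inv (hf.congr_of_ne (fun _ _ _ => rfl) fun t => ?_) ?_
  · have h0 := norm_ne_zero_iff.2 (h.deriv_ne_zero t)
    have := Plane.norm_sq_eq (deriv γ t)
    rw [Fin.sum_univ_two]; norm_cast; field_simp
    rw [this]
  · intro t σ h0
    rw [chordLog_add γ t σ h0]; push_cast
    rfl

lemma exists_hasSingularExpansion_chord :
    ∃ b, HasSingularExpansion (fun t s => (chordLog γ t s / signedChord γ t s : ℝ))
      (fun t => (‖deriv γ t‖⁻¹ : ℝ)) b := by
  have hf := HasExpansion.sum Finset.univ (fun j : Fin 2 =>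
    (h.hasExpansion_comp (contDiffOn_coord_div_norm_pow j 3)).mul (h.hasExpansion_deriv j))
  refine HasSingularExpansion.of_expansion_sq (hf.congr_of_ne (fun _ _ _ => rfl) fun t => ?_) ?_
  · have h0 := norm_ne_zero_iff.2 (h.deriv_ne_zero t)
    have := Plane.norm_sq_eq (deriv γ t)
    rw [Fin.sum_univ_two]; norm_cast; field_simp
    rw [this]
  · intro t σ h0
    rw [chordLog_add γ t σ h0, signedChord_add γ t σ h0]; norm_cast
    rw [Fin.sum_univ_two, Fin.sum_univ_two]
    rcases eq_or_ne (σ⁻¹ • (γ (t + σ) - γ t)) 0 with h1 | h1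
    · simp [h1]
    · field_simp

end IsRegularCurve

/-! ### Uniform estimates of finite parts over short arcs -/

lemma exists_integral_log_le {c : ℝ} (hc : 0 < c) : ∃ C h₀ : ℝ, 0 < h₀ ∧ h₀ ≤ 1 / 4 ∧ 0 ≤ C ∧
    ∀ h, 0 < h → h < h₀ → ∀ a t b, t - h / c ≤ a → b ≤ t + h / c →
      IntegrableOn (fun s => 1 + |log (s - t)|) (Icc a b) ∧
      ∫ s in Icc a b, (1 + |log (s - t)|) ≤ C * (h * |log h|) := by
  refine ⟨2 * (1 / c) * (2 + |log c| + 1), min (1 / 4) (min c (Real.exp (-1))),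
    by positivity, min_le_left _ _, by positivity, fun h h0 hh a t b ha hb => ?_⟩
  have h2 := hh.trans_le ((min_le_right _ _).trans (min_le_left _ _))
  have h3 := hh.trans_le ((min_le_right _ _).trans (min_le_right _ _))
  set H := h / c with hH
  have H0 : 0 < H := by positivity
  have H1 := (div_lt_one hc).2 h2
  have hlog : log h < -1 := by rwa [Real.log_lt_iff_lt_exp h0]
  have eqOn : ∀ s ∈ Icc (t - H) (t + H), 1 + |log (s - t)| = 1 - log (s - t) := by
    intro s hs
    have : |s - t| ≤ 1 := by rw [abs_le]; constructor <;> linarith [hs.1, hs.2]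
    rw [← Real.log_abs (s - t), abs_of_nonpos (Real.log_nonpos (abs_nonneg _) this)]; ring
  have ii : IntervalIntegrable (fun s => 1 - log (s - t)) volume (t - H) (t + H) := by
    apply IntervalIntegrable.sub (by simp)
    have := (intervalIntegral.intervalIntegrable_log' (a := -H) (b := H)).comp_sub_right t
    convert this using 1 <;> ring
  have hint : IntegrableOn (fun s => 1 + |log (s - t)|) (Icc (t - H) (t + H)) := by
    rw [intervalIntegrable_iff_integrableOn_Icc_of_le (by linarith)] at ii
    exact ii.congr_fun (fun s hs => (eqOn s hs).symm) measurableSet_Icc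
  have hsub := Icc_subset_Icc ha hb
  refine ⟨hint.mono_set hsub, ?_⟩
  calc _ ≤ ∫ s in Icc (t - H) (t + H), (1 + |log (s - t)|) :=
        setIntegral_mono_set hint (Eventually.of_forall fun s => by positivity) hsub.eventuallyLE
    _ = ∫ s in (t - H)..(t + H), (1 - log (s - t)) := by
        rw [setIntegral_congr_fun measurableSet_Icc eqOn, integral_Icc_eq_integral_Ioc,
          integral_of_le (by linarith)]
    _ = ∫ u in (-H)..H, (1 - log u) := by
        rw [intervalIntegral.integral_comp_sub_right (fun u => 1 - log u)]; congr 1 <;> ring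
    _ = 2 * H * (2 - log H) := by simp; ring
    _ = 2 * (1 / c) * h * (2 + log c - log h) := by rw [log_div h0.ne' hc.ne']; ring
    _ ≤ 2 * (1 / c) * h * ((2 + |log c| + 1) * |log h|) := by
        refine mul_le_mul_of_nonneg_left ?_ (by positivity)
        rw [abs_of_neg (by linarith : log h < 0)]
        nlinarith [le_abs_self (log c), abs_nonneg (log c)]
    _ = _ := by ring

/-- The arc `γ([a, b])` about `γ t` has parameter length at most `δ`, and its end points have
distance between `κ h` and `h` from `γ t`. -/
structure IsPatchArc (γ : ℝ → Plane) (κ h δ a t b : ℝ) : Prop where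
  mem : t ∈ Icc a b
  length_le : b - a ≤ δ
  left_gt : κ * h < ‖γ a - γ t‖
  left_lt : ‖γ a - γ t‖ < h
  right_gt : κ * h < ‖γ b - γ t‖
  right_lt : ‖γ b - γ t‖ < h

lemma IsPatchArc.mono {γ : ℝ → Plane} {κ h δ δ' a t b : ℝ} (H : IsPatchArc γ κ h δ a t b)
    (hδ : δ ≤ δ') : IsPatchArc γ κ h δ' a t b := { H with length_le := H.length_le.trans hδ }

/-- `L` is the finite part of `∫_a^b f ds`, for `f` with a singularity at `t` of order at most two,
and for every cutoff function of the chord length; `A` gives the divergent term. -/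
def HasArcFinitePart (γ : ℝ → Plane) (a t b : ℝ) (f : ℝ → ℂ) (A L : ℂ) : Prop :=
  ∀ W, IsCutoff W → Tendsto (fun ε : ℝ => (∫ s in Icc a b, (W (‖γ s - γ t‖ / ε) : ℂ) * f s) -
    (ε : ℂ)⁻¹ * (cutoffMoment W * A)) (𝓝[>] 0) (𝓝 L)

/-- Integrability over a chord arc of a remainder that is logarithmically bounded. -/
lemma IsRegularCurve.integrableOn_remainder {γ : ℝ → Plane} (h : IsRegularCurve γ) {a t b : ℝ}
    (hchord : IsChordArc γ a t b) {f : ℝ → ℂ} {A B : ℂ} {N₀ N₁ : ℝ}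
    (hf : ContinuousOn f (Icc a b \ {t}))
    (hrem : ∀ s ∈ Icc a b, s ≠ t → ‖f s - A * (chordLog γ t s / signedChord γ t s : ℝ) -
        B * (chordLog γ t s : ℝ)‖ ≤ N₀ + N₁ * (1 + |log (s - t)|))
    (li : IntegrableOn (fun s => 1 + |log (s - t)|) (Icc a b)) :
    IntegrableOn (fun s => f s - A * (chordLog γ t s / signedChord γ t s : ℝ) -
        B * (chordLog γ t s : ℝ)) (Icc a b) ∧
      ∀ᵐ s ∂volume.restrict (Icc a b), ‖f s - A * (chordLog γ t s / signedChord γ t s : ℝ) -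
        B * (chordLog γ t s : ℝ)‖ ≤ N₀ + N₁ * (1 + |log (s - t)|) := by
  set rem : ℝ → ℂ := fun s => f s - A * (chordLog γ t s / signedChord γ t s : ℝ) -
        B * (chordLog γ t s : ℝ)
  have hbound_int : IntegrableOn (fun s => N₀ + N₁ * (1 + |log (s - t)|)) (Icc a b) :=
    (integrableOn_const (by simp)).add (li.const_mul N₁)
  have hcg := h.smooth.continuous
  have hcg' := (contDiff_infty_iff_deriv.1 h.smooth).2.continuous
  have hcl : ContinuousOn (chordLog γ t) (Icc a b \ {t}) := by
    apply ContinuousOn.div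
    · exact (Continuous.inner (hcg.sub continuous_const) hcg').continuousOn
    · exact ((hcg.sub continuous_const).norm.pow 2).continuousOn
    · intro s hs
      exact pow_ne_zero _ (norm_ne_zero_iff.2 (hchord.ne hs.1 hs.2))
  have hcs :=
    hcl.div hchord.continuous_chord.continuousOn fun s hs => hchord.chord_ne_zero hs.1 hs.2
  have hremc : ContinuousOn rem (Icc a b \ {t}) :=
    (hf.sub (continuousOn_const.mul (continuous_ofReal.comp_continuousOn hcs))).sub
      (continuousOn_const.mul (continuous_ofReal.comp_continuousOn hcl))
  have hae : (Icc a b \ {t} : Set ℝ) =ᵐ[volume] Icc a b :=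
    sdiff_null_ae_eq_self (measure_singleton t)
  have hmeas : MeasurableSet (Icc a b \ {t}) := measurableSet_Icc.diff (measurableSet_singleton t)
  have hae2 : ∀ᵐ s ∂volume.restrict (Icc a b), ‖rem s‖ ≤ N₀ + N₁ * (1 + |log (s - t)|) := by
    rw [← Measure.restrict_congr_set hae, ae_restrict_iff' hmeas]
    exact Eventually.of_forall fun s hs => hrem s hs.1 hs.2
  have hri : IntegrableOn rem (Icc a b) := by
    refine Integrable.mono' hbound_int ?_ hae2
    rw [← Measure.restrict_congr_set hae]; exact hremc.aestronglyMeasurable hmeas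
  exact ⟨hri, hae2⟩

namespace IsRegularCurve

variable {γ : ℝ → Plane} (h : IsRegularCurve γ)
include h

/-- Over a short arc the finite part of `A ρ'/ρ² + B ρ'/ρ + remainder` is of size `|A| / η + |B|`, up
to the integral of the remainder, because both ends of the arc are at distance at least `κ η`. -/
lemma exists_arc_finitePart {κ : ℝ} (hκ : 0 < κ) : ∃ C h₀ δ : ℝ, 0 ≤ C ∧ 0 < h₀ ∧ h₀ ≤ 1 / 4 ∧
    0 < δ ∧ ∀ η a t b, 0 < η → η < h₀ → IsPatchArc γ κ η δ a t b →
    IsChordArc γ a t b ∧ ∀ (f : ℝ → ℂ) (A B : ℂ) (N₀ N₁ : ℝ),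
      0 ≤ N₀ → 0 ≤ N₁ → ContinuousOn f (Icc a b \ {t}) →
      (∀ s ∈ Icc a b, s ≠ t → ‖f s - A * (chordLog γ t s / signedChord γ t s : ℝ) -
        B * (chordLog γ t s : ℝ)‖ ≤ N₀ + N₁ * (1 + |log (s - t)|)) →
      IntegrableOn (fun s => f s - A * (chordLog γ t s / signedChord γ t s : ℝ) -
        B * (chordLog γ t s : ℝ)) (Icc a b) ∧ ∃ L, HasArcFinitePart γ a t b f A L ∧
        ‖L‖ ≤ C * (‖A‖ / η + ‖B‖ + N₀ * η + N₁ * (η * |log η|)) := by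
  obtain ⟨δ, c, hδ, hδ1, hc, hb⟩ := h.exists_chord_bounds
  obtain ⟨C, h₀, hh₀, hh₀', hC, hlog⟩ := exists_integral_log_le hc
  refine ⟨max (2 / κ) (max |log κ| (max (2 / c) C)), h₀, δ, ?_, hh₀, hh₀', hδ,
    fun η a t b hη hηh H => ?_⟩
  · exact (abs_nonneg _).trans ((le_max_left _ _).trans (le_max_right _ _))
  have hne : ∀ s, κ * η < ‖γ s - γ t‖ → s ≠ t := by
    rintro s hs rfl; rw [sub_self, norm_zero] at hs; nlinarith
  have hat := lt_of_le_of_ne H.mem.1 (hne a H.left_gt)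
  have htb := lt_of_le_of_ne H.mem.2 (hne b H.right_gt).symm
  have hbd : ∀ s ∈ Icc a b, s ≠ t → c * |s - t| ≤ ‖γ s - γ t‖ ∧
      0 < (s - t) * inner ℝ (γ s - γ t) (deriv γ s) := by
    intro s hs hst
    have := hb t (s - t) (sub_ne_zero.2 hst) (by
      have := H.length_le; rw [abs_le]; constructor <;> linarith [hs.1, hs.2])
    rwa [add_sub_cancel] at this
  have hchord : IsChordArc γ a t b :=
    ⟨h.smooth.differentiable (by simp), hat, htb, fun s hs hst => (hbd s hs hst).2⟩
  refine ⟨hchord, fun f A B N₀ N₁ hN₀ hN₁ hf hrem => ?_⟩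
  have hab := hat.le.trans htb.le
  have ha' : t - η / c ≤ a := by
    have := (hbd a (left_mem_Icc.2 hab) hat.ne).1
    rw [abs_of_neg (by linarith)] at this
    have : t - a ≤ η / c := by rw [le_div_iff₀ hc]; linarith [H.left_lt]
    linarith
  have hb' : b ≤ t + η / c := by
    have := (hbd b (right_mem_Icc.2 hab) htb.ne').1
    rw [abs_of_pos (by linarith)] at this
    have : b - t ≤ η / c := by rw [le_div_iff₀ hc]; linarith [H.right_lt]
    linarith
  obtain ⟨li, ll⟩ := hlog η hη hηh a t b ha' hb'
  have hbound_int : IntegrableOn (fun s => N₀ + N₁ * (1 + |log (s - t)|)) (Icc a b) :=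
    (integrableOn_const (by simp)).add (li.const_mul N₁)
  obtain ⟨hri, hae2⟩ := h.integrableOn_remainder hchord hf hrem li
  set rem : ℝ → ℂ := fun s => f s - A * (chordLog γ t s / signedChord γ t s : ℝ) -
        B * (chordLog γ t s : ℝ)
  refine ⟨hri, _, fun W hW => hchord.tendsto_finitePart hW A B hri, ?_⟩
  have r1 := (by positivity : 0 < κ * η).trans H.left_gt
  have r2 := (by positivity : 0 < κ * η).trans H.right_gt
  have b1 : ‖A * ((-‖γ a - γ t‖⁻¹ - ‖γ b - γ t‖⁻¹ : ℝ) : ℂ)‖ ≤ 2 / κ * (‖A‖ / η) := by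
    rw [norm_mul, norm_real, norm_eq_abs, abs_of_nonpos (by
      have := inv_pos.2 r1; have := inv_pos.2 r2; linarith)]
    have i1 := inv_anti₀ (by positivity) H.left_gt.le
    have i2 := inv_anti₀ (by positivity) H.right_gt.le
    calc _ ≤ ‖A‖ * ((κ * η)⁻¹ + (κ * η)⁻¹) := by gcongr; linarith
      _ = _ := by field_simp; ring
  have b2 : ‖B * (log (‖γ b - γ t‖ / ‖γ a - γ t‖) : ℝ)‖ ≤ |log κ| * ‖B‖ := by
    rw [norm_mul, norm_real, norm_eq_abs, mul_comm]
    refine mul_le_mul_of_nonneg_right ?_ (norm_nonneg _)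
    have q1 : κ ≤ ‖γ b - γ t‖ / ‖γ a - γ t‖ := by
      rw [le_div_iff₀ r1]
      exact (mul_le_mul_of_nonneg_left H.left_lt.le hκ.le).trans H.right_gt.le
    have q2 : ‖γ b - γ t‖ / ‖γ a - γ t‖ ≤ κ⁻¹ := by
      rw [div_le_iff₀ r1, ← div_eq_inv_mul, le_div_iff₀ hκ, mul_comm]
      exact (mul_le_mul_of_nonneg_left H.right_lt.le hκ.le).trans H.left_gt.le
    have l1 := Real.log_le_log hκ q1
    have l2 := Real.log_le_log (by positivity) q2
    rw [Real.log_inv] at l2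
    have hκ1 : κ < 1 := by
      have := H.left_gt.trans H.left_lt
      nlinarith
    rw [abs_of_neg (Real.log_neg hκ hκ1), abs_le]; exact ⟨by linarith, l2⟩
  have b3 : ‖∫ s in Icc a b, rem s‖ ≤ 2 / c * (N₀ * η) + C * (N₁ * (η * |log η|)) := by
    calc _ ≤ ∫ s in Icc a b, (N₀ + N₁ * (1 + |log (s - t)|)) :=
          norm_integral_le_of_norm_le hbound_int hae2
      _ = (b - a) * N₀ + N₁ * ∫ s in Icc a b, (1 + |log (s - t)|) := by
          rw [integral_add (integrable_const _) (li.const_mul N₁), integral_const_mul]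
          simp [hab]
      _ ≤ (2 * (η / c)) * N₀ + N₁ * (C * (η * |log η|)) := by
          gcongr
          linarith
      _ = _ := by ring
  set K := max (2 / κ) (max |log κ| (max (2 / c) C))
  have k1 : 2 / κ ≤ K := le_max_left _ _
  have k2 : |log κ| ≤ K := (le_max_left _ _).trans (le_max_right _ _)
  have k3 : 2 / c ≤ K := (le_max_left _ _).trans ((le_max_right _ _).trans (le_max_right _ _))
  have k4 : C ≤ K := (le_max_right _ _).trans ((le_max_right _ _).trans (le_max_right _ _))
  calc _ ≤ 2 / κ * (‖A‖ / η) + |log κ| * ‖B‖ + (2 / c * (N₀ * η) +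
        C * (N₁ * (η * |log η|))) :=
        (norm_add_le _ _).trans (add_le_add ((norm_add_le _ _).trans (add_le_add b1 b2)) b3)
    _ ≤ K * (‖A‖ / η) + K * ‖B‖ + (K * (N₀ * η) + K * (N₁ * (η * |log η|))) := by gcongr
    _ = _ := by ring

end IsRegularCurve

lemma IsPatchArc.abs_sub_le {γ : ℝ → Plane} {κ h δ a t b s : ℝ} (hp : IsPatchArc γ κ h δ a t b)
    (hs : s ∈ Icc a b) : |s - t| ≤ δ := by
  refine le_trans ?_ hp.length_le
  rw [abs_le]
  constructor <;> linarith [hs.1, hs.2, hp.mem.1, hp.mem.2]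

lemma mul_abs_log_le_one {η : ℝ} (h0 : 0 < η) (h1 : η < 1 / 4) : η * |log η| ≤ 1 := by
  have := (Real.abs_log_mul_self_lt η h0 (by linarith)).le
  rwa [abs_mul, abs_of_pos h0, mul_comm] at this

/-- The remainder of a kernel with a second-order singularity, multiplied by a density, after
subtraction of the matching combination of derivatives of the chord length. -/
lemma norm_kernel_mul_sub_le {kk a b β ν ψs ψ₀ ψ₁ cs cl A B : ℂ}
    {σ K M₀ M₁ N NA NB Ks Kc l : ℝ} (h0 : σ ≠ 0) (K0 : 0 ≤ K)
    (l0 : 0 ≤ l) (hb : ‖b‖ ≤ K) (e1 : ‖kk - a / σ ^ 2 - b / σ‖ ≤ K * l)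
    (e2 : ‖cl - 0 / σ ^ 2 - 1 / σ‖ ≤ Kc * l) (e3 : ‖cs - ν / σ ^ 2 - β / σ‖ ≤ Ks * l)
    (e4 : ‖(a / σ ^ 2 + b / σ) * (ψs - ψ₀ - (σ : ℝ) * ψ₁)‖ ≤ N) (hM₀ : ‖ψs‖ ≤ M₀) (hM₁ : ‖ψ₁‖ ≤ M₁)
    (nA : ‖A‖ ≤ NA) (nB : ‖B‖ ≤ NB) (hA : A * ν = a * ψ₀) (hB : B = b * ψ₀ + a * ψ₁ - A * β) :
    ‖kk * ψs - A * cs - B * cl‖ ≤ K * M₁ + N + (K * M₀ + NA * Ks + NB * Kc) * l := by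
  have h0' := ofReal_ne_zero.2 h0
  set r := kk - a / σ ^ 2 - b / σ with hr
  set rc := cl - 0 / σ ^ 2 - 1 / σ with hrc
  set rs := cs - ν / σ ^ 2 - β / σ with hrs
  set e := ψs - ψ₀ - (σ : ℝ) * ψ₁ with he
  have q1 : kk = a / σ ^ 2 + b / σ + r := by ring
  have q2 : cl = 1 / σ + rc := by ring
  have q3 : cs = ν / σ ^ 2 + β / σ + rs := by ring
  have q4 : ψs = ψ₀ + σ * ψ₁ + e := by ring
  have key : kk * ψs - A * cs - B * cl =
      b * ψ₁ + (a / σ ^ 2 + b / σ) * e + r * ψs - A * rs - B * rc := by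
    have q7 : A * cs = a * ψ₀ / σ ^ 2 + A * β / σ + A * rs := by rw [← hA]; ring
    have q6 : kk * ψs = (a / σ ^ 2 + b / σ) * (ψ₀ + σ * ψ₁ + e) + r * ψs := by ring
    have q8 : B * cl = (b * ψ₀ + a * ψ₁ - A * β) / σ + B * rc := by rw [← hB]; ring
    rw [q7, q6, q8]; field_simp; ring
  have n0 : ‖b * ψ₁‖ ≤ K * M₁ := by rw [norm_mul]; exact mul_le_mul hb hM₁ (norm_nonneg _) K0
  have n2 : ‖r * ψs‖ ≤ K * l * M₀ := by
    rw [norm_mul]; exact mul_le_mul e1 hM₀ (norm_nonneg _) (by positivity)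
  have n3 : ‖A * rs‖ ≤ NA * (Ks * l) := by
    rw [norm_mul]; exact mul_le_mul nA e3 (norm_nonneg _) ((norm_nonneg _).trans nA)
  have n4 : ‖B * rc‖ ≤ NB * (Kc * l) := by
    rw [norm_mul]; exact mul_le_mul nB e2 (norm_nonneg _) ((norm_nonneg _).trans nB)
  rw [key]
  have m1 := norm_sub_le (b * ψ₁ + (a / σ ^ 2 + b / σ) * e + r * ψs - A * rs) (B * rc)
  have m2 := norm_sub_le (b * ψ₁ + (a / σ ^ 2 + b / σ) * e + r * ψs) (A * rs)
  have m3 := norm_add_le (b * ψ₁ + (a / σ ^ 2 + b / σ) * e) (r * ψs)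
  have m4 := norm_add_le (b * ψ₁) ((a / σ ^ 2 + b / σ) * e)
  linarith

namespace IsRegularCurve

variable {γ : ℝ → Plane} (h : IsRegularCurve γ) {k : ℝ → ℝ → ℂ} {a b : ℝ → ℂ}
include h

omit h in
lemma continuousOn_kernel_mul {a' t b' : ℝ} (hc : IsChordArc γ a' t b')
    (hkc : ∀ t, ContinuousOn (k t) {s | γ s ≠ γ t}) {ψ : ℝ → ℂ} (hψ : ContinuousOn ψ (Icc a' b')) :
    ContinuousOn (fun s => k t s * ψ s) (Icc a' b' \ {t}) :=
  ((hkc t).mono fun _ hs => sub_ne_zero.1 (hc.ne hs.1 hs.2)).mul (hψ.mono sdiff_subset)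

/-- Finite parts over short arcs of a kernel with singularities of orders one and two. The parameter
`ψ₁` is the derivative of the density where the second order matters, and zero otherwise. -/
lemma exists_singular_bound {κ : ℝ} (hκ : 0 < κ) (hk : HasSingularExpansion k a b)
    (hkc : ∀ t, ContinuousOn (k t) {s | γ s ≠ γ t}) :
    ∃ C h₀ δ : ℝ, 0 ≤ C ∧ 0 < h₀ ∧ h₀ ≤ 1 / 4 ∧ 0 < δ ∧ ∀ η a' t b', 0 < η → η < h₀ →
      IsPatchArc γ κ η δ a' t b' → ∀ (ψ : ℝ → ℂ) (ψ₁ : ℂ) (M₀ M₁ N : ℝ), 0 ≤ N →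
      ContinuousOn ψ (Icc a' b') → (∀ s ∈ Icc a' b', ‖ψ s‖ ≤ M₀) → ‖ψ₁‖ ≤ M₁ →
      (∀ s ∈ Icc a' b', s ≠ t → ‖(a t / (s - t : ℝ) ^ 2 + b t / (s - t : ℝ)) *
        (ψ s - ψ t - (s - t : ℝ) * ψ₁)‖ ≤ N) →
      ∃ L, HasArcFinitePart γ a' t b' (fun s => k t s * ψ s) (a t * ψ t * (‖deriv γ t‖ : ℝ)) L ∧
        ‖L‖ ≤ C * (‖a t‖ * M₀ / η + M₀ + M₁ + N * η) := by
  obtain ⟨C₁, h₁, δ₁, hC₁, hh₁, hh₁', hδ₁, H₁⟩ := h.exists_arc_finitePart hκ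
  obtain ⟨K, δk, hδk, kab, hK⟩ := hk
  obtain ⟨Kc, δc, hδc, cab, hKc⟩ := h.hasSingularExpansion_chordLog
  obtain ⟨β, Ks, δs, hδs, sab, hKs⟩ := h.exists_hasSingularExpansion_chord
  obtain ⟨V, hV⟩ := h.exists_bound
  have K0 := (norm_nonneg _).trans (kab 0).1
  have Kc0 := (norm_nonneg _).trans (cab 0).1
  have Ks0 := (norm_nonneg _).trans (sab 0).1
  have V0 := (norm_nonneg _).trans (hV 0).1
  set KB := K + K + K * V * Ks with hKB
  refine ⟨C₁ * (1 + V + KB + K + (K + K * V * Ks + KB * Kc)), h₁,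
    min δ₁ (min δk (min δc δs)), by positivity, hh₁, hh₁', by positivity,
    fun η a' t b' hη hηh hp ψ ψ₁ M₀ M₁ N hN hψ hM₀ hM₁ hM₂ => ?_⟩
  obtain ⟨hch, H⟩ := H₁ η a' t b' hη hηh (hp.mono (min_le_left _ _))
  have hη1 := hηh.trans_le hh₁'
  have hM₀0 := (norm_nonneg _).trans (hM₀ t hp.mem)
  have hM₁0 := (norm_nonneg _).trans hM₁
  have hψt := hM₀ t hp.mem
  obtain ⟨hat, hbt⟩ := kab t
  have hVt := (hV t).1
  set A : ℂ := a t * ψ t * (‖deriv γ t‖ : ℝ) with hA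
  set B : ℂ := b t * ψ t + a t * ψ₁ - A * β t with hB
  have nA' : ‖A‖ ≤ ‖a t‖ * M₀ * V := by
    rw [norm_mul, norm_mul, norm_real, norm_norm]
    gcongr
  have nA : ‖A‖ ≤ K * M₀ * V := nA'.trans (by gcongr)
  have nB : ‖B‖ ≤ KB * (M₀ + M₁) := by
    calc _ ≤ ‖b t‖ * ‖ψ t‖ + ‖a t‖ * ‖ψ₁‖ + ‖A‖ * ‖β t‖ := by
          rw [← norm_mul, ← norm_mul, ← norm_mul]
          exact (norm_sub_le _ _).trans (add_le_add_left (norm_add_le _ _) _)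
      _ ≤ K * M₀ + K * M₁ + K * M₀ * V * Ks := by
          have := (sab t).2
          gcongr
      _ ≤ K * M₀ + K * M₁ + K * M₀ * V * Ks + (K * M₀ + K * M₁ + K * V * Ks * M₁) :=
          le_add_of_nonneg_right (by positivity)
      _ = _ := by rw [hKB]; ring
  obtain ⟨-, L, hL, hLb⟩ := H (fun s => k t s * ψ s) A B (K * M₁ + N)
    (K * M₀ + K * M₀ * V * Ks + KB * (M₀ + M₁) * Kc) (by positivity) (by positivity)
    (continuousOn_kernel_mul hch hkc hψ) fun s hs hst => by
      have h0 := sub_ne_zero.2 hst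
      have hσl := hp.abs_sub_le hs
      have hσ2 := hσl.trans (min_le_right _ _)
      have hσ3 := hσ2.trans (min_le_right _ _)
      have e1 := hK t _ h0 (hσ2.trans (min_le_left _ _))
      have e2 := hKc t _ h0 (hσ3.trans (min_le_left _ _))
      have e3 := hKs t _ h0 (hσ3.trans (min_le_right _ _))
      rw [add_sub_cancel] at e1 e2 e3
      refine norm_kernel_mul_sub_le h0 K0 (by positivity) hbt e1 e2 e3 (hM₂ s hs hst) (hM₀ s hs)
        hM₁ nA nB ?_ hB
      have := ofReal_ne_zero.2 (norm_ne_zero_iff.2 (h.deriv_ne_zero t))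
      rw [hA]; push_cast; field_simp
  refine ⟨L, hL, hLb.trans ?_⟩
  have hlog := mul_abs_log_le_one hη hη1
  rw [mul_assoc C₁]
  refine mul_le_mul_of_nonneg_left ?_ hC₁
  calc _ ≤ ‖a t‖ * M₀ * V / η + KB * (M₀ + M₁) + (K * M₁ + N) * η +
        (K * M₀ + K * M₀ * V * Ks + KB * (M₀ + M₁) * Kc) * 1 := by gcongr
    _ ≤ _ := by
        have h1 : 0 ≤ K * M₁ * (1 - η) := mul_nonneg (by positivity) (by linarith)
        have h2 : 0 ≤ K * M₀ + (K + K * V * Ks) * M₁ := by positivity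
        have h3 : 0 ≤ (1 + KB + K + (K + K * V * Ks + KB * Kc)) * (‖a t‖ * M₀ / η) +
          (1 + V) * (M₀ + M₁) + (V + KB + K + (K + K * V * Ks + KB * Kc)) * (N * η) := by positivity
        linear_combination h1 + h2 + h3

/-- Integrals over short arcs of a kernel with a logarithmic singularity. -/
lemma exists_weaklySingular_bound {κ : ℝ} (hκ : 0 < κ)
    (hk : HasSingularExpansion k (fun _ => 0) (fun _ => 0))
    (hkc : ∀ t, ContinuousOn (k t) {s | γ s ≠ γ t}) :
    ∃ C h₀ δ : ℝ, 0 ≤ C ∧ 0 < h₀ ∧ h₀ ≤ 1 / 4 ∧ 0 < δ ∧ ∀ η a' t b', 0 < η → η < h₀ →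
      IsPatchArc γ κ η δ a' t b' → ∀ (ψ : ℝ → ℂ) (M₀ : ℝ),
      ContinuousOn ψ (Icc a' b') → (∀ s ∈ Icc a' b', ‖ψ s‖ ≤ M₀) →
      IntegrableOn (fun s => k t s * ψ s) (Icc a' b') ∧
      HasArcFinitePart γ a' t b' (fun s => k t s * ψ s) 0 (∫ s in Icc a' b', k t s * ψ s) ∧
        ‖∫ s in Icc a' b', k t s * ψ s‖ ≤ C * (M₀ * (η * |log η|)) := by
  obtain ⟨C₁, h₁, δ₁, hC₁, hh₁, hh₁', hδ₁, H₁⟩ := h.exists_arc_finitePart hκ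
  obtain ⟨K, δk, hδk, kab, hK⟩ := hk
  have K0 := (norm_nonneg _).trans (kab 0).2
  refine ⟨C₁ * K, h₁, min δ₁ δk, by positivity, hh₁, hh₁', by positivity,
    fun η a' t b' hη hηh hp ψ M₀ hψ hM₀ => ?_⟩
  obtain ⟨hch, H⟩ := H₁ η a' t b' hη hηh (hp.mono (min_le_left _ _))
  have hM₀0 := (norm_nonneg _).trans (hM₀ t hp.mem)
  obtain ⟨hi, L, hL, hLb⟩ := H (fun s => k t s * ψ s) 0 0 0 (K * M₀) le_rfl (by positivity)
    (continuousOn_kernel_mul hch hkc hψ) (by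
      intro s hs hst
      have hσl := hp.abs_sub_le hs
      have e1 := hK t (s - t) (sub_ne_zero.2 hst) (hσl.trans (min_le_right _ _))
      rw [add_sub_cancel, zero_div, zero_div, sub_zero, sub_zero] at e1
      rw [zero_mul, zero_mul, sub_zero, sub_zero, norm_mul]
      calc _ ≤ K * (1 + |log (s - t)|) * M₀ := by
            have := hM₀ s hs
            gcongr
        _ = _ := by ring)
  have hL2 := fun W hW => hch.tendsto_finitePart (W := W) hW 0 0 hi
  simp only [zero_mul, sub_zero, zero_add] at hL2 hi
  have := tendsto_nhds_unique (hL2 _ sharpCutoff_isCutoff) (hL _ sharpCutoff_isCutoff)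
  rw [this]
  refine ⟨hi, hL, hLb.trans (le_of_eq ?_)⟩
  simp [norm_zero]; ring

end IsRegularCurve

/-! ### Finite parts over the whole boundary -/

lemma tendsto_ofReal_zero : Tendsto (fun ε : ℝ => (ε : ℂ)) (𝓝[>] 0) (𝓝 0) :=
  (continuous_ofReal.tendsto 0).mono_left nhdsWithin_le_nhds

namespace SmoothDomain

variable (D : SmoothDomain)

/-- The function `f`, restricted to `Γ`, is continuous off the point `x`. -/
def ContinuousOff {E : Type*} [TopologicalSpace E] (x : Plane) (f : Plane → E) : Prop :=
  ∀ i, ContinuousOn (fun s => f (D.curve i s)) {s | D.curve i s ≠ x}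

/-- Absolute convergence of the line integral. -/
def LineIntegrable {E : Type*} [NormedAddCommGroup E] [NormedSpace ℝ E]
    (A : Set Plane) (f : Plane → E) : Prop :=
  ∀ i, IntegrableOn (fun s => ‖deriv (D.curve i) s‖ • f (D.curve i s))
    (Ico 0 (D.period i) ∩ D.curve i ⁻¹' A)

/-- `v` is the finite part of `∫_Γ f ds`, for `f` with a singularity at `x` of order at most two,
and for every cutoff function of the distance to `x`; `A` gives the divergent term. -/
def HasCutoffFinitePart (x : Plane) (f : Plane → ℂ) (A v : ℂ) : Prop :=
  ∀ W, IsCutoff W → Tendsto (fun ε : ℝ =>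
    D.lineIntegral univ (fun y => (W (dist y x / ε) : ℂ) * f y) -
      (ε : ℂ)⁻¹ * (cutoffMoment W * A)) (𝓝[>] 0) (𝓝 v)

variable {D}

lemma measurableSet_param (i : Fin D.numCurves) {A : Set Plane} (hA : MeasurableSet A) :
    MeasurableSet (Ico 0 (D.period i) ∩ D.curve i ⁻¹' A) :=
  measurableSet_Ico.inter ((D.curve_continuous i).measurable hA)

lemma lineIntegral_congr {E : Type*} [NormedAddCommGroup E] [NormedSpace ℝ E] {A : Set Plane}
    (hA : MeasurableSet A) {f g : Plane → E} (h : ∀ y ∈ A, y ∈ frontier D.Ω → f y = g y) :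
    D.lineIntegral A f = D.lineIntegral A g := by
  refine sum_congr rfl fun i _ => setIntegral_congr_fun (measurableSet_param i hA) ?_
  intro s hs
  simp only
  rw [h _ hs.2 (D.curve_mem_frontier i s)]

namespace LineIntegrable

variable {E : Type*} [NormedAddCommGroup E] [NormedSpace ℝ E] {A B : Set Plane} {f g : Plane → E}

lemma mono (hf : D.LineIntegrable B f) (h : A ⊆ B) : D.LineIntegrable A f := fun i =>
  (hf i).mono_set (inter_subset_inter_right _ (preimage_mono h))

lemma lineIntegral_add (hf : D.LineIntegrable A f) (hg : D.LineIntegrable A g) :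
    D.lineIntegral A (fun y => f y + g y) = D.lineIntegral A f + D.lineIntegral A g := by
  unfold lineIntegral
  rw [← sum_add_distrib]
  refine sum_congr rfl fun i _ => ?_
  simp [smul_add]
  exact integral_add (hf i) (hg i)

lemma union (hf : D.LineIntegrable A f) (hg : D.LineIntegrable B f) :
    D.LineIntegrable (A ∪ B) f := fun i => by
  rw [preimage_union, inter_union_distrib_left]
  exact (hf i).union (hg i)

lemma lineIntegral_union (hA : D.LineIntegrable A f) (hB : D.LineIntegrable B f)
    (hm : MeasurableSet B) (hd : Disjoint A B) :
    D.lineIntegral (A ∪ B) f = D.lineIntegral A f + D.lineIntegral B f := by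
  unfold lineIntegral
  rw [← sum_add_distrib]
  refine sum_congr rfl fun i _ => ?_
  rw [preimage_union, inter_union_distrib_left]
  exact setIntegral_union ((hd.preimage _).mono inter_subset_right inter_subset_right)
    (measurableSet_param i hm) (hA i) (hB i)

/-- Components of the integral of a vector field. -/
lemma lineIntegral_apply {σ : ℕ} {f : Plane → Fin σ → ℂ}
    (hf : ∀ k, D.LineIntegrable A (fun y => f y k)) (k : Fin σ) :
    D.lineIntegral A f k = D.lineIntegral A (fun y => f y k) := by
  unfold lineIntegral
  rw [Finset.sum_apply]
  refine sum_congr rfl fun i _ => ?_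
  have hi := Integrable.of_eval fun k => hf k i
  exact (ContinuousLinearMap.integral_comp_comm (ContinuousLinearMap.proj (R := ℝ) k) hi).symm

end LineIntegrable

lemma lineIntegral_const_mul (c : ℂ) (A : Set Plane) (f : Plane → ℂ) :
    D.lineIntegral A (fun y => c * f y) = c * D.lineIntegral A f := by
  unfold lineIntegral
  rw [mul_sum]
  refine sum_congr rfl fun i _ => ?_
  rw [← integral_const_mul]
  congr 1
  ext s
  simp [real_smul]; ring

/-- A function that is continuous off `x` can be integrated at a distance from `x`. -/
lemma ContinuousOff.lineIntegrable {E : Type*} [NormedAddCommGroup E] [NormedSpace ℝ E]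
    {x : Plane} {f : Plane → E} (hf : D.ContinuousOff x f) {d : ℝ} (hd : 0 < d) {A : Set Plane}
    (hA : ∀ y ∈ A, y ∈ frontier D.Ω → d ≤ dist y x) : D.LineIntegrable A f := by
  intro i
  set K : Set ℝ := Icc 0 (D.period i) ∩ {s | d ≤ dist (D.curve i s) x}
  have hKc : IsCompact K := isCompact_Icc.inter_right
    (isClosed_le continuous_const ((D.curve_continuous i).dist continuous_const))
  have hc : ContinuousOn (fun s => ‖deriv (D.curve i) s‖ • f (D.curve i s)) K := by
    refine (D.deriv_curve_continuous i).norm.continuousOn.smul ((hf i).mono ?_)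
    rintro s ⟨-, hs⟩ h0; rw [mem_ofPred_eq, h0, dist_self] at hs; linarith
  refine (hc.integrableOn_compact hKc).mono_set ?_
  rintro s ⟨hs, hs2⟩
  exact ⟨⟨hs.1, hs.2.le⟩, hA _ hs2 (D.curve_mem_frontier i s)⟩

lemma ContinuousOff.lineIntegrable_cutoff {x : Plane} {f : Plane → ℂ}
    (hf : D.ContinuousOff x f) {W : ℝ → ℝ} (hW : IsCutoff W) {ε : ℝ} (hε : 0 < ε) (A : Set Plane) :
    D.LineIntegrable A (fun y => (W (dist y x / ε) : ℂ) * f y) := by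
  suffices h1 : D.LineIntegrable univ (fun y => (W (dist y x / ε) : ℂ) * f y) from
    h1.mono (subset_univ _)
  have h2 := hf.lineIntegrable (half_pos hε) (A := {y | ε / 2 ≤ dist y x}) fun y hy _ => hy
  refine fun i => IntegrableOn.of_forall_sdiff_eq_zero (((h2 i).bdd_mul (c := 1)
    (f := fun s => (W (dist (D.curve i s) x / ε) : ℂ)) ?_ ?_).congr
    (Eventually.of_forall fun s => ?_)) (measurableSet_param i MeasurableSet.univ) fun s hs => ?_
  · exact (Complex.measurable_ofReal.comp (hW.measurable.comp (((D.curve_continuous i).measurable.dist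
      measurable_const).div_const ε))).aestronglyMeasurable
  · exact Eventually.of_forall fun s => by simpa using hW.abs_le_one _
  · simp [real_smul]; ring
  · have : dist (D.curve i s) x < ε / 2 := not_le.1 fun h => hs.2 ⟨hs.1.1, h⟩
    simp [hW.eq_zero (dist (D.curve i s) x / ε) (by positivity) (by rw [div_le_iff₀ hε]; linarith)]

section Arc

variable {i : Fin D.numCurves} {a t b : ℝ}

lemma arc_indicator_periodic {E : Type*} [Zero E] {F : ℝ → E}
    (hF : Function.Periodic F (D.period i)) (A : Set Plane) :
    Function.Periodic ((D.curve i ⁻¹' A).indicator F) (D.period i) := by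
  intro s
  by_cases h : D.curve i s ∈ A
  · have h' : s + D.period i ∈ D.curve i ⁻¹' A := by
      rw [mem_preimage, D.curve_periodic i s]; exact h
    rw [indicator_of_mem h', indicator_of_mem (by exact h), hF s]
  · have h' : s + D.period i ∉ D.curve i ⁻¹' A := by
      rw [mem_preimage, D.curve_periodic i s]; exact h
    rw [indicator_of_notMem h', indicator_of_notMem (by exact h)]

lemma density_periodic {E : Type*} [NormedAddCommGroup E] [NormedSpace ℝ E] (f : Plane → E) :
    Function.Periodic (fun s => ‖deriv (D.curve i) s‖ • f (D.curve i s)) (D.period i) := by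
  intro s
  simp [D.curve_periodic i s, (D.curve_periodic i).deriv_periodic s]

variable {E : Type*} [NormedAddCommGroup E] [NormedSpace ℝ E]

lemma setIntegral_density (f : Plane → E) {A : Set Plane} (hA : MeasurableSet A) (a : ℝ) :
    ∫ s in Ico 0 (D.period i) ∩ D.curve i ⁻¹' A, ‖deriv (D.curve i) s‖ • f (D.curve i s) =
      ∫ s in Ico a (a + D.period i) ∩ D.curve i ⁻¹' A, ‖deriv (D.curve i) s‖ • f (D.curve i s) := by
  have hT := D.period_pos i
  have hm := (D.curve_continuous i).measurable hA
  rw [← setIntegral_indicator hm, ← setIntegral_indicator hm, integral_Ico_eq_integral_Ioc,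
    integral_Ico_eq_integral_Ioc, ← integral_of_le hT.le, ← integral_of_le (by linarith)]
  simpa using (arc_indicator_periodic (density_periodic (i := i) f) A).intervalIntegral_add_eq 0 a

lemma integrableOn_density {f : Plane → E} {A : Set Plane} (hA : MeasurableSet A)
    (h : IntegrableOn (fun s => ‖deriv (D.curve i) s‖ • f (D.curve i s))
      (Ico a (a + D.period i) ∩ D.curve i ⁻¹' A)) :
    IntegrableOn (fun s => ‖deriv (D.curve i) s‖ • f (D.curve i s))
      (Ico 0 (D.period i) ∩ D.curve i ⁻¹' A) := by
  have hT := D.period_pos i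
  have hm := (D.curve_continuous i).measurable hA
  rw [IntegrableOn, inter_comm, ← Measure.restrict_restrict hm, ← IntegrableOn,
    ← integrable_indicator_iff hm, ← IntegrableOn] at h ⊢
  rw [← intervalIntegrable_iff_integrableOn_Ico_of_le (by linarith)] at h ⊢
  exact (arc_indicator_periodic (density_periodic (i := i) f) A).intervalIntegrable hT.ne' h 0 _

lemma Ico_inter_preimage_arc (hab : b - a < D.period i) :
    Ico a (a + D.period i) ∩ D.curve i ⁻¹' (D.curve i '' Icc a b) = Icc a b := by
  ext s
  refine ⟨fun hs => (curve_mem_arc_iff hab hs.1).1 hs.2, fun hs => ?_⟩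
  have hs' : s ∈ Ico a (a + D.period i) := ⟨hs.1, by linarith [hs.2]⟩
  exact ⟨hs', (curve_mem_arc_iff hab hs').2 hs⟩

lemma preimage_arc_of_ne {j : Fin D.numCurves} (hj : j ≠ i) :
    D.curve j ⁻¹' (D.curve i '' Icc a b) = ∅ := eq_empty_of_forall_notMem (curve_notMem_arc hj)

lemma lineIntegral_arc (hab : b - a < D.period i) (f : Plane → E) :
    D.lineIntegral (D.curve i '' Icc a b) f =
      ∫ s in Icc a b, ‖deriv (D.curve i) s‖ • f (D.curve i s) := by
  unfold lineIntegral
  rw [Finset.sum_eq_single i, setIntegral_density f arc_isCompact.measurableSet a,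
    Ico_inter_preimage_arc hab]
  · intro j _ hj
    rw [preimage_arc_of_ne hj, inter_empty, setIntegral_empty]
  · simp

lemma lineIntegrable_arc (hab : b - a < D.period i) {f : Plane → E}
    (hf : IntegrableOn (fun s => ‖deriv (D.curve i) s‖ • f (D.curve i s)) (Icc a b)) :
    D.LineIntegrable (D.curve i '' Icc a b) f := by
  intro j
  by_cases hj : j = i
  · subst hj
    refine integrableOn_density (a := a) arc_isCompact.measurableSet ?_
    rwa [Ico_inter_preimage_arc hab]
  · rw [preimage_arc_of_ne hj, inter_empty]
    exact integrableOn_empty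

/-- The finite part splits into the integral over the complement of an arc and the finite part over
the arc. -/
lemma HasCutoffFinitePart.of_arc (ht : t ∈ Ioo a b) (hab : b - a < D.period i) {f : Plane → ℂ}
    (hf : D.ContinuousOff (D.curve i t) f) {A L : ℂ} (hL : HasArcFinitePart (D.curve i) a t b
      (fun s => ‖deriv (D.curve i) s‖ • f (D.curve i s)) A L) :
    D.HasCutoffFinitePart (D.curve i t) f A (D.lineIntegral (D.curve i '' Icc a b)ᶜ f + L) := by
  obtain ⟨d, hd, hdist⟩ := exists_dist_ge_of_notMem_arc hab ht
  intro W hW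
  refine ((hL W hW).const_add (D.lineIntegral (D.curve i '' Icc a b)ᶜ f)).congr' ?_
  have hlt : ∀ᶠ ε : ℝ in 𝓝[>] 0, ε < d := nhdsWithin_le_nhds (Iio_mem_nhds hd)
  filter_upwards [hlt, self_mem_nhdsWithin] with ε hε hε0
  have hmeas : MeasurableSet (D.curve i '' Icc a b) := arc_isCompact.measurableSet
  rw [← add_sub_assoc]
  congr 1
  rw [← compl_union_self (D.curve i '' Icc a b),
    LineIntegrable.lineIntegral_union (hf.lineIntegrable_cutoff hW hε0 _)
      (hf.lineIntegrable_cutoff hW hε0 _) hmeas disjoint_compl_left, lineIntegral_arc hab]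
  congr 1
  · refine lineIntegral_congr hmeas.compl fun y hy hyf => ?_
    rw [hW.eq_one _ ((one_lt_div hε0).2 (hε.trans_le (hdist y hyf hy)))]; simp
  · refine setIntegral_congr_fun measurableSet_Icc fun s _ => ?_
    simp [real_smul, dist_eq_norm]; ring

lemma ContinuousOff.lineIntegrable_compl_arc (ht : t ∈ Ioo a b) (hab : b - a < D.period i)
    {f : Plane → E} (hf : D.ContinuousOff (D.curve i t) f) :
    D.LineIntegrable (D.curve i '' Icc a b)ᶜ f := by
  obtain ⟨d, hd, hdist⟩ := exists_dist_ge_of_notMem_arc hab ht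
  exact hf.lineIntegrable hd fun y hy hyf => hdist y hyf hy

end Arc

lemma lineIntegral_sharpCutoff (x : Plane) (f : Plane → ℂ) {ε : ℝ} (hε : 0 < ε) :
    D.lineIntegral {y | ε < dist y x} f =
      D.lineIntegral univ (fun y => (sharpCutoff (dist y x / ε) : ℂ) * f y) := by
  refine sum_congr rfl fun i _ => ?_
  have hm : MeasurableSet (D.curve i ⁻¹' {y | ε < dist y x}) := (D.curve_continuous i).measurable
      (isOpen_lt continuous_const (continuous_id.dist continuous_const)).measurableSet
  rw [preimage_univ, inter_univ, ← setIntegral_indicator hm]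
  refine setIntegral_congr_fun measurableSet_Ico fun s _ => ?_
  unfold indicator sharpCutoff
  by_cases h : ε < dist (D.curve i s) x
  · simp [h, one_lt_div hε]
  · simp [h, one_lt_div hε]

lemma HasCutoffFinitePart.tendsto_sharp {σ : ℕ} {x : Plane} {f : Plane → Fin σ → ℂ}
    {A v : Fin σ → ℂ} (hc : ∀ k, D.ContinuousOff x (fun y => f y k))
    (h : ∀ k, D.HasCutoffFinitePart x (fun y => f y k) (A k) (v k)) (k : Fin σ) :
    Tendsto (fun ε : ℝ => D.lineIntegral {y | ε < dist y x} f k -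
      (ε : ℂ)⁻¹ * (cutoffMoment sharpCutoff * A k)) (𝓝[>] 0) (𝓝 (v k)) := by
  refine ((h k) _ sharpCutoff_isCutoff).congr' ?_
  filter_upwards [self_mem_nhdsWithin] with ε hε
  rw [LineIntegrable.lineIntegral_apply (A := {y : Plane | ε < dist y x})
    (fun k => (hc k).lineIntegrable hε fun y hy _ => (le_of_lt hy)),
    lineIntegral_sharpCutoff x _ hε]

lemma HasCutoffFinitePart.hasPrincipalValue {σ : ℕ} {x : Plane} {f : Plane → Fin σ → ℂ}
    {v : Fin σ → ℂ} (hc : ∀ k, D.ContinuousOff x (fun y => f y k))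
    (h : ∀ k, D.HasCutoffFinitePart x (fun y => f y k) 0 (v k)) : D.HasPrincipalValue x f v :=
  tendsto_pi_nhds.2 fun k => by simpa using tendsto_sharp (A := 0) hc h k

lemma HasCutoffFinitePart.hasFinitePart {σ : ℕ} {x : Plane} {f : Plane → Fin σ → ℂ}
    {A v : Fin σ → ℂ} (hc : ∀ k, D.ContinuousOff x (fun y => f y k))
    (h : ∀ k, D.HasCutoffFinitePart x (fun y => f y k) (A k) (v k)) : D.HasFinitePart x f v :=
  ⟨fun k => cutoffMoment sharpCutoff * A k, tendsto_pi_nhds.2 fun k => by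
    simpa using tendsto_sharp hc h k⟩

namespace HasCutoffFinitePart

variable {x : Plane} {f g : Plane → ℂ} {A A' v v' : ℂ}

lemma congr (hf : D.HasCutoffFinitePart x f A v) (h : ∀ y ∈ frontier D.Ω, y ≠ x → f y = g y) :
    D.HasCutoffFinitePart x g A v := by
  intro W hW
  refine (hf W hW).congr fun ε => ?_
  congr 1
  refine lineIntegral_congr MeasurableSet.univ fun y _ hy => ?_
  by_cases hyx : y = x
  · rw [hyx, dist_self, zero_div, hW.eq_zero 0 le_rfl (by norm_num)]; simp
  · rw [h y hy hyx]

lemma add (hcf : D.ContinuousOff x f) (hcg : D.ContinuousOff x g)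
    (hf : D.HasCutoffFinitePart x f A v) (hg : D.HasCutoffFinitePart x g A' v') :
    D.HasCutoffFinitePart x (fun y => f y + g y) (A + A') (v + v') := by
  intro W hW
  refine ((hf W hW).add (hg W hW)).congr' ?_
  filter_upwards [self_mem_nhdsWithin] with ε hε
  simp [mul_add]
  rw [LineIntegrable.lineIntegral_add (hcf.lineIntegrable_cutoff hW hε _)
    (hcg.lineIntegrable_cutoff hW hε _)]
  ring

lemma const_mul (c : ℂ) (hf : D.HasCutoffFinitePart x f A v) :
    D.HasCutoffFinitePart x (fun y => c * f y) (c * A) (c * v) := by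
  intro W hW
  refine ((hf W hW).const_mul c).congr fun ε => ?_
  simp [mul_left_comm _ c]
  rw [lineIntegral_const_mul]
  ring

lemma sub (hcf : D.ContinuousOff x f) (hcg : D.ContinuousOff x g)
    (hf : D.HasCutoffFinitePart x f A v) (hg : D.HasCutoffFinitePart x g A' v') :
    D.HasCutoffFinitePart x (fun y => f y - g y) (A - A') (v - v') := by
  simpa [sub_eq_add_neg] using hf.add hcf (fun j => continuousOn_const.mul (hcg j))
    (hg.const_mul (-1))

/-- The value of the finite part is independent of the way the divergent part is written. -/
lemma value_eq (hf : D.HasCutoffFinitePart x f A v) {W : ℝ → ℝ} (hW : IsCutoff W) {v' : ℂ}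
    (h : Tendsto (fun ε : ℝ => D.lineIntegral univ (fun y => (W (dist y x / ε) : ℂ) * f y))
      (𝓝[>] 0) (𝓝 v')) : v = v' := by
  have h1 := (h.sub (hf W hW))
  simp [sub_sub_cancel] at h1
  have h2 := tendsto_ofReal_zero.mul h1
  have h3 : Tendsto (fun _ : ℝ => (cutoffMoment W * A : ℂ)) (𝓝[>] 0) (𝓝 (0 * (v' - v))) := by
    refine h2.congr' ?_
    filter_upwards [self_mem_nhdsWithin] with ε hε
    have := ofReal_ne_zero.2 (ne_of_gt hε)
    field_simp
  have h4 := tendsto_nhds_unique h3 tendsto_const_nhds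
  have h5 := hf W hW
  rw [← h4] at h5
  simp [zero_mul, mul_zero, sub_zero] at h5
  exact tendsto_nhds_unique h5 h

end HasCutoffFinitePart

end SmoothDomain

/-! ### Partial derivatives -/

lemma two_le_infty : (2 : WithTop ℕ∞) ≤ ∞ := by norm_cast

section PartialDerivatives

variable {f g : Plane → ℂ} {x : Plane} (j : Fin 2)

lemma pd_add (hf : DifferentiableAt ℝ f x) (hg : DifferentiableAt ℝ g x) :
    pd j (fun y => f y + g y) x = pd j f x + pd j g x := by
  simp only [pd, fderiv_fun_add hf hg]; rfl

lemma pd_sub (hf : DifferentiableAt ℝ f x) (hg : DifferentiableAt ℝ g x) :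
    pd j (fun y => f y - g y) x = pd j f x - pd j g x := by
  simp only [pd, fderiv_fun_sub hf hg]; rfl

lemma pd_mul (hf : DifferentiableAt ℝ f x) (hg : DifferentiableAt ℝ g x) :
    pd j (fun y => f y * g y) x = f x * pd j g x + pd j f x * g x := by
  simp [pd, fderiv_fun_mul hf hg]
  simp [mul_comm]

lemma pd_const_mul (c : ℂ) (hf : DifferentiableAt ℝ f x) :
    pd j (fun y => c * f y) x = c * pd j f x := by
  simp only [pd, fderiv_const_mul hf]
  simp

lemma pd_sum {ι : Type*} {s : Finset ι} {F : ι → Plane → ℂ}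
    (hF : ∀ i ∈ s, DifferentiableAt ℝ (F i) x) :
    pd j (fun y => ∑ i ∈ s, F i y) x = ∑ i ∈ s, pd j (F i) x := by
  simp only [pd, fderiv_fun_sum hF]
  simp

lemma pd_congr (h : f =ᶠ[𝓝 x] g) : pd j f x = pd j g x := by simp [pd, h.fderiv_eq]

lemma pd_congr_of_isOpen {S : Set Plane} (hS : IsOpen S) (h : ∀ y ∈ S, f y = g y) (hx : x ∈ S) :
    pd j f x = pd j g x := pd_congr j (eventually_of_mem (hS.mem_nhds hx) h)

lemma pd_comp_sub_const (f : Plane → ℂ) (z : Plane) :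
    pd j (fun y => f (y - z)) = fun y => pd j f (y - z) := by
  ext y
  simp [pd, fderiv_comp_sub]

lemma pd_comp_neg (f : Plane → ℂ) (x : Plane) : pd j (fun y => f (-y)) x = -pd j f (-x) := by
  have h := fderiv_comp_smul (𝕜 := ℝ) (f := f) (c := (-1 : ℝ)) (x := x)
  simp at h
  simp [pd, h]

lemma pd_comp_smul (f : Plane → ℂ) (t : ℝ) (x : Plane) :
    pd j (fun y => f (t • y)) x = t * pd j f (t • x) := by
  simp only [pd, fderiv_comp_smul]
  simp

lemma pd_coord (a m : Fin 2) (x : Plane) : pd m (fun y => (y a : ℂ)) x = if a = m then 1 else 0 := by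
  have h := (ofRealCLM.comp (proj a : Plane →L[ℝ] ℝ)).fderiv (x := x)
  rw [pd, show (fun y : Plane => (y a : ℂ)) = ofRealCLM.comp (proj a : Plane →L[ℝ] ℝ) from rfl]
  split_ifs <;> simp [*]

lemma contDiff_coord (a : Fin 2) : ContDiff ℝ ∞ fun y : Plane => (y a : ℂ) :=
  (ofRealCLM.comp (proj a : Plane →L[ℝ] ℝ)).contDiff

lemma ContDiffOn.pd {S : Set Plane} (hS : IsOpen S) (hf : ContDiffOn ℝ ∞ f S) :
    ContDiffOn ℝ ∞ (pd j f) S := (hf.fderiv_of_isOpen hS (by simp)).clm_apply contDiffOn_const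

lemma pd_comm (hf : ContDiffAt ℝ 2 f x) (i j : Fin 2) : pd i (pd j f) x = pd j (pd i f) x := by
  have hd := (hf.fderiv_right (m := 1) (by norm_num)).differentiableAt (by norm_num)
  have e : ∀ i j : Fin 2, pd i (pd j f) x = fderiv ℝ (fderiv ℝ f) x (single i 1) (single j 1) := by
    intro i j
    have : pd j f = fun y => (fderiv ℝ f y) (single j 1) := rfl
    rw [this]; simp [pd]; rw [fderiv_clm_apply hd (differentiableAt_const _)]
    simp
  rw [e, e]
  exact hf.isSymmSndFDerivAt (by simp) _ _

lemma ContDiffOn.differentiableAt_of_isOpen {S : Set Plane} (hf : ContDiffOn ℝ ∞ f S)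
    (hS : IsOpen S) (hx : x ∈ S) : DifferentiableAt ℝ f x :=
  (hf.contDiffAt (hS.mem_nhds hx)).differentiableAt (by simp)

/-- First derivatives of a homogeneous function (Euler). -/
lemma pd_homogeneous {k : ℕ} (hf : ∀ (t : ℝ) (r : Plane), t ≠ 0 → r ≠ 0 →
    f (t • r) = ((t : ℂ) ^ k)⁻¹ * f r) (hd : DifferentiableOn ℝ f {0}ᶜ) (t : ℝ) (r : Plane) (ht : t ≠ 0)
    (hr : r ≠ 0) : pd j f (t • r) = ((t : ℂ) ^ (k + 1))⁻¹ * pd j f r := by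
  have ht' := ofReal_ne_zero.2 ht
  have h1 := pd_comp_smul j f t r
  have h2 := pd_congr_of_isOpen j isOpen_punctured (fun y hy => hf t y ht hy) hr
  rw [pd_const_mul j _ ((hd r hr).differentiableAt (isOpen_punctured.mem_nhds hr))] at h2
  rw [h2] at h1
  field_simp
  field_simp at h1
  rw [h1]; ring

/-- Euler's identity for a function of degree `-k`. -/
lemma euler_homogeneous {k : ℕ} (hf : ∀ (t : ℝ) (r : Plane), t ≠ 0 → r ≠ 0 →
    f (t • r) = ((t : ℂ) ^ k)⁻¹ * f r) (hx : x ≠ 0) (hd : DifferentiableAt ℝ f x) :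
    (x 0 : ℂ) * pd 0 f x + x 1 * pd 1 f x = -k * f x := by
  rw [← fderiv_eq_pd]
  have hd' : DifferentiableAt ℝ f ((1 : ℝ) • x) := by rwa [one_smul]
  have h1 := hd'.hasFDerivAt.comp_hasDerivAt 1 ((hasDerivAt_id (1 : ℝ)).smul_const x)
  rw [one_smul] at h1
  have h2 : HasDerivAt (fun t : ℝ => ((t : ℂ) ^ k)⁻¹ * f x) (-k * f x) 1 := by
    have h3 : HasDerivAt (fun t : ℝ => ((t : ℂ) ^ k)) (k : ℂ) 1 := by
      have h4 := (hasDerivAt_pow k ((1 : ℝ) : ℂ)).comp_ofReal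
      simpa using h4
    have := (h3.inv (by simp)).mul_const (f x)
    simpa using this
  refine h1.unique (h2.congr_of_eventuallyEq ?_)
  filter_upwards [isOpen_ne.mem_nhds (one_ne_zero : (1 : ℝ) ≠ 0)] with t ht
  exact hf t x ht hx

end PartialDerivatives

/-! ### Second-order systems and the reciprocity flux -/

variable {σ : ℕ}

/-- Coefficients `C_{kjlm}` of a second-order system. -/
abbrev Stiffness (σ : ℕ) := Fin σ → Fin 2 → Fin σ → Fin 2 → ℂ

/-- The stress `∑ C_{kjlm} ∂_m v_l` of a field `v`. -/
def stress (C : Stiffness σ) (v : Fin σ → Plane → ℂ) (k : Fin σ) (j : Fin 2) (y : Plane) : ℂ :=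
  ∑ l, ∑ m, C k j l m * pd m (v l) y

/-- The field `v` is smooth on `S` and solves `-∑_j ∂_j (stress v)_{kj} = κ v_k` there. -/
structure IsSolutionOn (C : Stiffness σ) (kap : ℂ)
    (v : Fin σ → Plane → ℂ) (S : Set Plane) : Prop where
  smooth : ∀ l, ContDiffOn ℝ ∞ (v l) S
  eq : ∀ r ∈ S, ∀ k, ∑ j, pd j (stress C v k j) r = -kap * v k r

/-- The flux `∑_k ((stress v)_{kj} u_k - (stress u)_{kj} v_k)` of Betti's reciprocity formula. -/
def flux (C : Stiffness σ) (v u : Fin σ → Plane → ℂ) (j : Fin 2) (y : Plane) : ℂ :=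
  ∑ k, (stress C v k j y * u k y - stress C u k j y * v k y)

section Systems

variable {C : Stiffness σ} {kap : ℂ} {v u : Fin σ → Plane → ℂ} {S : Set Plane}

lemma contDiffOn_stress (hS : IsOpen S) (hv : ∀ l, ContDiffOn ℝ ∞ (v l) S) (k : Fin σ)
    (j : Fin 2) : ContDiffOn ℝ ∞ (stress C v k j) S := by
  exact ContDiffOn.sum fun l _ => ContDiffOn.sum fun m _ =>
    contDiffOn_const.mul ((hv l).pd m hS)

lemma contDiffOn_flux (hS : IsOpen S) (hv : ∀ l, ContDiffOn ℝ ∞ (v l) S)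
    (hu : ∀ l, ContDiffOn ℝ ∞ (u l) S) (j : Fin 2) : ContDiffOn ℝ ∞ (flux C v u j) S := by
  exact ContDiffOn.sum fun k _ => ((contDiffOn_stress hS hv k j).mul (hu k)).sub
    ((contDiffOn_stress hS hu k j).mul (hv k))

lemma stress_congr (hS : IsOpen S) (h : ∀ l, ∀ y ∈ S, v l y = u l y) {y : Plane} (hy : y ∈ S)
    (k : Fin σ) (j : Fin 2) : stress C v k j y = stress C u k j y := by
  refine sum_congr rfl fun l _ => sum_congr rfl fun m _ => ?_
  rw [pd_congr_of_isOpen m hS (h l) hy]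

lemma stress_add {y : Plane} (hv : ∀ l, DifferentiableAt ℝ (v l) y)
    (hu : ∀ l, DifferentiableAt ℝ (u l) y) (k : Fin σ) (j : Fin 2) :
    stress C (fun l y => v l y + u l y) k j y = stress C v k j y + stress C u k j y := by
  unfold stress
  simp only [← sum_add_distrib]
  refine sum_congr rfl fun l _ => sum_congr rfl fun m _ => ?_
  rw [pd_add m (hv l) (hu l), mul_add]

lemma stress_const (c : Fin σ → ℂ) (k : Fin σ) (j : Fin 2) : stress C (fun l _ => c l) k j = 0 := by
  ext; simp [stress, pd]

lemma stress_const_mul (c : ℂ) {y : Plane} (hv : ∀ l, DifferentiableAt ℝ (v l) y) (k : Fin σ)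
    (j : Fin 2) : stress C (fun l y => c * v l y) k j y = c * stress C v k j y := by
  unfold stress
  rw [mul_sum]
  refine sum_congr rfl fun l _ => ?_
  rw [mul_sum]
  refine sum_congr rfl fun m _ => ?_
  rw [pd_const_mul m c (hv l)]; ring

lemma stress_sum {ι : Type*} {s : Finset ι} {w : ι → Fin σ → Plane → ℂ} {y : Plane}
    (hw : ∀ i ∈ s, ∀ l, DifferentiableAt ℝ (w i l) y) (k : Fin σ) (j : Fin 2) :
    stress C (fun l y => ∑ i ∈ s, w i l y) k j y = ∑ i ∈ s, stress C (w i) k j y := by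
  simp only [stress]
  rw [sum_comm (s := s)]
  refine sum_congr rfl fun l _ => ?_
  rw [sum_comm (s := s)]
  refine sum_congr rfl fun m _ => ?_
  rw [pd_sum m fun i hi => hw i hi l, mul_sum]

lemma stress_comp_sub_const (v : Fin σ → Plane → ℂ) (z : Plane) (k : Fin σ) (j : Fin 2) :
    stress C (fun l y => v l (y - z)) k j = fun y => stress C v k j (y - z) := by
  unfold stress
  simp [pd_comp_sub_const]

lemma pd_stress (hS : IsOpen S) (hv : ∀ l, ContDiffOn ℝ ∞ (v l) S) (k : Fin σ) (j i : Fin 2)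
    {y : Plane} (hy : y ∈ S) :
    pd i (stress C v k j) y = ∑ l, ∑ m, C k j l m * pd i (pd m (v l)) y := by
  have hd := fun l m =>
    ((hv l).pd m hS).differentiableAt_of_isOpen hS hy
  unfold stress
  rw [pd_sum i fun l _ => DifferentiableAt.fun_sum fun m _ => (hd l m).const_mul _]
  refine sum_congr rfl fun l _ => ?_
  rw [pd_sum i fun m _ => (hd l m).const_mul _]
  exact sum_congr rfl fun m _ => pd_const_mul i _ (hd l m)

lemma stress_pd (hS : IsOpen S) (hv : ∀ l, ContDiffOn ℝ ∞ (v l) S) (p : Fin 2) {y : Plane}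
    (hy : y ∈ S) (k : Fin σ) (j : Fin 2) :
    stress C (fun l => pd p (v l)) k j y = pd p (stress C v k j) y := by
  rw [pd_stress hS hv k j p hy]
  refine sum_congr rfl fun l _ => sum_congr rfl fun m _ => ?_
  rw [pd_comm (((hv l).contDiffAt (hS.mem_nhds hy)).of_le two_le_infty)]

namespace IsSolutionOn

lemma const (c : Fin σ → ℂ) : IsSolutionOn C 0 (fun l _ => c l) S :=
  ⟨fun l => contDiffOn_const, fun r _ k => by simp [stress_const, _root_.pd]⟩

lemma mono {S' : Set Plane} (h : IsSolutionOn C kap v S) (hs : S' ⊆ S) : IsSolutionOn C kap v S' :=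
  ⟨fun l => (h.smooth l).mono hs, fun r hr => h.eq r (hs hr)⟩

lemma congr (hS : IsOpen S) (h : IsSolutionOn C kap v S) (e : ∀ l, ∀ y ∈ S, u l y = v l y) :
    IsSolutionOn C kap u S := by
  refine ⟨fun l => (h.smooth l).congr (e l), fun r hr k => ?_⟩
  rw [e k r hr, ← h.eq r hr k]
  refine sum_congr rfl fun j _ => ?_
  exact pd_congr_of_isOpen j hS (fun y hy => stress_congr hS e hy k j) hr

lemma const_mul (hS : IsOpen S) (c : ℂ) (h : IsSolutionOn C kap v S) :
    IsSolutionOn C kap (fun l y => c * v l y) S := by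
  refine ⟨fun l => contDiffOn_const.mul (h.smooth l), fun r hr k => ?_⟩
  rw [mul_left_comm, ← h.eq r hr k, mul_sum]
  refine sum_congr rfl fun j _ => ?_
  rw [← pd_const_mul j c ((contDiffOn_stress hS h.smooth k j).differentiableAt_of_isOpen hS hr)]
  exact pd_congr_of_isOpen j hS (fun y hy => stress_const_mul c
    (fun l => (h.smooth l).differentiableAt_of_isOpen hS hy) k j) hr

lemma sum (hS : IsOpen S) {ι : Type*} {s : Finset ι} {w : ι → Fin σ → Plane → ℂ}
    (h : ∀ i ∈ s, IsSolutionOn C kap (w i) S) :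
    IsSolutionOn C kap (fun l y => ∑ i ∈ s, w i l y) S := by
  refine ⟨fun l => ContDiffOn.sum fun i hi => (h i hi).smooth l, fun r hr k => ?_⟩
  rw [mul_sum, ← sum_congr rfl fun i hi => (h i hi).eq r hr k, sum_comm]
  refine sum_congr rfl fun j _ => ?_
  rw [← pd_sum j fun i hi =>
    (contDiffOn_stress hS (h i hi).smooth k j).differentiableAt_of_isOpen hS hr]
  exact pd_congr_of_isOpen j hS (fun y hy => stress_sum
    (fun i hi l => ((h i hi).smooth l).differentiableAt_of_isOpen hS hy) k j) hr

lemma comp_sub_const (h : IsSolutionOn C kap v S) (z : Plane) :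
    IsSolutionOn C kap (fun l y => v l (y - z)) ((fun y => y - z) ⁻¹' S) := by
  refine ⟨fun l => (h.smooth l).comp (by fun_prop) (mapsTo_preimage _ _), fun r hr k => ?_⟩
  rw [← h.eq _ hr k]
  refine sum_congr rfl fun j _ => ?_
  rw [stress_comp_sub_const, pd_comp_sub_const]

lemma pd (hS : IsOpen S) (h : IsSolutionOn C kap v S) (p : Fin 2) :
    IsSolutionOn C kap (fun l => pd p (v l)) S := by
  refine ⟨fun l => (h.smooth l).pd p hS, fun r hr k => ?_⟩
  have hs := fun j => contDiffOn_stress (C := C) hS h.smooth k j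
  have e1 : ∀ j, _root_.pd j (stress C (fun l => _root_.pd p (v l)) k j) r =
      _root_.pd p (_root_.pd j (stress C v k j)) r := fun j => by
    rw [pd_congr_of_isOpen j hS (fun y hy => stress_pd hS h.smooth p hy k j) hr,
      pd_comm (((hs j).contDiffAt (hS.mem_nhds hr)).of_le two_le_infty)]
  simp only [e1]
  rw [← pd_sum p fun j _ => ((hs j).pd j hS).differentiableAt_of_isOpen hS hr,
    pd_congr_of_isOpen p hS (fun y hy => h.eq y hy k) hr,
    pd_const_mul p _ ((h.smooth k).differentiableAt_of_isOpen hS hr)]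

/-- The reciprocity flux of two solutions is divergence free. -/
lemma div_flux_eq_zero (hS : IsOpen S) (hC : ∀ k j l m, C k j l m = C l m k j)
    (hv : IsSolutionOn C kap v S) (hu : IsSolutionOn C kap u S) {y : Plane} (hy : y ∈ S) :
    ∑ j, _root_.pd j (flux C v u j) y = 0 := by
  have dv := fun l =>
    (hv.smooth l).differentiableAt_of_isOpen hS hy
  have du := fun l =>
    (hu.smooth l).differentiableAt_of_isOpen hS hy
  have sv : ∀ k j, DifferentiableAt ℝ (stress C v k j) y := fun k j =>
    (contDiffOn_stress hS hv.smooth k j).differentiableAt_of_isOpen hS hy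
  have su : ∀ k j, DifferentiableAt ℝ (stress C u k j) y := fun k j =>
    (contDiffOn_stress hS hu.smooth k j).differentiableAt_of_isOpen hS hy
  have e1 : ∀ j, _root_.pd j (flux C v u j) y = ∑ k, ((stress C v k j y * _root_.pd j (u k) y +
      _root_.pd j (stress C v k j) y * u k y) - (stress C u k j y * _root_.pd j (v k) y +
      _root_.pd j (stress C u k j) y * v k y)) := by
    intro j; unfold flux
    rw [pd_sum j fun k _ => ((sv k j).fun_mul (du k)).fun_sub ((su k j).fun_mul (dv k))]
    refine sum_congr rfl fun k _ => ?_
    rw [pd_sub j ((sv k j).fun_mul (du k)) ((su k j).fun_mul (dv k)), pd_mul j (sv k j) (du k),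
      pd_mul j (su k j) (dv k)]
  simp only [e1]
  have e2 : ∑ j, ∑ k, stress C v k j y * _root_.pd j (u k) y =
      ∑ j, ∑ k, stress C u k j y * _root_.pd j (v k) y := by
    simp only [stress, sum_mul]; rw [sum_comm]
    have : ∀ (k : Fin σ) (j : Fin 2), ∑ l, ∑ m, C k j l m * _root_.pd m (v l) y * _root_.pd j (u k) y
        = ∑ l, ∑ m, C l m k j * _root_.pd j (u k) y * _root_.pd m (v l) y := fun k j =>
      sum_congr rfl fun l _ => sum_congr rfl fun m _ => by rw [hC k j l m]; ring
    simp only [this]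
    -- exchange the index pairs `(k, j)` and `(l, m)`
    calc _ = ∑ k : Fin σ, ∑ l : Fin σ, ∑ j : Fin 2, ∑ m : Fin 2,
          C l m k j * _root_.pd j (u k) y * _root_.pd m (v l) y := sum_congr rfl fun k _ => sum_comm
      _ = ∑ l : Fin σ, ∑ k : Fin σ, ∑ m : Fin 2, ∑ j : Fin 2,
          C l m k j * _root_.pd j (u k) y * _root_.pd m (v l) y := by
          rw [sum_comm]; exact sum_congr rfl fun l _ => sum_congr rfl fun k _ => sum_comm
      _ = ∑ l : Fin σ, ∑ m : Fin 2, ∑ k : Fin σ, ∑ j : Fin 2,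
          C l m k j * _root_.pd j (u k) y * _root_.pd m (v l) y := sum_congr rfl fun l _ => sum_comm
      _ = _ := sum_comm
  have e3 : ∑ j, ∑ k, _root_.pd j (stress C v k j) y * u k y =
      ∑ j, ∑ k, _root_.pd j (stress C u k j) y * v k y := by
    rw [sum_comm, sum_comm (s := (Finset.univ : Finset (Fin 2)))]
    refine sum_congr rfl fun k _ => ?_
    rw [← sum_mul, ← sum_mul, hv.eq y hy, hu.eq y hy]; ring
  simp only [sum_sub_distrib, sum_add_distrib]
  rw [e2, e3, sub_self]

end IsSolutionOn

end Systems

/-! ### Growth of functions near the origin -/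

/-- Logarithmic growth at the origin. -/
def IsLogBounded (e : Plane → ℂ) : Prop := ∃ B, ∀ r, r ≠ 0 → ‖r‖ ≤ 1 → ‖e r‖ ≤ B * (1 + |log ‖r‖|)

namespace IsLogBounded

variable {e e' : Plane → ℂ}

lemma add (h : IsLogBounded e) (h' : IsLogBounded e') : IsLogBounded (fun r => e r + e' r) := by
  obtain ⟨B, hB⟩ := h
  obtain ⟨B', hB'⟩ := h'
  refine ⟨B + B', fun r h0 h1 => (norm_add_le _ _).trans ?_⟩
  have := hB r h0 h1
  have := hB' r h0 h1
  linarith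

lemma const_mul (c : ℂ) (h : IsLogBounded e) : IsLogBounded (fun r => c * e r) := by
  obtain ⟨B, hB⟩ := h
  refine ⟨‖c‖ * B, fun r h0 h1 => ?_⟩
  rw [norm_mul, mul_assoc]
  exact mul_le_mul_of_nonneg_left (hB r h0 h1) (norm_nonneg _)

lemma sum {ι : Type*} {s : Finset ι} {e : ι → Plane → ℂ} (h : ∀ i ∈ s, IsLogBounded (e i)) :
    IsLogBounded (fun r => ∑ i ∈ s, e i r) := by
  choose! B hB using h
  refine ⟨∑ i ∈ s, B i, fun r h0 h1 => ?_⟩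
  rw [sum_mul]
  exact (norm_sum_le _ _).trans (Finset.sum_le_sum fun i hi => hB i hi r h0 h1)

lemma congr (h : IsLogBounded e) (he : ∀ r, r ≠ 0 → e' r = e r) : IsLogBounded e' := by
  obtain ⟨B, hB⟩ := h
  exact ⟨B, fun r h0 h1 => by rw [he r h0]; exact hB r h0 h1⟩

lemma exists_le_div (h : IsLogBounded e) : ∃ C, 0 ≤ C ∧ ∀ r, r ≠ 0 → ‖r‖ ≤ 1 → ‖e r‖ ≤ C / ‖r‖ := by
  obtain ⟨B, hB⟩ := h
  refine ⟨2 * |B|, by positivity, fun r h0 h1 => ?_⟩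
  have hr := norm_pos_iff.2 h0
  rw [le_div_iff₀ hr]
  have h2 := (Real.abs_log_mul_self_lt ‖r‖ hr h1).le
  rw [abs_mul, abs_norm] at h2
  calc _ ≤ B * (1 + |log ‖r‖|) * ‖r‖ := by
        gcongr
        exact hB r h0 h1
    _ = B * (‖r‖ + |log ‖r‖| * ‖r‖) := by ring
    _ ≤ |B| * (1 + 1) := by
        refine mul_le_mul (le_abs_self B) (by linarith) (by positivity) (abs_nonneg _)
    _ = _ := by ring

lemma tendsto_smul (h : IsLogBounded e) {ζ : Plane} (hζ : ζ ≠ 0) :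
    Tendsto (fun ε : ℝ => (ε : ℂ) * e (ε • ζ)) (𝓝[>] 0) (𝓝 0) := by
  obtain ⟨B, hB⟩ := h
  have hz := norm_pos_iff.2 hζ
  have hlim : Tendsto (fun ε : ℝ => B * (ε * (1 + |log ‖ζ‖|) + |log ε * ε|)) (𝓝[>] 0) (𝓝 0) := by
    have h1 : Tendsto (fun ε : ℝ => ε * (1 + |log ‖ζ‖|)) (𝓝[>] 0) (𝓝 0) := by
      have : Tendsto (fun ε : ℝ => ε * (1 + |log ‖ζ‖|)) (𝓝 0) (𝓝 (0 * (1 + |log ‖ζ‖|))) :=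
        (continuous_id.mul continuous_const).tendsto 0
      rw [zero_mul] at this; exact this.mono_left nhdsWithin_le_nhds
    have h2 : Tendsto (fun ε : ℝ => |log ε * ε|) (𝓝[>] 0) (𝓝 |0|) := by
      have := (tendsto_log_mul_rpow_nhdsGT_zero one_pos).abs
      simpa only [Real.rpow_one] using this
    have := (h1.add h2).const_mul B
    simpa using this
  have hB0 : 0 ≤ B := by
    have h0 := smul_ne_zero (inv_ne_zero hz.ne') hζ
    have h1 : ‖‖ζ‖⁻¹ • ζ‖ = 1 := by rw [norm_smul, norm_inv, norm_norm, inv_mul_cancel₀ hz.ne']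
    have := (norm_nonneg _).trans (hB _ h0 h1.le)
    rw [h1] at this; simpa using this
  refine squeeze_zero_norm' ?_ hlim
  have hlt : ∀ᶠ ε : ℝ in 𝓝[>] 0, ε < ‖ζ‖⁻¹ := nhdsWithin_le_nhds (Iio_mem_nhds (inv_pos.2 hz))
  filter_upwards [hlt, self_mem_nhdsWithin] with ε hε hε0
  have hε0 : 0 < ε := hε0
  have hn : ‖ε • ζ‖ = ε * ‖ζ‖ := by rw [norm_smul, norm_eq_abs, abs_of_pos hε0]
  have := hB (ε • ζ) (smul_ne_zero hε0.ne' hζ) (by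
    rw [hn]
    calc _ ≤ ‖ζ‖⁻¹ * ‖ζ‖ := by gcongr
      _ = 1 := inv_mul_cancel₀ hz.ne')
  rw [norm_mul, norm_real, norm_eq_abs, abs_of_pos hε0]
  rw [hn, log_mul hε0.ne' hz.ne'] at this
  calc _ ≤ ε * (B * (1 + |log ε + log ‖ζ‖|)) := by gcongr
    _ ≤ ε * (B * (1 + (|log ε| + |log ‖ζ‖|))) := by
        gcongr
        exact abs_add_le _ _
    _ = _ := by rw [abs_mul, abs_of_pos hε0]; ring

end IsLogBounded

/-- Homogeneity of degree `-k` on the whole punctured plane, including the parity. -/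
def IsHomogeneous (k : ℕ) (e : Plane → ℂ) : Prop :=
  ∀ (t : ℝ) (r : Plane), t ≠ 0 → r ≠ 0 → e (t • r) = ((t : ℂ) ^ k)⁻¹ * e r

namespace IsHomogeneous

variable {k : ℕ} {e e' : Plane → ℂ}

lemma const_mul (c : ℂ) (h : IsHomogeneous k e) : IsHomogeneous k (fun r => c * e r) :=
  fun t r ht hr => by simp only [h t r ht hr]; ring

lemma sum {ι : Type*} {s : Finset ι} {e : ι → Plane → ℂ} (h : ∀ i ∈ s, IsHomogeneous k (e i)) :
    IsHomogeneous k (fun r => ∑ i ∈ s, e i r) := fun t r ht hr => by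
  simp [mul_sum]
  exact sum_congr rfl fun i hi => h i hi t r ht hr

lemma pd (h : IsHomogeneous k e) (hd : ContDiffOn ℝ ∞ e {0}ᶜ) (j : Fin 2) :
    IsHomogeneous (k + 1) (pd j e) := fun t r ht hr =>
  pd_homogeneous j h (hd.differentiableOn (by simp)) t r ht hr

lemma neg (h : IsHomogeneous k e) {r : Plane} (hr : r ≠ 0) : e (-r) = (-1) ^ k * e r := by
  have := h (-1) r (by norm_num) hr
  rw [neg_one_smul] at this
  rw [this, ← inv_pow]
  norm_num

lemma exists_le_div (h : IsHomogeneous k e) (hc : ContinuousOn e {0}ᶜ) :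
    ∃ C, 0 ≤ C ∧ ∀ r, r ≠ 0 → ‖e r‖ ≤ C / ‖r‖ ^ k := by
  obtain ⟨C, hC⟩ := (isCompact_sphere (0 : Plane) 1).exists_bound_of_continuousOn (hc.mono (by
    rintro y hy rfl; simp at hy))
  refine ⟨|C|, abs_nonneg _, fun r hr => ?_⟩
  have hr' := norm_pos_iff.2 hr
  have h1 := h ‖r‖ (‖r‖⁻¹ • r) hr'.ne' (smul_ne_zero (inv_ne_zero hr'.ne') hr)
  rw [smul_smul, mul_inv_cancel₀ hr'.ne', one_smul] at h1
  have h2 := hC (‖r‖⁻¹ • r) (by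
    rw [mem_sphere_zero_iff_norm, norm_smul, norm_inv, norm_norm, inv_mul_cancel₀ hr'.ne'])
  rw [h1, norm_mul, norm_inv, norm_pow, norm_real, norm_norm, ← div_eq_inv_mul]
  gcongr
  exact h2.trans (le_abs_self C)

end IsHomogeneous

/-! ### Flux integrals over the whole plane -/

lemma contDiff_pd_bumpC_mul {F : Plane → ℂ} (hF : ContDiffOn ℝ ∞ F {0}ᶜ) (j : Fin 2) :
    ContDiff ℝ 1 (fun ζ => pd j bumpC ζ * F ζ) ∧
      HasCompactSupport (fun ζ => pd j bumpC ζ * F ζ) := by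
  constructor
  · rw [contDiff_iff_contDiffAt]
    intro ζ
    by_cases h : ζ = 0
    · have : (fun ζ => pd j bumpC ζ * F ζ) =ᶠ[𝓝 ζ] fun _ => 0 := by
        rw [h]
        filter_upwards [Metric.ball_mem_nhds (0 : Plane) (by norm_num : (0 : ℝ) < 1 / 2)] with z hz
        rw [pd_bumpC_eq_zero (Or.inl (by simpa using hz)), zero_mul]
      exact contDiffAt_const.congr_of_eventuallyEq this
    · have h1 := ContDiffOn.pd j isOpen_univ bumpC_contDiff.contDiffOn
      have h2 : ContDiffAt ℝ ∞ (pd j bumpC) ζ := h1.contDiffAt univ_mem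
      exact (h2.mul (hF.contDiffAt (isOpen_punctured.mem_nhds h))).of_le (by norm_cast)
  · refine HasCompactSupport.intro (isCompact_closedBall (0 : Plane) 1) fun ζ hζ => ?_
    rw [pd_bumpC_eq_zero, zero_mul]
    right
    simpa using hζ

/-- A derivative of a divergence-free field has no flux through the bump. -/
lemma bumpFlux_pd_eq_zero {F : Fin 2 → Plane → ℂ} (hF : ∀ j, ContDiffOn ℝ ∞ (F j) {0}ᶜ)
    (hdiv : ∀ r, r ≠ 0 → ∑ j, pd j (F j) r = 0) (m : Fin 2) :
    bumpFlux (fun j => pd m (F j)) = 0 := by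
  have hint' : ∀ i j k : Fin 2, Integrable (pd i (fun ζ => pd j bumpC ζ * F k ζ)) := by
    intro i j k
    have := contDiff_pd_bumpC_mul (hF k) j
    refine (continuous_pd this.1 i).integrable_of_hasCompactSupport ?_
    refine this.2.mono' fun x hx => ?_
    by_contra h
    exact hx (pd_eq_zero_of_notMem_tsupport h i)
  have e : ∀ᵐ ζ : Plane, ∑ j, pd j bumpC ζ * pd m (F j) ζ =
      ∑ j, (pd m (fun ζ => pd j bumpC ζ * F j ζ) ζ - pd j (fun ζ => pd m bumpC ζ * F j ζ) ζ) := by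
    filter_upwards [Measure.ae_ne volume 0] with ζ hζ
    have hb := fun j =>
      (ContDiffOn.pd j isOpen_univ bumpC_contDiff.contDiffOn).differentiableAt_of_isOpen isOpen_univ
        (mem_univ ζ)
    have hd := fun j =>
      (hF j).differentiableAt_of_isOpen isOpen_punctured hζ
    have hc : ∀ j, pd m (pd j bumpC) ζ = pd j (pd m bumpC) ζ := fun j =>
      pd_comm (bumpC_contDiff (n := 2)).contDiffAt m j
    have := hdiv ζ hζ
    simp only [pd_mul _ (hb _) (hd _), hc]; rw [Fin.sum_univ_two] at this ⊢
    rw [Fin.sum_univ_two]; linear_combination (pd m bumpC ζ) * this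
  have hsub : ∀ j, Integrable (fun ζ => pd m (fun ζ => pd j bumpC ζ * F j ζ) ζ -
      pd j (fun ζ => pd m bumpC ζ * F j ζ) ζ) := fun j => (hint' m j j).sub (hint' j m j)
  unfold bumpFlux
  rw [integral_congr_ae e, integral_finsetSum _ fun j _ => hsub j]
  refine Finset.sum_eq_zero fun j _ => ?_
  rw [integral_sub (hint' m j j) (hint' j m j),
    integral_pd_eq_zero (contDiff_pd_bumpC_mul (hF j) j).1 (contDiff_pd_bumpC_mul (hF j) j).2,
    integral_pd_eq_zero (contDiff_pd_bumpC_mul (hF j) m).1 (contDiff_pd_bumpC_mul (hF j) m).2,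
    sub_self]

lemma bumpFlux_sum {ι : Type*} {s : Finset ι} {F : ι → Fin 2 → Plane → ℂ}
    (hF : ∀ i ∈ s, ∀ j, ContinuousOn (F i j) {0}ᶜ) :
    bumpFlux (fun j ζ => ∑ i ∈ s, F i j ζ) = ∑ i ∈ s, bumpFlux (F i) := by
  unfold bumpFlux
  rw [← integral_finsetSum _ fun i hi => bumpFlux_integrable (hF i hi)]
  congr 1
  ext ζ
  rw [sum_comm]
  simp [mul_sum]

lemma bumpFlux_add {F F' : Fin 2 → Plane → ℂ} (hF : ∀ j, ContinuousOn (F j) {0}ᶜ)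
    (hF' : ∀ j, ContinuousOn (F' j) {0}ᶜ) :
    bumpFlux (fun j ζ => F j ζ + F' j ζ) = bumpFlux F + bumpFlux F' := by
  simp only [bumpFlux, mul_add, sum_add_distrib]
  exact integral_add (bumpFlux_integrable hF) (bumpFlux_integrable hF')

lemma bumpFlux_const_mul (c : ℂ) (F : Fin 2 → Plane → ℂ) :
    bumpFlux (fun j ζ => c * F j ζ) = c * bumpFlux F := by
  unfold bumpFlux
  rw [← integral_const_mul]
  congr 1
  ext ζ
  rw [mul_sum]
  exact sum_congr rfl fun j _ => by ring

lemma bumpFlux_congr {F F' : Fin 2 → Plane → ℂ} (h : ∀ j ζ, ζ ≠ 0 → F j ζ = F' j ζ) :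
    bumpFlux F = bumpFlux F' := by
  apply integral_congr_ae
  filter_upwards [Measure.ae_ne volume 0] with ζ hζ
  exact sum_congr rfl fun j _ => by rw [h j ζ hζ]

/-! ### Fundamental solutions -/

/-- A layer model whose Green's function is a translation-invariant symmetric fundamental solution
of an elliptic second-order system `-∑ C_{kjlm} ∂_j ∂_m u_l = κ u_k`, with conormal derivative
`∑ C_{kjlm} ∂_m u_l n_j`.  Its principal part `g₀` has a gradient of degree `-1`, and the remainder
has logarithmically bounded derivatives up to the second order. -/
structure IsFundamentalModel {σ : ℕ} (M : LayerModel σ)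
    (C : Stiffness σ) (kap : ℂ) (g₀ : Fin σ → Fin σ → Plane → ℂ) : Prop where
  G_eq : ∀ x y, M.G x y = M.G (x - y) 0
  conormal_eq : ∀ u n x k, M.conormal u n x k =
    ∑ j, stress C (fun l y => u y l) k j x * (n j : ℂ)
  C_symm : ∀ k j l m, C k j l m = C l m k j
  even : ∀ r, M.G (-r) 0 = M.G r 0
  symm : ∀ r a b, M.G r 0 a b = M.G r 0 b a
  solution : ∀ p, IsSolutionOn C kap (fun l r => M.G r 0 l p) {0}ᶜ
  smooth₀ : ∀ l p, ContDiffOn ℝ ∞ (g₀ l p) {0}ᶜ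
  homogeneous₀ : ∀ l p m, IsHomogeneous 1 (pd m (g₀ l p))
  logBounded : ∀ l p, IsLogBounded (fun r => M.G r 0 l p)
  logBounded_pd : ∀ l p m, IsLogBounded (pd m (fun r => M.G r 0 l p - g₀ l p r))
  logBounded_pd_pd : ∀ l p m j, IsLogBounded (pd j (pd m (fun r => M.G r 0 l p - g₀ l p r)))
  normalization : ∀ k p, bumpFlux (stress C (fun l => g₀ l p) k) = if k = p then 1 else 0

namespace IsFundamentalModel

variable {σ : ℕ} {M : LayerModel σ} {C : Stiffness σ} {kap : ℂ}
  {g₀ : Fin σ → Fin σ → Plane → ℂ} (hM : IsFundamentalModel M C kap g₀)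
include hM

/-- The principal part solves the homogeneous system, by scaling. -/
lemma solution₀ (p : Fin σ) : IsSolutionOn C 0 (fun l => g₀ l p) {0}ᶜ := by
  refine ⟨fun l => hM.smooth₀ l p, fun r hr k => ?_⟩
  have hop := isOpen_punctured
  set g₁ : Fin σ → Plane → ℂ := fun l r => M.G r 0 l p - g₀ l p r with hg₁
  have s1 : ∀ l, ContDiffOn ℝ ∞ (g₁ l) {0}ᶜ := fun l =>
    ((hM.solution p).smooth l).sub (hM.smooth₀ l p)
  have hs : ∀ j, ∀ y ∈ ({0}ᶜ : Set Plane), stress C (fun l r => M.G r 0 l p) k j y =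
      stress C (fun l => g₀ l p) k j y + stress C g₁ k j y := by
    intro j y hy
    rw [← stress_add (fun l => (hM.smooth₀ l p).differentiableAt_of_isOpen hop hy)
      (fun l => (s1 l).differentiableAt_of_isOpen hop hy)]
    simp [hg₁]
  have hpd : ∀ y ∈ ({0}ᶜ : Set Plane), ∑ j, pd j (stress C (fun l => g₀ l p) k j) y =
      -kap * M.G y 0 k p - ∑ j, pd j (stress C g₁ k j) y := by
    intro y hy; rw [← (hM.solution p).eq y hy k, eq_sub_iff_add_eq, ← sum_add_distrib]
    refine sum_congr rfl fun j _ => ?_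
    rw [pd_congr_of_isOpen j hop (hs j) hy,
      pd_add j ((contDiffOn_stress hop (fun l => hM.smooth₀ l p) k j).differentiableAt_of_isOpen hop hy)
        ((contDiffOn_stress hop s1 k j).differentiableAt_of_isOpen hop hy)]
  have hlog : IsLogBounded (fun y => ∑ j, pd j (stress C (fun l => g₀ l p) k j) y) := by
    refine (((hM.logBounded k p).const_mul (-kap)).add ((IsLogBounded.sum (s := Finset.univ) fun j _ =>
      IsLogBounded.sum (s := Finset.univ) fun l _ => IsLogBounded.sum (s := Finset.univ) fun m _ =>
        (hM.logBounded_pd_pd l p m j).const_mul (C k j l m)).const_mul (-1))).congr fun y hy => ?_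
    rw [hpd y hy, neg_one_mul]; simp only [pd_stress hop s1 k _ _ hy]
    rfl
  have hhom : IsHomogeneous 2 (fun y => ∑ j, pd j (stress C (fun l => g₀ l p) k j) y) := by
    intro t y ht hy
    simp only [pd_stress hop (fun l => hM.smooth₀ l p) k _ _ hy,
      pd_stress hop (fun l => hM.smooth₀ l p) k _ _ (smul_ne_zero ht hy)]
    exact IsHomogeneous.sum (fun j _ => IsHomogeneous.sum fun l _ => IsHomogeneous.sum fun m _ =>
      ((hM.homogeneous₀ l p m).pd ((hM.smooth₀ l p).pd m hop) j).const_mul (C k j l m)) t y ht hy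
  have h1 := hlog.tendsto_smul (ζ := r) hr
  -- a logarithmically bounded function of degree `-2` vanishes
  have h2 := tendsto_ofReal_zero.mul h1
  rw [zero_mul] at h2
  rw [neg_zero, zero_mul]
  refine (tendsto_nhds_unique h2 (tendsto_const_nhds.congr' ?_)).symm
  filter_upwards [self_mem_nhdsWithin] with ε hε
  have hε' := ofReal_ne_zero.2 (ne_of_gt hε)
  have h3 := hhom ε r (ne_of_gt hε) hr
  simp only at h3
  rw [h3]
  field_simp

lemma bumpFlux_flux_const (c : Fin σ → ℂ) (p : Fin σ) :
    bumpFlux (flux C (fun l => g₀ l p) (fun l _ => c l)) = c p := by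
  have e : ∀ j ζ, flux C (fun l => g₀ l p) (fun l _ => c l) j ζ =
      ∑ k, c k * stress C (fun l => g₀ l p) k j ζ := by simp [flux, stress_const, mul_comm]
  rw [bumpFlux_congr fun j ζ _ => e j ζ, bumpFlux_sum
    (F := fun k j ζ => c k * stress C (fun l => g₀ l p) k j ζ) fun k _ j => continuousOn_const.mul
    (contDiffOn_stress isOpen_punctured (fun l => hM.smooth₀ l p) k j).continuousOn]
  simp only [bumpFlux_const_mul]
  have := hM.normalization
  calc _ = ∑ k, c k * (if k = p then 1 else 0) :=
        sum_congr rfl fun k _ => by rw [← this k p]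
    _ = _ := by simp

/-- The derivative of the flux of `g₀` against a linear field is itself free of flux through the bump;
by the product rule this reduces the claim to the flux of `g₀` against a constant. -/
lemma bumpFlux_flux_pd (ℓ : Fin σ → Plane →L[ℝ] ℂ) (p : Fin σ) (m : Fin 2) :
    bumpFlux (flux C (fun l => pd m (g₀ l p)) (fun l => ℓ l)) = -ℓ p (single m 1) := by
  have hop := isOpen_punctured
  have hpdl : ∀ l q, pd q (fun ζ => ℓ l ζ) = fun _ => ℓ l (single q 1) := by
    intro l q; ext ζ; simp [pd]
  have hsl : ∀ k j, stress C (fun l => ℓ l) k j =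
      fun _ => ∑ l, ∑ q, C k j l q * ℓ l (single q 1) := by
    intro k j; ext ζ; unfold stress
    refine sum_congr rfl fun l _ => sum_congr rfl fun q _ => ?_
    rw [hpdl]
  have hℓ : IsSolutionOn C 0 (fun l => ℓ l) {0}ᶜ := by
    refine ⟨fun l => (ℓ l).contDiff.contDiffOn, fun r _ k => ?_⟩
    simp [hsl]; simp [pd]
  have hF := fun j => contDiffOn_flux (C := C) hop (hM.solution₀ p).smooth hℓ.smooth j
  have h0 := bumpFlux_pd_eq_zero hF (fun r hr =>
    (hM.solution₀ p).div_flux_eq_zero hop hM.C_symm hℓ hr) m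
  have e : ∀ j ζ, ζ ≠ 0 → pd m (flux C (fun l => g₀ l p) (fun l => ℓ l) j) ζ =
      flux C (fun l => pd m (g₀ l p)) (fun l => ℓ l) j ζ +
        flux C (fun l => g₀ l p) (fun l _ => ℓ l (single m 1)) j ζ := by
    intro j ζ hζ
    have d1 : ∀ k, DifferentiableAt ℝ (stress C (fun l => g₀ l p) k j) ζ := fun k =>
      (contDiffOn_stress hop (hM.solution₀ p).smooth k j).differentiableAt_of_isOpen hop hζ
    have d2 := fun k =>
      (hM.smooth₀ k p).differentiableAt_of_isOpen hop hζ
    have d3 : ∀ k, DifferentiableAt ℝ (fun ζ => ℓ k ζ) ζ := fun k => (ℓ k).differentiableAt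
    have d4 : ∀ k, DifferentiableAt ℝ (stress C (fun l => ℓ l) k j) ζ := fun k => by
      rw [hsl]; exact differentiableAt_const _
    have h4 : ∀ k, pd m (stress C (fun l => ℓ l) k j) ζ = 0 := fun k => by rw [hsl]; simp [pd]
    unfold flux
    rw [pd_sum m fun k _ => ((d1 k).fun_mul (d3 k)).fun_sub ((d4 k).fun_mul (d2 k)),
      ← sum_add_distrib]
    refine sum_congr rfl fun k _ => ?_
    rw [pd_sub m ((d1 k).fun_mul (d3 k)) ((d4 k).fun_mul (d2 k)), pd_mul m (d1 k) (d3 k),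
      pd_mul m (d4 k) (d2 k), h4, stress_const, ← stress_pd hop (hM.solution₀ p).smooth m hζ, hpdl, Pi.zero_apply]
    ring
  rw [bumpFlux_congr e, bumpFlux_add
    (fun j => (contDiffOn_flux hop ((hM.solution₀ p).pd hop m).smooth hℓ.smooth j).continuousOn)
    (fun j => (contDiffOn_flux hop (hM.solution₀ p).smooth (fun l => contDiffOn_const) j).continuousOn),
    hM.bumpFlux_flux_const (fun l => ℓ l (single m 1)) p] at h0
  exact eq_neg_of_add_eq_zero_left h0

end IsFundamentalModel

/-! ### Green's representation at a boundary point -/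

/-- `F` is `O(1/|y - x|)` near `x`, and `ε F(x + ε ζ)` converges to `F₀(ζ)`. -/
def HasLeadingPart (x : Plane) (F F₀ : Plane → ℂ) : Prop :=
  (∃ C, ∀ᶠ y in 𝓝[≠] x, ‖F y‖ ≤ C / ‖y - x‖) ∧
    ∀ ζ, ζ ≠ 0 → Tendsto (fun ε : ℝ => (ε : ℂ) * F (x + ε • ζ)) (𝓝[>] 0) (𝓝 (F₀ ζ))

lemma tendsto_add_smul (x ζ : Plane) : Tendsto (fun ε : ℝ => x + ε • ζ) (𝓝[>] 0) (𝓝 x) := by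
  have : Tendsto (fun ε : ℝ => x + ε • ζ) (𝓝 0) (𝓝 (x + (0 : ℝ) • ζ)) :=
    (continuous_const.add (continuous_id.smul continuous_const)).tendsto 0
  rw [zero_smul, add_zero] at this
  exact this.mono_left nhdsWithin_le_nhds

lemma ContinuousAt.exists_norm_le {w : Plane → ℂ} {x : Plane} (hw : ContinuousAt w x) :
    ∃ C, 0 ≤ C ∧ ∀ᶠ y in 𝓝[≠] x, ‖w y‖ ≤ C := by
  refine ⟨‖w x‖ + 1, by positivity, nhdsWithin_le_nhds ?_⟩
  filter_upwards [hw.norm.eventually_lt continuousAt_const (lt_add_one ‖w x‖)] with y hy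
  exact hy.le

lemma eventually_punctured_unit (x : Plane) : ∀ᶠ y in 𝓝[≠] x, y - x ≠ 0 ∧ ‖y - x‖ ≤ 1 := by
  filter_upwards [self_mem_nhdsWithin, nhdsWithin_le_nhds (Metric.closedBall_mem_nhds x one_pos)]
    with y hy hy1
  exact ⟨sub_ne_zero.2 hy, mem_closedBall_iff_norm.1 hy1⟩

namespace HasLeadingPart

variable {x : Plane} {F F₀ F' F₀' e w : Plane → ℂ}

lemma congr (h : HasLeadingPart x F F₀) (hF : ∀ y, y ≠ x → F' y = F y)
    (h0 : ∀ ζ, ζ ≠ 0 → F₀' ζ = F₀ ζ) : HasLeadingPart x F' F₀' := by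
  obtain ⟨⟨C, hC⟩, hl⟩ := h
  refine ⟨⟨C, ?_⟩, fun ζ hζ => ?_⟩
  · filter_upwards [hC, self_mem_nhdsWithin] with y hy hyx
    rwa [hF y hyx]
  · rw [h0 ζ hζ]
    refine (hl ζ hζ).congr' ?_
    filter_upwards [self_mem_nhdsWithin] with ε hε
    rw [hF]; intro hc; exact smul_ne_zero (ne_of_gt hε) hζ (add_eq_left.1 hc)

lemma add (h : HasLeadingPart x F F₀) (h' : HasLeadingPart x F' F₀') :
    HasLeadingPart x (fun y => F y + F' y) (fun ζ => F₀ ζ + F₀' ζ) := by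
  obtain ⟨⟨C, hC⟩, hl⟩ := h
  obtain ⟨⟨C', hC'⟩, hl'⟩ := h'
  refine ⟨⟨C + C', ?_⟩, fun ζ hζ => ?_⟩
  · filter_upwards [hC, hC'] with y h1 h2
    rw [add_div]; exact (norm_add_le _ _).trans (add_le_add h1 h2)
  · simpa only [mul_add] using (hl ζ hζ).add (hl' ζ hζ)

/-- Multiplication by a function that is continuous at the singular point. -/
lemma mul (h : HasLeadingPart x F F₀) (hw : ContinuousAt w x) :
    HasLeadingPart x (fun y => F y * w y) (fun ζ => F₀ ζ * w x) := by
  obtain ⟨⟨C, hC⟩, hl⟩ := h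
  obtain ⟨C', hC'0, hC'⟩ := hw.exists_norm_le
  refine ⟨⟨C * C', ?_⟩, fun ζ hζ => ?_⟩
  · filter_upwards [hC, hC'] with y h1 h2
    rw [norm_mul]
    calc _ ≤ C / ‖y - x‖ * C' := mul_le_mul h1 h2 (norm_nonneg _) ((norm_nonneg _).trans h1)
      _ = _ := by ring
  · refine ((hl ζ hζ).mul (hw.tendsto.comp (tendsto_add_smul x ζ))).congr fun ε => ?_
    simp [Function.comp]; ring

lemma const_mul (c : ℂ) (h : HasLeadingPart x F F₀) :
    HasLeadingPart x (fun y => c * F y) (fun ζ => c * F₀ ζ) :=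
  (h.mul (continuousAt_const (y := c))).congr (fun _ _ => mul_comm _ _) fun _ _ => mul_comm _ _

lemma sub (h : HasLeadingPart x F F₀) (h' : HasLeadingPart x F' F₀') :
    HasLeadingPart x (fun y => F y - F' y) (fun ζ => F₀ ζ - F₀' ζ) :=
  (h.add (h'.const_mul (-1))).congr (fun _ _ => by ring) fun _ _ => by ring

lemma sum {ι : Type*} {s : Finset ι} {F F₀ : ι → Plane → ℂ}
    (h : ∀ i ∈ s, HasLeadingPart x (F i) (F₀ i)) :
    HasLeadingPart x (fun y => ∑ i ∈ s, F i y) (fun ζ => ∑ i ∈ s, F₀ i ζ) := by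
  classical
  induction s using Finset.induction_on with
  | empty =>
    refine ⟨⟨0, Eventually.of_forall fun y => by simp⟩, fun ζ _ => by simp⟩
  | insert i s hi ih =>
    simp [Finset.sum_insert hi]
    exact (h i (Finset.mem_insert_self i s)).add (ih fun j hj => h j (Finset.mem_insert_of_mem hj))

lemma of_homogeneous (he : IsHomogeneous 1 e) (hc : ContinuousOn e {0}ᶜ) (x : Plane) :
    HasLeadingPart x (fun y => e (y - x)) e := by
  obtain ⟨C, -, hC⟩ := he.exists_le_div hc
  refine ⟨⟨C, ?_⟩, fun ζ hζ => ?_⟩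
  · filter_upwards [eventually_punctured_unit x] with y hy
    simpa using hC _ hy.1
  · refine tendsto_const_nhds.congr' ?_
    filter_upwards [self_mem_nhdsWithin] with ε hε
    have hε' := ofReal_ne_zero.2 (ne_of_gt hε)
    rw [add_sub_cancel_left, he ε ζ (ne_of_gt hε) hζ]; field_simp

lemma of_logBounded (he : IsLogBounded e) (x : Plane) :
    HasLeadingPart x (fun y => e (y - x)) (fun _ => 0) := by
  obtain ⟨C, -, hC⟩ := he.exists_le_div
  refine ⟨⟨C, ?_⟩, fun ζ hζ => ?_⟩
  · filter_upwards [eventually_punctured_unit x] with y hy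
    exact hC _ hy.1 hy.2
  · simpa only [add_sub_cancel_left] using he.tendsto_smul hζ

/-- A singularity of degree `-2`, weakened by a first-order zero. -/
lemma of_homogeneous_two (he : IsHomogeneous 2 e) (hc : ContinuousOn e {0}ᶜ)
    (hw : DifferentiableAt ℝ w x) :
    HasLeadingPart x (fun y => e (y - x) * (w y - w x)) (fun ζ => e ζ * fderiv ℝ w x ζ) := by
  obtain ⟨C, hC0, hC⟩ := he.exists_le_div hc
  obtain ⟨C', hC'⟩ := hw.isBigO_sub.bound
  refine ⟨⟨C * C', ?_⟩, fun ζ hζ => ?_⟩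
  · filter_upwards [eventually_punctured_unit x, nhdsWithin_le_nhds hC'] with y hy hy'
    rw [norm_mul]
    calc _ ≤ C / ‖y - x‖ ^ 2 * (C' * ‖y - x‖) := by
          gcongr
          exact hC _ hy.1
      _ = _ := by field_simp
  · have hl : HasDerivAt (fun ε : ℝ => w (x + ε • ζ)) (fderiv ℝ w x ζ) 0 := by
      have h1 : HasDerivAt (fun ε : ℝ => x + ε • ζ) ζ 0 := by
        simpa using ((hasDerivAt_id (0 : ℝ)).smul_const ζ).const_add x
      have h2 : HasFDerivAt w (fderiv ℝ w x) (x + (0 : ℝ) • ζ) := by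
        rw [zero_smul, add_zero]; exact hw.hasFDerivAt
      exact h2.comp_hasDerivAt 0 h1
    have h2 := (hl.tendsto_slope_zero.mono_left
      (nhdsWithin_mono _ fun (ε : ℝ) (hε : 0 < ε) => hε.ne')).const_mul (e ζ)
    refine h2.congr' ?_
    filter_upwards [self_mem_nhdsWithin] with ε hε
    rw [add_sub_cancel_left, he ε ζ (ne_of_gt hε) hζ, zero_add, zero_smul, add_zero, real_smul]
    push_cast; field_simp

end HasLeadingPart

namespace SmoothDomain

variable (D : SmoothDomain)

/-- The flux of a divergence-free field through the boundary, in terms of its leading part at a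
boundary point. The values at the point itself are irrelevant. -/
lemma tendsto_flux_of_leadingPart (i : Fin D.numCurves) (t : ℝ) {O : Set Plane} (hO : IsOpen O)
    (hΩO : closure D.Ω ⊆ O) {F F₀ : Fin 2 → Plane → ℂ}
    (hF : ∀ j, ContDiffOn ℝ 1 (F j) (O \ {D.curve i t})) (hdiv : ∀ y ∈ D.Ω, ∑ j, pd j (F j) y = 0)
    (hlead : ∀ j, HasLeadingPart (D.curve i t) (F j) (F₀ j))
    (hF₀ : ∀ j, ContinuousOn (F₀ j) {0}ᶜ) (hodd : ∀ j ζ, ζ ≠ 0 → F₀ j (-ζ) = -F₀ j ζ) :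
    Tendsto (fun ε : ℝ => D.lineIntegral univ (fun y =>
      (smoothCutoff (dist y (D.curve i t) / ε) : ℂ) * ∑ j, F j y * (D.normal y j : ℂ)))
      (𝓝[>] 0) (𝓝 (-(1 / 2) * bumpFlux F₀)) := by
  choose C hC using fun j => (hlead j).1
  have h := D.tendsto_smooth_flux i t hO hΩO (F := F)
    (F₀ := fun j ζ => if ζ = 0 then 0 else F₀ j ζ) hF hdiv (C := max (C 0) (C 1)) ?_ ?_ ?_ ?_
  · rwa [bumpFlux_congr (F' := F₀) fun j ζ hζ => if_neg hζ] at h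
  · filter_upwards [hC 0, hC 1] with y h0 h1 j
    have hle : C j ≤ max (C 0) (C 1) := by fin_cases j <;> simp
    have : ‖F j y‖ ≤ C j / ‖y - D.curve i t‖ := by fin_cases j; exacts [h0, h1]
    exact this.trans (by gcongr)
  · intro j
    exact (hF₀ j).congr fun ζ hζ => if_neg hζ
  · intro j ζ
    by_cases hζ : ζ = 0
    · simp [hζ]
    · simp [neg_eq_zero, if_neg hζ]
      exact hodd j ζ hζ
  · intro j ζ hζ
    simp [if_neg hζ]; exact (hlead j).2 ζ hζ

end SmoothDomain

namespace IsFundamentalModel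

variable {σ : ℕ} {M : LayerModel σ} {C : Stiffness σ} {kap : ℂ}
  {g₀ : Fin σ → Fin σ → Plane → ℂ} (hM : IsFundamentalModel M C kap g₀)
include hM

lemma smooth (l p : Fin σ) : ContDiffOn ℝ ∞ (fun r => M.G r 0 l p) {0}ᶜ := (hM.solution p).smooth l

lemma smooth_sub (l p : Fin σ) : ContDiffOn ℝ ∞ (fun r => M.G r 0 l p - g₀ l p r) {0}ᶜ :=
  (hM.smooth l p).sub (hM.smooth₀ l p)

lemma pd_G_eq (l p : Fin σ) (m : Fin 2) {r : Plane} (hr : r ≠ 0) : pd m (fun r => M.G r 0 l p) r =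
      pd m (g₀ l p) r + pd m (fun r => M.G r 0 l p - g₀ l p r) r := by
  have hop := isOpen_punctured
  rw [← pd_add m ((hM.smooth₀ l p).differentiableAt_of_isOpen hop hr)
    ((hM.smooth_sub l p).differentiableAt_of_isOpen hop hr)]
  simp

lemma pd_pd_G_eq (l p : Fin σ) (j m : Fin 2) {r : Plane} (hr : r ≠ 0) :
    pd j (pd m (fun r => M.G r 0 l p)) r =
      pd j (pd m (g₀ l p)) r + pd j (pd m (fun r => M.G r 0 l p - g₀ l p r)) r := by
  have hop := isOpen_punctured
  rw [← pd_add j (((hM.smooth₀ l p).pd m hop).differentiableAt_of_isOpen hop hr)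
    (((hM.smooth_sub l p).pd m hop).differentiableAt_of_isOpen hop hr)]
  exact pd_congr_of_isOpen j hop (fun y hy => hM.pd_G_eq l p m hy) hr

lemma hasLeadingPart_pd (x : Plane) (l p : Fin σ) (m : Fin 2) :
    HasLeadingPart x (fun y => pd m (fun r => M.G r 0 l p) (y - x)) (pd m (g₀ l p)) :=
  ((HasLeadingPart.of_homogeneous (hM.homogeneous₀ l p m)
    ((hM.smooth₀ l p).pd m isOpen_punctured).continuousOn x).add
    (HasLeadingPart.of_logBounded (hM.logBounded_pd l p m) x)).congr
    (fun _ hy => hM.pd_G_eq l p m (sub_ne_zero.2 hy)) fun _ _ => (add_zero _).symm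

/-- The representation formula for solutions, at a boundary point. -/
lemma tendsto_green (D : SmoothDomain) (i : Fin D.numCurves) (t : ℝ) {O : Set Plane}
    (hO : IsOpen O) (hΩO : closure D.Ω ⊆ O) {u : Fin σ → Plane → ℂ}
    (hu : IsSolutionOn C kap u O) (p : Fin σ) : Tendsto (fun ε : ℝ => D.lineIntegral univ (fun y =>
      (smoothCutoff (dist y (D.curve i t) / ε) : ℂ) *
        ∑ j, flux C (fun l y => M.G (y - D.curve i t) 0 l p) u j y * (D.normal y j : ℂ)))
      (𝓝[>] 0) (𝓝 (-(1 / 2) * u p (D.curve i t))) := by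
  set x := D.curve i t
  have hop := isOpen_punctured
  have hxO := hΩO (frontier_subset_closure (D.curve_mem_frontier i t))
  have hxΩ : x ∉ D.Ω := D.curve_notMem i t
  have hopx : IsOpen (O \ {x}) := hO.sdiff isClosed_singleton
  have hv : IsSolutionOn C kap (fun l y => M.G (y - x) 0 l p) (O \ {x}) :=
    ((hM.solution p).comp_sub_const x).mono fun y hy => sub_ne_zero.2 hy.2
  have hu' := hu.mono (sdiff_subset (s := O) (t := {x}))
  have huc := fun k =>
    ((hu.smooth k).contDiffAt (hO.mem_nhds hxO)).continuousAt
  have hsc : ∀ k j, ContinuousAt (stress C u k j) x := fun k j =>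
    ((contDiffOn_stress hO hu.smooth k j).contDiffAt (hO.mem_nhds hxO)).continuousAt
  rw [← hM.bumpFlux_flux_const (fun l => u l x) p]
  have h0 := stress_const (C := C) (fun l => u l x)
  have hlead : ∀ j, HasLeadingPart x (flux C (fun l y => M.G (y - x) 0 l p) u j)
      (flux C (fun l => g₀ l p) (fun l _ => u l x) j) := by
    intro j
    refine HasLeadingPart.sum fun k _ => ?_
    rw [stress_comp_sub_const (fun l r => M.G r 0 l p), h0]
    refine (((HasLeadingPart.sum (s := Finset.univ) fun l _ =>
      HasLeadingPart.sum (s := Finset.univ) fun m _ => (hM.hasLeadingPart_pd x l p m).const_mul (C k j l m)).mul (huc k)).sub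
      ((HasLeadingPart.of_logBounded (hM.logBounded k p) x).mul (hsc k j))).congr
      (fun y _ => ?_) fun ζ _ => ?_
    · simp [stress]; ring
    · simp only [stress, Pi.zero_apply]; ring
  refine D.tendsto_flux_of_leadingPart i t hO hΩO (fun j =>
    (contDiffOn_flux hopx hv.smooth hu'.smooth j).of_le (by norm_cast)) (fun y hy =>
    hv.div_flux_eq_zero hopx hM.C_symm hu' ⟨hΩO (subset_closure hy), fun hc => hxΩ (hc ▸ hy)⟩)
    hlead (fun j => (contDiffOn_flux hop (fun l => hM.smooth₀ l p)
      (fun l => contDiffOn_const) j).continuousOn) fun j ζ hζ => ?_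
  have hs : ∀ k, IsHomogeneous 1 (stress C (fun l => g₀ l p) k j) := fun k =>
    IsHomogeneous.sum fun l _ => IsHomogeneous.sum fun m _ =>
      (hM.homogeneous₀ l p m).const_mul _
  unfold flux
  rw [← sum_neg_distrib]
  refine sum_congr rfl fun k _ => ?_
  rw [(hs k).neg hζ, h0]
  simp

end IsFundamentalModel

variable {σ : ℕ} {C : Stiffness σ} {kap : ℂ}

/-- `v` solves the equation away from the origin, where it is singular of degree `-1` with principal
part `v₀`, and the flux of `v₀` against linear fields through small circles is `-L`. -/
structure IsDipoleField (C : Stiffness σ) (kap : ℂ)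
    (v v₀ : Fin σ → Plane → ℂ) (L : (Fin σ → Plane →L[ℝ] ℂ) → ℂ) : Prop where
  solution : IsSolutionOn C kap v {0}ᶜ
  solution₀ : IsSolutionOn C 0 v₀ {0}ᶜ
  homogeneous : ∀ l, IsHomogeneous 1 (v₀ l)
  logBounded : ∀ l, IsLogBounded (fun r => v l r - v₀ l r)
  logBounded_pd : ∀ l m, IsLogBounded (fun r => pd m (v l) r - pd m (v₀ l) r)
  bumpFlux_eq : ∀ ℓ, bumpFlux (flux C v₀ (fun l => ℓ l)) = -L ℓ

lemma IsFundamentalModel.isDipoleField {M : LayerModel σ} {g₀ : Fin σ → Fin σ → Plane → ℂ}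
    (hM : IsFundamentalModel M C kap g₀) (q : Fin σ) (m : Fin 2) :
    IsDipoleField C kap (fun l => pd m (fun r => M.G r 0 l q)) (fun l => pd m (g₀ l q))
      (fun ℓ => ℓ q (single m 1)) :=
  ⟨(hM.solution q).pd isOpen_punctured m, (hM.solution₀ q).pd isOpen_punctured m,
    fun l => hM.homogeneous₀ l q m,
    fun l => (hM.logBounded_pd l q m).congr fun r hr => by rw [hM.pd_G_eq l q m hr]; ring,
    fun l j => (hM.logBounded_pd_pd l q m j).congr fun r hr => by
      rw [hM.pd_pd_G_eq l q j m hr]; ring, fun ℓ => hM.bumpFlux_flux_pd ℓ q m⟩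

namespace IsDipoleField

lemma sum {ι : Type*} [Fintype ι] {v v₀ : ι → Fin σ → Plane → ℂ}
    {L : ι → (Fin σ → Plane →L[ℝ] ℂ) → ℂ} (c : ι → ℂ)
    (h : ∀ i, IsDipoleField C kap (v i) (v₀ i) (L i)) :
    IsDipoleField C kap (fun l r => ∑ i, c i * v i l r) (fun l r => ∑ i, c i * v₀ i l r)
      (fun ℓ => ∑ i, c i * L i ℓ) := by
  have hop := isOpen_punctured
  have d := fun i l r hr => ((h i).solution.smooth l).differentiableAt_of_isOpen hop (x := r) hr
  have d₀ := fun i l r hr => ((h i).solution₀.smooth l).differentiableAt_of_isOpen hop (x := r) hr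
  refine ⟨IsSolutionOn.sum hop fun i _ => (h i).solution.const_mul hop _,
    IsSolutionOn.sum hop fun i _ => (h i).solution₀.const_mul hop _,
    fun l => IsHomogeneous.sum fun i _ => ((h i).homogeneous l).const_mul _,
    fun l => (IsLogBounded.sum (s := Finset.univ) fun i _ =>
      ((h i).logBounded l).const_mul (c i)).congr fun r _ => by simp only [mul_sub, sum_sub_distrib],
    fun l m => (IsLogBounded.sum (s := Finset.univ) fun i _ =>
      ((h i).logBounded_pd l m).const_mul (c i)).congr fun r hr => ?_, fun ℓ => ?_⟩
  · rw [pd_sum m fun i _ => (d i l r hr).const_mul _, pd_sum m fun i _ => (d₀ i l r hr).const_mul _,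
      ← sum_sub_distrib]
    exact sum_congr rfl fun i _ => by
      rw [pd_const_mul m _ (d i l r hr), pd_const_mul m _ (d₀ i l r hr), mul_sub]
  · rw [bumpFlux_congr (F' := fun j ζ => ∑ i, c i * flux C (v₀ i) (fun l => ℓ l) j ζ) fun j ζ hζ => ?_,
      bumpFlux_sum (F := fun i j ζ => c i * flux C (v₀ i) (fun l => ℓ l) j ζ) fun i _ j =>
      continuousOn_const.mul (contDiffOn_flux hop (h i).solution₀.smooth
        (fun l => (ℓ l).contDiff.contDiffOn) j).continuousOn, ← sum_neg_distrib]
    · exact sum_congr rfl fun i _ => by rw [bumpFlux_const_mul, (h i).bumpFlux_eq, mul_neg]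
    · simp only [flux, stress_sum fun i _ l => (d₀ i l ζ hζ).const_mul _,
        stress_const_mul _ fun l => d₀ _ l ζ hζ, mul_sum, sum_mul, ← sum_sub_distrib]
      rw [sum_comm]; exact sum_congr rfl fun i _ => sum_congr rfl fun k _ => by ring

variable {v v₀ : Fin σ → Plane → ℂ} {L : (Fin σ → Plane →L[ℝ] ℂ) → ℂ}
  (h : IsDipoleField C kap v v₀ L)
include h

lemma homogeneous_stress (k : Fin σ) (j : Fin 2) : IsHomogeneous 2 (stress C v₀ k j) :=
  IsHomogeneous.sum fun l _ => IsHomogeneous.sum fun m _ =>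
    ((h.homogeneous l).pd (h.solution₀.smooth l) m).const_mul _

/-- The representation formula with a dipole field in place of the fundamental solution, after
subtraction of the part of degree `-2` of the flux. -/
lemma tendsto_green (hC : ∀ k j l m, C k j l m = C l m k j) (D : SmoothDomain)
    (i : Fin D.numCurves) (t : ℝ) {O : Set Plane}
    (hO : IsOpen O) (hΩO : closure D.Ω ⊆ O) {u : Fin σ → Plane → ℂ} (hu : IsSolutionOn C kap u O) :
    Tendsto (fun ε : ℝ => D.lineIntegral univ (fun y =>
      (smoothCutoff (dist y (D.curve i t) / ε) : ℂ) *
        ∑ j, (flux C (fun l y => v l (y - D.curve i t)) u j y -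
          flux C (fun l y => v₀ l (y - D.curve i t))
            (fun l _ => u l (D.curve i t)) j y) * (D.normal y j : ℂ)))
      (𝓝[>] 0) (𝓝 ((1 / 2) * L fun l => fderiv ℝ (u l) (D.curve i t))) := by
  set x := D.curve i t
  have hop := isOpen_punctured
  have hxO := hΩO (frontier_subset_closure (D.curve_mem_frontier i t))
  have hxΩ : x ∉ D.Ω := D.curve_notMem i t
  have hopx : IsOpen (O \ {x}) := hO.sdiff isClosed_singleton
  have hsub : (O \ {x}) ⊆ (fun y => y - x) ⁻¹' {0}ᶜ := fun y hy => sub_ne_zero.2 hy.2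
  have svx := (h.solution.comp_sub_const x).mono hsub
  have svx₀ := (h.solution₀.comp_sub_const x).mono hsub
  have hu' := hu.mono (sdiff_subset (s := O) (t := {x}))
  have huc := fun k => (hu.smooth k).contDiffAt (hO.mem_nhds hxO)
  have hsc : ∀ k j, ContinuousAt (stress C u k j) x := fun k j =>
    ((contDiffOn_stress hO hu.smooth k j).contDiffAt (hO.mem_nhds hxO)).continuousAt
  have hconst := IsSolutionOn.const (C := C) (S := O \ {x}) (fun l => u l x)
  set ℓ : Fin σ → Plane →L[ℝ] ℂ := fun l => fderiv ℝ (u l) x with hℓ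
  have hstr : ∀ k j, stress C (fun l => ℓ l) k j = fun _ => stress C u k j x := by
    intro k j; ext ζ; unfold stress
    simp [pd, hℓ]
  have hs₁ : ∀ k j, IsLogBounded (fun r => stress C v k j r - stress C v₀ k j r) := fun k j =>
    (IsLogBounded.sum (s := Finset.univ) fun l _ => IsLogBounded.sum (s := Finset.univ) fun m _ =>
      (h.logBounded_pd l m).const_mul (C k j l m)).congr fun r _ => by
        simp only [stress, mul_sub, sum_sub_distrib]
  have hlead : ∀ j, HasLeadingPart x (fun y => flux C (fun l y => v l (y - x)) u j y -
      flux C (fun l y => v₀ l (y - x)) (fun l _ => u l x) j y) (flux C v₀ (fun l => ℓ l) j) := by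
    intro j
    have h1 := HasLeadingPart.sum (s := (Finset.univ : Finset (Fin σ))) fun k _ =>
      (((HasLeadingPart.of_homogeneous_two (h.homogeneous_stress k j)
        (contDiffOn_stress hop h.solution₀.smooth k j).continuousOn
        ((huc k).differentiableAt (by simp))).sub ((HasLeadingPart.of_homogeneous (h.homogeneous k)
        (h.solution₀.smooth k).continuousOn x).mul (hsc k j))).add
      ((HasLeadingPart.of_logBounded (hs₁ k j) x).mul (huc k).continuousAt)).sub
      ((HasLeadingPart.of_logBounded (h.logBounded k) x).mul (hsc k j))
    refine h1.congr (fun y hy => ?_) fun ζ hζ => ?_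
    · unfold flux
      rw [← sum_sub_distrib]
      refine sum_congr rfl fun k _ => ?_
      rw [stress_comp_sub_const v, stress_comp_sub_const v₀, stress_const]; simp; ring
    · refine sum_congr rfl fun k _ => ?_
      rw [hstr]; ring
  have hval : (1 / 2 : ℂ) * L ℓ = -(1 / 2) * bumpFlux (flux C v₀ (fun l => ℓ l)) := by
    rw [h.bumpFlux_eq]; ring
  rw [hval]
  have f1 := contDiffOn_flux (C := C) hopx svx.smooth hu'.smooth
  have f2 := contDiffOn_flux (C := C) hopx svx₀.smooth hconst.smooth
  refine D.tendsto_flux_of_leadingPart i t hO hΩO (fun j =>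
    ((f1 j).sub (f2 j)).of_le (by norm_cast)) (fun y hy => ?_)
    hlead (fun j => (contDiffOn_flux hop h.solution₀.smooth
      (fun l => (ℓ l).contDiff.contDiffOn) j).continuousOn) fun j ζ hζ => ?_
  · have hyO : y ∈ O \ {x} := ⟨hΩO (subset_closure hy), fun hc => hxΩ (hc ▸ hy)⟩
    rw [sum_congr rfl fun j _ => pd_sub j ((f1 j).differentiableAt_of_isOpen hopx hyO)
      ((f2 j).differentiableAt_of_isOpen hopx hyO), sum_sub_distrib,
      svx.div_flux_eq_zero hopx hC hu' hyO, svx₀.div_flux_eq_zero hopx hC hconst hyO, sub_zero]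
  · unfold flux
    rw [← sum_neg_distrib]
    refine sum_congr rfl fun k _ => ?_
    rw [(h.homogeneous_stress k j).neg hζ, (h.homogeneous k).neg hζ, hstr]; simp [map_neg]
    ring

end IsDipoleField

/-! ### Kernels built from homogeneous functions of the chord -/

namespace HasSingularExpansion

variable {k k' : ℝ → ℝ → ℂ} {a b a' b' c : ℝ → ℂ}

lemma bounded_mul (hc : ∃ C, ∀ t, ‖c t‖ ≤ C) (hk : HasSingularExpansion k a b) :
    HasSingularExpansion (fun t s => c t * k t s) (fun t => c t * a t) (fun t => c t * b t) := by
  obtain ⟨M, hM⟩ := hc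
  obtain ⟨C, δ, hδ, h1, h2⟩ := hk
  have hM0 := (norm_nonneg _).trans (hM 0)
  refine ⟨M * C, δ, hδ, fun t => ?_, fun t σ h0 h => ?_⟩
  · rw [norm_mul, norm_mul]
    exact ⟨mul_le_mul (hM t) (h1 t).1 (norm_nonneg _) hM0,
      mul_le_mul (hM t) (h1 t).2 (norm_nonneg _) hM0⟩
  · calc _ = ‖c t * (k t (t + σ) - a t / σ ^ 2 - b t / σ)‖ := by congr 1; ring
      _ ≤ M * (C * (1 + |log σ|)) := by
          rw [norm_mul]; exact mul_le_mul (hM t) (h2 t σ h0 h) (norm_nonneg _) hM0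
      _ = _ := by ring

lemma congr_near (hk : HasSingularExpansion k a b) {δ : ℝ} (hδ : 0 < δ)
    (e : ∀ t σ, σ ≠ 0 → |σ| ≤ δ → k' t (t + σ) = k t (t + σ)) : HasSingularExpansion k' a b := by
  obtain ⟨C, δ', hδ', h1, h2⟩ := hk
  refine ⟨C, min δ δ', lt_min hδ hδ', h1, fun t σ h0 h => ?_⟩
  rw [e t σ h0 (h.trans (min_le_left _ _))]
  exact h2 t σ h0 (h.trans (min_le_right _ _))

lemma congr_coeff (hk : HasSingularExpansion k a b) (ha : ∀ t, a' t = a t) (hb : ∀ t, b' t = b t) :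
    HasSingularExpansion k a' b' := by rwa [funext ha, funext hb]

lemma sum {ι : Type*} (s : Finset ι) {k : ι → ℝ → ℝ → ℂ} {a b : ι → ℝ → ℂ}
    (hk : ∀ i, HasSingularExpansion (k i) (a i) (b i)) :
    HasSingularExpansion (fun t x => ∑ i ∈ s, k i t x) (fun t => ∑ i ∈ s, a i t)
      (fun t => ∑ i ∈ s, b i t) := by
  classical
  induction s using Finset.induction_on with
  | empty => simpa using of_bound (k := fun _ _ => 0) (C := 0) one_pos (by simp)
  | insert i s hi ih =>
    simp [Finset.sum_insert hi]; exact (hk i).add ih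

end HasSingularExpansion

/-- A function has a Taylor expansion of order two along the parameter, with bounded
coefficients. -/
def IsTaylorWeight (w : ℝ → ℂ) : Prop := HasExpansion (fun t σ => w (t + σ)) w

lemma Function.Periodic.isTaylorWeight {w : ℝ → ℂ} {T : ℝ} (hw : Function.Periodic w T) (hT : 0 < T)
    (hs : ContDiff ℝ ∞ w) : IsTaylorWeight w := by
  have s1 := (contDiff_infty_iff_deriv.1 hs).2
  have s2 := (contDiff_infty_iff_deriv.1 s1).2
  obtain ⟨M0, h0⟩ := hw.exists_norm_le hT hs.continuous
  obtain ⟨M1, h1⟩ := hw.deriv_periodic.exists_norm_le hT s1.continuous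
  obtain ⟨M2, h2⟩ := hw.deriv_periodic.deriv_periodic.exists_norm_le hT s2.continuous
  refine ⟨deriv w, max M0 (max M1 M2), 1, one_pos, fun t => ⟨(h0 t).trans (le_max_left _ _),
    (h1 t).trans ((le_max_left _ _).trans (le_max_right _ _))⟩, fun t σ _ _ => ?_⟩
  have := norm_sub_sub_smul_le (fun s => (hs.differentiable (by simp) s).hasDerivAt)
    (fun s => (s1.differentiable (by simp) s).hasDerivAt) h2 t σ
  rw [sq_abs, real_smul] at this
  refine this.trans ?_
  gcongr
  exact (le_max_right _ _).trans (le_max_right _ _)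

namespace SmoothDomain

variable (D : SmoothDomain) (i : Fin D.numCurves)

lemma rotCW_deriv_smooth (m : Fin 2) : ContDiff ℝ ∞ fun s => rotCW (deriv (D.curve i) s) m := by
  have h' : ∀ k : Fin 2, ContDiff ℝ ∞ (fun s => deriv (D.curve i) s k) := fun k =>
    (proj (𝕜 := ℝ) k).contDiff.comp (D.deriv_curve_smooth i)
  obtain rfl | rfl : m = 0 ∨ m = 1 := by omega
  · simpa only [rotCW_zero_apply] using h' 1
  · simpa only [rotCW_one_apply] using (h' 0).neg

lemma isTaylorWeight_rotCW (j : Fin 2) :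
    IsTaylorWeight fun s => (rotCW (deriv (D.curve i) s) j : ℂ) := by
  refine Function.Periodic.isTaylorWeight (T := D.period i) (fun s => ?_) (D.period_pos i) ?_
  · rw [D.deriv_curve_periodic i s]
  · exact ofRealCLM.contDiff.comp (D.rotCW_deriv_smooth i j)

lemma speed_smooth : ContDiff ℝ ∞ (fun s => ‖deriv (D.curve i) s‖) :=
  (D.deriv_curve_smooth i).norm ℝ (D.curve_regular i)

lemma isTaylorWeight_speed : IsTaylorWeight fun s => (‖deriv (D.curve i) s‖ : ℂ) := by
  refine Function.Periodic.isTaylorWeight (T := D.period i) (fun s => ?_) (D.period_pos i)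
    (ofRealCLM.contDiff.comp (D.speed_smooth i))
  rw [D.deriv_curve_periodic i s]

lemma normal_curve_smooth (m : Fin 2) : ContDiff ℝ ∞ fun s => D.normal (D.curve i s) m := by
  simp only [D.normal_curve]
  exact ((D.speed_smooth i).inv fun s => norm_ne_zero_iff.2 (D.curve_regular i s)).mul
    (D.rotCW_deriv_smooth i m)

lemma continuous_normal_curve (m : Fin 2) : Continuous fun s => (D.normal (D.curve i s) m : ℂ) :=
  continuous_ofReal.comp (D.normal_curve_smooth i m).continuous

lemma continuousOff_kernel {e w : Plane → ℂ} (he : ContinuousOn e {0}ᶜ)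
    (hw : ∀ j, Continuous fun s => w (D.curve j s)) (x : Plane) :
    D.ContinuousOff x (fun y => e (y - x) * w y) := fun j =>
  (he.comp (((D.curve_continuous j).sub continuous_const).continuousOn)
    fun _ hs => sub_ne_zero.2 hs).mul (hw j).continuousOn

end SmoothDomain

namespace IsRegularCurve

variable {γ : ℝ → Plane} (h : IsRegularCurve γ) {e : Plane → ℂ} {w : ℝ → ℂ}
include h

lemma exists_homogeneous_eq (k : ℕ) (he : IsHomogeneous k e) : ∃ δ > 0, ∀ t σ, σ ≠ 0 → |σ| ≤ δ →
    e (γ (t + σ) - γ t) = ((σ : ℂ) ^ k)⁻¹ * e (σ⁻¹ • (γ (t + σ) - γ t)) := by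
  obtain ⟨δ, c, hδ, -, hc, H⟩ := h.exists_chord_bounds
  refine ⟨δ, hδ, fun t σ h0 hσ => ?_⟩
  have hne := norm_pos_iff.1 ((mul_pos hc (abs_pos.2 h0)).trans_le (H t σ h0 hσ).1)
  rw [← he σ _ h0 (smul_ne_zero (inv_ne_zero h0) hne), smul_inv_smul₀ h0]

lemma exists_hasSingularExpansion_homogeneous_two (he : IsHomogeneous 2 e)
    (hs : ContDiffOn ℝ ∞ e {0}ᶜ) (hw : IsTaylorWeight w) :
    ∃ b, HasSingularExpansion (fun t s => e (γ s - γ t) * w s)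
      (fun t => e (deriv γ t) * w t) b := by
  obtain ⟨δ, hδ, H⟩ := h.exists_homogeneous_eq 2 he
  obtain ⟨b, hb⟩ := HasSingularExpansion.of_expansion_sq
    (k := fun t s => (((s - t : ℝ) : ℂ) ^ 2)⁻¹ * (e ((s - t)⁻¹ • (γ (t + (s - t)) - γ t)) *
      w (t + (s - t)))) ((h.hasExpansion_comp (hs.of_le two_le_infty)).mul hw)
    (fun t σ _ => by simp [add_sub_cancel_left])
  refine ⟨b, hb.congr_near hδ fun t σ h0 hσ => ?_⟩
  simp only [H t σ h0 hσ]
  ring_nf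

lemma hasSingularExpansion_homogeneous_one (he : IsHomogeneous 1 e)
    (hs : ContDiffOn ℝ ∞ e {0}ᶜ) (hw : IsTaylorWeight w) :
    HasSingularExpansion (fun t s => e (γ s - γ t) * w s) (fun _ => 0)
      (fun t => e (deriv γ t) * w t) := by
  obtain ⟨δ, hδ, H⟩ := h.exists_homogeneous_eq 1 he
  refine (HasSingularExpansion.of_expansion_inv
    (k := fun t s => ((s - t : ℝ) : ℂ)⁻¹ * (e ((s - t)⁻¹ • (γ (t + (s - t)) - γ t)) *
      w (t + (s - t)))) ((h.hasExpansion_comp (hs.of_le two_le_infty)).mul hw)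
    (fun t σ _ => by simp [add_sub_cancel_left])).congr_near hδ fun t σ h0 hσ => ?_
  simp only [H t σ h0 hσ, pow_one]
  ring_nf

lemma hasSingularExpansion_logBounded (he : IsLogBounded e) (hw : ∃ C, ∀ s, ‖w s‖ ≤ C) :
    HasSingularExpansion (fun t s => e (γ s - γ t) * w s) (fun _ => 0) (fun _ => 0) := by
  obtain ⟨δ, c, hδ, hδ1, hc, H⟩ := h.exists_chord_bounds
  obtain ⟨M, hM, -, hlip, -⟩ := h.exists_taylor
  obtain ⟨B, hB⟩ := he
  obtain ⟨C, hC⟩ := hw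
  have hC0 := (norm_nonneg _).trans (hC 0)
  refine HasSingularExpansion.of_bound (C := |B| * (1 + |log c| + |log M|) * C)
    (δ := min δ M⁻¹) (by positivity) fun t σ h0 hσ => ?_
  have hσ0 := abs_pos.2 h0
  obtain ⟨h1, -⟩ := H t σ h0 (hσ.trans (min_le_left _ _))
  have h2 := hlip t σ
  set r := γ (t + σ) - γ t
  have hr0 := (mul_pos hc hσ0).trans_le h1
  have hr1 := h2.trans (by
    calc M * |σ| ≤ M * M⁻¹ := by gcongr; exact hσ.trans (min_le_right _ _)
      _ = 1 := mul_inv_cancel₀ hM.ne')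
  have l1 : log c + log σ ≤ log ‖r‖ := by
    rw [← Real.log_abs σ, ← log_mul hc.ne' hσ0.ne']
    exact Real.log_le_log (mul_pos hc hσ0) h1
  have l2 : log ‖r‖ ≤ log M + log σ := by
    rw [← Real.log_abs σ, ← log_mul hM.ne' hσ0.ne']; exact Real.log_le_log hr0 h2
  have l3 : |log ‖r‖| ≤ |log c| + |log M| + |log σ| := by
    rw [abs_le]; constructor
    · linarith [neg_abs_le (log c), neg_abs_le (log σ), abs_nonneg (log M)]
    · linarith [le_abs_self (log M), le_abs_self (log σ), abs_nonneg (log c)]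
  rw [norm_mul]
  calc _ ≤ |B| * (1 + |log ‖r‖|) * C := by
        refine mul_le_mul ((hB r (norm_pos_iff.1 hr0) hr1).trans ?_) (hC _) (norm_nonneg _)
          (by positivity)
        gcongr
        exact le_abs_self B
    _ ≤ |B| * ((1 + |log c| + |log M|) * (1 + |log σ|)) * C := by
        gcongr
        nlinarith [abs_nonneg (log c), abs_nonneg (log M), abs_nonneg (log σ)]
    _ = _ := by ring

end IsRegularCurve

/-! ### The finite part of a flux that is homogeneous of degree minus two -/

namespace SmoothDomain

variable {D : SmoothDomain} {i : Fin D.numCurves} {a t b : ℝ}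

/-- The integral over the rest of the boundary of a function that has a primitive along it. -/
lemma lineIntegral_compl_arc_eq_sub (ht : t ∈ Ioo a b) (hab : b - a < D.period i)
    {f G : Plane → ℂ} (hf : D.ContinuousOff (D.curve i t) f)
    (hG : ∀ j s, D.curve j s ≠ D.curve i t →
      HasDerivAt (fun s => G (D.curve j s)) (‖deriv (D.curve j) s‖ • f (D.curve j s)) s) :
    D.lineIntegral (D.curve i '' Icc a b)ᶜ f = G (D.curve i a) - G (D.curve i b) := by
  have hle := ht.1.le.trans ht.2.le
  -- the fundamental theorem of calculus on a parameter interval that avoids the singular point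
  have ftc : ∀ j (c d : ℝ), c ≤ d → (∀ s ∈ Icc c d, D.curve j s ≠ D.curve i t) →
      ∫ s in c..d, ‖deriv (D.curve j) s‖ • f (D.curve j s) =
        G (D.curve j d) - G (D.curve j c) := fun j c d hcd hne => by
    refine intervalIntegral.integral_eq_sub_of_hasDerivAt
      (fun s hs => hG j s (hne s (by rwa [uIcc_of_le hcd] at hs))) ?_
    refine ContinuousOn.intervalIntegrable ?_
    rw [uIcc_of_le hcd]
    exact ((D.deriv_curve_continuous j).norm.continuousOn).smul ((hf j).mono hne)
  unfold lineIntegral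
  rw [Finset.sum_eq_single i]
  · rw [setIntegral_density f arc_isCompact.measurableSet.compl a]
    have hset : Ico a (a + D.period i) ∩ D.curve i ⁻¹' (D.curve i '' Icc a b)ᶜ =
        Ioo b (a + D.period i) := by
      rw [preimage_compl, ← sdiff_eq, ← sdiff_self_inter, Ico_inter_preimage_arc hab]; ext s
      exact ⟨fun hs => ⟨not_le.1 fun hc => hs.2 ⟨hs.1.1, hc⟩, hs.1.2⟩,
        fun hs => ⟨⟨hle.trans hs.1.le, hs.2⟩, fun hc => not_le.2 hs.1 hc.2⟩⟩
    rw [hset, ← integral_Ioc_eq_integral_Ioo, ← integral_of_le (by linarith),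
      ftc i b (a + D.period i) (by linarith), D.curve_periodic i a]
    intro s hs hc
    obtain ⟨k, hk⟩ := (D.curve_eq_iff i).1 hc
    have := int_eq_zero_of_abs_mul_lt (k := k) (T := D.period i) (by linarith [hs.2, ht.1])
      (by linarith [hs.1, ht.2])
    simp [this] at hk; linarith [hs.1, ht.2]
  · intro j _ hj
    have hne : ∀ s, D.curve j s ≠ D.curve i t := fun s hs => by
      have := curve_notMem_arc (a := t) (b := t) hj s
      simp [hs] at this
    rw [preimage_compl, preimage_arc_of_ne hj, compl_empty, inter_univ, integral_Ico_eq_integral_Ioc, ← integral_of_le (D.period_pos j).le,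
      ftc j 0 _ (D.period_pos j).le (fun s _ => hne s), (D.curve_periodic j).eq, sub_self]
  · simp

/-- The flux of a divergence-free field that is homogeneous of degree `-2` is the derivative along
the curve of the function `r ↦ r₀ F₁ - r₁ F₀`, so that its finite part over the closed curves of the
boundary vanishes. -/
lemma exists_hasCutoffFinitePart_homogeneous_two (D : SmoothDomain) (i : Fin D.numCurves) (t : ℝ)
    {F : Fin 2 → Plane → ℂ} (hs : ∀ j, ContDiffOn ℝ ∞ (F j) {0}ᶜ) (hh : ∀ j, IsHomogeneous 2 (F j))
    (hdiv : ∀ r, r ≠ 0 → ∑ j, pd j (F j) r = 0) : ∃ A, D.HasCutoffFinitePart (D.curve i t)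
      (fun y => ∑ j, F j (y - D.curve i t) * (D.normal y j : ℂ)) A 0 := by
  have hop := isOpen_punctured
  have h := D.curve_isRegularCurve i
  set γ := D.curve i with hγ
  set x := γ t with hx
  set f : Plane → ℂ := fun y => ∑ j, F j (y - x) * (D.normal y j : ℂ) with hf
  set U : Plane → ℂ := fun r => (r 0 : ℂ) * F 1 r - (r 1 : ℂ) * F 0 r with hU
  have hUs : ContDiffOn ℝ ∞ U {0}ᶜ :=
    ((contDiff_coord 0).contDiffOn.mul (hs 1)).sub ((contDiff_coord 1).contDiffOn.mul (hs 0))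
  have hUh : IsHomogeneous 1 U := fun τ r hτ hr => by
    simp only [hU, hh _ τ r hτ hr, PiLp.smul_apply, smul_eq_mul, ofReal_mul]; field_simp
  have pdU : ∀ r, r ≠ 0 → pd 0 U r = -F 1 r ∧ pd 1 U r = F 0 r := fun r hr => by
    have dF := fun j => (hs j).differentiableAt_of_isOpen hop (x := r) hr
    have dc := fun k => (contDiff_coord k).differentiable (by simp) r
    have e0 := euler_homogeneous (hh 0) hr (dF 0)
    have e1 := euler_homogeneous (hh 1) hr (dF 1)
    have ed := hdiv r hr
    rw [Fin.sum_univ_two] at ed; constructor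
    · rw [pd_sub 0 ((dc 0).fun_mul (dF 1)) ((dc 1).fun_mul (dF 0)), pd_mul 0 (dc 0) (dF 1),
        pd_mul 0 (dc 1) (dF 0), pd_coord, pd_coord]
      simp only [if_true, one_ne_zero, if_false]; linear_combination e1 - (r 1 : ℂ) * ed
    · rw [pd_sub 1 ((dc 0).fun_mul (dF 1)) ((dc 1).fun_mul (dF 0)), pd_mul 1 (dc 0) (dF 1),
        pd_mul 1 (dc 1) (dF 0), pd_coord, pd_coord]
      simp only [if_true, zero_ne_one, if_false]; linear_combination -e0 + (r 0 : ℂ) * ed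
  have hfs : ∀ j s, ‖deriv (D.curve j) s‖ • f (D.curve j s) =
      ∑ m, F m (D.curve j s - x) * (rotCW (deriv (D.curve j) s) m : ℂ) := fun j s => by
    simp only [hf, ← D.speed_smul_normal j s, smul_sum, PiLp.smul_apply, smul_eq_mul,
      real_smul, ofReal_mul]
    exact sum_congr rfl fun m _ => by ring
  have hcont : D.ContinuousOff x f := fun j => continuousOn_finsetSum _ fun m _ =>
    D.continuousOff_kernel (w := fun y => (D.normal y m : ℂ)) (hs m).continuousOn
      (fun k => D.continuous_normal_curve k m) x j
  have hG : ∀ j s, D.curve j s ≠ x → HasDerivAt (fun s => U (D.curve j s - x))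
      (‖deriv (D.curve j) s‖ • f (D.curve j s)) s := fun j s hsx => by
    have hr := sub_ne_zero.2 hsx
    have h1 := (hUs.differentiableAt_of_isOpen hop hr).hasFDerivAt.comp_hasDerivAt s
      ((D.curve_hasDerivAt j s).sub_const x)
    refine h1.congr_deriv ?_
    rw [fderiv_eq_pd, (pdU _ hr).1, (pdU _ hr).2, hfs, Fin.sum_univ_two, rotCW_zero_apply,
      rotCW_one_apply]
    push_cast; ring
  -- the expansion of the kernel along the curve
  choose bk hbk using fun j => h.exists_hasSingularExpansion_homogeneous_two (hh j) (hs j)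
    (D.isTaylorWeight_rotCW i j)
  have hk := HasSingularExpansion.sum Finset.univ hbk
  obtain ⟨β, hβ⟩ := h.exists_hasSingularExpansion_chord
  have hcl := h.hasSingularExpansion_chordLog
  have hv0 := norm_ne_zero_iff.2 (h.deriv_ne_zero t)
  have hv0' : (‖deriv γ t‖ : ℂ) ≠ 0 := ofReal_ne_zero.2 hv0
  set A : ℂ := -U (deriv γ t) * ‖deriv γ t‖ with hA
  set B : ℂ := ∑ j, bk j t - A * β t with hB
  obtain ⟨Cr, δr, hδr, -, hrem⟩ := (hk.add (hβ.bounded_mul (c := fun _ => -A)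
    ⟨_, fun _ => le_rfl⟩)).add (hcl.bounded_mul (c := fun _ => -B) ⟨_, fun _ => le_rfl⟩)
  have hrem' : ∀ σ, σ ≠ 0 → |σ| ≤ δr → ‖∑ j, F j (γ (t + σ) - x) * (rotCW (deriv γ (t + σ)) j : ℂ) -
      A * (chordLog γ t (t + σ) / signedChord γ t (t + σ) : ℝ) -
      B * (chordLog γ t (t + σ) : ℝ)‖ ≤ Cr * (1 + |log σ|) := fun σ h0 hσ => by
    refine le_of_eq_of_le ?_ (hrem t σ h0 hσ)
    congr 1
    have ea : (∑ j, F j (deriv γ t) * (rotCW (deriv γ t) j : ℂ)) = A * (‖deriv γ t‖⁻¹ : ℝ) := by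
      rw [hA, Fin.sum_univ_two, rotCW_zero_apply, rotCW_one_apply]; push_cast; field_simp
      ring
    simp only [← hγ, ea, hB]; ring
  obtain ⟨δ, c, hδ, hδ1, hc, hch⟩ := h.exists_chord_bounds
  obtain ⟨Cl, hl, hl0, hl1, hCl, hlog⟩ := exists_integral_log_le one_pos
  have hT := D.period_pos i
  set τ₀ : ℝ := min (min δ δr) (min (hl / 2) (D.period i / 4))
  have hτ₀0 : 0 < τ₀ := by positivity
  set I : ℝ → ℂ := fun τ => ∫ s in Icc (t - τ) (t + τ), (‖deriv γ s‖ • f (γ s) -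
    A * (chordLog γ t s / signedChord γ t s : ℝ) - B * (chordLog γ t s : ℝ)) with hI
  have key : ∀ τ, 0 < τ → τ ≤ τ₀ → D.HasCutoffFinitePart x f A (U (γ (t - τ) - x) - U (γ (t + τ) - x)
      + (A * ((-‖γ (t - τ) - x‖⁻¹ - ‖γ (t + τ) - x‖⁻¹ : ℝ) : ℂ) +
        B * (log (‖γ (t + τ) - x‖ / ‖γ (t - τ) - x‖) : ℝ) + I τ)) ∧
      ‖I τ‖ ≤ |Cr| * (Cl * (τ * |log τ|)) := by
    intro τ hτ hττ
    have t1 := hττ.trans ((min_le_left _ _).trans (min_le_left _ _))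
    have t2 := hττ.trans ((min_le_left _ _).trans (min_le_right _ _))
    have t3 := hττ.trans ((min_le_right _ _).trans (min_le_left _ _))
    have t4 := hττ.trans ((min_le_right _ _).trans (min_le_right _ _))
    have hmem : t ∈ Ioo (t - τ) (t + τ) := ⟨by linarith, by linarith⟩
    have hab : t + τ - (t - τ) < D.period i := by linarith
    have habs : ∀ s ∈ Icc (t - τ) (t + τ), |s - t| ≤ τ := fun s hs =>
      abs_le.2 ⟨by linarith [hs.1], by linarith [hs.2]⟩
    have hca : IsChordArc γ (t - τ) t (t + τ) := ⟨D.curve_differentiable i, hmem.1, hmem.2,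
      fun s hs hst => by
        have := (hch t (s - t) (sub_ne_zero.2 hst) ((habs s hs).trans t1)).2
        rwa [add_sub_cancel] at this⟩
    obtain ⟨li, lb⟩ := hlog τ hτ (by linarith) (t - τ) t (t + τ) (by simp) (by simp)
    have hcf : ContinuousOn (fun s => ‖deriv γ s‖ • f (γ s)) (Icc (t - τ) (t + τ) \ {t}) :=
      ((D.deriv_curve_continuous i).norm.continuousOn).smul
        ((hcont i).mono fun s hs => sub_ne_zero.1 (hca.ne hs.1 hs.2))
    obtain ⟨r1, r2⟩ := h.integrableOn_remainder hca (A := A) (B := B) (N₀ := 0) (N₁ := |Cr|) hcf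
      (fun s hs hst => by
        have := hrem' (s - t) (sub_ne_zero.2 hst) ((habs s hs).trans t2)
        rw [add_sub_cancel, ← hfs] at this; rw [zero_add]
        exact this.trans (mul_le_mul_of_nonneg_right (le_abs_self _) (by positivity))) li
    have := HasCutoffFinitePart.of_arc hmem hab hcont (A := A)
      (L := A * ((-‖γ (t - τ) - x‖⁻¹ - ‖γ (t + τ) - x‖⁻¹ : ℝ) : ℂ) +
        B * (log (‖γ (t + τ) - x‖ / ‖γ (t - τ) - x‖) : ℝ) + I τ)
      fun W hW => hca.tendsto_finitePart hW A B r1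
    rw [lineIntegral_compl_arc_eq_sub hmem hab (G := fun y => U (y - x)) hcont hG] at this
    refine ⟨this, ?_⟩
    simp only [zero_add] at r2
    calc _ ≤ ∫ s in Icc (t - τ) (t + τ), |Cr| * (1 + |log (s - t)|) :=
          norm_integral_le_of_norm_le (li.const_mul _) r2
      _ = |Cr| * ∫ s in Icc (t - τ) (t + τ), (1 + |log (s - t)|) := integral_const_mul _ _
      _ ≤ _ := by gcongr
  -- the value does not depend on the arc, and it is computed by shrinking the arc
  obtain ⟨v, hv⟩ : ∃ v, D.HasCutoffFinitePart x f A v := ⟨_, (key τ₀ hτ₀0 le_rfl).1⟩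
  have hvz : v = 0 := by
    have hZ := ((h.hasExpansion_comp (hUs.of_le two_le_infty)).add
      ((h.hasExpansion_comp (e := fun r => ((‖r‖⁻¹ : ℝ) : ℂ)) ?_).const_mul A))
    swap
    · exact ofRealCLM.contDiff.comp_contDiffOn
        ((contDiffOn_id.norm ℝ fun r hr => hr).inv fun r hr => norm_ne_zero_iff.2 hr)
    obtain ⟨b, C, δz, hδz, -, hZ⟩ := hZ
    set q : ℝ → Plane := fun σ => σ⁻¹ • (γ (t + σ) - x) with hq
    set Z : ℝ → ℂ := fun σ => U (q σ) + A * ((‖q σ‖⁻¹ : ℝ) : ℂ) with hZd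
    have hZ' : ∀ σ, σ ≠ 0 → |σ| ≤ δz → ‖Z σ - σ * b t‖ ≤ C * σ ^ 2 := fun σ h0 hσ => by
      refine le_of_eq_of_le ?_ (hZ t σ h0 hσ)
      have : U (deriv γ t) + A * ((‖deriv γ t‖⁻¹ : ℝ) : ℂ) = 0 := by
        rw [hA]; push_cast; field_simp; ring
      simp only [this, sub_zero]
      rfl
    have hne := fun σ h0 hσ => norm_pos_iff.1
      ((mul_pos hc (abs_pos.2 h0)).trans_le (hch t σ h0 hσ).1)
    have hUq : ∀ σ, σ ≠ 0 → |σ| ≤ δ → U (γ (t + σ) - x) = (σ : ℂ)⁻¹ * U (q σ) := fun σ h0 hσ => by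
      have := hUh σ (q σ) h0 (smul_ne_zero (inv_ne_zero h0) (hne σ h0 hσ))
      rwa [hq, smul_inv_smul₀ h0, pow_one] at this
    have hnq : ∀ σ, σ ≠ 0 → ‖γ (t + σ) - x‖ = |σ| * ‖q σ‖ := fun σ h0 => by
      rw [hq, norm_smul, norm_inv, norm_eq_abs, mul_inv_cancel_left₀ (abs_pos.2 h0).ne']
    have hev : ∀ᶠ τ : ℝ in 𝓝[>] 0, 0 < τ ∧ τ ≤ min τ₀ δz := by
      filter_upwards [Ioc_mem_nhdsGT (show (0 : ℝ) < min τ₀ δz by positivity)] with τ hτ using hτ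
    have l1 : Tendsto (fun τ : ℝ => -((τ : ℂ)⁻¹ * (Z (-τ) + Z τ))) (𝓝[>] 0) (𝓝 0) := by
      refine squeeze_zero_norm' (a := fun τ => 2 * C * τ) ?_ ?_
      · filter_upwards [hev] with τ ⟨h0, h1⟩
        have h2 : |τ| ≤ δz := by rw [abs_of_pos h0]; exact h1.trans (min_le_right _ _)
        have e1 := hZ' τ h0.ne' h2
        have e2 := hZ' (-τ) (neg_ne_zero.2 h0.ne') (by rwa [abs_neg])
        rw [norm_neg, norm_mul, norm_inv, norm_real, Real.norm_of_nonneg h0.le, inv_mul_le_iff₀ h0]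
        calc _ = ‖(Z (-τ) - ((-τ : ℝ) : ℂ) * b t) + (Z τ - τ * b t)‖ := by congr 1; push_cast; ring
          _ ≤ C * (-τ) ^ 2 + C * τ ^ 2 := (norm_add_le _ _).trans (add_le_add e2 e1)
          _ = _ := by ring
      · have : Tendsto (fun τ : ℝ => 2 * C * τ) (𝓝 0) (𝓝 (2 * C * 0)) := tendsto_id.const_mul _
        rw [mul_zero] at this; exact this.mono_left nhdsWithin_le_nhds
    have hq0 : Tendsto (fun σ => log ‖q σ‖) (𝓝[≠] 0) (𝓝 (log ‖deriv γ t‖)) :=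
      ((h.hasDerivAt t).tendsto_slope_zero.norm).log hv0
    have l2 : Tendsto (fun τ : ℝ => B * ((log ‖q τ‖ - log ‖q (-τ)‖ : ℝ) : ℂ)) (𝓝[>] 0) (𝓝 0) := by
      have hp : Tendsto (fun τ : ℝ => τ) (𝓝[>] 0) (𝓝[≠] 0) :=
        tendsto_id.mono_left (nhdsWithin_mono _ fun y hy => ne_of_gt hy)
      have hn : Tendsto (fun τ : ℝ => -τ) (𝓝[>] 0) (𝓝[≠] 0) := by
        refine tendsto_nhdsWithin_iff.2 ⟨?_, ?_⟩
        · have : Tendsto (fun τ : ℝ => -τ) (𝓝 0) (𝓝 (-0)) := tendsto_id.neg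
          rw [neg_zero] at this; exact this.mono_left nhdsWithin_le_nhds
        · filter_upwards [self_mem_nhdsWithin] with τ hτ using neg_ne_zero.2 (ne_of_gt hτ)
      have := ((hq0.comp hp).sub (hq0.comp hn)).ofReal.const_mul B
      simpa using this
    have l3 : Tendsto I (𝓝[>] 0) (𝓝 0) := by
      refine squeeze_zero_norm' (a := fun τ => |Cr| * (Cl * |log τ * τ|)) ?_ ?_
      · filter_upwards [hev] with τ ⟨h0, h1⟩
        refine (key τ h0 (h1.trans (min_le_left _ _))).2.trans_eq ?_
        rw [abs_mul, abs_of_pos h0, mul_comm τ]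
      · have := (tendsto_log_mul_rpow_nhdsGT_zero one_pos).abs
        simpa using (this.const_mul Cl).const_mul |Cr|
    have hlim := (l1.add l2).add l3
    rw [add_zero, add_zero] at hlim
    refine tendsto_nhds_unique (tendsto_const_nhds.congr' ?_) hlim
    filter_upwards [hev] with τ ⟨h0, h1⟩
    have hτδ : |τ| ≤ δ := by
      rw [abs_of_pos h0]
      exact h1.trans ((min_le_left _ _).trans ((min_le_left _ _).trans (min_le_left _ _)))
    have hn0 := neg_ne_zero.2 h0.ne'
    have hτδ' : |(-τ)| ≤ δ := by rwa [abs_neg]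
    have e := tendsto_nhds_unique (hv _ sharpCutoff_isCutoff)
      ((key τ h0 (h1.trans (min_le_left _ _))).1 _ sharpCutoff_isCutoff)
    have p1 : ‖q τ‖ ≠ 0 := norm_ne_zero_iff.2 (smul_ne_zero (inv_ne_zero h0.ne') (hne τ h0.ne' hτδ))
    have p2 : ‖q (-τ)‖ ≠ 0 := norm_ne_zero_iff.2 (smul_ne_zero (inv_ne_zero hn0)
      (hne (-τ) hn0 hτδ'))
    rw [e, sub_eq_add_neg t τ, hUq τ h0.ne' hτδ, hUq (-τ) hn0 hτδ', hnq τ h0.ne', hnq (-τ) hn0,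
      abs_neg, abs_of_pos h0, mul_div_mul_left _ _ h0.ne', log_div p1 p2]
    simp only [hZd]; push_cast; ring
  exact ⟨A, hvz ▸ hv⟩

end SmoothDomain

/-! ### The kernels of the layer operators -/

/-- The coefficients of the conormal derivative `u ↦ ∑_{q,m} c_{qm} ∂_m u_q`, in its component `p`
and for the normal `n`. -/
def conormalCoeff {σ : ℕ} (C : Stiffness σ) (n : Plane) (p q : Fin σ) (m : Fin 2) : ℂ :=
  ∑ j, C p j q m * (n j : ℂ)

/-- The conormal derivative, in its component `p` and for the normal `n`, of the rows of the Green's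
function: the field of a dipole at the origin. -/
def dipoleField {σ : ℕ} (M : LayerModel σ) (C : Stiffness σ) (n : Plane)
    (p l : Fin σ) (r : Plane) : ℂ :=
  ∑ q, ∑ m, conormalCoeff C n p q m * pd m (fun r => M.G r 0 l q) r

lemma sum_stress_mul_normal {σ : ℕ} (C : Stiffness σ)
    (u : Fin σ → Plane → ℂ) (n x : Plane) (p : Fin σ) :
    ∑ j, stress C u p j x * (n j : ℂ) = ∑ q, ∑ m, conormalCoeff C n p q m * pd m (u q) x := by
  simp only [stress, conormalCoeff, sum_mul]
  rw [sum_comm]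
  refine sum_congr rfl fun q _ => ?_
  rw [sum_comm]
  exact sum_congr rfl fun m _ => sum_congr rfl fun j _ => by ring

namespace IsFundamentalModel

variable {σ : ℕ} {M : LayerModel σ} {C : Stiffness σ} {kap : ℂ}
  {g₀ : Fin σ → Fin σ → Plane → ℂ} (hM : IsFundamentalModel M C kap g₀)
include hM

lemma trace1_apply (D : SmoothDomain) (u : Plane → Fin σ → ℂ) (x : Plane) (p : Fin σ) :
    M.trace1 D u x p = ∑ q, ∑ m, conormalCoeff C (D.normal x) p q m * pd m (fun y => u y q) x := by
  rw [LayerModel.trace1, hM.conormal_eq, sum_stress_mul_normal]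

lemma G_swap (x y : Plane) : M.G x y = M.G (y - x) 0 := by rw [hM.G_eq, ← hM.even, neg_sub]

lemma kerK_apply (D : SmoothDomain) (x y : Plane) (p q : Fin σ) : M.kerK D x y p q =
      ∑ j, stress C (fun l r => M.G r 0 l p) q j (y - x) * (D.normal y j : ℂ) := by
  simp only [LayerModel.kerK, Matrix.transpose_apply, LayerModel.matTrace1, LayerModel.trace1,
    hM.conormal_eq, hM.G_swap x]
  refine sum_congr rfl fun j _ => ?_
  rw [stress_comp_sub_const (fun l r => M.G r 0 l p)]

lemma kerK'_apply (D : SmoothDomain) (x y : Plane) (p q : Fin σ) :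
    M.kerK' D x y p q = -dipoleField M C (D.normal x) p q (y - x) := by
  simp only [LayerModel.kerK', LayerModel.matTrace1, hM.trace1_apply D, hM.G_eq _ y, dipoleField]
  simp only [← sum_neg_distrib]
  refine sum_congr rfl fun l _ => sum_congr rfl fun m _ => ?_
  rw [pd_comp_sub_const m (fun r => M.G r 0 l q)]
  have := pd_comp_neg m (fun r => M.G r 0 q l) (y - x)
  simp only [hM.even] at this
  simp [hM.symm _ l q]
  rw [this, neg_sub]
  ring

lemma dipoleField_isSolutionOn (n : Plane) (p : Fin σ) :
    IsSolutionOn C kap (dipoleField M C n p) {0}ᶜ :=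
  IsSolutionOn.sum isOpen_punctured fun q _ => IsSolutionOn.sum isOpen_punctured
    fun m _ => ((hM.solution q).pd isOpen_punctured m).const_mul isOpen_punctured _

lemma stress_dipoleField (n : Plane) (p q : Fin σ) (j : Fin 2) {r : Plane} (hr : r ≠ 0) :
    stress C (dipoleField M C n p) q j r = ∑ l, ∑ m, conormalCoeff C n p l m *
      pd m (stress C (fun k r => M.G r 0 k l) q j) r := by
  have hop := isOpen_punctured
  have d := fun l m k =>
    ((hM.smooth k l).pd m hop).differentiableAt_of_isOpen hop hr
  have e : dipoleField M C n p = fun k r => ∑ l, ∑ m, conormalCoeff C n p l m *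
    pd m (fun r => M.G r 0 k l) r := rfl
  rw [e, stress_sum fun l _ k => DifferentiableAt.fun_sum fun m _ => (d l m k).const_mul _]
  refine sum_congr rfl fun l _ => ?_
  rw [stress_sum fun m _ k => (d l m k).const_mul _]
  refine sum_congr rfl fun m _ => ?_
  rw [stress_const_mul _ (d l m), stress_pd hop (fun k => hM.smooth k l) m hr]

lemma kerT_apply (D : SmoothDomain) {x y : Plane} (hxy : y ≠ x) (p q : Fin σ) :
    M.kerT D x y p q = -∑ j, stress C (dipoleField M C (D.normal x) p) q j (y - x) *
      (D.normal y j : ℂ) := by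
  have hop := isOpen_punctured
  have hr := sub_ne_zero.2 hxy
  have hs : ∀ l j, DifferentiableAt ℝ (fun r => stress C (fun k r => M.G r 0 k l) q j (y - r)) x :=
    fun l j => ((contDiffOn_stress (C := C) hop (fun k => hM.smooth k l) q j).differentiableAt_of_isOpen
      hop hr).comp x (f := fun r => y - r) (by fun_prop)
  have hp : ∀ l j m, pd m (fun r => (D.normal y j : ℂ) *
      stress C (fun k r => M.G r 0 k l) q j (y - r)) x =
      -((D.normal y j : ℂ) * pd m (stress C (fun k r => M.G r 0 k l) q j) (y - x)) := fun l j m => by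
    have h1 := congrFun (pd_comp_sub_const m
      (fun r => stress C (fun k r => M.G r 0 k l) q j (-r)) y) x
    simp only [neg_sub] at h1
    rw [pd_const_mul m _ (hs l j), h1, pd_comp_neg, neg_sub, mul_neg]
  simp only [LayerModel.kerT, LayerModel.matTrace1, hM.trace1_apply D, hM.kerK_apply D,
    hM.stress_dipoleField _ p q _ hr, mul_comm _ (D.normal y _ : ℂ),
    pd_sum _ fun j _ => (hs _ j).const_mul (D.normal y j : ℂ), hp]
  simp [Fin.sum_univ_two, sum_add_distrib, mul_add, mul_neg, mul_sum, sum_neg_distrib,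
    mul_left_comm]
  ring

/-- Green's representation formula on the boundary for `K u - S γ₁ u`. -/
lemma eq_of_hasCutoffFinitePart_green (D : SmoothDomain) (i : Fin D.numCurves) (t : ℝ)
    {O : Set Plane} (hO : IsOpen O) (hΩO : closure D.Ω ⊆ O) {u : Plane → Fin σ → ℂ}
    (hu : IsSolutionOn C kap (fun l y => u y l) O) (p : Fin σ) {A v : ℂ}
    (h : D.HasCutoffFinitePart (D.curve i t) (fun y => ∑ q, M.kerK D (D.curve i t) y p q * u y q -
      ∑ q, M.G (D.curve i t) y p q * M.trace1 D u y q) A v) : v = -(1 / 2) * u (D.curve i t) p := by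
  refine h.value_eq smoothCutoff_isCutoff ((hM.tendsto_green D i t hO hΩO hu p).congr fun ε => ?_)
  congr 1
  simp [hM.kerK_apply, hM.G_swap (D.curve i t), LayerModel.trace1, hM.conormal_eq, flux,
    Fin.sum_univ_two, sub_mul, sum_mul, mul_add, add_mul, sum_sub_distrib, sum_add_distrib,
    stress_comp_sub_const (fun l r => M.G r 0 l p), hM.symm _ p]
  simp [mul_comm, mul_left_comm]

/-- The conormal derivative of Green's representation formula, for `T u - K' γ₁ u`. -/
lemma eq_of_hasCutoffFinitePart_green_conormal (D : SmoothDomain) (i : Fin D.numCurves) (t : ℝ)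
    {O : Set Plane} (hO : IsOpen O) (hΩO : closure D.Ω ⊆ O) {u : Plane → Fin σ → ℂ}
    (hu : IsSolutionOn C kap (fun l y => u y l) O) (p : Fin σ) {A v : ℂ}
    (hc : D.ContinuousOff (D.curve i t) (fun y => ∑ q, M.kerT D (D.curve i t) y p q * u y q -
      ∑ q, M.kerK' D (D.curve i t) y p q * M.trace1 D u y q))
    (h : D.HasCutoffFinitePart (D.curve i t) (fun y => ∑ q, M.kerT D (D.curve i t) y p q * u y q -
      ∑ q, M.kerK' D (D.curve i t) y p q * M.trace1 D u y q) A v) :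
    v = -(1 / 2) * M.trace1 D u (D.curve i t) p := by
  have hop := isOpen_punctured
  set x := D.curve i t
  have hd := IsDipoleField.sum (fun a : Fin σ × Fin 2 => conormalCoeff C (D.normal x) p a.1 a.2)
    fun a => hM.isDipoleField a.1 a.2
  simp only [Fintype.sum_prod_type] at hd
  set v₀ : Fin σ → Plane → ℂ := fun l r =>
    ∑ q, ∑ m, conormalCoeff C (D.normal x) p q m * pd m (g₀ l q) r
  have hconst := IsSolutionOn.const (C := C) (S := {0}ᶜ) (fun l => u x l)
  have hFh : ∀ j, IsHomogeneous 2 (flux C v₀ (fun l _ => u x l) j) := fun j => by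
    have e : flux C v₀ (fun l _ => u x l) j = fun y => ∑ k, u x k * stress C v₀ k j y := by
      ext y; simp [flux, stress_const, mul_comm]
    rw [e]; exact IsHomogeneous.sum fun k _ => (hd.homogeneous_stress k j).const_mul _
  have hFs := fun j => contDiffOn_flux (C := C) hop hd.solution₀.smooth hconst.smooth j
  obtain ⟨A₂, hA₂⟩ := D.exists_hasCutoffFinitePart_homogeneous_two i t hFs hFh
    fun r hr => hd.solution₀.div_flux_eq_zero hop hM.C_symm hconst hr
  have hc₂ : D.ContinuousOff x (fun y => ∑ j, flux C v₀ (fun l _ => u x l) j (y - x) *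
      (D.normal y j : ℂ)) := fun k => continuousOn_finsetSum _ fun j _ =>
    D.continuousOff_kernel (w := fun y => (D.normal y j : ℂ)) (hFs j).continuousOn
      (fun k => D.continuous_normal_curve k j) x k
  have h2 := (((h.add hc hc₂ hA₂).const_mul (-1)).congr fun y _ hy => ?_).value_eq
    smoothCutoff_isCutoff (hd.tendsto_green hM.C_symm D i t hO hΩO hu)
  · rw [hM.trace1_apply]
    simp only [pd]; linear_combination -h2
  · change _ = ∑ j, (flux C (fun l y => dipoleField M C (D.normal x) p l (y - x)) _ j y -
      flux C (fun l y => v₀ l (y - x)) (fun l _ => u x l) j y) * _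
    simp only [hM.kerT_apply D hy, hM.kerK'_apply, LayerModel.trace1, hM.conormal_eq, flux,
      stress_comp_sub_const, stress_const, Fin.sum_univ_two, sub_mul, sum_mul, mul_add, sum_add_distrib, neg_mul, add_mul, neg_add, sum_neg_distrib]
    simp [mul_comm, mul_left_comm]; ring

end IsFundamentalModel

/-! ### Singular expansions of the layer kernels -/

lemma IsTaylorWeight.exists_bound {w : ℝ → ℂ} (hw : IsTaylorWeight w) : ∃ B, ∀ s, ‖w s‖ ≤ B :=
  have ⟨_, B, _, _, hB, _⟩ := hw
  ⟨B, fun s => (hB s).1⟩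

lemma IsRegularCurve.exists_sub_ne_zero {γ : ℝ → Plane} (h : IsRegularCurve γ) :
    ∃ δ > 0, ∀ t σ, σ ≠ 0 → |σ| ≤ δ → γ (t + σ) - γ t ≠ 0 := by
  obtain ⟨δ, c, hδ, -, hc, H⟩ := h.exists_chord_bounds
  exact ⟨δ, hδ, fun t σ h0 hσ =>
    norm_pos_iff.1 ((mul_pos hc (abs_pos.2 h0)).trans_le (H t σ h0 hσ).1)⟩

namespace IsFundamentalModel

variable {σ : ℕ} {M : LayerModel σ} {C : Stiffness σ} {kap : ℂ}
  {g₀ : Fin σ → Fin σ → Plane → ℂ} (hM : IsFundamentalModel M C kap g₀)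
  (D : SmoothDomain) (i : Fin D.numCurves) (p q : Fin σ)
include hM

lemma hasSingularExpansion_pd {γ : ℝ → Plane} (h : IsRegularCurve γ) {w : ℝ → ℂ}
    (hw : IsTaylorWeight w) (l p : Fin σ) (m : Fin 2) :
    HasSingularExpansion (fun t s => pd m (fun r => M.G r 0 l p) (γ s - γ t) * w s) (fun _ => 0)
      (fun t => pd m (g₀ l p) (deriv γ t) * w t) := by
  obtain ⟨δ, hδ, H⟩ := h.exists_sub_ne_zero
  refine (((h.hasSingularExpansion_homogeneous_one (hM.homogeneous₀ l p m)
    ((hM.smooth₀ l p).pd m isOpen_punctured) hw).add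
    (h.hasSingularExpansion_logBounded (hM.logBounded_pd l p m) hw.exists_bound)).congr_near hδ
    fun t σ h0 hσ => ?_).congr_coeff (fun t => by simp) fun t => by simp
  rw [hM.pd_G_eq l p m (H t σ h0 hσ)]
  ring

lemma exists_hasSingularExpansion_pd_pd {γ : ℝ → Plane} (h : IsRegularCurve γ) {w : ℝ → ℂ}
    (hw : IsTaylorWeight w) (l p : Fin σ) (j m : Fin 2) : ∃ a b, HasSingularExpansion
      (fun t s => pd j (pd m (fun r => M.G r 0 l p)) (γ s - γ t) * w s) a b := by
  obtain ⟨δ, hδ, H⟩ := h.exists_sub_ne_zero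
  have hop := isOpen_punctured
  have hs := (hM.smooth₀ l p).pd m hop
  obtain ⟨b, hb⟩ := h.exists_hasSingularExpansion_homogeneous_two
    ((hM.homogeneous₀ l p m).pd hs j) (hs.pd j hop) hw
  refine ⟨_, _, (hb.add
    (h.hasSingularExpansion_logBounded (hM.logBounded_pd_pd l p m j) hw.exists_bound)).congr_near hδ
    fun t σ h0 hσ => ?_⟩
  rw [hM.pd_pd_G_eq l p j m (H t σ h0 hσ)]
  ring

lemma hasSingularExpansion_G :
    HasSingularExpansion (fun t s => M.G (D.curve i t) (D.curve i s) p q *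
      ‖deriv (D.curve i) s‖) (fun _ => 0) (fun _ => 0) := by
  simp only [hM.G_swap (D.curve i _)]
  obtain ⟨B, hB⟩ := (D.curve_isRegularCurve i).exists_bound
  exact (D.curve_isRegularCurve i).hasSingularExpansion_logBounded (hM.logBounded p q)
    (w := fun s => (‖deriv (D.curve i) s‖ : ℂ)) ⟨B, fun s => by simpa using (hB s).1⟩

/-- The coefficient of `1 / s` is the stress of the principal part in the direction of the tangent. -/
lemma hasSingularExpansion_kerK :
    HasSingularExpansion (fun t s => M.kerK D (D.curve i t) (D.curve i s) p q *
      ‖deriv (D.curve i) s‖) (fun _ => 0) (fun t => ∑ j, stress C (fun l => g₀ l p) q j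
        (deriv (D.curve i) t) * (rotCW (deriv (D.curve i) t) j : ℂ)) := by
  have h1 := HasSingularExpansion.sum Finset.univ fun j : Fin 2 =>
    HasSingularExpansion.sum Finset.univ fun l : Fin σ =>
    HasSingularExpansion.sum Finset.univ fun m : Fin 2 =>
      (hM.hasSingularExpansion_pd (D.curve_isRegularCurve i) (D.isTaylorWeight_rotCW i j) l p
        m).bounded_mul (c := fun _ => C q j l m) ⟨_, fun _ => le_rfl⟩
  refine (h1.congr_near one_pos fun t s _ _ => ?_).congr_coeff (fun t => by simp) fun t => ?_
  · simp only [hM.kerK_apply, stress, ← D.speed_smul_normal i, PiLp.smul_apply, smul_eq_mul,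
      ofReal_mul, sum_mul]
    exact sum_congr rfl fun j _ => sum_congr rfl fun l _ =>
      sum_congr rfl fun m _ => by ring
  · simp only [stress, sum_mul, mul_assoc]

omit hM in
lemma exists_norm_conormalCoeff_le (q : Fin σ) (m : Fin 2) :
    ∃ B, ∀ t, ‖conormalCoeff C (D.normal (D.curve i t)) p q m‖ ≤ B := by
  refine Function.Periodic.exists_norm_le (T := D.period i) (fun t => ?_) (D.period_pos i) ?_
  · rw [D.curve_periodic i t]
  · exact continuous_finsetSum _ fun j _ => continuous_const.mul (D.continuous_normal_curve i j)

lemma exists_hasSingularExpansion_kerK' :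
    ∃ b, HasSingularExpansion (fun t s => M.kerK' D (D.curve i t) (D.curve i s) p q *
      ‖deriv (D.curve i) s‖) (fun _ => 0) b := by
  have h1 := (HasSingularExpansion.sum Finset.univ fun l : Fin σ =>
    HasSingularExpansion.sum Finset.univ fun m : Fin 2 =>
      (hM.hasSingularExpansion_pd (D.curve_isRegularCurve i) (D.isTaylorWeight_speed i) q l
        m).bounded_mul (exists_norm_conormalCoeff_le (C := C) D i p l m)).bounded_mul
        (c := fun _ => -1) ⟨_, fun _ => le_rfl⟩
  refine ⟨_, (h1.congr_near one_pos fun t s _ _ => ?_).congr_coeff (fun t => by simp) fun t => rfl⟩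
  rw [hM.kerK'_apply, dipoleField, neg_mul, neg_one_mul, sum_mul, neg_inj]
  simp only [sum_mul, mul_assoc]

lemma exists_hasSingularExpansion_kerT :
    ∃ a b, HasSingularExpansion (fun t s => M.kerT D (D.curve i t) (D.curve i s) p q *
      ‖deriv (D.curve i) s‖) a b := by
  choose a b hab using fun (j : Fin 2) (l k : Fin σ) (m m' : Fin 2) =>
    hM.exists_hasSingularExpansion_pd_pd (D.curve_isRegularCurve i) (D.isTaylorWeight_rotCW i j)
      k l m m'
  have h1 := (HasSingularExpansion.sum Finset.univ fun j : Fin 2 =>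
    HasSingularExpansion.sum Finset.univ fun l : Fin σ =>
    HasSingularExpansion.sum Finset.univ fun m : Fin 2 =>
      (HasSingularExpansion.sum Finset.univ fun k : Fin σ =>
      HasSingularExpansion.sum Finset.univ fun m' : Fin 2 =>
      (hab j l k m m').bounded_mul (c := fun _ => C q j k m') ⟨_, fun _ => le_rfl⟩).bounded_mul
        (exists_norm_conormalCoeff_le (C := C) D i p l m)).bounded_mul
        (c := fun _ => -1) ⟨_, fun _ => le_rfl⟩
  obtain ⟨δ, hδ, H⟩ := (D.curve_isRegularCurve i).exists_sub_ne_zero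
  refine ⟨_, _, h1.congr_near hδ fun t s h0 hs => ?_⟩
  have hr := H t s h0 hs
  rw [hM.kerT_apply D (sub_ne_zero.1 hr), neg_mul, neg_one_mul, sum_mul, neg_inj]
  refine sum_congr rfl fun j _ => ?_
  rw [hM.stress_dipoleField _ p q j hr, ← D.speed_smul_normal i]
  simp only [pd_stress isOpen_punctured (fun k => hM.smooth k _) q j _ hr, sum_mul, mul_sum, PiLp.smul_apply, smul_eq_mul, ofReal_mul]
  exact sum_congr rfl fun l _ => sum_congr rfl fun m _ =>
    sum_congr rfl fun k _ => sum_congr rfl fun m' _ => by ring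

lemma continuousOff_G (x : Plane) : D.ContinuousOff x (fun y => M.G x y p q) := by
  simp only [hM.G_swap x]
  intro k
  simpa using D.continuousOff_kernel (w := fun _ => 1) (hM.smooth p q).continuousOn
    (fun _ => continuous_const) x k

lemma continuousOff_kerK (x : Plane) : D.ContinuousOff x (fun y => M.kerK D x y p q) := by
  simp only [hM.kerK_apply]
  exact fun k => continuousOn_finsetSum _ fun j _ => D.continuousOff_kernel
    (w := fun y => (D.normal y j : ℂ)) (contDiffOn_stress isOpen_punctured
      (fun l => hM.smooth l p) q j).continuousOn (fun k => D.continuous_normal_curve k j) x k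

lemma continuousOff_kerK' (x : Plane) : D.ContinuousOff x (fun y => M.kerK' D x y p q) := by
  simp only [hM.kerK'_apply]
  intro k
  have := (D.continuousOff_kernel (w := fun _ => 1)
    ((hM.dipoleField_isSolutionOn (D.normal x) p).smooth q).continuousOn
    (fun _ => continuous_const) x k).fun_neg
  simpa using this

lemma continuousOff_kerT (x : Plane) : D.ContinuousOff x (fun y => M.kerT D x y p q) := by
  have h1 : D.ContinuousOff x fun y => -∑ j, stress C (dipoleField M C (D.normal x) p) q j (y - x) *
      (D.normal y j : ℂ) := fun k => (continuousOn_finsetSum _ fun j _ => D.continuousOff_kernel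
    (w := fun y => (D.normal y j : ℂ)) (contDiffOn_stress isOpen_punctured
      (hM.dipoleField_isSolutionOn (D.normal x) p).smooth q j).continuousOn
      (fun k => D.continuous_normal_curve k j) x k).neg
  exact fun k => (h1 k).congr fun s hs => hM.kerT_apply D hs p q

end IsFundamentalModel

/-! ### The contribution of a patch -/

namespace SmoothDomain

variable {D : SmoothDomain}

lemma HasCutoffFinitePart.sum {ι : Type*} (s : Finset ι) {x : Plane} {f : ι → Plane → ℂ}
    {A v : ι → ℂ} (hc : ∀ j, D.ContinuousOff x (f j))
    (hf : ∀ j, D.HasCutoffFinitePart x (f j) (A j) (v j)) :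
    D.HasCutoffFinitePart x (fun y => ∑ j ∈ s, f j y) (∑ j ∈ s, A j) (∑ j ∈ s, v j) := by
  classical
  induction s using Finset.induction_on with
  | empty =>
    intro W _; simp [lineIntegral]
  | insert j s hj ih =>
    simp only [Finset.sum_insert hj]
    exact (hf j).add (hc j) (fun k => continuousOn_finsetSum _ fun j _ => hc j k) ih

lemma LineIntegrable.sum {ι : Type*} (s : Finset ι) {A : Set Plane} {f : ι → Plane → ℂ}
    (hf : ∀ j, D.LineIntegrable A (f j)) : D.LineIntegrable A (fun y => ∑ j ∈ s, f j y) := by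
  intro k
  simp only [smul_sum]
  exact integrable_finsetSum _ fun j _ => hf j k

lemma LineIntegrable.lineIntegral_sum {ι : Type*} (s : Finset ι) {A : Set Plane}
    {f : ι → Plane → ℂ} (hf : ∀ j, D.LineIntegrable A (f j)) :
    D.lineIntegral A (fun y => ∑ j ∈ s, f j y) = ∑ j ∈ s, D.lineIntegral A (f j) := by
  simp only [lineIntegral, smul_sum]
  rw [sum_comm]
  exact sum_congr rfl fun k _ => integral_finsetSum _ fun j _ => hf j k

/-- The data of a density along one of the curves that enter the estimates for kernels with a
singularity of order two at the point of parameter `t`: bounds for the density, its derivative at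
`t` and the second-order remainder. -/
structure IsTaylorDensity {σ : ℕ} (D : SmoothDomain) (i : Fin D.numCurves) (a t b : ℝ)
    (f : Plane → Fin σ → ℂ) (M₀ M₁ M₂ : ℝ) : Prop where
  nonneg : 0 ≤ M₀ ∧ 0 ≤ M₁ ∧ 0 ≤ M₂
  continuous : ∀ j q, Continuous fun s => f (D.curve j s) q
  bound : ∀ q, ∀ s ∈ Icc a b, ‖f (D.curve i s) q‖ ≤ M₀
  lipschitz : ∀ q, ∀ s ∈ Icc a b, ‖f (D.curve i s) q - f (D.curve i t) q‖ ≤ M₁ * |s - t|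
  taylor : ∀ q, ∃ d, ‖d‖ ≤ M₁ ∧ ∀ s ∈ Icc a b,
    ‖f (D.curve i s) q - f (D.curve i t) q - (s - t : ℝ) * d‖ ≤ M₂ * (s - t) ^ 2

/-- The kernel `N` has a cutoff finite part against all densities on the boundary, to which patches
of size `η` contribute at most a constant times `E η M₀ M₁ M₂`. -/
def HasPatchBound {σ : ℕ} (D : SmoothDomain) (κ : ℝ) (N : Plane → Plane → Matrix (Fin σ) (Fin σ) ℂ)
    (E : ℝ → ℝ → ℝ → ℝ → ℝ) (pv : Prop) : Prop :=
  ∃ C ε : ℝ, 0 ≤ C ∧ 0 < ε ∧ ∀ i η a t b, 0 < η → η < ε → b - a < D.period i →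
    t ∈ Ioo a b → IsPatchArc (D.curve i) κ η ε a t b → ∀ (f : Plane → Fin σ → ℂ) (M₀ M₁ M₂ : ℝ),
    D.IsTaylorDensity i a t b f M₀ M₁ M₂ → ∃ A L : Fin σ → ℂ,
      (pv → A = 0) ∧ ‖L‖ ≤ C * E η M₀ M₁ M₂ ∧ ∀ p, D.HasCutoffFinitePart (D.curve i t)
        (fun y => ∑ q, N (D.curve i t) y p q * f y q) (A p) (D.lineIntegral (D.curve i '' Icc a b)ᶜ
          (fun y => ∑ q, N (D.curve i t) y p q * f y q) + L p)

/-- Patch bounds for a matrix kernel follow from bounds for its entries, and the integral over the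
rest of the boundary is the one over the complement of the arc. -/
lemma HasPatchBound.of_components {σ : ℕ} {κ : ℝ} {N : Plane → Plane → Matrix (Fin σ) (Fin σ) ℂ}
    {E : ℝ → ℝ → ℝ → ℝ → ℝ} {pv : Prop} (hN : ∀ x p q, D.ContinuousOff x (fun y => N x y p q))
    (hE : ∀ η M₀ M₁ M₂, 0 < η → η < 1 → 0 ≤ M₀ → 0 ≤ M₁ → 0 ≤ M₂ → 0 ≤ E η M₀ M₁ M₂)
    (h : ∀ i p q, ∃ C h₀ δ : ℝ, 0 ≤ C ∧ 0 < h₀ ∧ h₀ ≤ 1 / 4 ∧ 0 < δ ∧ ∀ η a t b, 0 < η → η < h₀ →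
      IsPatchArc (D.curve i) κ η δ a t b → ∀ (ψ : ℝ → ℂ) (ψ₁ : ℂ) (M₀ M₁ M₂ : ℝ),
      0 ≤ M₂ → ContinuousOn ψ (Icc a b) → (∀ s ∈ Icc a b, ‖ψ s‖ ≤ M₀) → ‖ψ₁‖ ≤ M₁ →
      (∀ s ∈ Icc a b, ‖ψ s - ψ t‖ ≤ M₁ * |s - t|) →
      (∀ s ∈ Icc a b, ‖ψ s - ψ t - (s - t : ℝ) * ψ₁‖ ≤ M₂ * (s - t) ^ 2) →
      ∃ A L, (pv → A = 0) ∧ HasArcFinitePart (D.curve i) a t b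
        (fun s => N (D.curve i t) (D.curve i s) p q * ‖deriv (D.curve i) s‖ * ψ s) A L ∧
        ‖L‖ ≤ C * E η M₀ M₁ M₂) : D.HasPatchBound κ N E pv := by
  choose C h₀ δ hC hh₀ hh₁ hδ H using h
  obtain ⟨ε, hε, hεx⟩ := ((eventually_all.2 fun x : Fin D.numCurves × Fin σ × Fin σ =>
    Ioc_mem_nhdsGT (lt_min (hh₀ x.1 x.2.1 x.2.2) (hδ x.1 x.2.1 x.2.2))).and
    (Ioo_mem_nhdsGT one_pos)).exists
  refine ⟨∑ i, ∑ p, ∑ q, C i p q, ε, sum_nonneg fun i _ => sum_nonneg fun p _ =>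
    sum_nonneg fun q _ => hC i p q, hεx.1, fun i η a t b hη hηε hab ht hp f M₀ M₁ M₂ hf => ?_⟩
  obtain ⟨m0, m1, m2⟩ := hf.nonneg
  have hE0 := hE η M₀ M₁ M₂ hη (hηε.trans hεx.2) m0 m1 m2
  have key : ∀ p q, ∃ A L, (pv → A = 0) ∧ HasArcFinitePart (D.curve i) a t b
        (fun s => N (D.curve i t) (D.curve i s) p q * ‖deriv (D.curve i) s‖ * f (D.curve i s) q) A L ∧
        ‖L‖ ≤ C i p q * E η M₀ M₁ M₂ := fun p q => by
    obtain ⟨d, hd, hd'⟩ := hf.taylor q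
    exact H i p q η a t b hη (hηε.trans_le ((hε (i, p, q)).2.trans (min_le_left _ _)))
      (hp.mono ((hε (i, p, q)).2.trans (min_le_right _ _))) _ d M₀ M₁ M₂ m2
      (hf.continuous i q).continuousOn (hf.bound q) hd (hf.lipschitz q) hd'
  choose A L hA hL hLb using key
  have hcont : ∀ p q, D.ContinuousOff (D.curve i t) (fun y => N (D.curve i t) y p q * f y q) :=
    fun p q j => (hN _ p q j).mul (hf.continuous j q).continuousOn
  refine ⟨fun p => ∑ q, A p q, fun p => ∑ q, L p q, fun h0 => ?_, ?_, fun p => ?_⟩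
  · ext p
    exact Finset.sum_eq_zero fun q _ => hA p q h0
  · refine (pi_norm_le_iff_of_nonneg (mul_nonneg (sum_nonneg fun i _ =>
      sum_nonneg fun p _ => sum_nonneg fun q _ => hC i p q) hE0)).2 fun p => ?_
    refine (norm_sum_le _ _).trans ((Finset.sum_le_sum fun q _ => hLb p q).trans ?_)
    rw [← sum_mul]
    refine mul_le_mul_of_nonneg_right ?_ hE0
    refine le_trans ?_ (Finset.single_le_sum (f := fun i => ∑ p, ∑ q, C i p q) (fun i _ =>
      sum_nonneg fun p _ => sum_nonneg fun q _ => hC i p q) (Finset.mem_univ i))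
    exact Finset.single_le_sum (f := fun p => ∑ q, C i p q) (fun p _ =>
      sum_nonneg fun q _ => hC i p q) (Finset.mem_univ p)
  · rw [LineIntegrable.lineIntegral_sum _ fun q => (hcont p q).lineIntegrable_compl_arc ht hab,
      ← sum_add_distrib]
    refine HasCutoffFinitePart.sum _ (hcont p) fun q => HasCutoffFinitePart.of_arc ht hab (hcont p q) ?_
    convert hL p q using 2 with s
    rw [real_smul]; ring

lemma HasPatchBound.of_singular {σ : ℕ} {κ : ℝ} (hκ : 0 < κ)
    {N : Plane → Plane → Matrix (Fin σ) (Fin σ) ℂ}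
    (hN : ∀ x p q, D.ContinuousOff x (fun y => N x y p q))
    (hk : ∀ i p q, ∃ b, HasSingularExpansion (fun t s => N (D.curve i t) (D.curve i s) p q *
      ‖deriv (D.curve i) s‖) (fun _ => 0) b) :
    D.HasPatchBound κ N (fun η M₀ M₁ _ => M₀ + M₁ * η) True := by
  refine HasPatchBound.of_components hN (fun η M₀ M₁ M₂ hη _ _ _ _ => by positivity) fun i p q => ?_
  obtain ⟨b, hk⟩ := hk i p q
  have ⟨K, _, _, hK, _⟩ := hk
  have K0 := (norm_nonneg _).trans (hK 0).1
  obtain ⟨C₁, h₀, δ, hC, h0, h1, hδ, H⟩ :=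
    (D.curve_isRegularCurve i).exists_singular_bound hκ hk fun t =>
      (hN (D.curve i t) p q i).mul
        (continuous_ofReal.comp (D.deriv_curve_continuous i).norm).continuousOn
  refine ⟨C₁ * (1 + K), h₀, δ, by positivity, h0, h1, hδ,
    fun η a t b hη hηh hp ψ ψ₁ M₀ M₁ M₂ _ hψ hM₀ hψ₁ hM₁ _ => ?_⟩
  have m0 := (norm_nonneg _).trans (hM₀ t hp.mem)
  have m1 := (norm_nonneg _).trans hψ₁
  obtain ⟨L, hL, hLb⟩ := H η a t b hη hηh hp ψ 0 M₀ 0 (K * M₁) (by positivity) hψ hM₀ (by simp)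
    fun s hs hst => by
      have := abs_pos.2 (sub_ne_zero.2 hst)
      rw [zero_div, zero_add, mul_zero, sub_zero, norm_mul, norm_div, norm_real, norm_eq_abs]
      calc _ ≤ K / |s - t| * (M₁ * |s - t|) := by gcongr; exacts [(hK t).2, hM₁ s hs]
        _ = _ := by field_simp
  refine ⟨_, L, fun _ => by simp, hL, hLb.trans ?_⟩
  rw [mul_assoc C₁]
  refine mul_le_mul_of_nonneg_left ?_ hC
  have : 0 ≤ K * M₀ + M₁ * η := by positivity
  simp only [norm_zero, zero_mul, zero_div]
  linarith

lemma HasPatchBound.of_weaklySingular {σ : ℕ} {κ : ℝ} (hκ : 0 < κ)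
    {N : Plane → Plane → Matrix (Fin σ) (Fin σ) ℂ}
    (hN : ∀ x p q, D.ContinuousOff x (fun y => N x y p q))
    (hk : ∀ i p q, HasSingularExpansion (fun t s => N (D.curve i t) (D.curve i s) p q *
      ‖deriv (D.curve i) s‖) (fun _ => 0) (fun _ => 0)) :
    D.HasPatchBound κ N (fun η M₀ _ _ => M₀ * (η * |log η|)) True := by
  refine HasPatchBound.of_components hN (fun η M₀ M₁ M₂ hη _ _ _ _ => by positivity) fun i p q => ?_
  obtain ⟨C₁, h₀, δ, hC, h0, h1, hδ, H⟩ :=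
    (D.curve_isRegularCurve i).exists_weaklySingular_bound hκ (hk i p q) fun t =>
      (hN (D.curve i t) p q i).mul
        (continuous_ofReal.comp (D.deriv_curve_continuous i).norm).continuousOn
  refine ⟨C₁, h₀, δ, hC, h0, h1, hδ, fun η a t b hη hηh hp ψ ψ₁ M₀ M₁ M₂ _ hψ hM₀ _ _ _ => ?_⟩
  obtain ⟨-, hL, hLb⟩ := H η a t b hη hηh hp ψ M₀ hψ hM₀
  exact ⟨0, _, fun _ => rfl, hL, hLb⟩

end SmoothDomain


namespace IsFundamentalModel

variable {σ : ℕ} {M : LayerModel σ} {C : Stiffness σ} {kap : ℂ}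
  {g₀ : Fin σ → Fin σ → Plane → ℂ} (hM : IsFundamentalModel M C kap g₀)
  (D : SmoothDomain) {κ : ℝ} (hκ : 0 < κ)
include hM hκ

lemma hasPatchBound_kerT : D.HasPatchBound κ (M.kerT D)
    (fun η M₀ M₁ M₂ => M₀ / η + M₁ + M₂ * η) False := by
  refine SmoothDomain.HasPatchBound.of_components (fun x p q => hM.continuousOff_kerT D p q x)
    (fun η M₀ M₁ M₂ hη _ _ _ _ => by positivity) fun i p q => ?_
  obtain ⟨a, b, hk⟩ := hM.exists_hasSingularExpansion_kerT D i p q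
  have ⟨K, _, _, hK, _⟩ := hk
  have K0 := (norm_nonneg _).trans (hK 0).1
  obtain ⟨C₁, h₀, δ, hC, h0, h1, hδ, H⟩ :=
    (D.curve_isRegularCurve i).exists_singular_bound hκ hk fun t =>
      (hM.continuousOff_kerT D p q (D.curve i t) i).mul
        (continuous_ofReal.comp (D.deriv_curve_continuous i).norm).continuousOn
  refine ⟨C₁ * (2 + 2 * K), h₀, min δ 1, by positivity, h0, h1, by positivity,
    fun η a' t b' hη hηh hp ψ ψ₁ M₀ M₁ M₂ m2 hψ hM₀ hψ₁ _ hM₂ => ?_⟩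
  have m0 := (norm_nonneg _).trans (hM₀ t hp.mem)
  have m1 := (norm_nonneg _).trans hψ₁
  obtain ⟨L, hL, hLb⟩ := H η a' t b' hη hηh (hp.mono (min_le_left _ _)) ψ ψ₁ M₀ M₁ (2 * K * M₂)
    (by positivity) hψ hM₀ hψ₁ fun s hs hst => by
      have h3 := abs_pos.2 (sub_ne_zero.2 hst)
      have h4 := (hp.abs_sub_le hs).trans (min_le_right _ _)
      have hn : ‖a t / ((s - t : ℝ) : ℂ) ^ 2 + b t / ((s - t : ℝ) : ℂ)‖ ≤
          K / |s - t| ^ 2 + K / |s - t| := by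
        refine (norm_add_le _ _).trans ?_
        rw [norm_div, norm_div, norm_pow, norm_real, norm_eq_abs]
        gcongr
        exacts [(hK t).1, (hK t).2]
      rw [norm_mul]
      calc _ ≤ (K / |s - t| ^ 2 + K / |s - t|) * (M₂ * |s - t| ^ 2) := by
            gcongr
            rw [sq_abs]; exact hM₂ s hs
        _ = K * M₂ + K * M₂ * |s - t| := by field_simp
        _ ≤ K * M₂ + K * M₂ * 1 := by gcongr
        _ = _ := by ring
  refine ⟨_, L, False.elim, hL, hLb.trans ?_⟩
  rw [mul_assoc C₁]
  refine mul_le_mul_of_nonneg_left ?_ hC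
  have e : M₀ ≤ M₀ / η := by rw [le_div_iff₀ hη]; nlinarith
  calc _ ≤ K * M₀ / η + M₀ / η + M₁ + 2 * K * M₂ * η := by gcongr; exact (hK t).1
    _ ≤ K * M₀ / η + M₀ / η + M₁ + 2 * K * M₂ * η +
        ((1 + K) * (M₀ / η) + (1 + 2 * K) * M₁ + 2 * (M₂ * η)) :=
        le_add_of_nonneg_right (by positivity)
    _ = _ := by ring

open SmoothDomain in
lemma exists_hasCutoffFinitePart_G (i : Fin D.numCurves) (p q : Fin σ) :
    ∃ ε > 0, ∀ η a t b, 0 < η → η < ε → b - a < D.period i → t ∈ Ioo a b →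
      IsPatchArc (D.curve i) κ η ε a t b → ∀ f : Plane → ℂ,
      (∀ j, Continuous fun s => f (D.curve j s)) →
      D.LineIntegrable univ (fun y => M.G (D.curve i t) y p q * f y) ∧
      D.HasCutoffFinitePart (D.curve i t) (fun y => M.G (D.curve i t) y p q * f y) 0
        (D.lineIntegral univ (fun y => M.G (D.curve i t) y p q * f y)) := by
  obtain ⟨C₁, h₀, δ, -, hh₀, -, hδ, H⟩ :=
    (D.curve_isRegularCurve i).exists_weaklySingular_bound hκ (hM.hasSingularExpansion_G D i p q)
      fun t => (hM.continuousOff_G D p q (D.curve i t) i).mul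
        (continuous_ofReal.comp (D.deriv_curve_continuous i).norm).continuousOn
  refine ⟨min h₀ δ, lt_min hh₀ hδ, fun η a t b hη hηε hab ht hp f hf => ?_⟩
  have hcont : D.ContinuousOff (D.curve i t) (fun y => M.G (D.curve i t) y p q * f y) := fun j =>
    (hM.continuousOff_G D p q _ j).mul (hf j).continuousOn
  obtain ⟨B, hB⟩ := isCompact_Icc.exists_bound_of_continuousOn (s := Icc a b) (hf i).continuousOn
  obtain ⟨h1, h2, -⟩ := H η a t b hη (hηε.trans_le (min_le_left _ _)) (hp.mono (min_le_right _ _)) _ B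
    (hf i).continuousOn hB
  have e : (fun s => M.G (D.curve i t) (D.curve i s) p q * ‖deriv (D.curve i) s‖ *
      f (D.curve i s)) = fun s => ‖deriv (D.curve i) s‖ • (M.G (D.curve i t) (D.curve i s) p q *
      f (D.curve i s)) := by ext s; rw [real_smul]; ring
  simp only [e] at h1 h2
  have i1 := lineIntegrable_arc (f := fun y => M.G (D.curve i t) y p q * f y) hab h1
  have i2 := hcont.lineIntegrable_compl_arc ht hab
  have hu := i2.lineIntegral_union i1 arc_isCompact.measurableSet disjoint_compl_left
  have hi := i2.union i1
  rw [compl_union_self] at hu hi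
  refine ⟨hi, ?_⟩
  rw [hu, lineIntegral_arc hab]
  exact HasCutoffFinitePart.of_arc ht hab hcont h2

open SmoothDomain in
/-- The single-layer potential is also the finite part of its kernel. -/
lemma exists_hasCutoffFinitePart_opS : ∃ ε > 0, ∀ i η a t b, 0 < η → η < ε →
    b - a < D.period i → t ∈ Ioo a b → IsPatchArc (D.curve i) κ η ε a t b →
    ∀ f : Plane → Fin σ → ℂ, (∀ j q, Continuous fun s => f (D.curve j s) q) → ∀ p,
      D.HasCutoffFinitePart (D.curve i t) (fun y => ∑ q, M.G (D.curve i t) y p q * f y q) 0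
        (M.opS D f (D.curve i t) p) := by
  choose ε' hε' H using fun i p q => hM.exists_hasCutoffFinitePart_G D hκ i p q
  obtain ⟨ε, hε, hε0⟩ := ((eventually_all.2 fun x : Fin D.numCurves × Fin σ × Fin σ =>
    Ioc_mem_nhdsGT (hε' x.1 x.2.1 x.2.2)).and (Ioo_mem_nhdsGT one_pos)).exists
  refine ⟨ε, hε0.1, fun i η a t b hη hηε hab ht hp f hf p => ?_⟩
  have key := fun p q => H i p q η a t b hη (hηε.trans_le (hε (i, p, q)).2) hab ht
    (hp.mono (hε (i, p, q)).2) (fun y => f y q) fun j => hf j q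
  have hcont : ∀ q, D.ContinuousOff (D.curve i t) (fun y => M.G (D.curve i t) y p q * f y q) :=
    fun q j => (hM.continuousOff_G D p q _ j).mul (hf j q).continuousOn
  have hsum := HasCutoffFinitePart.sum Finset.univ hcont fun q => (key p q).2
  rw [Finset.sum_const_zero, ← LineIntegrable.lineIntegral_sum _ fun q => (key p q).1] at hsum
  have hint : ∀ p, D.LineIntegrable univ (fun y => (M.G (D.curve i t) y *ᵥ f y) p) := fun p =>
    LineIntegrable.sum (f := fun q y => M.G (D.curve i t) y p q * f y q) _ fun q => (key p q).1
  unfold LayerModel.opS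
  rw [LineIntegrable.lineIntegral_apply hint p]
  exact hsum

end IsFundamentalModel

/-! ### The error made by dropping a patch -/

namespace SmoothDomain

variable {D : SmoothDomain}

lemma HasCutoffFinitePart.unique {x : Plane} {f : Plane → ℂ} {A v v' : ℂ}
    (h : D.HasCutoffFinitePart x f A v) (h' : D.HasCutoffFinitePart x f A v') : v = v' :=
  tendsto_nhds_unique (h _ sharpCutoff_isCutoff) (h' _ sharpCutoff_isCutoff)

lemma continuousOff_sum_mul {σ : ℕ} {N : Plane → Matrix (Fin σ) (Fin σ) ℂ} {f : Plane → Fin σ → ℂ}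
    {x : Plane} (hN : ∀ p q, D.ContinuousOff x (fun y => N y p q))
    (hf : ∀ j q, Continuous fun s => f (D.curve j s) q) (p : Fin σ) :
    D.ContinuousOff x (fun y => ∑ q, N y p q * f y q) := fun j =>
  continuousOn_finsetSum _ fun q _ => (hN p q j).mul (hf j q).continuousOn

/-- If the integral operators with kernels `N₁` and `N₂` satisfy a boundary identity of Green's type
for the fields `Φ` with Neumann data `Ψ`, then dropping a patch changes the difference of their
values at the densities `α φ` and `β φ` only by the contributions of the patch at the densities
`α φ - Φ` and `β φ - Ψ`. -/
lemma exists_layer_error {σ : ℕ} {κ : ℝ} {N₁ N₂ : Plane → Plane → Matrix (Fin σ) (Fin σ) ℂ}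
    {E₁ E₂ : ℝ → ℝ → ℝ → ℝ → ℝ} {pv : Prop} (hc₁ : ∀ x p q, D.ContinuousOff x (fun y => N₁ x y p q))
    (hc₂ : ∀ x p q, D.ContinuousOff x (fun y => N₂ x y p q))
    (h₁ : D.HasPatchBound κ N₁ E₁ pv) (h₂ : D.HasPatchBound κ N₂ E₂ True) :
    ∃ C₁ C₂ ε : ℝ, 0 ≤ C₁ ∧ 0 ≤ C₂ ∧ 0 < ε ∧ ∀ i η a t b, 0 < η → η < ε → b - a < D.period i →
      t ∈ Ioo a b → IsPatchArc (D.curve i) κ η ε a t b →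
      ∀ (α β : ℂ) (φ Φ Ψ : Plane → Fin σ → ℂ) (u : Fin σ → ℂ) (K₀ K₁ K₂ F₀ F₁ F₂ H₀ H₁ H₂ : ℝ),
      D.IsTaylorDensity i a t b φ K₀ K₁ K₂ →
      D.IsTaylorDensity i a t b (fun y => α • φ y - Φ y) F₀ F₁ F₂ →
      D.IsTaylorDensity i a t b (fun y => β • φ y - Ψ y) H₀ H₁ H₂ →
      (∀ p A v, D.ContinuousOff (D.curve i t) (fun y => ∑ q, N₁ (D.curve i t) y p q * Φ y q -
          ∑ q, N₂ (D.curve i t) y p q * Ψ y q) →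
        D.HasCutoffFinitePart (D.curve i t) (fun y => ∑ q, N₁ (D.curve i t) y p q * Φ y q -
          ∑ q, N₂ (D.curve i t) y p q * Ψ y q) A v → v = -(1 / 2) * u p) →
      ∃ A τ k : Fin σ → ℂ, (pv → A = 0) ∧ (∀ p, D.HasCutoffFinitePart (D.curve i t)
          (fun y => ∑ q, N₁ (D.curve i t) y p q * φ y q) (A p) (τ p)) ∧
        (∀ p, D.HasCutoffFinitePart (D.curve i t)
          (fun y => ∑ q, N₂ (D.curve i t) y p q * φ y q) 0 (k p)) ∧
        ‖α • τ - β • k - (D.lineIntegral (D.curve i '' Icc a b)ᶜ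
            (fun y => N₁ (D.curve i t) y *ᵥ (α • φ y - Φ y)) -
          D.lineIntegral (D.curve i '' Icc a b)ᶜ
            (fun y => N₂ (D.curve i t) y *ᵥ (β • φ y - Ψ y)) - (1 / 2 : ℂ) • u)‖ ≤
          C₁ * E₁ η F₀ F₁ F₂ + C₂ * E₂ η H₀ H₁ H₂ := by
  obtain ⟨C₁, ε₁, hC₁, hε₁, P₁⟩ := h₁
  obtain ⟨C₂, ε₂, hC₂, hε₂, P₂⟩ := h₂
  refine ⟨C₁, C₂, min ε₁ ε₂, hC₁, hC₂, lt_min hε₁ hε₂,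
    fun i η a t b hη hηε hab ht hp α β φ Φ Ψ u K₀ K₁ K₂ F₀ F₁ F₂ H₀ H₁ H₂ hφ hF hH green => ?_⟩
  have e₁ := hηε.trans_le (min_le_left _ _)
  have e₂ := hηε.trans_le (min_le_right _ _)
  have p₁ := hp.mono (min_le_left ε₁ ε₂)
  have p₂ := hp.mono (min_le_right ε₁ ε₂)
  set x := D.curve i t with hx
  set S := (D.curve i '' Icc a b)ᶜ with hS
  obtain ⟨A, L, hA, -, hL⟩ := P₁ i η a t b hη e₁ hab ht p₁ φ K₀ K₁ K₂ hφ
  obtain ⟨A', L', hA', -, hL'⟩ := P₂ i η a t b hη e₂ hab ht p₂ φ K₀ K₁ K₂ hφ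
  obtain ⟨A₁, L₁, -, hLb₁, hL₁⟩ := P₁ i η a t b hη e₁ hab ht p₁ _ F₀ F₁ F₂ hF
  obtain ⟨A₂, L₂, -, hLb₂, hL₂⟩ := P₂ i η a t b hη e₂ hab ht p₂ _ H₀ H₁ H₂ hH
  refine ⟨A, _, _, hA, hL, fun p => by simpa only [hA' trivial, Pi.zero_apply] using hL' p, ?_⟩
  have key : ∀ p, α * (D.lineIntegral S (fun y => ∑ q, N₁ x y p q * φ y q) + L p) -
      β * (D.lineIntegral S (fun y => ∑ q, N₂ x y p q * φ y q) + L' p) -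
      (D.lineIntegral S (fun y => ∑ q, N₁ x y p q * (α • φ y - Φ y) q) -
        D.lineIntegral S (fun y => ∑ q, N₂ x y p q * (β • φ y - Ψ y) q) - 1 / 2 * u p) =
      L₁ p - L₂ p := fun p => by
    have c1 := continuousOff_sum_mul (hc₁ x) hφ.continuous p
    have c2 := continuousOff_sum_mul (hc₂ x) hφ.continuous p
    have c3 := continuousOff_sum_mul (f := fun y => α • φ y - Φ y) (hc₁ x) hF.continuous p
    have c4 := continuousOff_sum_mul (f := fun y => β • φ y - Ψ y) (hc₂ x) hH.continuous p
    have cm : ∀ (c : ℂ) (f : Plane → ℂ), D.ContinuousOff x f → D.ContinuousOff x fun y => c * f y :=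
      fun c f hf j => continuousOn_const.mul (hf j)
    have cs : ∀ f g : Plane → ℂ, D.ContinuousOff x f → D.ContinuousOff x g →
        D.ContinuousOff x fun y => f y - g y := fun f g hf hg j => (hf j).sub (hg j)
    have eq : ∀ y, α * (∑ q, N₁ x y p q * φ y q) - (∑ q, N₁ x y p q * (α • φ y - Φ y) q) -
        (β * (∑ q, N₂ x y p q * φ y q) - ∑ q, N₂ x y p q * (β • φ y - Ψ y) q) =
        ∑ q, N₁ x y p q * Φ y q - ∑ q, N₂ x y p q * Ψ y q := fun y => by
      simp only [Pi.sub_apply, Pi.smul_apply, smul_eq_mul, mul_sub, sum_sub_distrib,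
        mul_sum, mul_left_comm _ α, mul_left_comm _ β]
      ring
    have h := HasCutoffFinitePart.sub (cs _ _ (cm α _ c1) c3) (cs _ _ (cm β _ c2) c4)
      (HasCutoffFinitePart.sub (cm α _ c1) c3 ((hL p).const_mul α) (hL₁ p))
      (HasCutoffFinitePart.sub (cm β _ c2) c4 ((hL' p).const_mul β) (hL₂ p))
    have hcont := cs _ _ (cs _ _ (cm α _ c1) c3) (cs _ _ (cm β _ c2) c4)
    simp only [eq] at h hcont; linear_combination green p _ _ hcont h
  have int : ∀ (N : Plane → Plane → Matrix (Fin σ) (Fin σ) ℂ) (f : Plane → Fin σ → ℂ),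
      (∀ x p q, D.ContinuousOff x (fun y => N x y p q)) →
      (∀ j q, Continuous fun s => f (D.curve j s) q) → ∀ p,
      D.lineIntegral S (fun y => N x y *ᵥ f y) p =
        D.lineIntegral S (fun y => ∑ q, N x y p q * f y q) := fun N f hN hf p =>
    LineIntegrable.lineIntegral_apply (f := fun y => N x y *ᵥ f y)
      (fun p => (continuousOff_sum_mul (hN x) hf p).lineIntegrable_compl_arc ht hab) p
  have fin : ∀ v : Fin σ → ℂ, v = L₁ - L₂ → ‖v‖ ≤ C₁ * E₁ η F₀ F₁ F₂ + C₂ * E₂ η H₀ H₁ H₂ := by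
    rintro v rfl; exact (norm_sub_le _ _).trans (add_le_add hLb₁ hLb₂)
  refine fin _ (funext fun p => ?_)
  have i1 := int N₁ (fun y => α • φ y - Φ y) hc₁ hF.continuous p
  have i2 := int N₂ (fun y => β • φ y - Ψ y) hc₂ hH.continuous p
  simp only [Pi.sub_apply, Pi.smul_apply, smul_eq_mul] at i1 i2 ⊢
  rw [i1, i2]
  exact key p

end SmoothDomain

namespace IsFundamentalModel

variable {σ : ℕ} {M : LayerModel σ} {C : Stiffness σ} {kap : ℂ}
  {g₀ : Fin σ → Fin σ → Plane → ℂ} (hM : IsFundamentalModel M C kap g₀)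
  (D : SmoothDomain) {κ : ℝ} (hκ : 0 < κ)
include hM hκ

lemma exists_isV_error {E : ℝ → ℝ → ℝ → ℝ → ℝ} (hE : D.HasPatchBound κ (M.kerK D) E True) :
    ∃ C₁ C₂ ε : ℝ, 0 ≤ C₁ ∧ 0 ≤ C₂ ∧ 0 < ε ∧ ∀ i η a t b, 0 < η → η < ε → b - a < D.period i →
      t ∈ Ioo a b → IsPatchArc (D.curve i) κ η ε a t b →
      ∀ (α β : ℂ) (φ Φ : Plane → Fin σ → ℂ) (O : Set Plane) (K₀ K₁ K₂ F₀ F₁ F₂ H₀ H₁ H₂ : ℝ),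
      IsOpen O → closure D.Ω ⊆ O → IsSolutionOn C kap (fun l y => Φ y l) O →
      D.IsTaylorDensity i a t b φ K₀ K₁ K₂ →
      D.IsTaylorDensity i a t b (fun y => α • φ y - Φ y) F₀ F₁ F₂ →
      D.IsTaylorDensity i a t b (fun y => β • φ y - M.trace1 D Φ y) H₀ H₁ H₂ →
      ∃ v, M.IsV D α β φ (D.curve i t) v ∧
        ‖v - M.Vtilde D α β φ Φ (D.curve i '' Icc a b) (D.curve i t)‖ ≤
          C₁ * E η F₀ F₁ F₂ + C₂ * (H₀ * (η * |log η|)) := by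
  obtain ⟨C₁, C₂, ε₁, hC₁, hC₂, hε₁, H⟩ := SmoothDomain.exists_layer_error
    (N₁ := M.kerK D) (N₂ := M.G) (fun x p q => hM.continuousOff_kerK D p q x)
    (fun x p q => hM.continuousOff_G D p q x) hE
    (SmoothDomain.HasPatchBound.of_weaklySingular (D := D) hκ
      (fun x p q => hM.continuousOff_G D p q x) fun i p q => hM.hasSingularExpansion_G D i p q)
  obtain ⟨ε₂, hε₂, H₂⟩ := hM.exists_hasCutoffFinitePart_opS D hκ
  refine ⟨C₁, C₂, min ε₁ ε₂, hC₁, hC₂, lt_min hε₁ hε₂, fun i η a t b hη hηε hab ht hp α β φ Φ O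
    K₀ K₁ K₂ F₀ F₁ F₂ H₀ H₁ H₂' hO hΩO hΦ hφ hF hH => ?_⟩
  obtain ⟨A, τ, k, hA, hτ, hk, hle⟩ := H i η a t b hη (hηε.trans_le (min_le_left _ _)) hab ht
    (hp.mono (min_le_left _ _)) α β φ Φ (M.trace1 D Φ) (Φ (D.curve i t)) _ _ _ _ _ _ _ _ _ hφ hF hH
    fun p A v _ hv => hM.eq_of_hasCutoffFinitePart_green D i t hO hΩO hΦ p hv
  have hkS : k = M.opS D φ (D.curve i t) := funext fun p =>
    (hk p).unique (H₂ i η a t b hη (hηε.trans_le (min_le_right _ _)) hab ht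
      (hp.mono (min_le_right _ _)) φ hφ.continuous p)
  refine ⟨_, ⟨τ, SmoothDomain.HasCutoffFinitePart.hasPrincipalValue (fun p =>
    SmoothDomain.continuousOff_sum_mul (fun p q => hM.continuousOff_kerK D p q _) hφ.continuous p) fun p => ?_, rfl⟩, ?_⟩
  · have := hτ p
    rw [hA trivial] at this; exact this
  · rw [← hkS]
    exact hle

lemma exists_isW_error :
    ∃ C₁ C₂ ε : ℝ, 0 ≤ C₁ ∧ 0 ≤ C₂ ∧ 0 < ε ∧ ∀ i η a t b, 0 < η → η < ε → b - a < D.period i →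
      t ∈ Ioo a b → IsPatchArc (D.curve i) κ η ε a t b →
      ∀ (α β : ℂ) (φ Φ : Plane → Fin σ → ℂ) (O : Set Plane) (K₀ K₁ K₂ F₀ F₁ F₂ H₀ H₁ H₂ : ℝ),
      IsOpen O → closure D.Ω ⊆ O → IsSolutionOn C kap (fun l y => Φ y l) O →
      D.IsTaylorDensity i a t b φ K₀ K₁ K₂ →
      D.IsTaylorDensity i a t b (fun y => α • φ y - Φ y) F₀ F₁ F₂ →
      D.IsTaylorDensity i a t b (fun y => β • φ y - M.trace1 D Φ y) H₀ H₁ H₂ →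
      ∃ w, M.IsW D α β φ (D.curve i t) w ∧
        ‖w - M.Wtilde D α β φ Φ (D.curve i '' Icc a b) (D.curve i t)‖ ≤
          C₁ * (F₀ / η + F₁ + F₂ * η) + C₂ * (H₀ + H₁ * η) := by
  obtain ⟨C₁, C₂, ε, hC₁, hC₂, hε, H⟩ := SmoothDomain.exists_layer_error
    (N₁ := M.kerT D) (N₂ := M.kerK' D) (fun x p q => hM.continuousOff_kerT D p q x)
    (fun x p q => hM.continuousOff_kerK' D p q x) (hM.hasPatchBound_kerT D hκ)
    (SmoothDomain.HasPatchBound.of_singular (D := D) hκ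
      (fun x p q => hM.continuousOff_kerK' D p q x)
      fun i p q => hM.exists_hasSingularExpansion_kerK' D i p q)
  refine ⟨C₁, C₂, ε, hC₁, hC₂, hε, fun i η a t b hη hηε hab ht hp α β φ Φ O
    K₀ K₁ K₂ F₀ F₁ F₂ H₀ H₁ H₂' hO hΩO hΦ hφ hF hH => ?_⟩
  obtain ⟨A, τ, k, -, hτ, hk, hle⟩ := H i η a t b hη hηε hab ht hp α β φ Φ (M.trace1 D Φ)
    (M.trace1 D Φ (D.curve i t)) _ _ _ _ _ _ _ _ _ hφ hF hH
    fun p A v hc hv => hM.eq_of_hasCutoffFinitePart_green_conormal D i t hO hΩO hΦ p hc hv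
  exact ⟨_, ⟨τ, k, SmoothDomain.HasCutoffFinitePart.hasFinitePart (fun p =>
    SmoothDomain.continuousOff_sum_mul (fun p q => hM.continuousOff_kerT D p q _) hφ.continuous p) hτ,
    SmoothDomain.HasCutoffFinitePart.hasPrincipalValue (fun p =>
    SmoothDomain.continuousOff_sum_mul (fun p q => hM.continuousOff_kerK' D p q _) hφ.continuous p) hk, rfl⟩, hle⟩

end IsFundamentalModel

/-! ### Functions that vanish at several points of a short interval -/

/-- If a real function vanishes at `n` points of an interval, then its lower derivatives are bounded
by powers of the length of the interval times a bound for the derivative of order `n` (Rolle). -/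
lemma abs_iteratedDeriv_le_of_zeros {a b M : ℝ} (n : ℕ) : ∀ (g : ℝ → ℝ), ContDiff ℝ ∞ g →
    ∀ z : Fin n → ℝ, StrictMono z → (∀ j, z j ∈ Icc a b) → (∀ j, g (z j) = 0) →
    (∀ s ∈ Icc a b, |iteratedDeriv n g s| ≤ M) → ∀ k ≤ n, ∀ s ∈ Icc a b,
      |iteratedDeriv k g s| ≤ M * (b - a) ^ (n - k) := by
  induction n with
  | zero =>
    intro g _ z _ _ _ hM k hk s hs
    obtain rfl : k = 0 := by omega
    simpa using hM s hs
  | succ n ih =>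
    intro g hg z hz hzm hz0 hM
    have hg' := (contDiff_infty_iff_deriv.1 hg).2
    have hw : ∀ j : Fin n, ∃ w ∈ Ioo (z j.castSucc) (z j.succ), deriv g w = 0 := fun j =>
      exists_deriv_eq_zero (hz Fin.castSucc_lt_succ) hg.continuous.continuousOn (by rw [hz0, hz0])
    choose w hw hw0 using hw
    have hwm : StrictMono w := by
      intro i j hij
      calc w i < z i.succ := (hw i).2
        _ ≤ z j.castSucc := hz.monotone (by
            rw [Fin.le_def]; simp [Fin.val_succ, Fin.val_castSucc]; omega)
        _ < w j := (hw j).1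
    have h1 := ih (deriv g) hg' w hwm (fun j => ⟨(hzm _).1.trans (hw j).1.le,
      (hw j).2.le.trans (hzm _).2⟩) hw0 (fun s hs => by rw [← iteratedDeriv_succ']; exact hM s hs)
    intro k hk s hs
    cases k with
    | succ k =>
      rw [iteratedDeriv_succ', Nat.add_sub_add_right]; exact h1 k (by omega) s hs
    | zero =>
      rw [Nat.sub_zero]
      have h2 := Convex.norm_image_sub_le_of_norm_deriv_le (f := g) (C := M * (b - a) ^ n)
        (fun s _ => hg.differentiable (by simp) s)
        (fun s hs => by simpa using h1 0 (Nat.zero_le n) s hs) (convex_Icc a b) (hzm 0) hs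
      rw [hz0, sub_zero, norm_eq_abs, norm_eq_abs] at h2
      refine h2.trans ?_
      rw [pow_succ, ← mul_assoc]
      refine mul_le_mul_of_nonneg_left ?_ ((abs_nonneg _).trans (h1 0 (Nat.zero_le n) s hs |>.trans
        (by simp)))
      rw [abs_le]; constructor <;> linarith [hs.1, hs.2, (hzm 0).1, (hzm 0).2]

lemma ContinuousLinearMap.iteratedDeriv_comp {E F : Type*} [NormedAddCommGroup E] [NormedSpace ℝ E]
    [NormedAddCommGroup F] [NormedSpace ℝ F] (L : E →L[ℝ] F) {f : ℝ → E} (hf : ContDiff ℝ ∞ f)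
    (k : ℕ) : iteratedDeriv k (fun s => L (f s)) = fun s => L (iteratedDeriv k f s) := by
  ext s
  have := L.iteratedFDeriv_comp_left (hf.contDiffAt (x := s)) (i := k) (by exact_mod_cast le_top)
  change iteratedFDeriv ℝ k (L ∘ f) s _ = _
  rw [this]
  rfl

/-- A function with `n` zeros in an interval is controlled by its `n`-th derivative: by Rolle's
theorem each derivative of lower order has a zero there. -/
lemma norm_iteratedDeriv_le_of_zeros {σ n : ℕ} {a b M : ℝ} {ψ : ℝ → Fin σ → ℂ}
    (hψ : ContDiff ℝ ∞ ψ) {z : Fin n → ℝ} (hz : Function.Injective z) (hzm : ∀ j, z j ∈ Icc a b)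
    (hz0 : ∀ j, ψ (z j) = 0) (hM0 : 0 ≤ M) (hab : a ≤ b)
    (hM : ∀ s ∈ Icc a b, ‖iteratedDeriv n ψ s‖ ≤ M) {k : ℕ} (hk : k ≤ n) {s : ℝ}
    (hs : s ∈ Icc a b) : ‖iteratedDeriv k ψ s‖ ≤ 2 * M * (b - a) ^ (n - k) := by
  set S : Finset ℝ := Finset.univ.image z with hS
  have hcard : S.card = n := by rw [Finset.card_image_of_injective _ hz, Finset.card_fin]
  set z' := S.orderEmbOfFin hcard
  have hmem : ∀ j, ∃ i, z i = z' j := fun j => by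
    obtain ⟨i, -, hi⟩ := Finset.mem_image.1 (S.orderEmbOfFin_mem hcard j)
    exact ⟨i, hi⟩
  have key : ∀ L : (Fin σ → ℂ) →L[ℝ] ℝ, (∀ v, |L v| ≤ ‖v‖) →
      |L (iteratedDeriv k ψ s)| ≤ M * (b - a) ^ (n - k) := fun L hL => by
    have := abs_iteratedDeriv_le_of_zeros (a := a) (b := b) (M := M) n (fun s => L (ψ s))
      (L.contDiff.comp hψ) z' z'.strictMono (fun j => by
        obtain ⟨i, hi⟩ := hmem j; rw [← hi]; exact hzm i) (fun j => by
        obtain ⟨i, hi⟩ := hmem j; rw [← hi, hz0, map_zero])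
      (fun s hs => by rw [L.iteratedDeriv_comp hψ]; exact (hL _).trans (hM s hs)) k hk s hs
    rwa [L.iteratedDeriv_comp hψ] at this
  refine (pi_norm_le_iff_of_nonneg (by have := sub_nonneg.2 hab; positivity)).2 fun q => ?_
  have h1 := key (Complex.reCLM.comp (ContinuousLinearMap.proj q)) fun v =>
    (Complex.abs_re_le_norm _).trans (norm_le_pi_norm v q)
  have h2 := key (Complex.imCLM.comp (ContinuousLinearMap.proj q)) fun v =>
    (Complex.abs_im_le_norm _).trans (norm_le_pi_norm v q)
  calc _ ≤ _ := Complex.norm_le_abs_re_add_abs_im _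
    _ ≤ _ := add_le_add h1 h2
    _ = _ := by ring

namespace SmoothDomain

variable {D : SmoothDomain}

lemma SmoothDensity.isTaylorDensity {σ : ℕ} {f : Plane → Fin σ → ℂ} (hf : D.SmoothDensity f)
    {i : Fin D.numCurves} {a t b M₀ M₁ M₂ : ℝ} (h0 : 0 ≤ M₀) (h1 : 0 ≤ M₁) (h2 : 0 ≤ M₂)
    (ht : t ∈ Icc a b) (b0 : ∀ s ∈ Icc a b, ‖iteratedDeriv 0 (fun s => f (D.curve i s)) s‖ ≤ M₀)
    (b1 : ∀ s ∈ Icc a b, ‖iteratedDeriv 1 (fun s => f (D.curve i s)) s‖ ≤ M₁)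
    (b2 : ∀ s ∈ Icc a b, ‖iteratedDeriv 2 (fun s => f (D.curve i s)) s‖ ≤ M₂) :
    D.IsTaylorDensity i a t b f M₀ M₁ M₂ := by
  set ψ := fun s => f (D.curve i s) with hψ
  have hs := hf i
  have hs' := (contDiff_infty_iff_deriv.1 hs).2
  rw [iteratedDeriv_one] at b1
  rw [iteratedDeriv_succ', iteratedDeriv_one] at b2
  have lip : ∀ s ∈ Icc a b, ‖ψ s - ψ t‖ ≤ M₁ * |s - t| := fun s h =>
    Convex.norm_image_sub_le_of_norm_deriv_le (fun s _ => hs.differentiable (by simp) s) b1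
      (convex_Icc a b) ht h
  have lip' : ∀ s ∈ Icc a b, ‖deriv ψ s - deriv ψ t‖ ≤ M₂ * |s - t| := fun s h =>
    Convex.norm_image_sub_le_of_norm_deriv_le (fun s _ => hs'.differentiable (by simp) s) b2
      (convex_Icc a b) ht h
  refine ⟨⟨h0, h1, h2⟩, fun j q => (continuous_apply q).comp (hf j).continuous, fun q s h =>
    (norm_le_pi_norm _ q).trans (by simpa using b0 s h), fun q s h =>
    (norm_le_pi_norm (ψ s - ψ t) q).trans (lip s h), fun q => ⟨deriv ψ t q,
    (norm_le_pi_norm _ q).trans (b1 t ht), fun s h => ?_⟩⟩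
  have h3 := Convex.norm_image_sub_le_of_norm_hasDerivWithin_le
    (f := fun u => ψ u - (u - t) • deriv ψ t) (f' := fun u => deriv ψ u - deriv ψ t)
    (C := M₂ * |s - t|) (s := uIcc t s) (x := t) (y := s) (fun u _ => by
      have := (hs.differentiable (by simp) u).hasDerivAt.fun_sub
        (((hasDerivAt_id u).sub_const t).smul_const (deriv ψ t))
      rw [one_smul] at this; exact this.hasDerivWithinAt)
    (fun u hu => (lip' u (uIcc_subset_Icc ht h hu)).trans
      (mul_le_mul_of_nonneg_left (abs_sub_left_of_mem_uIcc hu) h2)) (convex_uIcc t s)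
    left_mem_uIcc right_mem_uIcc
  rw [norm_eq_abs, mul_assoc, abs_mul_abs_self, ← sq] at h3
  refine le_trans ?_ h3
  refine le_trans (le_of_eq ?_) (norm_le_pi_norm _ q)
  simp only [Pi.sub_apply, Pi.smul_apply, real_smul, hψ]
  push_cast
  ring

end SmoothDomain

/-! ### Patches and interpolants -/

namespace SmoothDomain

variable (D : SmoothDomain)

/-- Small patches are arcs to which the estimates of finite parts apply, and their parameter length is
at most a constant times their size. -/
lemma exists_patch_bounds {κ : ℝ} (hκ : 0 < κ) {ε : ℝ} (hε : 0 < ε) :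
    ∃ K h₀ : ℝ, 1 ≤ K ∧ 0 < h₀ ∧ ∀ h, 0 < h → h < h₀ → ∀ p : Patch D κ h,
      p.t ∈ Ioo p.a p.b ∧ IsPatchArc (D.curve p.i) κ h ε p.a p.t p.b ∧ p.b - p.a ≤ K * h := by
  choose δ c hδ _ hc H using fun i => (D.curve_isRegularCurve i).exists_chord_bounds
  obtain ⟨K, hK⟩ := (finite_range fun i => (c i)⁻¹).bddAbove
  have hK' : ∀ i, (c i)⁻¹ ≤ max K 1 := fun i => (hK (mem_range_self i)).trans (le_max_left _ _)
  obtain ⟨h₀, hh₀, hh₀'⟩ := ((eventually_all.2 fun i => Ioc_mem_nhdsGT (lt_min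
    (mul_pos (hc i) (hδ i)) (mul_pos (hc i) hε))).and (Ioo_mem_nhdsGT one_pos)).exists
  refine ⟨max K 1, h₀, le_max_right _ _, hh₀'.1, fun h hh hhh p => ?_⟩
  have hb1 := hhh.trans_le ((hh₀ p.i).2.trans (min_le_left _ _))
  have hb2 := hhh.trans_le ((hh₀ p.i).2.trans (min_le_right _ _))
  have hle := p.t_mem.1.trans p.t_mem.2
  have hdist : ∀ s ∈ Icc p.a p.b, ∀ u ∈ Icc p.a p.b, dist (D.curve p.i s) (D.curve p.i u) < h :=
    fun s hs u hu => (Metric.dist_le_diam_of_mem arc_isCompact.isBounded (mem_image_of_mem _ hs)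
      (mem_image_of_mem _ hu)).trans_lt p.diam_lt
  have hchord : ∀ u, 0 < u → u ≤ δ p.i → p.a + u ≤ p.b → c p.i * u < h := fun u h0 h1 h2 => by
    have h3 := (H p.i p.a u h0.ne' (by rwa [abs_of_pos h0])).1
    rw [abs_of_pos h0] at h3; exact h3.trans_lt (hdist _ ⟨by linarith, h2⟩ _ ⟨le_rfl, hle⟩)
  have hne : ∀ u, κ * h < dist (D.curve p.i p.t) (D.curve p.i u) → p.t ≠ u := fun u hu he => by
    rw [he, dist_self] at hu; linarith [mul_pos hκ hh]
  have ht : p.t ∈ Ioo p.a p.b := ⟨lt_of_le_of_ne p.t_mem.1 (hne _ p.dist_left).symm,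
    lt_of_le_of_ne p.t_mem.2 (hne _ p.dist_right)⟩
  have hlen : p.b - p.a ≤ δ p.i := by
    by_contra hlt
    exact absurd (hchord _ (hδ p.i) le_rfl (by linarith)) (by linarith)
  have hlen' := hchord _ (by linarith [ht.1, ht.2]) hlen (by linarith)
  refine ⟨ht, ⟨p.t_mem, ?_, ?_, ?_, ?_, ?_⟩, ?_⟩
  · exact (lt_of_mul_lt_mul_left (hlen'.trans hb2) (hc p.i).le).le
  · rw [← dist_eq_norm, dist_comm]; exact p.dist_left
  · exact hdist _ ⟨le_rfl, hle⟩ _ p.t_mem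
  · rw [← dist_eq_norm, dist_comm]; exact p.dist_right
  · exact hdist _ ⟨hle, le_rfl⟩ _ p.t_mem
  · calc p.b - p.a = (c p.i)⁻¹ * (c p.i * (p.b - p.a)) := (inv_mul_cancel_left₀ (hc p.i).ne' _).symm
      _ ≤ max K 1 * h := by
          have := hK' p.i
          have := (hc p.i).le
          gcongr

variable {D}

lemma SmoothDensity.exists_iteratedDeriv_bound {σ : ℕ} {φ : Plane → Fin σ → ℂ}
    (hφ : D.SmoothDensity φ) (N : ℕ) :
    ∃ B, 0 ≤ B ∧ ∀ i, ∀ k ≤ N, ∀ s, ‖iteratedDeriv k (fun s => φ (D.curve i s)) s‖ ≤ B := by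
  have hp : ∀ i k, Function.Periodic (iteratedDeriv k (fun s => φ (D.curve i s))) (D.period i) := by
    intro i k
    induction k with
    | zero => intro s; simp [D.curve_periodic i s]
    | succ k ih => rw [iteratedDeriv_succ]; exact ih.deriv_periodic
  choose B hB using fun x : Fin D.numCurves × Fin (N + 1) =>
    (hp x.1 x.2).exists_norm_le (D.period_pos x.1)
      ((hφ x.1).continuous_iteratedDeriv x.2 (by exact_mod_cast le_top))
  obtain ⟨K, hK⟩ := (finite_range B).bddAbove
  exact ⟨max K 0, le_max_right _ _, fun i k hk s => (hB (i, ⟨k, by omega⟩) s).trans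
    ((hK (mem_range_self _)).trans (le_max_left _ _))⟩

end SmoothDomain

namespace IsFundamentalModel

variable {σ : ℕ} {M : LayerModel σ} {C : Stiffness σ} {kap : ℂ}
  {g₀ : Fin σ → Fin σ → Plane → ℂ} (hM : IsFundamentalModel M C kap g₀)
include hM

lemma sourceField_isSolutionOn {L : ℕ} (z : Fin L → Plane) (c : Fin L → Fin σ → ℂ) :
    IsSolutionOn C kap (fun l y => M.sourceField z c y l) (range z)ᶜ := by
  have hop := (finite_range z).isClosed.isOpen_compl
  refine IsSolutionOn.congr hop (IsSolutionOn.sum (s := Finset.univ) hop fun j _ =>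
    IsSolutionOn.sum (s := Finset.univ) hop fun q _ => (((hM.solution q).comp_sub_const (z j)).mono
      fun y hy => ?_).const_mul hop (c j q)) fun l y _ => ?_
  · exact sub_ne_zero.2 fun h => hy ⟨j, h.symm⟩
  · simp only [LayerModel.sourceField, Finset.sum_apply, Matrix.mulVec, hM.G_eq y]
    exact sum_congr rfl fun j _ => sum_congr rfl fun q _ => mul_comm _ _

omit hM in
lemma _root_.SmoothDomain.smoothDensity_of_contDiffOn (D : SmoothDomain) {O : Set Plane}
    (hO : IsOpen O) (hΩO : closure D.Ω ⊆ O) {u : Plane → Fin σ → ℂ}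
    (hu : ∀ q, ContDiffOn ℝ ∞ (fun y => u y q) O) : D.SmoothDensity u := fun i =>
  contDiff_pi.2 fun q => contDiff_iff_contDiffAt.2 fun s =>
    ((hu q).contDiffAt (hO.mem_nhds (hΩO (frontier_subset_closure (D.curve_mem_frontier i s))))).comp s
      (D.curve_smooth i).contDiffAt

lemma smoothDensity_trace1 (D : SmoothDomain) {O : Set Plane} (hO : IsOpen O)
    (hΩO : closure D.Ω ⊆ O) {u : Plane → Fin σ → ℂ}
    (hu : ∀ q, ContDiffOn ℝ ∞ (fun y => u y q) O) : D.SmoothDensity (M.trace1 D u) := fun i =>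
  contDiff_pi.2 fun p => by
    simp only [hM.trace1_apply D]
    refine ContDiff.sum fun q _ => ContDiff.sum fun m _ => ContDiff.mul (ContDiff.sum fun j _ =>
      contDiff_const.mul (ofRealCLM.contDiff.comp (D.normal_curve_smooth i j))) ?_
    exact contDiff_iff_contDiffAt.2 fun s => (((hu q).pd m hO).contDiffAt (hO.mem_nhds (hΩO
      (frontier_subset_closure (D.curve_mem_frontier i s))))).comp s (D.curve_smooth i).contDiffAt

/-- The error estimates for a fundamental model, in terms of a rate `B` that is determined by the
singularity of the double-layer kernel. -/
lemma exists_error_bound (D : SmoothDomain) {P : ℕ} (hP : 1 ≤ P) {κ : ℝ} (hκ : 0 < κ) (α β : ℂ)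
    (c₀ c₁ : ℝ) {φ : Plane → Fin σ → ℂ} (hφ : D.SmoothDensity φ) {E : ℝ → ℝ → ℝ → ℝ → ℝ} {B : ℝ → ℝ}
    (hE : D.HasPatchBound κ (M.kerK D) E True)
    (hEB : ∀ K, 0 ≤ K → ∃ C', 0 ≤ C' ∧ ∀ h M₂, 0 < h → h < 1 / 4 →
      E h (K * h ^ P) (K * h ^ (P - 1)) M₂ ≤ C' * B h)
    (hB : ∀ h, 0 < h → h < 1 / 4 → h ^ P * (h * |log h|) ≤ B h) : ∃ C h₀ : ℝ, 0 < h₀ ∧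
      ∀ h : ℝ, 0 < h → h < h₀ →
      ∀ (p : Patch D κ h) (y : Fin P → Plane), Function.Injective y → (∀ j, y j ∈ p.arc) →
      ∀ (L : ℕ) (z : Fin L → Plane) (c : Fin L → Fin σ → ℂ),
        M.IsCollocationInterpolant D α β φ y z c → (∀ k ≤ P, ∀ s ∈ Icc p.a p.b,
          ‖iteratedDeriv k (fun s => M.sourceField z c (p.χ s)) s‖ ≤ c₀ ∧
          ‖iteratedDeriv k (fun s => M.trace1 D (M.sourceField z c) (p.χ s)) s‖ ≤ c₁) →
        (∃ v, M.IsV D α β φ p.x v ∧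
          ‖v - M.Vtilde D α β φ (M.sourceField z c) p.arc p.x‖ ≤ C * B h) ∧
        ((P = 1 → ∀ s ∈ Icc p.a p.b,
            ‖iteratedDeriv 2 (fun s => M.sourceField z c (p.χ s)) s‖ ≤ c₀) →
          ∃ w, M.IsW D α β φ p.x w ∧
            ‖w - M.Wtilde D α β φ (M.sourceField z c) p.arc p.x‖ ≤ C * h ^ (P - 1)) := by
  obtain ⟨C₁, C₂, ε₁, hC₁, hC₂, hε₁, HV⟩ := hM.exists_isV_error D hκ hE
  obtain ⟨C₃, C₄, ε₂, hC₃, hC₄, hε₂, HW⟩ := hM.exists_isW_error D hκ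
  obtain ⟨K, h₁, hK1, hh₁, HP⟩ := D.exists_patch_bounds hκ (lt_min hε₁ hε₂)
  obtain ⟨Bφ, hBφ0, hBφ⟩ := hφ.exists_iteratedDeriv_bound (P + 2)
  set N : ℝ := ‖α‖ * Bφ + ‖β‖ * Bφ + |c₀| + |c₁| with hN
  have hN0 : 0 ≤ N := by positivity
  set Q : ℝ := 2 * N * K ^ P with hQ
  have hQ0 : 0 ≤ Q := by positivity
  obtain ⟨C₅, hC₅, HE⟩ := hEB Q hQ0
  refine ⟨(C₁ * C₅ + C₂ * Q) + (C₃ * (Q + Q + (Q + N)) + C₄ * (Q + Q)),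
    min (1 / 4) (min h₁ (min ε₁ ε₂)), by positivity, fun h hh hhh p y hy hya L z c hint hbd => ?_⟩
  have hh1 := hhh.trans_le (min_le_left _ _)
  have hh2 := hhh.trans_le ((min_le_right _ _).trans (min_le_left _ _))
  have hh3 := hhh.trans_le ((min_le_right _ _).trans (min_le_right _ _))
  obtain ⟨ht, hpa, hlen⟩ := HP h hh hh2 p
  have hle := p.t_mem.1.trans p.t_mem.2
  set Φ := M.sourceField z c
  set O : Set Plane := (range z)ᶜ
  have hop := (finite_range z).isClosed.isOpen_compl
  have hΩO : closure D.Ω ⊆ O := by rintro w hw ⟨l, rfl⟩; exact hint.source_exterior l hw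
  have hsol := hM.sourceField_isSolutionOn z c
  have sΦ := D.smoothDensity_of_contDiffOn hop hΩO hsol.smooth
  have sΨ := hM.smoothDensity_trace1 D hop hΩO hsol.smooth
  -- the interpolation error of one of the two traces
  have err : ∀ (δ : ℂ) (Ψ : Plane → Fin σ → ℂ) (c' : ℝ), D.SmoothDensity Ψ → ‖δ‖ * Bφ + c' ≤ N →
      (∀ k ≤ P, ∀ s ∈ Icc p.a p.b, ‖iteratedDeriv k (fun s => Ψ (D.curve p.i s)) s‖ ≤ c') →
      (∀ j, Ψ (y j) = δ • φ (y j)) → D.SmoothDensity (fun y => δ • φ y - Ψ y) ∧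
      (∀ k ≤ P + 2, ∀ s, ‖iteratedDeriv k (fun s => Ψ (D.curve p.i s)) s‖ ≤ c' →
        ‖iteratedDeriv k (fun s => δ • φ (D.curve p.i s) - Ψ (D.curve p.i s)) s‖ ≤ N) ∧
      ∀ k ≤ P, ∀ s ∈ Icc p.a p.b,
        ‖iteratedDeriv k (fun s => δ • φ (D.curve p.i s) - Ψ (D.curve p.i s)) s‖ ≤
          Q * h ^ (P - k) := by
    intro δ Ψ c' hΨ hNle hb h0
    have sm := fun j => ((hφ j).const_smul δ).sub (hΨ j)
    have hd : ∀ k ≤ P + 2, ∀ s, ‖iteratedDeriv k (fun s => Ψ (D.curve p.i s)) s‖ ≤ c' →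
        ‖iteratedDeriv k (fun s => δ • φ (D.curve p.i s) - Ψ (D.curve p.i s)) s‖ ≤ N := by
      intro k hk s hs
      have e : iteratedDeriv k (fun s => δ • φ (D.curve p.i s) - Ψ (D.curve p.i s)) s =
          δ • iteratedDeriv k (fun s => φ (D.curve p.i s)) s -
            iteratedDeriv k (fun s => Ψ (D.curve p.i s)) s := by
        rw [iteratedDeriv_fun_sub (((hφ p.i).const_smul δ).of_le (by exact_mod_cast le_top)).contDiffAt
          ((hΨ p.i).of_le (by exact_mod_cast le_top)).contDiffAt, iteratedDeriv_fun_const_smul_field]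
      rw [e]
      refine (norm_sub_le _ _).trans (le_trans ?_ hNle)
      rw [norm_smul]
      exact add_le_add (mul_le_mul_of_nonneg_left (hBφ p.i k hk s) (norm_nonneg _)) hs
    refine ⟨sm, hd, fun k hk s hs => ?_⟩
    choose s' hs' hs'y using hya
    have := norm_iteratedDeriv_le_of_zeros (z := s') (sm p.i) (fun j j' hjj => hy (by
        rw [← hs'y j, ← hs'y j', hjj])) hs' (fun j => by
        have : D.curve p.i (s' j) = y j := hs'y j
        simp [this, h0, sub_self]) hN0 hle (fun s hs => hd P (by omega) s (hb P le_rfl s hs)) hk hs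
    calc _ ≤ _ := this
      _ ≤ 2 * N * (K * h) ^ (P - k) := by gcongr
      _ = 2 * N * K ^ (P - k) * h ^ (P - k) := by rw [mul_pow]; ring
      _ ≤ Q * h ^ (P - k) := by
          rw [hQ]
          gcongr
          omega
  obtain ⟨sf, df, bf⟩ := err α Φ c₀ sΦ (by
    rw [hN]; linarith [le_abs_self c₀, abs_nonneg c₁, mul_nonneg (norm_nonneg β) hBφ0])
    (fun k hk s hs => (hbd k hk s hs).1) hint.dirichlet
  obtain ⟨sg, dg, bg⟩ := err β (M.trace1 D Φ) c₁ sΨ (by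
    rw [hN]; linarith [le_abs_self c₁, abs_nonneg c₀, mul_nonneg (norm_nonneg α) hBφ0])
    (fun k hk s hs => (hbd k hk s hs).2) hint.neumann
  have second : ∀ f : Plane → Fin σ → ℂ, D.SmoothDensity f → ∃ M₂, 0 ≤ M₂ ∧ ∀ s ∈ Icc p.a p.b,
      ‖iteratedDeriv 2 (fun s => f (D.curve p.i s)) s‖ ≤ M₂ := fun f hf => by
    obtain ⟨M₂, hM₂⟩ := hf.exists_iteratedDeriv_bound 2
    exact ⟨M₂, hM₂.1, fun s _ => hM₂.2 p.i 2 le_rfl s⟩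
  obtain ⟨F₂, hF₂, bF₂⟩ := second _ sf
  obtain ⟨H₂, hH₂, bH₂⟩ := second _ sg
  have tφ : D.IsTaylorDensity p.i p.a p.t p.b φ Bφ Bφ Bφ := hφ.isTaylorDensity hBφ0 hBφ0 hBφ0 p.t_mem
    (fun s _ => hBφ _ _ (by omega) s) (fun s _ => hBφ _ _ (by omega) s)
    fun s _ => hBφ _ _ (by omega) s
  have hp0 : ∀ k, 0 ≤ Q * h ^ k := fun k => by positivity
  have tg := sg.isTaylorDensity (hp0 P) (hp0 (P - 1)) hH₂ p.t_mem (bg 0 (by omega)) (bg 1 hP) bH₂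
  have hPh : h ^ P = h ^ (P - 1) * h := by rw [← pow_succ, Nat.sub_add_cancel hP]
  have hBh := hB h hh hh1
  have hB0 := le_trans (by positivity) hBh
  have hq0 : 0 ≤ h ^ (P - 1) := by positivity
  constructor
  · have tf := sf.isTaylorDensity (hp0 P) (hp0 (P - 1)) hF₂ p.t_mem (bf 0 (by omega)) (bf 1 hP) bF₂
    obtain ⟨v, hv, hle⟩ := HV p.i h p.a p.t p.b hh (hh3.trans_le (min_le_left _ _)) p.length_lt ht
      (hpa.mono (min_le_left _ _)) α β φ Φ O _ _ _ _ _ _ _ _ _ hop hΩO hsol tφ tf tg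
    refine ⟨v, hv, hle.trans ?_⟩
    calc _ ≤ C₁ * (C₅ * B h) + C₂ * (Q * B h) := by
          refine add_le_add (mul_le_mul_of_nonneg_left (HE h _ hh hh1) hC₁)
            (mul_le_mul_of_nonneg_left ?_ hC₂)
          rw [mul_assoc]; exact mul_le_mul_of_nonneg_left hBh hQ0
      _ = (C₁ * C₅ + C₂ * Q) * B h := by ring
      _ ≤ _ := mul_le_mul_of_nonneg_right (le_add_of_nonneg_right (by positivity)) hB0
  · intro h2
    obtain ⟨M₂, hM₂, bM₂, hM₂h⟩ : ∃ M₂, 0 ≤ M₂ ∧ (∀ s ∈ Icc p.a p.b,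
        ‖iteratedDeriv 2 (fun s => α • φ (D.curve p.i s) - Φ (D.curve p.i s)) s‖ ≤ M₂) ∧
        M₂ * h ≤ (Q + N) * h ^ (P - 1) := by
      rcases hP.eq_or_lt with h1 | h1
      · refine ⟨N, hN0, fun s hs => df 2 (by omega) s (h2 h1.symm s hs), ?_⟩
        rw [← h1, pow_zero, mul_one]; nlinarith
      · refine ⟨Q * h ^ (P - 2), hp0 _, bf 2 h1, ?_⟩
        have : h ^ (P - 1) = h ^ (P - 2) * h := by rw [← pow_succ]; congr 1; omega
        rw [mul_assoc, ← this]
        exact mul_le_mul_of_nonneg_right (le_add_of_nonneg_right hN0) hq0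
    have tf := sf.isTaylorDensity (hp0 P) (hp0 (P - 1)) hM₂ p.t_mem (bf 0 (by omega)) (bf 1 hP) bM₂
    obtain ⟨w, hw, hle⟩ := HW p.i h p.a p.t p.b hh (hh3.trans_le (min_le_right _ _)) p.length_lt ht
      (hpa.mono (min_le_right _ _)) α β φ Φ O _ _ _ _ _ _ _ _ _ hop hΩO hsol tφ tf tg
    refine ⟨w, hw, hle.trans ?_⟩
    have e1 : Q * h ^ P / h = Q * h ^ (P - 1) := by rw [hPh]; field_simp
    have e2 : Q * h ^ (P - 1) * h ≤ Q * h ^ (P - 1) := mul_le_of_le_one_right (hp0 _) (by linarith)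
    calc _ ≤ C₃ * (Q * h ^ (P - 1) + Q * h ^ (P - 1) + (Q + N) * h ^ (P - 1)) +
          C₄ * (Q * h ^ (P - 1) + Q * h ^ (P - 1)) := by
          refine add_le_add (mul_le_mul_of_nonneg_left ?_ hC₃) (mul_le_mul_of_nonneg_left ?_ hC₄)
          · linarith
          · rw [hPh]; linarith
      _ = (C₃ * (Q + Q + (Q + N)) + C₄ * (Q + Q)) * h ^ (P - 1) := by ring
      _ ≤ _ := mul_le_mul_of_nonneg_right (le_add_of_nonneg_left (by positivity)) hq0

end IsFundamentalModel

/-! ### Power series and Hankel functions -/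

/-- The coefficients of an entire function of exponential type. -/
def IsExpType (c : ℕ → ℂ) : Prop := ∃ A B : ℝ, 0 ≤ B ∧ ∀ m, ‖c m‖ ≤ A * B ^ m / m.factorial

/-- The sum `∑ c_m ρ^m` at a real argument. -/
def seriesSum (c : ℕ → ℂ) (ρ : ℝ) : ℂ := ∑' m, c m * (ρ : ℂ) ^ m

namespace IsExpType

variable {c d : ℕ → ℂ} (hc : IsExpType c)
include hc

lemma bound_mono (h : ∀ m, ‖d m‖ ≤ (m + 1) * ‖c (m + 1)‖) : IsExpType d := by
  obtain ⟨A, B, hB, hA⟩ := hc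
  refine ⟨A * B, B, hB, fun m => (h m).trans
    ((mul_le_mul_of_nonneg_left (hA _) (by positivity)).trans_eq ?_)⟩
  rw [Nat.factorial_succ]
  push_cast
  field_simp
  ring

lemma deriv_coeff : IsExpType (fun m => (m + 1) * c (m + 1)) :=
  hc.bound_mono fun m => by rw [norm_mul]; norm_cast

lemma shift : IsExpType (fun m => c (m + 1)) :=
  hc.bound_mono fun m => le_mul_of_one_le_left (norm_nonneg _) (by linarith [m.cast_nonneg (α := ℝ)])

lemma summable (ρ : ℝ) : Summable fun m => c m * (ρ : ℂ) ^ m := by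
  obtain ⟨A, B, hB, hA⟩ := hc
  refine .of_norm_bounded ((Real.summable_pow_div_factorial (B * |ρ|)).mul_left A) fun m => ?_
  rw [norm_mul, norm_pow, norm_real, norm_eq_abs, mul_pow]
  exact (mul_le_mul_of_nonneg_right (hA m) (by positivity)).trans_eq (by ring)

lemma seriesSum_eq (ρ : ℝ) : seriesSum c ρ = c 0 + ρ * seriesSum (fun m => c (m + 1)) ρ := by
  rw [seriesSum, (hc.summable ρ).tsum_eq_zero_add, seriesSum, ← tsum_mul_left]
  simp only [pow_zero, mul_one]
  congr 2 with m
  ring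

lemma hasDerivAt (ρ : ℝ) :
    HasDerivAt (seriesSum c) (seriesSum (fun m => (m + 1) * c (m + 1)) ρ) ρ := by
  obtain ⟨A, B, hB, hA⟩ := hc.deriv_coeff
  have hu : Summable fun m : ℕ => ‖c m‖ * (m * (|ρ| + 1) ^ (m - 1)) := by
    rw [← summable_nat_add_iff 1]
    refine .of_norm_bounded ((Real.summable_pow_div_factorial (B * (|ρ| + 1))).mul_left A) fun m => ?_
    rw [Real.norm_of_nonneg (by positivity), Nat.add_sub_cancel, mul_pow]
    refine Eq.trans_le ?_ ((mul_le_mul_of_nonneg_right (hA m)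
      (by positivity : 0 ≤ (|ρ| + 1) ^ m)).trans_eq (by ring : _ = A * (B ^ m * (|ρ| + 1) ^ m / m.factorial)))
    rw [norm_mul, ← Nat.cast_succ, Complex.norm_natCast]; ring
  have := hasDerivAt_tsum_of_isPreconnected (t := ball (0 : ℝ) (|ρ| + 1))
    (g := fun m (r : ℝ) => c m * (r : ℂ) ^ m) (g' := fun m (r : ℝ) => c m * (m * (r : ℂ) ^ (m - 1)))
    hu Metric.isOpen_ball (convex_ball _ _).isPreconnected
    (fun m r _ => by simpa using (((hasDerivAt_id r).ofReal_comp).pow m).const_mul (c m))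
    (fun m r hr => by
      rw [Metric.mem_ball, dist_zero_right, norm_eq_abs] at hr
      rw [norm_mul, norm_mul, norm_pow, norm_real, norm_eq_abs, Complex.norm_natCast]
      gcongr) (y₀ := 0) (by simp; positivity) (hc.summable 0) (y := ρ) (by simp)
  refine this.congr_deriv ?_
  rw [(Summable.tsum_eq_zero_add (f := fun m => c m * (m * (ρ : ℂ) ^ (m - 1))) ?_)]
  · simp only [Nat.cast_zero, zero_mul, mul_zero, zero_add]
    congr with m
    push_cast; ring
  · rw [← summable_nat_add_iff 1]
    refine (hc.deriv_coeff.summable ρ).congr fun m => ?_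
    push_cast; ring

lemma contDiff : ContDiff ℝ ∞ (seriesSum c) := by
  suffices h : ∀ n : ℕ, ∀ c, IsExpType c → ContDiff ℝ n (seriesSum c) from
    contDiff_infty.2 fun n => h n c hc
  intro n
  induction n with
  | zero => exact fun c hc => contDiff_zero.2 (continuous_iff_continuousAt.2 fun ρ =>
      (hc.hasDerivAt ρ).continuousAt)
  | succ n ih =>
    intro c hc; rw [Nat.cast_add, Nat.cast_one, contDiff_succ_iff_deriv]
    refine ⟨fun ρ => (hc.hasDerivAt ρ).differentiableAt, by simp, ?_⟩
    rw [funext fun ρ => (hc.hasDerivAt ρ).deriv]; exact ih _ hc.deriv_coeff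

end IsExpType

lemma IsExpType.hasSum_mul_succ {c : ℕ → ℂ} (hc : IsExpType c) (ρ : ℝ) :
    HasSum (fun m : ℕ => (m + 1) * c m * (ρ : ℂ) ^ m)
      (seriesSum c ρ + ρ * seriesSum (fun m => (m + 1) * c (m + 1)) ρ) := by
  have h := (hasSum_nat_add_iff (f := fun m : ℕ => m * c m * (ρ : ℂ) ^ m) 1).1
    (((hc.deriv_coeff.summable ρ).hasSum.mul_left (ρ : ℂ)).congr_fun (fun m => by push_cast; ring))
  rw [Finset.sum_range_one, Nat.cast_zero, zero_mul, zero_mul, add_zero] at h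
  exact ((hc.summable ρ).hasSum.add h).congr_fun fun m => by ring

/-- Bessel's equation `ρ f'' + f' + s f = r`, in the variable `ρ = z² / (4 s)`, for power series. -/
lemma IsExpType.bessel_equation {c r : ℕ → ℂ} (hc : IsExpType c)
    {s : ℂ} (h : ∀ m : ℕ, (m + 1) * ((m + 1) * c (m + 1)) + s * c m = r m) (ρ : ℝ) :
    ρ * seriesSum (fun m => (m + 1) * ((↑(m + 1) + 1) * c (m + 1 + 1))) ρ +
      seriesSum (fun m => (m + 1) * c (m + 1)) ρ + s * seriesSum c ρ = seriesSum r ρ := by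
  rw [add_comm (ρ * _ : ℂ)]
  exact (((hc.deriv_coeff.hasSum_mul_succ ρ).add ((hc.summable ρ).hasSum.mul_left s)).congr_fun
    fun m => by rw [← h]; ring).tsum_eq.symm

/-- The coefficients of `J₀(z)` in powers of `ρ = z² / (4 s)`. -/
def jCoeff (s : ℝ) (m : ℕ) : ℂ := (-s) ^ m / (m.factorial : ℂ) ^ 2

/-- The coefficients of the regular part of `-π Y₀(z) / 2` in powers of `ρ = z² / (4 s)`. -/
def yCoeff (s : ℝ) (m : ℕ) : ℂ := jCoeff s m * psiSucc m

lemma jCoeff_succ (s : ℝ) (m : ℕ) : (m + 1) * ((m + 1) * jCoeff s (m + 1)) = -(s * jCoeff s m) := by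
  rw [jCoeff, jCoeff, Nat.factorial_succ]
  push_cast
  field_simp
  ring

lemma psiSucc_succ (m : ℕ) : psiSucc (m + 1) = psiSucc m + 1 / (m + 1) := by
  rw [psiSucc, psiSucc, harmonic_succ]
  push_cast
  ring

lemma jCoeff_isExpType (s : ℝ) : IsExpType (jCoeff s) := ⟨1, |s|, abs_nonneg s, fun m => by
  have h : (1 : ℝ) ≤ m.factorial := by exact_mod_cast m.factorial_pos
  simp [jCoeff, norm_pow, norm_neg, one_mul, norm_real, norm_eq_abs]
  gcongr
  exact le_self_pow₀ h two_ne_zero⟩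

lemma yCoeff_isExpType (s : ℝ) : IsExpType (yCoeff s) := by
  refine ⟨1 + |Real.eulerMascheroniConstant|, |s|, abs_nonneg s, fun m => ?_⟩
  have h : (1 : ℝ) ≤ m.factorial := by exact_mod_cast m.factorial_pos
  have hh : ∀ m : ℕ, |psiSucc m| ≤ m + |Real.eulerMascheroniConstant| := by
    intro m
    induction m with
    | zero => simp [psiSucc]
    | succ m ih =>
      have h1 : 1 / ((m : ℝ) + 1) ≤ 1 := by
        rw [div_le_one (by positivity)]
        linarith
      rw [psiSucc_succ]
      refine (abs_add_le _ _).trans ?_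
      rw [abs_of_nonneg (by positivity : 0 ≤ 1 / ((m : ℝ) + 1))]
      push_cast; linarith
  have hm : (m : ℝ) ≤ m.factorial := by exact_mod_cast m.self_le_factorial
  simp [yCoeff, jCoeff, norm_pow, norm_neg,
    norm_real, norm_eq_abs]
  have hp : |psiSucc m| ≤ (1 + |Real.eulerMascheroniConstant|) * m.factorial := by
    nlinarith [hh m, abs_nonneg Real.eulerMascheroniConstant]
  refine (mul_le_mul_of_nonneg_left hp (by positivity)).trans_eq ?_
  field_simp

lemma besselJ_zero (k r : ℝ) : (besselJ 0 (k * r) : ℂ) = seriesSum (jCoeff (k ^ 2 / 4)) (r ^ 2) := by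
  rw [besselJ, Complex.ofReal_tsum]
  congr with m
  have : (-1) ^ m * ((k : ℂ) * r / 2) ^ (2 * m) = (-(k ^ 2 / 4)) ^ m * (r ^ 2) ^ m := by
    rw [pow_mul, ← mul_pow]; ring
  rw [jCoeff]
  push_cast
  rw [add_zero, add_zero, div_mul_eq_mul_div, this]
  ring

lemma besselJ_one_term {k : ℝ} (hk : 0 < k) (r : ℝ) (m : ℕ) :
    (-1) ^ m / ((m.factorial : ℂ) * ((m + 1).factorial : ℂ)) * (k * r / 2 : ℂ) ^ (2 * m + 1) =
      -(2 * r / k) * ((m + 1) * jCoeff (k ^ 2 / 4) (m + 1) * (r ^ 2) ^ m) := by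
  have : (-1) ^ m * ((k : ℂ) * r / 2) ^ (2 * m) = (-(k ^ 2 / 4)) ^ m * (r ^ 2) ^ m := by
    rw [pow_mul, ← mul_pow]; ring
  rw [jCoeff, Nat.factorial_succ]
  push_cast
  rw [pow_succ (_ / 2), div_mul_eq_mul_div, ← mul_assoc, this, pow_succ _ m]
  field_simp
  ring

lemma besselJ_one {k : ℝ} (hk : 0 < k) (r : ℝ) : (besselJ 1 (k * r) : ℂ) =
    -(2 * r / k) * seriesSum (fun m => (m + 1) * jCoeff (k ^ 2 / 4) (m + 1)) (r ^ 2) := by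
  rw [besselJ, Complex.ofReal_tsum, seriesSum, ← tsum_mul_left]
  congr with m
  push_cast
  exact besselJ_one_term hk r m

lemma besselY_zero {k r : ℝ} (hk : 0 < k) (hr : 0 < r) : (besselY 0 (k * r) : ℂ) =
    2 / π * ((log (k / 2) + log (r ^ 2) / 2) * seriesSum (jCoeff (k ^ 2 / 4)) (r ^ 2) -
      seriesSum (yCoeff (k ^ 2 / 4)) (r ^ 2)) := by
  have hl : log (k * r / 2) = log (k / 2) + log (r ^ 2) / 2 := by
    rw [mul_div_right_comm, log_mul (by positivity) hr.ne', Real.log_pow]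
    ring
  have hy : ∑' m : ℕ, (-1 : ℂ) ^ m * (psiSucc m + psiSucc m) / (m.factorial * m.factorial) *
      (k * r / 2) ^ (2 * m) = 2 * seriesSum (yCoeff (k ^ 2 / 4)) (r ^ 2) := by
    rw [seriesSum, ← tsum_mul_left]
    congr with m
    have : (-1) ^ m * ((k : ℂ) * r / 2) ^ (2 * m) = (-(k ^ 2 / 4)) ^ m * (r ^ 2) ^ m := by
      rw [pow_mul, ← mul_pow]; ring
    rw [yCoeff, jCoeff, mul_div_assoc, mul_right_comm, this]; push_cast; ring
  rw [← besselJ_zero, besselY, hl]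
  push_cast
  simp [add_zero]
  rw [hy]
  ring

lemma besselY_one {k r : ℝ} (hk : 0 < k) (hr : 0 < r) : (besselY 1 (k * r) : ℂ) =
    -(2 * r / k) * (2 / π * ((log (k / 2) + log (r ^ 2) / 2) *
      seriesSum (fun m => (m + 1) * jCoeff (k ^ 2 / 4) (m + 1)) (r ^ 2) -
      seriesSum (fun m => (m + 1) * yCoeff (k ^ 2 / 4) (m + 1)) (r ^ 2)) +
      seriesSum (jCoeff (k ^ 2 / 4)) (r ^ 2) / (π * r ^ 2)) := by
  have hl : log (k * r / 2) = log (k / 2) + log (r ^ 2) / 2 := by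
    rw [mul_div_right_comm, log_mul (by positivity) hr.ne', Real.log_pow]
    ring
  have hj := jCoeff_isExpType (k ^ 2 / 4)
  have hy : ∑' m : ℕ, (-1 : ℂ) ^ m * (psiSucc m + psiSucc (m + 1)) /
      (m.factorial * (m + 1).factorial) * (k * r / 2) ^ (2 * m + 1) =
      -(2 * r / k) * (2 * seriesSum (fun m => (m + 1) * yCoeff (k ^ 2 / 4) (m + 1)) (r ^ 2) -
        seriesSum (fun m => jCoeff (k ^ 2 / 4) (m + 1)) (r ^ 2)) := by
    rw [seriesSum, seriesSum, ← tsum_mul_left, ← Summable.tsum_sub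
      (((yCoeff_isExpType _).deriv_coeff.summable _).mul_left 2) (hj.shift.summable _),
      ← tsum_mul_left]
    congr with m
    rw [mul_div_right_comm, mul_right_comm, besselJ_one_term hk, yCoeff, psiSucc_succ]
    push_cast; field_simp; ring
  have h0 : jCoeff (k ^ 2 / 4) 0 = 1 := by simp [jCoeff]
  have hr' : (r : ℂ) ≠ 0 := by exact_mod_cast hr.ne'
  rw [hj.seriesSum_eq, h0, besselY, hl]
  push_cast
  rw [hy, besselJ_one hk]
  norm_num
  field_simp
  ring

/-- A decomposition `H₀(k √ρ) = a(ρ) + b(ρ) log ρ` with smooth `a` and `b`, where `b` has the Taylor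
expansion `b = b₀ + ρ (b₀' + ρ b₂)`. -/
structure IsHankelProfile (k : ℝ) (a b b₁ b₂ : ℝ → ℂ) : Prop where
  smooth : ContDiff ℝ ∞ a ∧ ContDiff ℝ ∞ b ∧ ContDiff ℝ ∞ b₁ ∧ ContDiff ℝ ∞ b₂
  b_eq : ∀ ρ, b ρ = Complex.I / π + ρ * b₁ ρ
  b₁_eq : ∀ ρ, b₁ ρ = -(Complex.I / π * (k ^ 2 / 4)) + ρ * b₂ ρ
  hankel : ∀ r, 0 < r → hankel1 0 (k * r) = a (r ^ 2) + log (r ^ 2) * b (r ^ 2)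
  hankel_deriv : ∀ r, 0 < r → hankel1 1 (k * r) = -(2 * r / k) *
    (deriv a (r ^ 2) + log (r ^ 2) * deriv b (r ^ 2) + b (r ^ 2) / (r ^ 2 : ℝ))
  equation_b : ∀ ρ, 4 * (ρ * deriv (deriv b) ρ + deriv b ρ) + k ^ 2 * b ρ = 0
  equation_a : ∀ ρ, 4 * (ρ * deriv (deriv a) ρ + deriv a ρ) + k ^ 2 * a ρ + 8 * deriv b ρ = 0

lemma exists_isHankelProfile {k : ℝ} (hk : 0 < k) : ∃ a b b₁ b₂, IsHankelProfile k a b b₁ b₂ := by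
  have hj := jCoeff_isExpType (k ^ 2 / 4)
  have hy := yCoeff_isExpType (k ^ 2 / 4)
  set f := seriesSum (jCoeff (k ^ 2 / 4)) with hf
  set y := seriesSum (yCoeff (k ^ 2 / 4)) with hy'
  set A : ℂ := 1 + 2 * Complex.I / π * log (k / 2)
  set B : ℂ := 2 * Complex.I / π with hB
  have ha : deriv (fun ρ => A * f ρ - B * y ρ) = fun ρ =>
      A * seriesSum (fun m => (m + 1) * jCoeff (k ^ 2 / 4) (m + 1)) ρ -
      B * seriesSum (fun m => (m + 1) * yCoeff (k ^ 2 / 4) (m + 1)) ρ := funext fun ρ =>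
    (((hj.hasDerivAt ρ).const_mul A).sub ((hy.hasDerivAt ρ).const_mul B)).deriv
  have hb : deriv (fun ρ => Complex.I / π * f ρ) = fun ρ =>
      Complex.I / π * seriesSum (fun m => (m + 1) * jCoeff (k ^ 2 / 4) (m + 1)) ρ :=
    funext fun ρ => ((hj.hasDerivAt ρ).const_mul _).deriv
  have ej := hj.bessel_equation (s := (k ^ 2 / 4 : ℝ)) (r := 0)
    (fun m => by rw [jCoeff_succ, neg_add_cancel, Pi.zero_apply])
  have ey := hy.bessel_equation (s := (k ^ 2 / 4 : ℝ))
    (r := fun m => (m + 1) * jCoeff (k ^ 2 / 4) (m + 1)) fun m => by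
      have h : (m + 1 : ℂ) ≠ 0 := by exact_mod_cast m.succ_ne_zero
      have := jCoeff_succ (k ^ 2 / 4) m
      rw [yCoeff, yCoeff, psiSucc_succ]; push_cast at this ⊢
      linear_combination (psiSucc m : ℂ) * this +
        (m + 1) * jCoeff (k ^ 2 / 4) (m + 1) * mul_one_div_cancel h
  refine ⟨fun ρ => A * f ρ - B * y ρ, fun ρ => Complex.I / π * f ρ,
    fun ρ => Complex.I / π * seriesSum (fun m => jCoeff (k ^ 2 / 4) (m + 1)) ρ,
    fun ρ => Complex.I / π * seriesSum (fun m => jCoeff (k ^ 2 / 4) (m + 1 + 1)) ρ,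
    ⟨(contDiff_const.mul hj.contDiff).sub (contDiff_const.mul hy.contDiff),
      contDiff_const.mul hj.contDiff, contDiff_const.mul hj.shift.contDiff,
      contDiff_const.mul hj.shift.shift.contDiff⟩, fun ρ => ?_, fun ρ => ?_, fun r hr => ?_,
    fun r hr => ?_, fun ρ => ?_, fun ρ => ?_⟩
  · rw [hf, hj.seriesSum_eq]
    simp [jCoeff]; ring
  · rw [hj.shift.seriesSum_eq]
    simp [jCoeff]; ring
  · rw [hankel1, besselJ_zero, besselY_zero hk hr]
    ring
  · rw [hankel1, besselJ_one hk, besselY_one hk hr, ha, hb]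
    push_cast; ring
  · rw [hb, ((hj.deriv_coeff.hasDerivAt ρ).const_mul _).deriv]
    have e := ej ρ
    simp [seriesSum, zero_mul, tsum_zero] at e; simp only [hf, seriesSum]
    push_cast at e ⊢; linear_combination 4 * (Complex.I / π) * e
  · rw [ha, hb, (((hj.deriv_coeff.hasDerivAt ρ).const_mul A).fun_sub
      ((hy.deriv_coeff.hasDerivAt ρ).const_mul B)).deriv]
    have e := ej ρ
    have e' := ey ρ
    simp [seriesSum, zero_mul, tsum_zero] at e e'
    simp only [hf, hy', seriesSum]; push_cast at e e' ⊢
    linear_combination (exp := 1) 4 * A * e - 4 * B * e' + 4 * hB * ∑' m : ℕ,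
      (m + 1) * jCoeff (k ^ 2 / 4) (m + 1) * (ρ : ℂ) ^ m

/-! ### Radial functions and logarithmic expansions -/

/-- The logarithm of the square of the distance to the origin. -/
def logSq (x : Plane) : ℂ := (log (‖x‖ ^ 2) : ℂ)

lemma pd_radial {F : ℝ → ℂ} {F' : ℂ} {x : Plane} (hF : HasDerivAt F F' (‖x‖ ^ 2)) (m : Fin 2) :
    pd m (fun y => F (‖y‖ ^ 2)) x = 2 * x m * F' := by
  have h := (hF.hasFDerivAt.comp x (hasStrictFDerivAt_norm_sq x).hasFDerivAt).fderiv
  rw [pd, show (fun y : Plane => F (‖y‖ ^ 2)) = F ∘ fun y => ‖y‖ ^ 2 from rfl, h]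
  simp [EuclideanSpace.inner_single_right, mul_assoc]

lemma ContDiff.radial {F : ℝ → ℂ} (hF : ContDiff ℝ ∞ F) :
    ContDiff ℝ ∞ fun y : Plane => F (‖y‖ ^ 2) := hF.comp (contDiff_norm_sq ℝ)

lemma norm_sq_ne_zero {x : Plane} (hx : x ∈ ({0}ᶜ : Set Plane)) : ‖x‖ ^ 2 ≠ 0 :=
  pow_ne_zero 2 (norm_ne_zero_iff.2 hx)

lemma logSq_smooth : ContDiffOn ℝ ∞ logSq {0}ᶜ := fun x hx =>
  (ofRealCLM.contDiff.contDiffAt.comp x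
    ((contDiff_norm_sq ℝ).contDiffAt.log (norm_sq_ne_zero hx))).contDiffWithinAt

lemma hasDerivAt_ofReal_log {ρ : ℝ} (hρ : ρ ≠ 0) :
    HasDerivAt (fun ρ : ℝ => (log ρ : ℂ)) ((ρ : ℂ)⁻¹) ρ := by
  simpa using (Real.hasDerivAt_log hρ).ofReal_comp

lemma pd_logSq {x : Plane} (hx : x ∈ ({0}ᶜ : Set Plane)) (m : Fin 2) :
    pd m logSq x = 2 * x m * ((‖x‖ ^ 2 : ℝ) : ℂ)⁻¹ :=
  pd_radial (hasDerivAt_ofReal_log (norm_sq_ne_zero hx)) m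

lemma isHomogeneous_pd_logSq (m : Fin 2) : IsHomogeneous 1 (pd m logSq) := fun t r ht hr => by
  rw [pd_logSq hr, pd_logSq (smul_ne_zero ht hr), norm_smul, mul_pow, norm_eq_abs, sq_abs,
    PiLp.smul_apply, smul_eq_mul]
  push_cast
  field_simp

lemma exists_bound_of_contDiff {v : Plane → ℂ} (hv : ContDiff ℝ ∞ v) :
    ∃ B, 0 ≤ B ∧ ∀ x, ‖x‖ ≤ 1 → ‖v x‖ ≤ B := by
  obtain ⟨B, hB⟩ := (isCompact_closedBall (0 : Plane) 1).exists_bound_of_continuousOn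
    hv.continuous.continuousOn
  have h0 := hB 0 (by simp)
  exact ⟨B, (norm_nonneg _).trans h0, fun x hx => hB x (by simpa using hx)⟩

lemma exists_bound_mul_norm_of_contDiff {v : Plane → ℂ} (hv : ContDiff ℝ ∞ v) (h0 : v 0 = 0) :
    ∃ B, 0 ≤ B ∧ ∀ x, ‖x‖ ≤ 1 → ‖v x‖ ≤ B * ‖x‖ := by
  obtain ⟨B, hB⟩ := (isCompact_closedBall (0 : Plane) 1).exists_bound_of_continuousOn
    (hv.continuous_fderiv (by simp)).continuousOn
  have hB0 := hB 0 (by simp)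
  refine ⟨B, (norm_nonneg _).trans hB0, fun x hx => ?_⟩
  have := (convex_closedBall (0 : Plane) 1).norm_image_sub_le_of_norm_fderiv_le
    (fun y _ => hv.contDiffAt.differentiableAt (by simp)) hB (by simp : (0 : Plane) ∈ _)
    (by simpa using hx : x ∈ _)
  simpa [h0] using this

lemma contDiff_quadratic {X Y : Plane → ℂ} (hX : ContDiff ℝ ∞ X) (hY : ContDiff ℝ ∞ Y) (a b : Fin 2) :
    ContDiff ℝ ∞ fun x => (‖x‖ ^ 2 : ℝ) * X x + x a * x b * Y x :=
  ((ofRealCLM.contDiff.comp (contDiff_norm_sq ℝ)).mul hX).add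
    (((contDiff_coord a).mul (contDiff_coord b)).mul hY)

lemma exists_quadratic_bound {X Y : Plane → ℂ} (hX : ContDiff ℝ ∞ X) (hY : ContDiff ℝ ∞ Y)
    (a b : Fin 2) : ∃ B, 0 ≤ B ∧ ∀ x : Plane, ‖x‖ ≤ 1 →
      ‖(‖x‖ ^ 2 : ℝ) * X x + x a * x b * Y x‖ ≤ B * ‖x‖ ^ 2 := by
  obtain ⟨B, hB0, hB⟩ := exists_bound_of_contDiff hX
  obtain ⟨B', hB0', hB'⟩ := exists_bound_of_contDiff hY
  refine ⟨B + B', add_nonneg hB0 hB0', fun x hx => (norm_add_le _ _).trans ?_⟩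
  have h1 := PiLp.norm_apply_le x a
  have h2 := PiLp.norm_apply_le x b
  rw [norm_mul, norm_mul, norm_mul, norm_real, norm_real, norm_real, norm_pow,
    norm_norm, add_mul, sq, mul_comm B, mul_comm B']
  gcongr
  exacts [hB x hx, hB' x hx]

lemma IsLogBounded.of_le {e : Plane → ℂ} {B B' : ℝ} (hB : 0 ≤ B) (hB' : 0 ≤ B')
    (h : ∀ r, r ≠ 0 → ‖r‖ ≤ 1 → ‖e r‖ ≤ B + B' * ‖logSq r‖) : IsLogBounded e :=
  ⟨B + B' * 2, fun r h0 h1 => (h r h0 h1).trans (by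
    rw [logSq, norm_real, norm_eq_abs, Real.log_pow]; norm_num
    nlinarith [mul_nonneg hB (abs_nonneg (log ‖r‖))])⟩

lemma ContDiff.isLogBounded {s : Plane → ℂ} (hs : ContDiff ℝ ∞ s) : IsLogBounded s := by
  obtain ⟨B, hB0, hB⟩ := exists_bound_of_contDiff hs
  exact .of_le hB0 le_rfl fun r _ h1 => by simpa using hB r h1

lemma ContDiff.isLogBounded_logSq_mul {s : Plane → ℂ} (hs : ContDiff ℝ ∞ s) :
    IsLogBounded fun x => logSq x * s x := by
  obtain ⟨B, hB0, hB⟩ := exists_bound_of_contDiff hs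
  exact .of_le le_rfl hB0 fun r _ h1 => by
    rw [norm_mul, zero_add, mul_comm]
    exact mul_le_mul_of_nonneg_right (hB r h1) (norm_nonneg _)

/-- A homogeneous singularity is compensated by a zero of the same order. -/
lemma IsHomogeneous.isLogBounded_mul {e v : Plane → ℂ} {n : ℕ} {B : ℝ} (he : IsHomogeneous n e)
    (hc : ContinuousOn e {0}ᶜ) (hv : ∀ x, ‖x‖ ≤ 1 → ‖v x‖ ≤ B * ‖x‖ ^ n) (hB : 0 ≤ B) :
    IsLogBounded fun x => e x * v x := by
  obtain ⟨C, hC0, hC⟩ := he.exists_le_div hc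
  refine .of_le (mul_nonneg hC0 hB) le_rfl fun r h0 h1 => ?_
  rw [norm_mul, zero_mul, add_zero]
  refine (mul_le_mul (hC r h0) (hv r h1) (norm_nonneg _) (by positivity)).trans_eq ?_
  field_simp

/-- Logarithmic growth at the origin of all derivatives up to second order. -/
structure IsLogBounded₂ (f : Plane → ℂ) : Prop where
  self : IsLogBounded f
  first : ∀ m, IsLogBounded (pd m f)
  second : ∀ m j, IsLogBounded (pd j (pd m f))

/-- The derivatives up to second order of `s + w log ‖x‖²` are of logarithmic growth, for smooth `s`
and `w` where `w` has a double zero at the origin. -/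
lemma IsLogBounded₂.of_expansion {f s w : Plane → ℂ} (hs : ContDiff ℝ ∞ s) (hw : ContDiff ℝ ∞ w)
    (hw0 : ∃ B, 0 ≤ B ∧ ∀ x, ‖x‖ ≤ 1 → ‖w x‖ ≤ B * ‖x‖ ^ 2)
    (hf : ∀ x, x ∈ ({0}ᶜ : Set Plane) → f x = s x + logSq x * w x) : IsLogBounded₂ f := by
  have hop := isOpen_punctured
  obtain ⟨B, hB0, hB⟩ := hw0
  have sm : ∀ {v : Plane → ℂ}, ContDiff ℝ ∞ v → ∀ i, ContDiff ℝ ∞ (pd i v) := fun hv i =>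
    contDiffOn_univ.1 (hv.contDiffOn.pd i isOpen_univ)
  have df : ∀ {v : Plane → ℂ}, ContDiff ℝ ∞ v → ∀ x, DifferentiableAt ℝ v x := fun hv x =>
    hv.contDiffAt.differentiableAt (by simp)
  have dl : ∀ {v : Plane → ℂ}, ContDiffOn ℝ ∞ v {0}ᶜ → ∀ x ∈ ({0}ᶜ : Set Plane),
    DifferentiableAt ℝ v x := fun hv x hx => hv.differentiableAt_of_isOpen hop hx
  have sL := logSq_smooth
  have sLm := fun i => sL.pd i hop
  have hd : ∀ i, ∃ B, 0 ≤ B ∧ ∀ x, ‖x‖ ≤ 1 → ‖pd i w x‖ ≤ B * ‖x‖ ^ 1 := by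
    intro i
    have h0 : HasFDerivAt w (0 : Plane →L[ℝ] ℂ) 0 := by
      refine Asymptotics.IsBigO.hasFDerivAt (n := 2) (Asymptotics.IsBigO.of_bound B ?_) one_lt_two
      filter_upwards [Metric.closedBall_mem_nhds (0 : Plane) one_pos] with x hx
      simpa using hB x (by simpa using hx)
    simpa using exists_bound_mul_norm_of_contDiff (sm hw i) (by rw [pd, h0.fderiv]; rfl)
  have e1 : ∀ m, ∀ x ∈ ({0}ᶜ : Set Plane), pd m f x =
      pd m s x + (logSq x * pd m w x + pd m logSq x * w x) := fun m x hx => by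
    rw [pd_congr_of_isOpen m hop hf hx, pd_add m (df hs x) ((dl sL x hx).fun_mul (df hw x)),
      pd_mul m (dl sL x hx) (df hw x)]
  have hB1 := fun x hx => (hB x hx).trans
    (mul_le_mul_of_nonneg_left (pow_le_pow_of_le_one (norm_nonneg _) hx one_le_two) hB0)
  refine ⟨(hs.isLogBounded.add hw.isLogBounded_logSq_mul).congr hf, fun m => ((sm hs m).isLogBounded.add ((sm hw m).isLogBounded_logSq_mul.add
    ((isHomogeneous_pd_logSq m).isLogBounded_mul (sLm m).continuousOn hB1 hB0))).congr (e1 m),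
    fun m j => ?_⟩
  obtain ⟨B₁, hB₁, h₁⟩ := hd m
  obtain ⟨B₂, hB₂, h₂⟩ := hd j
  refine ((sm (sm hs m) j).isLogBounded.add (((sm (sm hw m) j).isLogBounded_logSq_mul.add
    ((isHomogeneous_pd_logSq j).isLogBounded_mul (sLm j).continuousOn h₁ hB₁)).add
    (((isHomogeneous_pd_logSq m).isLogBounded_mul (sLm m).continuousOn h₂ hB₂).add
    (((isHomogeneous_pd_logSq m).pd (sLm m) j).isLogBounded_mul
      ((sLm m).pd j hop).continuousOn hB hB0)))).congr fun x hx => ?_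
  have dw := df (sm hw m) x
  rw [pd_congr_of_isOpen j hop (e1 m) hx, pd_add j (df (sm hs m) x)
    (((dl sL x hx).fun_mul dw).fun_add ((dl (sLm m) x hx).fun_mul (df hw x))),
    pd_add j ((dl sL x hx).fun_mul dw) ((dl (sLm m) x hx).fun_mul (df hw x)),
    pd_mul j (dl sL x hx) dw, pd_mul j (dl (sLm m) x hx) (df hw x)]

/-! ### The normalization of a radial singularity -/

/-- `radialBump` as a function of the squared radius. -/
def bumpProfile (ρ : ℝ) : ℂ := (Real.smoothTransition ((1 - ρ) * (4 / 3)) : ℂ)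

lemma bumpProfile_contDiff : ContDiff ℝ ∞ bumpProfile :=
  ofRealCLM.contDiff.comp (Real.smoothTransition.contDiff.comp
    ((contDiff_const.sub contDiff_id).mul contDiff_const))

lemma sum_pd_bumpC_mul (F : Fin 2 → Plane → ℂ) (ζ : Plane) :
    ∑ j, pd j bumpC ζ * F j ζ = 2 * deriv bumpProfile (‖ζ‖ ^ 2) * ∑ j, (ζ j : ℂ) * F j ζ := by
  have h : ∀ j, pd j bumpC ζ = 2 * ζ j * deriv bumpProfile (‖ζ‖ ^ 2) := pd_radial
    (bumpProfile_contDiff.contDiffAt.differentiableAt (by simp)).hasDerivAt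
  rw [mul_sum]
  exact sum_congr rfl fun j _ => by rw [h]; ring

/-- Only the radial component of a field enters its flux through the bump. -/
lemma bumpFlux_congr_radial {F F' : Fin 2 → Plane → ℂ}
    (h : ∀ ζ ∈ ({0}ᶜ : Set Plane), ∑ j, (ζ j : ℂ) * F j ζ = ∑ j, (ζ j : ℂ) * F' j ζ) :
    bumpFlux F = bumpFlux F' := by
  refine integral_congr_ae (ae_of_all _ fun ζ => ?_)
  simp only [sum_pd_bumpC_mul]
  by_cases hζ : ζ = 0
  · simp [hζ]
  · rw [h ζ hζ]

lemma ofReal_norm_sq (x : Plane) : ((‖x‖ ^ 2 : ℝ) : ℂ) = x 0 ^ 2 + x 1 ^ 2 := by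
  rw [EuclideanSpace.norm_sq_eq]
  simp

/-- The flux of `x / |x|²` is `-2π`. -/
lemma bumpFlux_inv : bumpFlux (fun j x => (x j : ℂ) * ((‖x‖ ^ 2 : ℝ) : ℂ)⁻¹) = -(2 * π) := by
  have hs : ContDiff ℝ 1 fun y : ℝ => bumpProfile (y ^ 2) :=
    (bumpProfile_contDiff.of_le (by simp)).comp (contDiff_id.pow 2)
  have hc : HasCompactSupport fun y : ℝ => bumpProfile (y ^ 2) :=
    HasCompactSupport.intro (isCompact_Icc (a := -1) (b := 1)) fun y hy => by
      have : 1 ≤ y ^ 2 := (one_le_sq_iff_one_le_abs y).2 (le_of_not_gt fun h =>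
        hy ⟨(abs_lt.1 h).1.le, (abs_lt.1 h).2.le⟩)
      rw [bumpProfile, Real.smoothTransition.zero_of_nonpos (by nlinarith), Complex.ofReal_zero]
  have e := integral_fun_norm_addHaar (volume : Measure Plane)
    (fun r => 2 * deriv bumpProfile (r ^ 2) * ((r ^ 2 : ℝ) * ((r ^ 2 : ℝ) : ℂ)⁻¹))
  have hi : ∫ y in Ioi (0 : ℝ), y ^ (2 - 1) • (2 * deriv bumpProfile (y ^ 2) *
      ((y ^ 2 : ℝ) * ((y ^ 2 : ℝ) : ℂ)⁻¹)) = -1 := by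
    have h1 := hc.integral_Ioi_deriv_eq hs 0
    rw [show bumpProfile (0 ^ 2) = 1 by
      rw [bumpProfile, Real.smoothTransition.one_of_one_le (by norm_num), Complex.ofReal_one]] at h1
    rw [← h1]
    refine setIntegral_congr_fun measurableSet_Ioi fun y hy => ?_
    have hy0 : ((y ^ 2 : ℝ) : ℂ) ≠ 0 := by exact_mod_cast (pow_pos (mem_Ioi.1 hy) 2).ne'
    have hd := (bumpProfile_contDiff.contDiffAt.differentiableAt (x := y ^ 2)
      (by simp)).hasDerivAt.scomp y (hasDerivAt_pow 2 y)
    have h2 : deriv (fun y : ℝ => bumpProfile (y ^ 2)) y = _ := hd.deriv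
    simp only [h2, mul_inv_cancel₀ hy0, mul_one, real_smul]; push_cast; ring
  rw [finrank_euclideanSpace_fin, hi] at e
  calc _ = ∫ x : Plane, 2 * deriv bumpProfile (‖x‖ ^ 2) *
        ((‖x‖ ^ 2 : ℝ) * ((‖x‖ ^ 2 : ℝ) : ℂ)⁻¹) := by
        refine integral_congr_ae (ae_of_all _ fun x => (sum_pd_bumpC_mul
          (fun j x => (x j : ℂ) * ((‖x‖ ^ 2 : ℝ) : ℂ)⁻¹) x).trans ?_)
        simp only [ofReal_norm_sq, Fin.sum_univ_two]; ring
    _ = _ := e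
    _ = _ := by rw [measureReal_def]; simp [Real.pi_pos.le]

/-- The fields `x_k x_p x / |x|⁴`, whose radial components have the mean value `δ_{kp} / 2`. -/
def dyadField (k p j : Fin 2) (x : Plane) : ℂ := x j * (x k * x p * ((‖x‖ ^ 2 : ℝ) : ℂ)⁻¹ ^ 2)

lemma continuousOn_inv_norm_sq : ContinuousOn (fun x : Plane => ((‖x‖ ^ 2 : ℝ) : ℂ)⁻¹) {0}ᶜ := by
  refine ContinuousOn.inv₀ (by fun_prop) fun x hx => ?_
  exact_mod_cast norm_sq_ne_zero hx

lemma continuousOn_dyadField (k p j : Fin 2) : ContinuousOn (dyadField k p j) {0}ᶜ :=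
  (contDiff_coord j).continuous.continuousOn.mul
    (((contDiff_coord k).mul (contDiff_coord p)).continuous.continuousOn.mul
      (continuousOn_inv_norm_sq.pow 2))

lemma bumpFlux_comp_rotCW {F F' : Fin 2 → Plane → ℂ}
    (h : ∀ x, ∑ j, (x j : ℂ) * F' j x = ∑ j, (rotCW x j : ℂ) * F j (rotCW x)) :
    bumpFlux F' = bumpFlux F := by
  let e : Plane ≃ₗᵢ[ℝ] Plane := LinearIsometry.toLinearIsometryEquiv
    ⟨⟨⟨rotCW, fun x y => by ext j; fin_cases j <;> simp; ring⟩,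
      fun c x => by ext j; fin_cases j <;> simp [rotCW]⟩, norm_rotCW⟩ rfl
  have he : ∀ x, e x = rotCW x := fun _ => rfl
  refine (integral_congr_ae (ae_of_all _ fun x => ?_)).trans
    (e.measurePreserving.integral_comp e.toHomeomorph.measurableEmbedding _)
  simp only [sum_pd_bumpC_mul, he, norm_rotCW, h]

lemma bumpFlux_dyadField (k p : Fin 2) :
    bumpFlux (dyadField k p) = if k = p then -(π : ℂ) else 0 := by
  have h1 : bumpFlux (dyadField 1 1) = bumpFlux (dyadField 0 0) := bumpFlux_comp_rotCW fun x => by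
    simp [dyadField, norm_rotCW]; ring
  have h2 : bumpFlux (dyadField 0 1) = -bumpFlux (dyadField 0 1) := by
    rw [← neg_one_mul, ← bumpFlux_const_mul]
    refine (bumpFlux_comp_rotCW fun x => ?_).symm
    simp [dyadField, norm_rotCW]; ring
  have h3 : bumpFlux (dyadField 1 0) = bumpFlux (dyadField 0 1) := by
    congr 1 with j x; simp only [dyadField]; ring
  have h4 : bumpFlux (dyadField 0 0) + bumpFlux (dyadField 1 1) = -(2 * π) := by
    rw [← bumpFlux_inv, ← Fin.sum_univ_two (fun k => bumpFlux (dyadField k k)),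
      ← bumpFlux_sum fun k _ j => continuousOn_dyadField k k j]
    refine bumpFlux_congr_radial fun x hx => ?_
    simp only [dyadField, Fin.sum_univ_two, ofReal_norm_sq]; field_simp
  have h5 := self_eq_neg.1 h2
  have h6 : bumpFlux (dyadField 0 0) = -π := by rw [h1] at h4; linear_combination h4 / 2
  fin_cases k <;> fin_cases p <;> simp [h1, h3, h5, h6]

lemma bumpFlux_of_radial {F : Fin 2 → Plane → ℂ} {a b : ℂ} {k p : Fin 2}
    (h : ∀ x ∈ ({0}ᶜ : Set Plane), ∑ j, (x j : ℂ) * F j x =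
      a + b * (x k * x p * ((‖x‖ ^ 2 : ℝ) : ℂ)⁻¹)) :
    bumpFlux F = -(2 * π) * (a + if k = p then b / 2 else 0) := by
  have e : bumpFlux F = ∑ i : Fin 2, bumpFlux (![fun j x => a * (x j * ((‖x‖ ^ 2 : ℝ) : ℂ)⁻¹),
      fun j x => b * dyadField k p j x] i) := by
    rw [← bumpFlux_sum]
    · refine bumpFlux_congr_radial fun x hx => ?_
      have h0 : (x 0 : ℂ) ^ 2 + x 1 ^ 2 ≠ 0 := by
        rw [← ofReal_norm_sq]; exact_mod_cast norm_sq_ne_zero hx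
      rw [h x hx]
      simp only [dyadField, Fin.sum_univ_two, Matrix.cons_val_zero, Matrix.cons_val_one,
        ofReal_norm_sq]
      field_simp
    · intro i _ j
      fin_cases i
      · exact ((contDiff_coord j).continuous.continuousOn.mul continuousOn_inv_norm_sq).const_smul a
      · exact (continuousOn_dyadField k p j).const_smul b
  rw [e, Fin.sum_univ_two]
  simp only [Matrix.cons_val_zero, Matrix.cons_val_one, bumpFlux_const_mul, bumpFlux_inv,
    bumpFlux_dyadField]
  split_ifs <;> ring

/-! ### Cylindrical waves -/

/-- The function `a(|x|²) + b(|x|²) log |x|²`. -/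
def wave (a b : ℝ → ℂ) (x : Plane) : ℂ := a (‖x‖ ^ 2) + logSq x * b (‖x‖ ^ 2)

/-- The derivative of `a + b log`. -/
def waveDeriv (a b : ℝ → ℂ) (ρ : ℝ) : ℂ := deriv a ρ + (log ρ * deriv b ρ + (ρ : ℂ)⁻¹ * b ρ)

/-- The second derivative of `a + b log`. -/
def waveDeriv₂ (a b : ℝ → ℂ) (ρ : ℝ) : ℂ := deriv (deriv a) ρ + (log ρ * deriv (deriv b) ρ +
  (2 * (ρ : ℂ)⁻¹ * deriv b ρ - (ρ : ℂ)⁻¹ ^ 2 * b ρ))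

section

variable {a b : ℝ → ℂ} (ha : ContDiff ℝ ∞ a) (hb : ContDiff ℝ ∞ b)
include ha hb

lemma wave_smooth : ContDiffOn ℝ ∞ (wave a b) {0}ᶜ :=
  ha.radial.contDiffOn.add (logSq_smooth.mul hb.radial.contDiffOn)

lemma pd_wave {x : Plane} (hx : x ∈ ({0}ᶜ : Set Plane)) (m : Fin 2) :
    pd m (wave a b) x = 2 * x m * waveDeriv a b (‖x‖ ^ 2) := by
  have hd : ∀ {f : ℝ → ℂ}, ContDiff ℝ ∞ f → ∀ ρ, HasDerivAt f (deriv f ρ) ρ := fun hf ρ =>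
    (hf.contDiffAt.differentiableAt (by simp)).hasDerivAt
  refine pd_radial (((hd ha _).add ((hasDerivAt_ofReal_log (norm_sq_ne_zero hx)).mul
    (hd hb _))).congr_deriv ?_) m
  rw [waveDeriv]
  ring

lemma pd_pd_wave {x : Plane} (hx : x ∈ ({0}ᶜ : Set Plane)) (j m : Fin 2) :
    pd j (pd m (wave a b)) x = (if m = j then 2 * waveDeriv a b (‖x‖ ^ 2) else 0) +
      4 * (x j * x m) * waveDeriv₂ a b (‖x‖ ^ 2) := by
  have hd : ∀ {f : ℝ → ℂ}, ContDiff ℝ ∞ f → ∀ ρ, HasDerivAt f (deriv f ρ) ρ := fun hf ρ =>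
    (hf.contDiffAt.differentiableAt (by simp)).hasDerivAt
  have hd' : ∀ {f : ℝ → ℂ}, ContDiff ℝ ∞ f → ContDiff ℝ ∞ (deriv f) := fun hf =>
    (contDiff_infty_iff_deriv.1 hf).2
  have h0 := norm_sq_ne_zero hx
  have h0' : ((‖x‖ ^ 2 : ℝ) : ℂ) ≠ 0 := by exact_mod_cast h0
  have hw : HasDerivAt (waveDeriv a b) (waveDeriv₂ a b (‖x‖ ^ 2)) (‖x‖ ^ 2) := by
    refine ((hd (hd' ha) _).add (((hasDerivAt_ofReal_log h0).mul (hd (hd' hb) _)).add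
      (((hasDerivAt_id (‖x‖ ^ 2)).ofReal_comp.fun_inv h0').mul (hd hb _)))).congr_deriv ?_
    simp only [waveDeriv₂, id]; push_cast; ring
  have hdw := hw.differentiableAt.fun_comp' x (hasStrictFDerivAt_norm_sq x).differentiableAt
  have hdm : DifferentiableAt ℝ (fun y : Plane => 2 * (y m : ℂ)) x :=
    ((contDiff_coord m).contDiffAt.differentiableAt (by simp)).const_mul 2
  rw [pd_congr_of_isOpen j isOpen_punctured (fun y hy => pd_wave ha hb hy m) hx,
    pd_mul j hdm hdw, pd_radial hw,
    pd_const_mul j 2 ((contDiff_coord m).contDiffAt.differentiableAt (by simp)), pd_coord]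
  split_ifs <;> ring

end

/-- The tensor of the Laplacian. -/
def laplaceC (_ : Fin 1) (j : Fin 2) (_ : Fin 1) (m : Fin 2) : ℂ := if j = m then 1 else 0

lemma stress_laplaceC (v : Fin 1 → Plane → ℂ) (k : Fin 1) (j : Fin 2) (x : Plane) :
    stress laplaceC v k j x = pd j (v 0) x := by simp [stress, laplaceC]

namespace IsHankelProfile

variable {k : ℝ} {a b b₁ b₂ : ℝ → ℂ} (h : IsHankelProfile k a b b₁ b₂)
include h

lemma wave_eq {x : Plane} (hx : x ∈ ({0}ᶜ : Set Plane)) : wave a b x = hankel1 0 (k * ‖x‖) :=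
  (h.hankel _ (norm_pos_iff.2 hx)).symm

lemma waveDeriv_eq {x : Plane} (hx : x ∈ ({0}ᶜ : Set Plane)) :
    hankel1 1 (k * ‖x‖) = -(2 * ‖x‖ / k) * waveDeriv a b (‖x‖ ^ 2) := by
  rw [h.hankel_deriv _ (norm_pos_iff.2 hx), waveDeriv]
  ring

/-- Bessel's equation for the profile. -/
lemma waveDeriv₂_eq {x : Plane} (hx : x ∈ ({0}ᶜ : Set Plane)) :
    4 * (((‖x‖ ^ 2 : ℝ) : ℂ) * waveDeriv₂ a b (‖x‖ ^ 2) + waveDeriv a b (‖x‖ ^ 2)) =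
      -k ^ 2 * wave a b x := by
  have h0' : ((‖x‖ ^ 2 : ℝ) : ℂ) ≠ 0 := by exact_mod_cast norm_sq_ne_zero hx
  have ea := h.equation_a (‖x‖ ^ 2)
  have eb := h.equation_b (‖x‖ ^ 2)
  rw [waveDeriv, waveDeriv₂, wave, logSq]
  generalize ((‖x‖ ^ 2 : ℝ) : ℂ) = ρ at *
  have hi := mul_inv_cancel₀ h0'
  linear_combination ea + (log (‖x‖ ^ 2) : ℂ) * eb +
    (8 * deriv b (‖x‖ ^ 2) - 4 * ρ⁻¹ * b (‖x‖ ^ 2)) * hi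

/-- The Helmholtz equation. -/
lemma isSolutionOn : IsSolutionOn laplaceC (k ^ 2) (fun _ => wave a b) {0}ᶜ := by
  refine ⟨fun _ => wave_smooth h.smooth.1 h.smooth.2.1, fun x hx i => ?_⟩
  have e : ∀ j, stress laplaceC (fun _ => wave a b) i j = pd j (wave a b) := fun j =>
    funext fun x => stress_laplaceC _ i j x
  simp only [e]
  rw [← h.waveDeriv₂_eq hx, ofReal_norm_sq, Fin.sum_univ_two,
    pd_pd_wave h.smooth.1 h.smooth.2.1 hx, pd_pd_wave h.smooth.1 h.smooth.2.1 hx]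
  simp
  ring

end IsHankelProfile

/-! ### The scalar models -/

/-- A model whose Green's function is the principal part of another model is a fundamental model for
the equation without the term of order zero. -/
lemma IsFundamentalModel.of_principal {σ : ℕ} {M M₀ : LayerModel σ}
    {C : Stiffness σ} {kap : ℂ} {g₀ : Fin σ → Fin σ → Plane → ℂ}
    (hM : IsFundamentalModel M C kap g₀) (hG : ∀ x y l p, M₀.G x y l p = g₀ l p (x - y))
    (hc : M₀.conormal = M.conormal) (he : ∀ l p r, g₀ l p (-r) = g₀ l p r)
    (hs : ∀ l p r, g₀ l p r = g₀ p l r) (hl : ∀ l p, IsLogBounded (g₀ l p)) :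
    IsFundamentalModel M₀ C 0 g₀ := by
  have h0 : ∀ l p, (fun r => M₀.G r 0 l p) = g₀ l p := fun l p => by
    funext r
    rw [hG, sub_zero]
  have hz : ∀ l p, (fun r => M₀.G r 0 l p - g₀ l p r) = fun _ => 0 := fun l p => by
    funext r
    rw [hG, sub_zero, sub_self]
  have hp : ∀ m : Fin 2, pd m (fun _ : Plane => (0 : ℂ)) = fun _ => 0 := fun m => by
    funext r
    simp [pd]
  have hb : IsLogBounded fun _ => 0 := ContDiff.isLogBounded contDiff_const
  exact {
    G_eq := fun x y => by ext l p; rw [hG, hG, sub_zero]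
    conormal_eq := hc ▸ hM.conormal_eq
    C_symm := hM.C_symm
    even := fun r => by ext l p; simp only [hG, sub_zero, he]
    symm := fun r l p => by simp only [hG, hs l p]
    solution := fun p => (hM.solution₀ p).congr isOpen_punctured fun l y _ => congrFun (h0 l p) y
    smooth₀ := hM.smooth₀
    homogeneous₀ := hM.homogeneous₀
    logBounded := fun l p => by rw [h0]; exact hl l p
    logBounded_pd := fun l p m => by rw [hz, hp]; exact hb
    logBounded_pd_pd := fun l p m j => by rw [hz, hp, hp]; exact hb
    normalization := hM.normalization }

/-- `-(2π)⁻¹ log |x|`. -/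
def laplaceG₀ (_ _ : Fin 1) (x : Plane) : ℂ := -(1 / (4 * π)) * logSq x

lemma pd_laplaceG₀ {x : Plane} (hx : x ∈ ({0}ᶜ : Set Plane)) (m : Fin 2) :
    pd m (laplaceG₀ 0 0) x = -(1 / (4 * π)) * (2 * x m * ((‖x‖ ^ 2 : ℝ) : ℂ)⁻¹) := by
  rw [← pd_logSq hx]
  exact pd_const_mul m _ (logSq_smooth.differentiableAt_of_isOpen isOpen_punctured hx)

lemma helmholtz_isFundamentalModel {omega c : ℝ} (ho : 0 < omega) (hc : 0 < c) :
    IsFundamentalModel (helmholtzModel omega c) laplaceC ((omega / c : ℝ) ^ 2) laplaceG₀ := by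
  obtain ⟨a, b, b₁, b₂, h⟩ := exists_isHankelProfile (div_pos ho hc)
  have hop := isOpen_punctured
  have hG' : ∀ x y l p, (helmholtzModel omega c).G x y l p =
      Complex.I / 4 * hankel1 0 (omega / c * ‖x - y‖) := fun _ _ _ _ => rfl
  have hG : ∀ x ∈ ({0}ᶜ : Set Plane), ∀ l p, (helmholtzModel omega c).G x 0 l p =
      Complex.I / 4 * wave a b x := fun x hx _ _ => by rw [h.wave_eq hx, hG', sub_zero]
  have s₀ : ∀ l p, ContDiffOn ℝ ∞ (laplaceG₀ l p) {0}ᶜ := fun _ _ => contDiffOn_const.mul logSq_smooth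
  have hexp := IsLogBounded₂.of_expansion (s := fun x => Complex.I / 4 * a (‖x‖ ^ 2))
    (w := fun x => (‖x‖ ^ 2 : ℝ) * (Complex.I / 4 * b₁ (‖x‖ ^ 2)) + x 0 * x 0 * 0)
    (f := fun x => (helmholtzModel omega c).G x 0 0 0 - laplaceG₀ 0 0 x)
    (contDiff_const.mul h.smooth.1.radial)
    (contDiff_quadratic (contDiff_const.mul h.smooth.2.2.1.radial) contDiff_const 0 0)
    (exists_quadratic_bound (contDiff_const.mul h.smooth.2.2.1.radial) contDiff_const 0 0)
    fun x hx => by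
      rw [hG x hx, wave, h.b_eq, laplaceG₀]; field_simp
      linear_combination logSq x * Complex.I_sq
  have e0 : ∀ l : Fin 1, l = 0 := fun l => Subsingleton.elim _ _
  exact {
    G_eq := fun x y => by ext l p; rw [hG', hG', sub_zero]
    conormal_eq := fun u n x k => by
      simp only [stress_laplaceC, helmholtzModel, normalDeriv, e0 k]
      rfl
    C_symm := fun k j l m => by simp [laplaceC, eq_comm]
    even := fun r => by ext l p; rw [hG', hG', sub_zero, sub_zero, norm_neg]
    symm := fun r l p => rfl
    solution := fun p => by
      refine IsSolutionOn.congr hop (v := fun _ x => Complex.I / 4 * wave a b x)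
        (IsSolutionOn.const_mul hop _ ?_) fun l y hy => hG y hy l p
      exact_mod_cast h.isSolutionOn
    smooth₀ := s₀
    homogeneous₀ := fun l p m t r ht hr => by
      rw [e0 l, e0 p, pd_laplaceG₀ hr, pd_laplaceG₀ (smul_ne_zero ht hr), ← pd_logSq hr,
        ← pd_logSq (smul_ne_zero ht hr), isHomogeneous_pd_logSq m t r ht hr]
      ring
    logBounded := fun l p => ((h.smooth.1.radial.isLogBounded.add
      h.smooth.2.1.radial.isLogBounded_logSq_mul).const_mul _).congr fun r hr => hG r hr l p
    logBounded_pd := fun l p m => by rw [e0 l, e0 p]; exact hexp.first m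
    logBounded_pd_pd := fun l p m j => by rw [e0 l, e0 p]; exact hexp.second m j
    normalization := fun k p => by
      rw [e0 k, e0 p, bumpFlux_of_radial (a := -(1 / (2 * π))) (b := 0) (k := 0) (p := 1)]
      · simp
        field_simp
      · intro x hx
        have h0 : (x 0 : ℂ) ^ 2 + x 1 ^ 2 ≠ 0 := by
          rw [← ofReal_norm_sq]; exact_mod_cast norm_sq_ne_zero hx
        simp only [stress_laplaceC, pd_laplaceG₀ hx, Fin.sum_univ_two, ofReal_norm_sq]
        field_simp; ring }

lemma laplace_isFundamentalModel : IsFundamentalModel laplaceModel laplaceC 0 laplaceG₀ :=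
  (helmholtz_isFundamentalModel one_pos one_pos).of_principal (fun x y l p => by
    rw [laplaceG₀, logSq, Real.log_pow]
    refine ofReal_mul _ _ |>.trans ?_
    push_cast; ring) rfl (fun _ _ r => by simp [laplaceG₀, logSq]) (fun _ _ _ => rfl)
    fun _ _ => IsLogBounded.const_mul _
      ((contDiff_const.isLogBounded_logSq_mul (s := fun _ => 1)).congr fun r _ => (mul_one _).symm)

/-- The gradient of the logarithm at a point is radial, so the double-layer kernel of the scalar
equations has no term of order `1 / s`. -/
lemma laplaceG₀_tangential (p q : Fin 1) (v : Plane) (hv : v ≠ 0) :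
    ∑ j, stress laplaceC (fun l => laplaceG₀ l p) q j v * (rotCW v j : ℂ) = 0 := by
  simp [stress_laplaceC, Subsingleton.elim p 0, pd_laplaceG₀ hv, Fin.sum_univ_two,
    rotCW_zero_apply, rotCW_one_apply]
  ring

/-! ### The elastic models -/

/-- The elasticity tensor of an isotropic medium. -/
def elasticC (lam mu : ℝ) (k j l m : Fin 2) : ℂ := (if k = j ∧ l = m then (lam : ℂ) else 0) +
    mu * ((if k = l ∧ j = m then 1 else 0) + if k = m ∧ l = j then 1 else 0)

lemma stress_elasticC (lam mu : ℝ) (v : Fin 2 → Plane → ℂ) (k j : Fin 2) (x : Plane) :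
    stress (elasticC lam mu) v k j x = (if k = j then (lam : ℂ) * ∑ l, pd l (v l) x else 0) +
      mu * (pd j (v k) x + pd k (v j) x) := by
  fin_cases k <;> fin_cases j <;> simp [stress, elasticC] <;> ring

/-- Navier's form of the equations of elasticity. -/
lemma sum_pd_stress_elasticC (lam mu : ℝ) {v : Fin 2 → Plane → ℂ} {S : Set Plane} (hS : IsOpen S)
    (hv : ∀ l, ContDiffOn ℝ ∞ (v l) S) (k : Fin 2) {x : Plane} (hx : x ∈ S) :
    ∑ j, pd j (stress (elasticC lam mu) v k j) x =
      (lam + mu) * pd k (fun y => ∑ l, pd l (v l) y) x + mu * ∑ j, pd j (pd j (v k)) x := by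
  have hc := fun i j l =>
    pd_comm (((hv l).contDiffAt (hS.mem_nhds hx)).of_le two_le_infty) i j
  rw [pd_sum k fun l _ => ((hv l).pd l hS).differentiableAt_of_isOpen hS hx]
  simp only [pd_stress hS hv _ _ _ hx]
  fin_cases k <;> simp [elasticC, hc 1 0] <;> ring

/-- Kelvin's tensor without the constants of its logarithmic term, `-A δ log |x|² + B x xᵀ / |x|²`. -/
def kelvinG₀ (A B : ℂ) (l p : Fin 2) (x : Plane) : ℂ :=
  (if l = p then -A else 0) * logSq x + B * (x l * x p * ((‖x‖ ^ 2 : ℝ) : ℂ)⁻¹)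

lemma pd_inv_norm_sq {x : Plane} (hx : x ∈ ({0}ᶜ : Set Plane)) (m : Fin 2) :
    DifferentiableAt ℝ (fun x : Plane => ((‖x‖ ^ 2 : ℝ) : ℂ)⁻¹) x ∧
      pd m (fun x : Plane => ((‖x‖ ^ 2 : ℝ) : ℂ)⁻¹) x = -(2 * x m * ((‖x‖ ^ 2 : ℝ) : ℂ)⁻¹ ^ 2) := by
  have h0 : ((‖x‖ ^ 2 : ℝ) : ℂ) ≠ 0 := by exact_mod_cast norm_sq_ne_zero hx
  have h : HasDerivAt (fun ρ : ℝ => (ρ : ℂ)⁻¹) (-((‖x‖ ^ 2 : ℝ) : ℂ)⁻¹ ^ 2) (‖x‖ ^ 2) := by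
    refine ((hasDerivAt_id (‖x‖ ^ 2)).ofReal_comp.fun_inv h0).congr_deriv ?_
    simp [div_eq_mul_inv]
  refine ⟨DifferentiableAt.fun_comp' (f := fun x : Plane => ‖x‖ ^ 2) x
    h.differentiableAt (hasStrictFDerivAt_norm_sq x).differentiableAt, ?_⟩
  rw [pd_radial h]
  ring

lemma kelvinG₀_smooth (A B : ℂ) (l p : Fin 2) : ContDiffOn ℝ ∞ (kelvinG₀ A B l p) {0}ᶜ := by
  refine ContDiffOn.add (contDiffOn_const.mul logSq_smooth) (contDiffOn_const.mul ((((contDiff_coord l).mul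
    (contDiff_coord p)).contDiffOn).mul (ContDiffOn.inv
      (ofRealCLM.contDiff.comp (contDiff_norm_sq ℝ)).contDiffOn fun x hx => ?_)))
  exact ofReal_ne_zero.2 (norm_sq_ne_zero hx)

lemma pd_kelvinG₀ (A B : ℂ) (l p m : Fin 2) {x : Plane} (hx : x ∈ ({0}ᶜ : Set Plane)) :
    pd m (kelvinG₀ A B l p) x = ((‖x‖ ^ 2 : ℝ) : ℂ)⁻¹ * ((if l = p then -(2 * A) * x m else 0) +
      B * ((if l = m then (x p : ℂ) else 0) + (if p = m then (x l : ℂ) else 0) -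
        2 * x l * x p * x m * ((‖x‖ ^ 2 : ℝ) : ℂ)⁻¹)) := by
  have dl := logSq_smooth.differentiableAt_of_isOpen isOpen_punctured hx
  have dc : ∀ a, DifferentiableAt ℝ (fun y : Plane => (y a : ℂ)) x := fun a =>
    (contDiff_coord a).contDiffAt.differentiableAt (by simp)
  obtain ⟨di, ei⟩ := pd_inv_norm_sq hx m
  unfold kelvinG₀
  rw [pd_add m (dl.const_mul _) ((((dc l).fun_mul (dc p)).fun_mul di).const_mul B), pd_const_mul m _ dl,
    pd_const_mul m B (((dc l).fun_mul (dc p)).fun_mul di), pd_mul m ((dc l).fun_mul (dc p)) di,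
    pd_mul m (dc l) (dc p), pd_coord, pd_coord, ei, pd_logSq hx]
  split_ifs <;> ring

lemma isHomogeneous_pd_kelvinG₀ (A B : ℂ) (l p m : Fin 2) :
    IsHomogeneous 1 (pd m (kelvinG₀ A B l p)) := fun t r ht hr => by
  have h1 : (t : ℂ) ≠ 0 := by exact_mod_cast ht
  rw [pd_kelvinG₀ A B l p m hr, pd_kelvinG₀ A B l p m (smul_ne_zero ht hr), ofReal_norm_sq,
    ofReal_norm_sq]
  simp [PiLp.smul_apply, smul_eq_mul, ofReal_mul]
  split_ifs <;> field_simp <;> ring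

lemma bumpFlux_stress_kelvinG₀ {lam mu : ℝ} (A B : ℂ) (hAB : π * (2 * A * (lam + 3 * mu) -
    B * (lam + mu)) = 1) (k p : Fin 2) :
    bumpFlux (stress (elasticC lam mu) (fun l => kelvinG₀ A B l p) k) = if k = p then 1 else 0 := by
  rw [bumpFlux_of_radial (a := if k = p then mu * (B - 2 * A) else 0)
    (b := lam * (B - 2 * A) - mu * (2 * A + B)) (k := k) (p := p)]
  · split_ifs
    · linear_combination hAB
    · simp
  · intro x hx
    have h0 : (x 0 : ℂ) ^ 2 + x 1 ^ 2 ≠ 0 := by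
      rw [← ofReal_norm_sq]; exact_mod_cast norm_sq_ne_zero hx
    simp only [stress_elasticC, pd_kelvinG₀ A B _ p _ hx, ofReal_norm_sq]
    fin_cases k <;> fin_cases p <;> simp <;> field_simp <;> ring


lemma isLogBounded_kelvinG₀ (A B : ℂ) (l p : Fin 2) : IsLogBounded (kelvinG₀ A B l p) := by
  obtain ⟨K, hK0, hK⟩ := exists_quadratic_bound (X := fun _ => 0) (Y := fun _ => 1) contDiff_const
    contDiff_const l p
  have hh : IsHomogeneous 2 fun x : Plane => ((‖x‖ ^ 2 : ℝ) : ℂ)⁻¹ := fun t r _ _ => by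
    simp [norm_smul, mul_pow, mul_comm]
  refine (((contDiff_const (c := if l = p then -A else 0)).isLogBounded_logSq_mul).add
    ((hh.isLogBounded_mul continuousOn_inv_norm_sq hK hK0).const_mul B)).congr fun x _ => ?_
  rw [kelvinG₀]
  ring

/-- The field `φ δ_{lp} + c ∂_l ∂_p (φ - ψ)`. -/
def hessField (c : ℂ) (φ ψ : Plane → ℂ) (l p : Fin 2) (x : Plane) : ℂ :=
  (if l = p then 1 else 0) * φ x + c * (pd l (pd p φ) x - pd l (pd p ψ) x)

/-- A transversal wave `φ` and a longitudinal wave `ψ` combine to a solution of the equations of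
elasticity: the field `φ δ_{lp} + c ∂_l ∂_p φ` has no divergence and `∂_l ∂_p ψ` is a gradient. -/
lemma hessField_isSolutionOn {lam mu : ℝ} {T L : ℂ} (hT : T ≠ 0) (hTL : mu * T = (lam + 2 * mu) * L)
    {φ ψ : Plane → ℂ} (hφ : IsSolutionOn laplaceC T (fun _ => φ) {0}ᶜ)
    (hψ : IsSolutionOn laplaceC L (fun _ => ψ) {0}ᶜ) (p : Fin 2) :
    IsSolutionOn (elasticC lam mu) (mu * T) (fun l => hessField T⁻¹ φ ψ l p) {0}ᶜ := by
  have hop := isOpen_punctured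
  have lap : ∀ {K : ℂ} {f : Plane → ℂ}, IsSolutionOn laplaceC K (fun _ => f) {0}ᶜ →
      ∀ x ∈ ({0}ᶜ : Set Plane), ∑ j, pd j (pd j f) x = -K * f x := fun hf x hx => by
    rw [← hf.eq x hx 0]
    exact sum_congr rfl fun j _ => by rw [pd_stress hop hf.smooth 0 j j hx]; simp [laplaceC]
  have dd : ∀ {f : Plane → ℂ}, ContDiffOn ℝ ∞ f {0}ᶜ → ∀ x ∈ ({0}ᶜ : Set Plane),
    DifferentiableAt ℝ f x := fun hf x hx => hf.differentiableAt_of_isOpen hop hx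
  have sφ := hφ.smooth 0
  have sψ := hψ.smooth 0
  have sH := fun l =>
    ((sφ.pd p hop).pd l hop).sub ((sψ.pd p hop).pd l hop)
  have sv : ∀ l, ContDiffOn ℝ ∞ (hessField T⁻¹ φ ψ l p) {0}ᶜ := fun l =>
    (contDiffOn_const.mul sφ).add (contDiffOn_const.mul (sH l))
  have e1 : ∀ l m, ∀ x ∈ ({0}ᶜ : Set Plane), pd m (hessField T⁻¹ φ ψ l p) x =
      (if l = p then 1 else 0) * pd m φ x +
        T⁻¹ * (pd m (pd l (pd p φ)) x - pd m (pd l (pd p ψ)) x) := fun l m x hx => by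
    unfold hessField
    rw [pd_add m ((dd sφ x hx).const_mul _) ((dd (sH l) x hx).const_mul _),
      pd_const_mul m _ (dd sφ x hx), pd_const_mul m _ (dd (sH l) x hx), pd_sub m (dd ((sφ.pd p hop).pd l hop) x hx) (dd ((sψ.pd p hop).pd l hop) x hx)]
  have hdiv : ∀ x ∈ ({0}ᶜ : Set Plane), ∑ l, pd l (hessField T⁻¹ φ ψ l p) x =
      T⁻¹ * L * pd p ψ x := fun x hx => by
    have a1 := lap (hφ.pd hop p) x hx
    have a2 := lap (hψ.pd hop p) x hx
    simp only [e1 _ _ x hx, sum_add_distrib, ← mul_sum, sum_sub_distrib, a1, a2,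
      ite_mul, one_mul, zero_mul, Finset.sum_ite_eq', Finset.mem_univ, if_true]
    field_simp; ring
  refine ⟨sv, fun x hx k => ?_⟩
  have hlap : ∑ j, pd j (pd j (hessField T⁻¹ φ ψ k p)) x = (if k = p then 1 else 0) * (-T * φ x) +
      T⁻¹ * (-T * pd k (pd p φ) x + L * pd k (pd p ψ) x) := by
    have a1 := lap ((hφ.pd hop p).pd hop k) x hx
    have a2 := lap ((hψ.pd hop p).pd hop k) x hx
    have e2 : ∀ j, pd j (pd j (hessField T⁻¹ φ ψ k p)) x = (if k = p then 1 else 0) * pd j (pd j φ) x +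
        T⁻¹ * (pd j (pd j (pd k (pd p φ))) x - pd j (pd j (pd k (pd p ψ))) x) := fun j => by
      have sφ' := (((sφ.pd p hop).pd k hop).pd j hop)
      have sψ' := (((sψ.pd p hop).pd k hop).pd j hop)
      have dφ := dd (sφ.pd j hop) x hx
      rw [pd_congr_of_isOpen j hop (e1 k j) hx,
        pd_add j (dφ.const_mul _) (((dd sφ' x hx).fun_sub (dd sψ' x hx)).const_mul _),
        pd_const_mul j _ dφ, pd_const_mul j _ ((dd sφ' x hx).fun_sub (dd sψ' x hx)), pd_sub j (dd sφ' x hx) (dd sψ' x hx)]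
    simp only [e2, sum_add_distrib, ← mul_sum, sum_sub_distrib, a1, a2, lap hφ x hx]; ring
  rw [sum_pd_stress_elasticC lam mu hop sv k hx, hlap, pd_congr_of_isOpen k hop hdiv hx,
    pd_const_mul k _ (dd (sψ.pd p hop) x hx), hessField]
  linear_combination (-T⁻¹ * pd k (pd p ψ) x) * hTL

/-- The principal part of the elastic Green's functions, which is Kelvin's tensor. -/
def kelvinTensor (lam mu : ℝ) : Fin 2 → Fin 2 → Plane → ℂ :=
  kelvinG₀ ((lam + 3 * mu) / (8 * π * mu * (lam + 2 * mu)))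
    ((lam + mu) / (4 * π * mu * (lam + 2 * mu)))

namespace IsHankelProfile

variable {T L : ℝ} {a b b₁ b₂ a' b' b₁' b₂' : ℝ → ℂ} (hT : IsHankelProfile T a b b₁ b₂)
  (hL : IsHankelProfile L a' b' b₁' b₂') (hT0 : 0 < T)

include hT in
lemma deriv_b (ρ : ℝ) : deriv b ρ = b₁ ρ + ρ * deriv b₁ ρ := by
  have h1 : HasDerivAt b₁ (deriv b₁ ρ) ρ :=
    (hT.smooth.2.2.1.contDiffAt.differentiableAt (by simp)).hasDerivAt
  rw [funext hT.b_eq]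
  refine (((hasDerivAt_id ρ).ofReal_comp.mul h1).const_add _).deriv.trans ?_
  simp

include hT hL hT0

lemma elastodynamic_eq (hL0 : 0 < L) {x : Plane} (hx : x ∈ ({0}ᶜ : Set Plane)) (l p : Fin 2) :
    (if l = p then 1 else 0) * elastodynamicA L T ‖x‖ +
      elastodynamicB L T ‖x‖ * (x l * x p * ((‖x‖ ^ 2 : ℝ) : ℂ)⁻¹) =
      hessField ((T : ℂ) ^ 2)⁻¹ (wave a b) (wave a' b') l p x := by
  have h0 : (‖x‖ : ℂ) ≠ 0 := by exact_mod_cast norm_ne_zero_iff.2 hx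
  have hT' : (T : ℂ) ≠ 0 := by exact_mod_cast hT0.ne'
  have hL' : (L : ℂ) ≠ 0 := by exact_mod_cast hL0.ne'
  have eT := hT.waveDeriv₂_eq hx
  have eL := hL.waveDeriv₂_eq hx
  rw [elastodynamicA, elastodynamicB, hessField, pd_pd_wave hT.smooth.1 hT.smooth.2.1 hx,
    pd_pd_wave hL.smooth.1 hL.smooth.2.1 hx, ← hT.wave_eq hx, ← hL.wave_eq hx, hT.waveDeriv_eq hx,
    hL.waveDeriv_eq hx]
  push_cast at eT eL ⊢
  simp [eq_comm (a := p)]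
  split_ifs <;> field_simp <;> linear_combination (x l * x p : ℂ) * (eL - eT)

lemma isLogBounded_hessField_sub (mu : ℝ) (l p : Fin 2) {f : Plane → ℂ}
    (hf : ∀ x ∈ ({0}ᶜ : Set Plane), f x = Complex.I / (4 * mu) * hessField ((T : ℂ) ^ 2)⁻¹ (wave a b)
      (wave a' b') l p x - kelvinG₀ ((1 + (L / T) ^ 2) / (8 * π * mu))
        ((1 - (L / T) ^ 2) / (4 * π * mu)) l p x) : IsLogBounded₂ f := by
  have hd : ∀ {f : ℝ → ℂ}, ContDiff ℝ ∞ f → ContDiff ℝ ∞ (deriv f) := fun hf =>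
    (contDiff_infty_iff_deriv.1 hf).2
  obtain ⟨sa, sb, s1, s2⟩ := hT.smooth
  obtain ⟨sa', sb', s1', s2'⟩ := hL.smooth
  have hT' : (T : ℂ) ≠ 0 := by exact_mod_cast hT0.ne'
  set δ : ℂ := if l = p then 1 else 0 with hδ
  set c : ℂ := Complex.I / (4 * mu) with hc
  have hX : ContDiff ℝ ∞ fun ρ => c * δ * (b₁ ρ + 2 * ((T : ℂ) ^ 2)⁻¹ *
      ((b₂ ρ + deriv b₁ ρ) - (b₂' ρ + deriv b₁' ρ))) :=
    contDiff_const.mul (s1.add (contDiff_const.mul ((s2.add (hd s1)).sub (s2'.add (hd s1')))))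
  have hY : ContDiff ℝ ∞ fun ρ => c * (4 * ((T : ℂ) ^ 2)⁻¹) *
      (deriv (deriv b) ρ - deriv (deriv b') ρ) :=
    contDiff_const.mul ((hd (hd sb)).sub (hd (hd sb')))
  have hX₀ : ContDiff ℝ ∞ fun ρ => c * δ * (a ρ + 2 * ((T : ℂ) ^ 2)⁻¹ *
      ((deriv a ρ + b₁ ρ) - (deriv a' ρ + b₁' ρ))) :=
    contDiff_const.mul (sa.add (contDiff_const.mul (((hd sa).add s1).sub ((hd sa').add s1'))))
  have hY₀ : ContDiff ℝ ∞ fun ρ => c * (4 * ((T : ℂ) ^ 2)⁻¹) *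
      ((deriv (deriv a) ρ + 2 * deriv b₁ ρ + b₂ ρ) - (deriv (deriv a') ρ + 2 * deriv b₁' ρ + b₂' ρ)) :=
    contDiff_const.mul ((((hd (hd sa)).add (contDiff_const.mul (hd s1))).add s2).sub
      (((hd (hd sa')).add (contDiff_const.mul (hd s1'))).add s2'))
  refine IsLogBounded₂.of_expansion (hX₀.radial.add (((contDiff_coord l).mul
    (contDiff_coord p)).mul hY₀.radial)) (contDiff_quadratic hX.radial hY.radial l p)
    (exists_quadratic_bound hX.radial hY.radial l p) (fun x hx => (hf x hx).trans ?_)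
  have h0 : (‖x‖ : ℂ) ≠ 0 := by exact_mod_cast norm_ne_zero_iff.2 hx
  have hk : c * (Complex.I / π) = -(1 / (4 * π * mu)) := by
    rw [div_mul_div_comm, Complex.I_mul_I]; ring
  have hA : ((1 + (L / T : ℂ) ^ 2) / (8 * π * mu)) =
      -(c * (Complex.I / π)) * (1 + (L / T) ^ 2) / 2 := by rw [hk]; ring
  have hB : ((1 - (L / T : ℂ) ^ 2) / (4 * π * mu)) =
      -(c * (Complex.I / π)) * (1 - (L / T) ^ 2) := by rw [hk]; ring
  have e1 : (if l = p then -(-(c * (Complex.I / π)) * (1 + (L / T : ℂ) ^ 2) / 2) else 0) =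
      δ * (c * (Complex.I / π) * (1 + (L / T) ^ 2) / 2) := by
    rw [hδ]
    split_ifs <;> ring
  have e2 : ∀ z : ℂ, (if p = l then z else 0) = δ * z := fun z => by
    rw [hδ]; simp only [eq_comm (a := p), ite_mul, one_mul, zero_mul]
  rw [hA, hB, kelvinG₀, e1, hessField, pd_pd_wave sa sb hx, pd_pd_wave sa' sb' hx, e2, e2, ← hδ]
  simp only [wave, waveDeriv, waveDeriv₂, hT.deriv_b, hL.deriv_b, hT.b_eq, hL.b_eq, hT.b₁_eq, hL.b₁_eq]
  rw [← logSq]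
  field_simp
  ring

end IsHankelProfile

section

variable {lam mu : ℝ} (hmu : 0 < mu) (hlm : 0 < lam + 2 * mu)
include hmu hlm

lemma elastodynamic_isFundamentalModel {rho omega : ℝ} (hr : 0 < rho) (ho : 0 < omega) :
    IsFundamentalModel (elastodynamicModel lam mu rho omega) (elasticC lam mu)
      (mu * (waveNumberT mu rho omega : ℂ) ^ 2) (kelvinTensor lam mu) := by
  have hT0 : 0 < waveNumberT mu rho omega := mul_pos ho (Real.sqrt_pos.2 (div_pos hr hmu))
  have hL0 : 0 < waveNumberL lam mu rho omega := mul_pos ho (Real.sqrt_pos.2 (div_pos hr hlm))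
  have hTL : mu * waveNumberT mu rho omega ^ 2 = (lam + 2 * mu) * waveNumberL lam mu rho omega ^ 2 := by
    rw [waveNumberT, waveNumberL, mul_pow, mul_pow, Real.sq_sqrt (by positivity),
      Real.sq_sqrt (by positivity)]
    generalize lam + 2 * mu = K at *
    field_simp
  have hG' : ∀ x y l p, (elastodynamicModel lam mu rho omega).G x y l p =
      Complex.I / (4 * mu) * ((if l = p then 1 else 0) * elastodynamicA (waveNumberL lam mu rho omega)
        (waveNumberT mu rho omega) ‖x - y‖ + elastodynamicB (waveNumberL lam mu rho omega)
        (waveNumberT mu rho omega) ‖x - y‖ *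
          ((x - y) l * (x - y) p * ((‖x - y‖ ^ 2 : ℝ) : ℂ)⁻¹)) := fun x y l p => by
    simp [elastodynamicModel, unitDyad, Matrix.one_apply, div_eq_mul_inv]
    split_ifs <;> ring
  generalize waveNumberT mu rho omega = T at *
  generalize waveNumberL lam mu rho omega = L at *
  obtain ⟨a, b, b₁, b₂, h⟩ := exists_isHankelProfile hT0
  obtain ⟨a', b', b₁', b₂', h'⟩ := exists_isHankelProfile hL0
  have hG : ∀ x ∈ ({0}ᶜ : Set Plane), ∀ l p, (elastodynamicModel lam mu rho omega).G x 0 l p =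
      Complex.I / (4 * mu) * hessField ((T : ℂ) ^ 2)⁻¹ (wave a b) (wave a' b') l p x := fun x hx l p => by
    rw [hG', sub_zero, h.elastodynamic_eq h' hT0 hL0 hx]
  have hop := isOpen_punctured
  have hmu' : (mu : ℂ) ≠ 0 := by exact_mod_cast hmu.ne'
  have hlm' : (lam + 2 * mu : ℂ) ≠ 0 := by exact_mod_cast hlm.ne'
  have hT' : (T : ℂ) ≠ 0 := by exact_mod_cast hT0.ne'
  have hTL' : (mu * T ^ 2 : ℂ) = (lam + 2 * mu) * L ^ 2 := by exact_mod_cast hTL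
  have hq : (L / T : ℂ) ^ 2 = mu / (lam + 2 * mu) := by
    rw [div_pow, div_eq_div_iff (pow_ne_zero 2 hT') hlm']; linear_combination -hTL'
  have hexp : ∀ l p, IsLogBounded₂ fun x => (elastodynamicModel lam mu rho omega).G x 0 l p -
      kelvinTensor lam mu l p x := fun l p =>
    h.isLogBounded_hessField_sub h' hT0 mu l p fun x hx => by
      rw [hG x hx, kelvinTensor, hq]
      congr 2
      · rw [one_add_div hlm', div_div]
        congr 1 <;> ring
      · rw [one_sub_div hlm', div_div]
        congr 1 <;> ring
  exact {
    G_eq := fun x y => by ext l p; rw [hG', hG', sub_zero]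
    conormal_eq := fun u n x k => by
      simp only [stress_elasticC]
      fin_cases k <;> simp [elastodynamicModel, traction, partialD, pd, Fin.sum_univ_two] <;> ring
    C_symm := fun k j l m => by
      fin_cases k <;> fin_cases j <;> fin_cases l <;> fin_cases m <;> simp [elasticC]
    even := fun r => by ext l p; rw [hG', hG', sub_zero, sub_zero, norm_neg]; simp
    symm := fun r l p => by rw [hG', hG', mul_comm ((r - 0) l : ℂ)]; simp only [eq_comm (a := l)]
    solution := fun p => IsSolutionOn.congr hop (IsSolutionOn.const_mul hop (Complex.I / (4 * mu))
      (hessField_isSolutionOn (pow_ne_zero 2 hT') hTL' h.isSolutionOn h'.isSolutionOn p))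
      fun l x hx => hG x hx l p
    smooth₀ := kelvinG₀_smooth _ _
    homogeneous₀ := isHomogeneous_pd_kelvinG₀ _ _
    logBounded := fun l p => ((hexp l p).self.add (isLogBounded_kelvinG₀ _ _ l p)).congr
      fun x _ => (sub_add_cancel _ _).symm
    logBounded_pd := fun l p m => (hexp l p).first m
    logBounded_pd_pd := fun l p m j => (hexp l p).second m j
    normalization := bumpFlux_stress_kelvinG₀ _ _ (by field_simp; ring) }

lemma elastostatic_isFundamentalModel :
    IsFundamentalModel (elastostaticModel lam mu) (elasticC lam mu) 0 (kelvinTensor lam mu) := by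
  have h3 : (lam + 3 * mu : ℂ) ≠ 0 := by exact_mod_cast (by linarith : 0 < lam + 3 * mu).ne'
  refine (elastodynamic_isFundamentalModel hmu hlm one_pos one_pos).of_principal (fun x y l p => ?_) rfl
    (fun l p r => ?_) (fun l p r => ?_) fun l p => ?_
  · simp [elastostaticModel, unitDyad, Matrix.one_apply, kelvinTensor, kelvinG₀, logSq]
    split_ifs <;> field_simp <;> ring
  · simp [kelvinTensor, kelvinG₀, logSq]
  · simp [kelvinTensor, kelvinG₀, eq_comm (a := l), mul_comm (r l : ℂ)]
  · exact isLogBounded_kelvinG₀ _ _ l p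

end

end

theorem theorem5p3 (D : SmoothDomain) (P : ℕ) (hP : 1 ≤ P) (κ : ℝ) (hκ : 0 < κ) (hκ1 : κ < 1)
    (α β : ℂ) (c₀ c₁ : ℝ) :
    -- Laplace and Helmholtz
    (∀ M : LayerModel 1,
      (M = laplaceModel ∨ ∃ omega c : ℝ, 0 < omega ∧ 0 < c ∧ M = helmholtzModel omega c) →
      ∀ φ : Plane → Fin 1 → ℂ, D.SmoothDensity φ →
      ∃ C h₀ : ℝ, 0 < h₀ ∧
        ∀ h : ℝ, 0 < h → h < h₀ →
        ∀ (p : Patch D κ h) (y : Fin P → Plane), Function.Injective y → (∀ j, y j ∈ p.arc) →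
        ∀ (L : ℕ) (z : Fin L → Plane) (c : Fin L → Fin 1 → ℂ),
          M.IsCollocationInterpolant D α β φ y z c →
          (∀ k ≤ P, ∀ s ∈ Icc p.a p.b,
            ‖iteratedDeriv k (fun s => M.sourceField z c (p.χ s)) s‖ ≤ c₀ ∧
            ‖iteratedDeriv k (fun s => M.trace1 D (M.sourceField z c) (p.χ s)) s‖ ≤ c₁) →
          (∃ v, M.IsV D α β φ p.x v ∧
            ‖v - M.Vtilde D α β φ (M.sourceField z c) p.arc p.x‖
              ≤ C * (h ^ (P + 1) * |log h|)) ∧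
          ((P = 1 → ∀ s ∈ Icc p.a p.b,
              ‖iteratedDeriv 2 (fun s => M.sourceField z c (p.χ s)) s‖ ≤ c₀) →
            ∃ w, M.IsW D α β φ p.x w ∧
              ‖w - M.Wtilde D α β φ (M.sourceField z c) p.arc p.x‖ ≤ C * h ^ (P - 1))) ∧
    -- elastostatics and elastodynamics
    (∀ (lam mu : ℝ), 0 < mu → 0 < lam + 2 * mu →
      ∀ M : LayerModel 2,
      (M = elastostaticModel lam mu ∨
        ∃ rho omega : ℝ, 0 < rho ∧ 0 < omega ∧ M = elastodynamicModel lam mu rho omega) →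
      ∀ φ : Plane → Fin 2 → ℂ, D.SmoothDensity φ →
      ∃ C h₀ : ℝ, 0 < h₀ ∧
        ∀ h : ℝ, 0 < h → h < h₀ →
        ∀ (p : Patch D κ h) (y : Fin P → Plane), Function.Injective y → (∀ j, y j ∈ p.arc) →
        ∀ (L : ℕ) (z : Fin L → Plane) (c : Fin L → Fin 2 → ℂ),
          M.IsCollocationInterpolant D α β φ y z c →
          (∀ k ≤ P, ∀ s ∈ Icc p.a p.b,
            ‖iteratedDeriv k (fun s => M.sourceField z c (p.χ s)) s‖ ≤ c₀ ∧
            ‖iteratedDeriv k (fun s => M.trace1 D (M.sourceField z c) (p.χ s)) s‖ ≤ c₁) →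
          (∃ v, M.IsV D α β φ p.x v ∧
            ‖v - M.Vtilde D α β φ (M.sourceField z c) p.arc p.x‖ ≤ C * h ^ P) ∧
          ((P = 1 → ∀ s ∈ Icc p.a p.b,
              ‖iteratedDeriv 2 (fun s => M.sourceField z c (p.χ s)) s‖ ≤ c₀) →
            ∃ w, M.IsW D α β φ p.x w ∧
              ‖w - M.Wtilde D α β φ (M.sourceField z c) p.arc p.x‖ ≤ C * h ^ (P - 1))) := by
  refine ⟨fun M hM φ hφ => ?_, fun lam mu hmu hlm M hM φ hφ => ?_⟩
  · obtain ⟨kap, h⟩ : ∃ kap, IsFundamentalModel M laplaceC kap laplaceG₀ := by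
      rcases hM with rfl | ⟨omega, c, ho, hc, rfl⟩
      exacts [⟨_, laplace_isFundamentalModel⟩, ⟨_, helmholtz_isFundamentalModel ho hc⟩]
    refine h.exists_error_bound D hP hκ α β c₀ c₁ hφ (B := fun h => h ^ (P + 1) * |log h|)
      (.of_weaklySingular hκ (fun x p q => h.continuousOff_kerK D p q x) fun i p q =>
        (h.hasSingularExpansion_kerK D i p q).congr_coeff (fun _ => rfl)
          fun t => (laplaceG₀_tangential p q _ (D.curve_regular i t)).symm)
      (fun K hK => ⟨K, hK, fun h _ _ _ => ?_⟩) fun h _ _ => ?_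
    · rw [pow_succ, mul_assoc, mul_assoc]
    · rw [pow_succ, mul_assoc]
  · obtain ⟨kap, h⟩ : ∃ kap, IsFundamentalModel M (elasticC lam mu) kap (kelvinTensor lam mu) := by
      rcases hM with rfl | ⟨rho, omega, hr, ho, rfl⟩
      exacts [⟨_, elastostatic_isFundamentalModel hmu hlm⟩,
        ⟨_, elastodynamic_isFundamentalModel hmu hlm hr ho⟩]
    refine h.exists_error_bound D hP hκ α β c₀ c₁ hφ (B := fun h => h ^ P)
      (.of_singular hκ (fun x p q => h.continuousOff_kerK D p q x)
        fun i p q => ⟨_, h.hasSingularExpansion_kerK D i p q⟩)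
      (fun K hK => ⟨2 * K, by positivity, fun h _ _ _ => ?_⟩)
      fun h h0 h1 => mul_le_of_le_one_right (by positivity) (mul_abs_log_le_one h0 h1)
    rw [mul_assoc K, ← pow_succ, Nat.sub_add_cancel hP, two_mul, add_mul]
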